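/- Write $\lg=\log_2$ and $[\![n]\!]=\{0,\dots,n-1\}$. A tensor of shape $[\![n]\!]^d$ over a field $\mathbb F$ is a function $T:[\![n]\!]^d\to\mathbb F$; its rank is the least $s$ such that $T$ is a sum of $s$ tensors of the form $v_1\otimes\cdots\otimes v_d$ with $v_j\in\mathbb F^n$; it is rank-one if $T=v_1\otimes\cdots\otimes v_d$ with all $v_j\neq0$. A $[[\![n]\!]^d,k,\delta]_{\mathbb F}$ rank-metric code is a $k$-dimensional subspace $\mathcal C\subseteq\mathbb F^{[\![n]\!]^d}$ such that $\operatorname{rank}(S-T)\ge\delta$ for all distinct $S,T\in\mathcal C$. Tensors $H_0,\dots,H_{m-1}$ are parity checks of $\mathcal C$ if $\mathcal C=\{T:\langle T,H_a\rangle=0\text{ for all }a\}$, where $\langle S,T\rangle=\sum_i S(i)T(i)$. An algorithm corrects $e$ errors against $\mathcal C$ if on input $T+E$, with $T\in\mathcal C$ and $\operatorname{rank}(E)\le e$, it outputs $T$. Algorithms are programs of a random access machine over $\mathbb F$, where elementary operations on addresses and counters (addition and truncated subtraction of natural numbers, comparison, array access), and field operations, equality tests and a successor function in some enumeration of distinct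 elements of $\mathbb F$ (all of them if $\mathbb F$ is finite, infinitely many if $\mathbb F$ is infinite) have unit cost. The algorithms do not depend on $\mathbb F,n,d,r$ (the numbers $n,d,r$ are part of the input), and all implied constants are absolute. Let $\mathbb F$ be a field, $n,r\ge1$ and $d\ge2$. Then there are rank-metric codes with the parameters below, a list of parity checks of which can be computed from $n,d,r$ in $\mathrm{poly}((2nd)^d,(2r)^{O(\lg d)})$ steps, and which have a decoding algorithm that runs in $\mathrm{poly}((2nd)^d,(2r)^{O(\lg d)})$ steps and corrects $r$ errors: 1. if $|\mathbb F|>(2nd)^d$: $[[\![n]\!]^d,\ \max(0,\,n^d-dn(2r)^{\lceil\lg d\rceil}),\ 2r+1]_{\mathbb F}$, and the parity checks are all rank-one tensors; 2. for every $\mathbb F$: $[[\![n]\!]^d,\ k,\ 2r+1]_{\mathbb F}$ for some $k\ge n^d-dn(2r)^{\lceil\lg d\rceil}\cdot O(d\lg(2dn))$; 3. for every $\mathbb F$: $[[\![n]\!]^d,\ k,\ 2r+1]_{\mathbb F}$ for some $k\ge n^d-dn\,r^{\lceil\lg d\rceil}\cdot O((d\lg(2dn))^d)$, and the parity checks are all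 rank-one tensors. -/

import Mathlib

universe u

/-! ## Tensors, tensor rank and rank-metric codes -/

/-- Tensors of shape `⟦n⟧^d` over `F`, indexed by `i₁, …, i_d ∈ {0, …, n-1}`. -/
abbrev Tensor (F : Type u) (n d : ℕ) : Type u := (Fin d → Fin n) → F

namespace Tensor

variable {F : Type u} [Field F] {n d : ℕ}

/-- The tensor `v₁ ⊗ ⋯ ⊗ v_d`. -/
def pure (v : Fin d → Fin n → F) : Tensor F n d := fun i => ∏ j, v j (i j)

/-- `T = v₁ ⊗ ⋯ ⊗ v_d` with all `v_j` nonzero. -/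
def IsRankOne (T : Tensor F n d) : Prop :=
  ∃ v : Fin d → Fin n → F, (∀ j, v j ≠ 0) ∧ T = pure v

/-- The least number of terms in an expression of `T` as a sum of tensors `v₁ ⊗ ⋯ ⊗ v_d`
(for `d ≥ 1` such an expression always exists). -/
noncomputable def rank (T : Tensor F n d) : ℕ :=
  sInf {s : ℕ | ∃ v : Fin s → Fin d → Fin n → F, T = ∑ l, pure (v l)}

/-- The bilinear form `⟨S, T⟩ = ∑ S(i₁, …, i_d) T(i₁, …, i_d)`. -/
def inner (S T : Tensor F n d) : F := ∑ i, S i * T i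

/-- The code whose parity checks are the tensors `H₀, …, H_{m-1}`. -/
def codeOf {m : ℕ} (H : Fin m → Tensor F n d) : Submodule F (Tensor F n d) where
  carrier := {T | ∀ a, inner T (H a) = 0}
  zero_mem' := fun a => by simp [inner]
  add_mem' := fun {S T} hS hT a => by
    have h1 := hS a
    have h2 := hT a
    simp only [inner, Pi.add_apply, add_mul, Finset.sum_add_distrib] at *
    rw [h1, h2, add_zero]
  smul_mem' := fun x T hT a => by
    have h1 := hT a
    simp only [inner, Pi.smul_apply, smul_eq_mul, mul_assoc, ← Finset.mul_sum] at *
    rw [h1, mul_zero]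

/-- `C` is a `[⟦n⟧^d, k, δ]` rank-metric code: a `k`-dimensional subspace in which any two
distinct tensors have rank distance at least `δ`. -/
def IsRankMetricCode (C : Submodule F (Tensor F n d)) (k δ : ℕ) : Prop :=
  Module.finrank F C = k ∧ ∀ S ∈ C, ∀ T ∈ C, S ≠ T → δ ≤ rank (S - T)

end Tensor

/-! ## The computational model

A random access machine over a field, presented as a structured language. A program has
finitely many arrays of natural numbers (addresses, counters) and finitely many arrays of field
elements, and it may compute the position at which an array is accessed. Every elementary
operation costs one step. On natural numbers the operations are addition and truncated
subtraction only, so that the unit cost is harmless. On field elements they are the field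
operations, the equality test, and a successor function in some enumeration of the field. Programs
mention no field: the same program runs over every field. -/

/-- An enumeration of distinct elements `first, next first, next (next first), …` of `F`: it runs
through all of `F` if `F` is finite, and never repeats an element if `F` is infinite. -/
structure Enumeration (F : Type u) where
  first : F
  next : F → F
  distinct : ∀ i j : ℕ, (i : ℕ∞) < ENat.card F → (j : ℕ∞) < ENat.card F →
    next^[i] first = next^[j] first → i = j

/-- Expressions for natural numbers; `get a i` reads cell `i` of the array number `a`. -/
inductive NatExpr : Type
  | lit (k : ℕ)
  | get (a : ℕ) (i : NatExpr)
  | add (x y : NatExpr)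
  | sub (x y : NatExpr)

/-- Expressions for field elements; `get a i` reads cell `i` of the array number `a`. -/
inductive FieldExpr : Type
  | zero
  | one
  | get (a : ℕ) (i : NatExpr)
  | add (x y : FieldExpr)
  | sub (x y : FieldExpr)
  | mul (x y : FieldExpr)
  | inv (x : FieldExpr)
  | first
  | next (x : FieldExpr)

/-- Tests. -/
inductive Test : Type
  | natLt (x y : NatExpr)
  | fieldEq (x y : FieldExpr)
  | not (b : Test)
  | and (b c : Test)

/-- Programs. -/
inductive Prog : Type
  | skip
  | setNat (a : ℕ) (i x : NatExpr)
  | setField (a : ℕ) (i : NatExpr) (x : FieldExpr)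
  | seq (p q : Prog)
  | ite (b : Test) (p q : Prog)
  | while (b : Test) (p : Prog)

/-- The memory: cell `i` of the natural-number array `a` is `nat a i`, cell `i` of the field array
`a` is `fld a i`. -/
@[ext]
structure Store (F : Type u) where
  nat : ℕ → ℕ → ℕ
  fld : ℕ → ℕ → F

namespace Store

variable {F : Type u}

/-- Write `v` to cell `i` of the natural-number array `a`. -/
def setNat (σ : Store F) (a i v : ℕ) : Store F :=
  { σ with nat := fun b j => if b = a ∧ j = i then v else σ.nat b j }

/-- Write `v` to cell `i` of the field array `a`. -/
def setFld (σ : Store F) (a i : ℕ) (v : F) : Store F :=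
  { σ with fld := fun b j => if b = a ∧ j = i then v else σ.fld b j }

end Store

namespace NatExpr

/-- The value of an expression. -/
def eval {F : Type u} (σ : Store F) : NatExpr → ℕ
  | lit k => k
  | get a i => σ.nat a (i.eval σ)
  | add x y => x.eval σ + y.eval σ
  | sub x y => x.eval σ - y.eval σ

/-- The number of elementary operations in an expression. -/
def cost : NatExpr → ℕ
  | lit _ => 1
  | get _ i => i.cost + 1
  | add x y => x.cost + y.cost + 1
  | sub x y => x.cost + y.cost + 1

end NatExpr

namespace FieldExpr

/-- The value of an expression (with `0⁻¹ = 0`). -/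
def eval {F : Type u} [Field F] (en : Enumeration F) (σ : Store F) : FieldExpr → F
  | zero => 0
  | one => 1
  | get a i => σ.fld a (i.eval σ)
  | add x y => x.eval en σ + y.eval en σ
  | sub x y => x.eval en σ - y.eval en σ
  | mul x y => x.eval en σ * y.eval en σ
  | inv x => (x.eval en σ)⁻¹
  | first => en.first
  | next x => en.next (x.eval en σ)

/-- The number of elementary operations in an expression. -/
def cost : FieldExpr → ℕ
  | zero => 1
  | one => 1
  | get _ i => i.cost + 1
  | add x y => x.cost + y.cost + 1
  | sub x y => x.cost + y.cost + 1
  | mul x y => x.cost + y.cost + 1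
  | inv x => x.cost + 1
  | first => 1
  | next x => x.cost + 1

end FieldExpr

namespace Test

/-- The truth value of a test. -/
def Holds {F : Type u} [Field F] (en : Enumeration F) (σ : Store F) : Test → Prop
  | natLt x y => x.eval σ < y.eval σ
  | fieldEq x y => x.eval en σ = y.eval en σ
  | not b => ¬ b.Holds en σ
  | and b c => b.Holds en σ ∧ c.Holds en σ

/-- The number of elementary operations in a test. -/
def cost : Test → ℕ
  | natLt x y => x.cost + y.cost + 1
  | fieldEq x y => x.cost + y.cost + 1
  | not b => b.cost + 1
  | and b c => b.cost + c.cost + 1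

end Test

/-- `Exec en p σ t τ`: started in `σ`, the program `p` halts after exactly `t` steps in `τ`. -/
inductive Exec {F : Type u} [Field F] (en : Enumeration F) :
    Prog → Store F → ℕ → Store F → Prop
  | skip (σ : Store F) : Exec en Prog.skip σ 1 σ
  | setNat (a : ℕ) (i x : NatExpr) (σ : Store F) :
      Exec en (Prog.setNat a i x) σ (i.cost + x.cost + 1)
        (σ.setNat a (i.eval σ) (x.eval σ))
  | setField (a : ℕ) (i : NatExpr) (x : FieldExpr) (σ : Store F) :
      Exec en (Prog.setField a i x) σ (i.cost + x.cost + 1)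
        (σ.setFld a (i.eval σ) (x.eval en σ))
  | seq {p q : Prog} {σ τ υ : Store F} {s t : ℕ} :
      Exec en p σ s τ → Exec en q τ t υ → Exec en (Prog.seq p q) σ (s + t) υ
  | ite_true {b : Test} {p q : Prog} {σ τ : Store F} {t : ℕ} :
      b.Holds en σ → Exec en p σ t τ → Exec en (Prog.ite b p q) σ (b.cost + 1 + t) τ
  | ite_false {b : Test} {p q : Prog} {σ τ : Store F} {t : ℕ} :
      ¬ b.Holds en σ → Exec en q σ t τ → Exec en (Prog.ite b p q) σ (b.cost + 1 + t) τ
  | while_false {b : Test} {p : Prog} {σ : Store F} :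
      ¬ b.Holds en σ → Exec en (Prog.while b p) σ (b.cost + 1) σ
  | while_true {b : Test} {p : Prog} {σ τ υ : Store F} {s t : ℕ} :
      b.Holds en σ → Exec en p σ s τ → Exec en (Prog.while b p) τ t υ →
        Exec en (Prog.while b p) σ (b.cost + 1 + s + t) υ

/-! ## Explicit codes and decoding -/

namespace Tensor

variable {F : Type u} [Field F] {n d : ℕ}

/-- The position of the entry with index `i = (i₀, …, i_{d-1})` in the list of the `n ^ d` entries
of a tensor, namely `i₀ + i₁ n + ⋯ + i_{d-1} n^(d-1)`. -/
def pos (i : Fin d → Fin n) : ℕ := (finFunctionFinEquiv i : Fin (n ^ d))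

/-- The initial memory: the natural-number array `0` starts with `n, d, r`, the field array `0`
holds the entries of `Y`, and everything else is zero. -/
def input (r : ℕ) (Y : Tensor F n d) : Store F where
  nat := fun a k =>
    if a = 0 ∧ k = 0 then n else if a = 0 ∧ k = 1 then d else if a = 0 ∧ k = 2 then r else 0
  fld := fun a k =>
    if h : a = 0 ∧ k < n ^ d then Y (finFunctionFinEquiv.symm ⟨k, h.2⟩) else 0

/-- On input `n, d, r` alone, the program `p` halts within `t` steps and produces the list
`H₀, …, H_{m-1}` of tensors: their number in cell `0` of the natural-number array `1`, and all
their entries, one tensor after the other, in the field array `1`. -/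
def Constructs (en : Enumeration F) (p : Prog) (r t : ℕ) {m : ℕ}
    (H : Fin m → Tensor F n d) : Prop :=
  ∃ s ≤ t, ∃ τ : Store F, Exec en p (input r (0 : Tensor F n d)) s τ ∧
    τ.nat 1 0 = m ∧ ∀ (a : Fin m) (i : Fin d → Fin n), τ.fld 1 (a * n ^ d + pos i) = H a i

/-- On input `n, d, r` and any tensor `Y`, the program `p` halts within `t` steps; and if
`Y = T + E` with `T ∈ C` and `rank E ≤ e`, then it outputs `T` (in the field array `1`). -/
def Corrects (en : Enumeration F) (p : Prog) (r t e : ℕ)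
    (C : Submodule F (Tensor F n d)) : Prop :=
  ∀ Y : Tensor F n d, ∃ s ≤ t, ∃ τ : Store F, Exec en p (input r Y) s τ ∧
    ∀ T ∈ C, ∀ E : Tensor F n d, rank E ≤ e → Y = T + E →
      ∀ i : Fin d → Fin n, τ.fld 1 (pos i) = T i

/-- The tensors `H` are the parity checks of a `[⟦n⟧^d, k, 2r+1]` rank-metric code; within `t`
steps the program `con` constructs them, and `dec` corrects `r` errors against the code. -/
def IsExplicitCode (en : Enumeration F) (con dec : Prog) (r t k : ℕ) {m : ℕ}
    (H : Fin m → Tensor F n d) : Prop :=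
  IsRankMetricCode (codeOf H) k (2 * r + 1) ∧ Constructs en con r t H ∧
    Corrects en dec r t r (codeOf H)

end Tensor

/-- Bounds of the form `poly((2nd)^d, (2r)^{O(lg d)})`: up to the choice of the constant `c`, all
of them are of this form, because `2nd ≥ 2`, `2r ≥ 2` and `1 ≤ lg d ≤ ⌈lg d⌉ ≤ 2 lg d`. -/
def polyBound (c n d r : ℕ) : ℕ := c * ((2 * n * d) ^ d * (2 * r) ^ Nat.clog 2 d) ^ c

/-! The codes are evaluation codes. Put `N = d n` and read a tensor `T` as the polynomial `∑ T(i)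
x_0^{i_0} ⋯ x_{d-1}^{i_{d-1}}`. A rank-one tensor becomes a product of univariate polynomials, one
in each variable (`substPoly_pure`). Substituting `x_j = X^(N^j)` loses nothing; the result is the
polynomial of level 0 (`coeff_levelPoly_zero`). From one level to the next, the upper half of the
remaining variables is identified with the lower half in `2r` ways: `y_{D+j}` becomes `g^(l N^j)
y_j` for `l < 2r`. After `K = ⌈lg d⌉` levels one variable is left, and there are `(2r)^K`
polynomials of degree less than `N`, each determined by its values at `1, g, …, g^(N-1)`. Such a
value is the inner product with a rank-one tensor (`eval_levelPoly`). This gives `d n (2r)^K` parity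
checks of rank one, and the syndromes of `T + E` with `T` in the code are those of `E`.

The decoder climbs back through the levels. If `E` is a sum of `r` product tensors, a polynomial of
level `s` is `∑ P_k(X) Q_k(X^A)` with `r` terms, and its `2r` descendants are `S_l = ∑ P_k(X)
Q_k(g^l X)` (`exists_factors`). So the matrix `M = ∑ P_k ⊗ Q_k` has to be found from the `S_l`. As
in the decoding of Reed–Solomon codes, a locator comes first: polynomials `λ_0, …, λ_r`, not all
zero, with `∑ λ_i(g^l X) S_{l+i}(X) = 0` for `l < r`. One exists by counting unknowns, because `∑
λ_i(X) Q_k(g^i X) = 0` imposes conditions for only `r` polynomials `Q_k` (`exists_annihilator`,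
`exists_locator`). Conversely, every locator annihilates all rows of `M` (`annihilates_rows`), and a
matrix whose rows it annihilates is determined by `S_0, …, S_{r-1}` (`rows_eq_zero`). Both
uniqueness arguments look at the last nonzero antidiagonal. It has at most `r` nonzero entries,
either because the rank is at most `r` or because every such entry yields a root of a nonzero
polynomial of degree at most `r`. On the other hand `r` weighted sums over it with the distinct
nodes `g^b` vanish, which contradicts the invertibility of Vandermonde matrices. All of this is
linear algebra, so the decoder only solves linear systems (`den_levelStep`, `den_decoder`).

The element `g` must have distinct powers `g^a` for `a < N₀ = N^⌈d/2⌉` (`Good`). It is found among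
the first `N₀²` elements as soon as `|F| > N₀` (`exists_good`). Otherwise the program searches for
an extension `L` of some degree `t` with `N₀ < |L| ≤ N₀²`, tabulates its arithmetic, and runs the
same decoder on codes of elements (`den_fieldTables`, `Simulates.den`). A parity check over `L` is
replaced by its images under `t` coordinate functionals, or, to keep rank one, by the `t^d` products
of functionals of its factors (`inner_lift_eq_zero`, `inner_lift_pure_eq_zero`). The loss in
dimension follows from `t ≤ (d+1)/2 · lg(2dn)` (`degree_le`).

The minimum distance is a consequence of unique decoding (`Corrects.isRankMetricCode`). Over large
fields the dimension is made exact by appending unit tensors to the checks (`den_extendChecks`).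
Programs are written with bounded loops only, so that they denote functions on memories, and their
running time is bounded by the depth of nesting and the largest loop bound (`exists_exec`,
`exists_exec_poly`). -/

/-! ## Loop programs -/

/-- Programs with bounded loops only: `loop v a p` runs `p` for `v = 0, 1, …` up to the number in
cell `0` of array `a` (exclusive). -/
inductive LoopProg : Type
  | skip
  | setN (a : ℕ) (i x : NatExpr)
  | setF (a : ℕ) (i : NatExpr) (x : FieldExpr)
  | seq (p q : LoopProg)
  | ite (b : Test) (p q : LoopProg)
  | loop (v a : ℕ) (p : LoopProg)

instance (k : ℕ) : OfNat NatExpr k := ⟨.lit k⟩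
instance : Add NatExpr := ⟨.add⟩
instance : Sub NatExpr := ⟨.sub⟩
instance : Zero FieldExpr := ⟨.zero⟩
instance : One FieldExpr := ⟨.one⟩
instance : Add FieldExpr := ⟨.add⟩
instance : Sub FieldExpr := ⟨.sub⟩
instance : Mul FieldExpr := ⟨.mul⟩
instance : Inv FieldExpr := ⟨.inv⟩

/-- The scalar variable of type `ℕ` stored in cell `0` of array `a`. -/
abbrev nv (a : ℕ) : NatExpr := .get a 0

/-- The scalar variable with values in the field stored in cell `0` of array `a`. -/
abbrev fv (a : ℕ) : FieldExpr := .get a 0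

/-- The test `x ≤ y`. -/
abbrev Test.natLe (x y : NatExpr) : Test := .not (.natLt y x)

/-- The test `x = y` of numbers. -/
abbrev Test.natEq (x y : NatExpr) : Test := .and (.natLe x y) (.natLe y x)

section EvalLemmas

variable {F : Type u} (σ : Store F)

@[simp] theorem NatExpr.eval_ofNat (k : ℕ) :
    NatExpr.eval σ (no_index (OfNat.ofNat k : NatExpr)) = k := rfl
@[simp] theorem NatExpr.eval_get (a : ℕ) (i : NatExpr) :
    NatExpr.eval σ (.get a i) = σ.nat a (i.eval σ) := rfl
@[simp] theorem NatExpr.eval_add (x y : NatExpr) : (x + y).eval σ = x.eval σ + y.eval σ := rfl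
@[simp] theorem NatExpr.eval_sub (x y : NatExpr) : (x - y).eval σ = x.eval σ - y.eval σ := rfl

variable [Field F] (en : Enumeration F)

@[simp] theorem FieldExpr.eval_zero : (0 : FieldExpr).eval en σ = 0 := rfl
@[simp] theorem FieldExpr.eval_one : (1 : FieldExpr).eval en σ = 1 := rfl
@[simp] theorem FieldExpr.eval_get (a : ℕ) (i : NatExpr) :
    FieldExpr.eval en σ (.get a i) = σ.fld a (i.eval σ) := rfl
@[simp] theorem FieldExpr.eval_add (x y : FieldExpr) :
    (x + y).eval en σ = x.eval en σ + y.eval en σ := rfl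
@[simp] theorem FieldExpr.eval_sub (x y : FieldExpr) :
    (x - y).eval en σ = x.eval en σ - y.eval en σ := rfl
@[simp] theorem FieldExpr.eval_mul (x y : FieldExpr) :
    (x * y).eval en σ = x.eval en σ * y.eval en σ := rfl
@[simp] theorem FieldExpr.eval_inv (x : FieldExpr) : (x⁻¹).eval en σ = (x.eval en σ)⁻¹ := rfl
@[simp] theorem FieldExpr.eval_first : FieldExpr.first.eval en σ = en.first := rfl
@[simp] theorem FieldExpr.eval_next (x : FieldExpr) :
    (FieldExpr.next x).eval en σ = en.next (x.eval en σ) := rfl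
@[simp] theorem Test.holds_natLt (x y : NatExpr) :
    (Test.natLt x y).Holds en σ ↔ x.eval σ < y.eval σ := Iff.rfl
@[simp] theorem Test.holds_fieldEq (x y : FieldExpr) :
    (Test.fieldEq x y).Holds en σ ↔ x.eval en σ = y.eval en σ := Iff.rfl
@[simp] theorem Test.holds_not (b : Test) : (Test.not b).Holds en σ ↔ ¬ b.Holds en σ := Iff.rfl
@[simp] theorem Test.holds_and (b c : Test) :
    (Test.and b c).Holds en σ ↔ b.Holds en σ ∧ c.Holds en σ := Iff.rfl

end EvalLemmas

namespace Store

variable {F : Type u} (σ : Store F)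

@[simp] theorem nat_setNat (a i v b j : ℕ) :
    (σ.setNat a i v).nat b j = if b = a ∧ j = i then v else σ.nat b j := rfl
@[simp] theorem fld_setNat (a i v : ℕ) : (σ.setNat a i v).fld = σ.fld := rfl
@[simp] theorem nat_setFld (a i : ℕ) (v : F) : (σ.setFld a i v).nat = σ.nat := rfl
@[simp] theorem fld_setFld (a i : ℕ) (v : F) (b j : ℕ) :
    (σ.setFld a i v).fld b j = if b = a ∧ j = i then v else σ.fld b j := rfl

/-- The two stores differ at most in the arrays listed. -/
def Same (wn wf : List ℕ) (σ τ : Store F) : Prop :=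
  (∀ a ∉ wn, τ.nat a = σ.nat a) ∧ ∀ a ∉ wf, τ.fld a = σ.fld a

theorem Same.refl (wn wf : List ℕ) (σ : Store F) : Same wn wf σ σ := ⟨fun _ _ => rfl, fun _ _ => rfl⟩

theorem Same.trans {wn wf wn' wf' : List ℕ} {σ τ υ : Store F} (h : Same wn wf σ τ)
    (h' : Same wn' wf' τ υ) (hn : ∀ a ∈ wn', a ∈ wn := by decide)
    (hf : ∀ a ∈ wf', a ∈ wf := by decide) : Same wn wf σ υ :=
  ⟨fun a ha => (h'.1 a fun h1 => ha (hn a h1)).trans (h.1 a ha),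
    fun a ha => (h'.2 a fun h1 => ha (hf a h1)).trans (h.2 a ha)⟩

end Store

namespace LoopProg

/-- Assignment to a scalar variable of type `ℕ`. -/
abbrev letN (a : ℕ) (x : NatExpr) : LoopProg := setN a 0 x

/-- Assignment to a scalar variable with values in the field. -/
abbrev letF (a : ℕ) (x : FieldExpr) : LoopProg := setF a 0 x

/-- Sequential composition. -/
infixr:60 " ;; " => LoopProg.seq

/-- Translation into the language of the random access machine. -/
def toProg : LoopProg → Prog
  | skip => .skip
  | setN a i x => .setNat a i x
  | setF a i x => .setField a i x
  | seq p q => .seq p.toProg q.toProg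
  | ite b p q => .ite b p.toProg q.toProg
  | loop v a p => .seq (.setNat v 0 0)
      (.while (.natLt (nv v) (nv a)) (.seq p.toProg (.setNat v 0 (nv v + 1))))

/-- The arrays of numbers that a program may write to. -/
def wn : LoopProg → List ℕ
  | skip => []
  | setN a _ _ => [a]
  | setF _ _ _ => []
  | seq p q => p.wn ++ q.wn
  | ite _ p q => p.wn ++ q.wn
  | loop v _ p => v :: p.wn

/-- The arrays of field elements that a program may write to. -/
def wf : LoopProg → List ℕ
  | skip => []
  | setN _ _ _ => []
  | setF a _ _ => [a]
  | seq p q => p.wf ++ q.wf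
  | ite _ p q => p.wf ++ q.wf
  | loop _ _ p => p.wf

/-- The arrays that hold the bounds of loops. -/
def bds : LoopProg → List ℕ
  | skip => []
  | setN _ _ _ => []
  | setF _ _ _ => []
  | seq p q => p.bds ++ q.bds
  | ite _ p q => p.bds ++ q.bds
  | loop _ a p => a :: p.bds

/-- No loop writes to its own counter or bound. -/
def ok : LoopProg → Bool
  | skip => true
  | setN _ _ _ => true
  | setF _ _ _ => true
  | seq p q => p.ok && q.ok
  | ite _ p q => p.ok && q.ok
  | loop v a p => p.ok && decide (v ∉ p.wn) && decide (a ∉ p.wn) && decide (a ≠ v)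

/-- No loop bound is ever written to. -/
def static (p : LoopProg) : Bool := p.ok && decide (∀ a ∈ p.bds, a ∉ p.wn)

/-- The largest depth of nested loops. -/
def depth : LoopProg → ℕ
  | skip => 0
  | setN _ _ _ => 0
  | setF _ _ _ => 0
  | seq p q => max p.depth q.depth
  | ite _ p q => max p.depth q.depth
  | loop _ _ p => p.depth + 1

/-- A bound for the number of steps, apart from the repetitions in loops. -/
def weight : LoopProg → ℕ
  | skip => 1
  | setN _ i x => i.cost + x.cost + 1
  | setF _ i x => i.cost + x.cost + 1
  | seq p q => p.weight + q.weight
  | ite b p q => b.cost + 1 + p.weight + q.weight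
  | loop _ _ p => p.weight + 21

variable {F : Type u}

/-- Run `f` for the values `0, …, b - 1` of the counter `v`. -/
def iter (f : Store F → Store F) (v : ℕ) : ℕ → Store F → Store F
  | 0, σ => σ.setNat v 0 0
  | b + 1, σ => (f (iter f v b σ)).setNat v 0 (b + 1)

theorem iter_same {f : Store F → Store F} {wn wf : List ℕ}
    (hf : ∀ σ, Store.Same wn wf σ (f σ)) (v b : ℕ) (σ : Store F) :
    Store.Same (v :: wn) wf σ (iter f v b σ) := by
  induction b with
  | zero =>
    refine ⟨fun a ha => funext fun j => ?_, fun a _ => rfl⟩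
    simp only [List.mem_cons, not_or] at ha
    simp [iter, ha.1]
  | succ b ih =>
    refine ⟨fun a ha => funext fun j => ?_, fun a ha => ?_⟩
    · have h1 := congrFun (ih.1 a ha) j
      simp only [List.mem_cons, not_or] at ha
      have h2 := congrFun ((hf (iter f v b σ)).1 a ha.2) j
      simp [iter, ha.1, h1, h2]
    · simp [iter, (hf (iter f v b σ)).2 a ha, ih.2 a ha]

variable [Field F] (en : Enumeration F)

open Classical in
/-- The final memory. -/
noncomputable def den : LoopProg → Store F → Store F
  | skip, σ => σ
  | setN a i x, σ => σ.setNat a (i.eval σ) (x.eval σ)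
  | setF a i x, σ => σ.setFld a (i.eval σ) (x.eval en σ)
  | seq p q, σ => q.den (p.den σ)
  | ite b p q, σ => if b.Holds en σ then p.den σ else q.den σ
  | loop v a p, σ => iter p.den v (σ.nat a 0) σ

@[simp] theorem den_skip (σ : Store F) : den en skip σ = σ := rfl
@[simp] theorem den_setN (a : ℕ) (i x : NatExpr) (σ : Store F) :
    den en (setN a i x) σ = σ.setNat a (i.eval σ) (x.eval σ) := rfl
@[simp] theorem den_setF (a : ℕ) (i : NatExpr) (x : FieldExpr) (σ : Store F) :
    den en (setF a i x) σ = σ.setFld a (i.eval σ) (x.eval en σ) := rfl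
@[simp] theorem den_seq (p q : LoopProg) (σ : Store F) :
    den en (p ;; q) σ = den en q (den en p σ) := rfl
open Classical in
theorem den_ite_pos {b : Test} {σ : Store F} (h : b.Holds en σ) (p q : LoopProg) :
    den en (ite b p q) σ = den en p σ := by
  simp [den, h]
theorem den_ite_neg {b : Test} {σ : Store F} (h : ¬ b.Holds en σ) (p q : LoopProg) :
    den en (ite b p q) σ = den en q σ := by
  simp [den, h]

/-- Frame property. Since `wn` and `wf` are computed from the syntax, every later claim that some
array is preserved reduces to a decidable membership test. -/
theorem den_same (p : LoopProg) (σ : Store F) : Store.Same p.wn p.wf σ (den en p σ) := by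
  induction p generalizing σ with
  | skip => exact ⟨fun _ _ => rfl, fun _ _ => rfl⟩
  | setN a i x =>
    refine ⟨fun b hb => funext fun j => ?_, fun _ _ => rfl⟩
    simp only [wn, List.mem_singleton] at hb
    simp [den, hb]
  | setF a i x =>
    refine ⟨fun _ _ => rfl, fun b hb => funext fun j => ?_⟩
    simp only [wf, List.mem_singleton] at hb
    simp [den, hb]
  | seq p q hp hq =>
    refine ⟨fun a ha => ?_, fun a ha => ?_⟩
    · simp only [wn, List.mem_append, not_or] at ha
      rw [den, (hq _).1 a ha.2, (hp _).1 a ha.1]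
    · simp only [wf, List.mem_append, not_or] at ha
      rw [den, (hq _).2 a ha.2, (hp _).2 a ha.1]
  | ite b p q hp hq =>
    refine ⟨fun a ha => ?_, fun a ha => ?_⟩
    · simp only [wn, List.mem_append, not_or] at ha
      rw [den]
      split_ifs
      exacts [(hp _).1 a ha.1, (hq _).1 a ha.2]
    · simp only [wf, List.mem_append, not_or] at ha
      rw [den]
      split_ifs
      exacts [(hp _).2 a ha.1, (hq _).2 a ha.2]
  | loop v a p hp => exact iter_same hp v _ σ

theorem den_nat {p : LoopProg} {a : ℕ} (h : a ∉ p.wn) (σ : Store F) :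
    (den en p σ).nat a = σ.nat a := (den_same en p σ).1 a h

theorem den_fld {p : LoopProg} {a : ℕ} (h : a ∉ p.wf) (σ : Store F) :
    (den en p σ).fld a = σ.fld a := (den_same en p σ).2 a h

/-- The rule for loops: `I` is an invariant. -/
theorem den_loop {v a : ℕ} {p : LoopProg} {σ : Store F} (I : ℕ → Store F → Prop)
    (h0 : I 0 (σ.setNat v 0 0))
    (hs : ∀ i < σ.nat a 0, ∀ τ, Store.Same (v :: p.wn) p.wf σ τ → τ.nat v 0 = i → I i τ →
      I (i + 1) ((den en p τ).setNat v 0 (i + 1))) :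
    I (σ.nat a 0) (den en (loop v a p) σ) := by
  have key : ∀ b ≤ σ.nat a 0, I b (iter (den en p) v b σ) := by
    intro b
    induction b with
    | zero => exact fun _ => h0
    | succ b ih =>
      intro hb
      refine hs b (by omega) _ (iter_same (den_same en p) v b σ) ?_ (ih (by omega))
      cases b <;> simp [iter]
  exact key _ le_rfl

/-- All loop bounds met on the run from `σ` are at most `X`. -/
def BoundsLe (X : ℕ) : LoopProg → Store F → Prop
  | skip, _ => True
  | setN _ _ _, _ => True
  | setF _ _ _, _ => True
  | seq p q, σ => p.BoundsLe X σ ∧ q.BoundsLe X (den en p σ)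
  | ite b p q, σ => (b.Holds en σ → p.BoundsLe X σ) ∧ (¬ b.Holds en σ → q.BoundsLe X σ)
  | loop v a p, σ => σ.nat a 0 ≤ X ∧
      ∀ i < σ.nat a 0, p.BoundsLe X (iter (den en p) v i σ)

theorem boundsLe_of_not_mem {X : ℕ} {p : LoopProg} {σ : Store F}
    (h : ∀ a ∈ p.bds, a ∉ p.wn) (hX : ∀ a ∈ p.bds, σ.nat a 0 ≤ X) : p.BoundsLe en X σ := by
  induction p generalizing σ with
  | skip => trivial
  | setN a i x => trivial
  | setF a i x => trivial
  | seq p q ihp ihq =>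
    simp only [bds, wn, List.mem_append, not_or] at h hX
    refine ⟨ihp (fun a ha => (h a (Or.inl ha)).1) fun a ha => hX a (Or.inl ha),
      ihq (fun a ha => (h a (Or.inr ha)).2) fun a ha => ?_⟩
    rw [den_nat en (h a (Or.inr ha)).1]
    exact hX a (Or.inr ha)
  | ite b p q ihp ihq =>
    simp only [bds, wn, List.mem_append, not_or] at h hX
    exact ⟨fun _ => ihp (fun a ha => (h a (Or.inl ha)).1) fun a ha => hX a (Or.inl ha),
      fun _ => ihq (fun a ha => (h a (Or.inr ha)).2) fun a ha => hX a (Or.inr ha)⟩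
  | loop v a p ih =>
    simp only [bds, wn, List.mem_cons, not_or] at h hX
    refine ⟨hX a (Or.inl rfl), fun i _ => ih (fun b hb => (h b (Or.inr hb)).2) fun b hb => ?_⟩
    rw [(iter_same (den_same en p) v i σ).1 b (by
      simpa only [List.mem_cons, not_or] using h b (Or.inr hb))]
    exact hX b (Or.inr hb)

theorem boundsLe_of_static {X : ℕ} {p : LoopProg} {σ : Store F} (h : p.static = true)
    (hX : ∀ a ∈ p.bds, σ.nat a 0 ≤ X) : p.BoundsLe en X σ := by
  simp only [static, Bool.and_eq_true, decide_eq_true_eq] at h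
  exact boundsLe_of_not_mem en h.2 hX

/-- Each level of nesting costs a factor of at most `X + 1`, and `weight` collects everything else.
The condition `ok` protects counters and bounds from the loop body, so that the `while` loop
performs exactly the rounds counted by `iter`. -/
theorem exists_exec {X : ℕ} {p : LoopProg} {σ : Store F} (hp : p.ok = true)
    (h : p.BoundsLe en X σ) :
    ∃ s ≤ p.weight * (X + 1) ^ p.depth, Exec en p.toProg σ s (den en p σ) := by
  have one_le : ∀ k, 1 ≤ (X + 1) ^ k := fun k => Nat.one_le_pow _ _ (Nat.succ_pos X)
  have grow : ∀ {w k l : ℕ}, k ≤ l → w * (X + 1) ^ k ≤ w * (X + 1) ^ l := fun hkl =>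
    Nat.mul_le_mul_left _ (Nat.pow_le_pow_right (Nat.succ_pos X) hkl)
  induction p generalizing σ with
  | skip => exact ⟨1, by simp [weight, depth], .skip σ⟩
  | setN a i x => exact ⟨_, by simp [weight, depth], .setNat a i x σ⟩
  | setF a i x => exact ⟨_, by simp [weight, depth], .setField a i x σ⟩
  | seq p q ihp ihq =>
    simp only [ok, Bool.and_eq_true] at hp
    obtain ⟨s, hs, hs'⟩ := ihp hp.1 h.1
    obtain ⟨t, ht, ht'⟩ := ihq hp.2 h.2
    refine ⟨s + t, ?_, .seq hs' ht'⟩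
    rw [weight, depth, add_mul]
    exact add_le_add (hs.trans (grow (le_max_left _ _))) (ht.trans (grow (le_max_right _ _)))
  | ite b p q ihp ihq =>
    simp only [ok, Bool.and_eq_true] at hp
    have hb1 := Nat.mul_le_mul_left (b.cost + 1) (one_le (max p.depth q.depth))
    by_cases hb : b.Holds en σ
    · obtain ⟨s, hs, hs'⟩ := ihp hp.1 (h.1 hb)
      refine ⟨_, ?_, by simpa [den_ite_pos en hb, toProg] using Exec.ite_true hb hs'⟩
      have := hs.trans (grow (le_max_left p.depth q.depth))
      simp only [weight, depth, add_mul (b.cost + 1 + _), add_mul (b.cost + 1)]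
      omega
    · obtain ⟨s, hs, hs'⟩ := ihq hp.2 (h.2 hb)
      refine ⟨_, ?_, by simpa [den_ite_neg en hb, toProg] using Exec.ite_false hb hs'⟩
      have := hs.trans (grow (le_max_right p.depth q.depth))
      simp only [weight, depth, add_mul (b.cost + 1 + _), add_mul (b.cost + 1)]
      omega
  | loop v a p ih =>
    simp only [ok, Bool.and_eq_true, decide_eq_true_eq] at hp
    obtain ⟨⟨⟨hp, hv⟩, ha⟩, hav⟩ := hp
    set T := p.weight * (X + 1) ^ p.depth with hT
    have htest : (Test.natLt (nv v) (nv a)).cost = 5 := rfl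
    have ha' : ∀ k, (iter (den en p) v k σ).nat a 0 = σ.nat a 0 := fun k => by
      rw [(iter_same (den_same en p) v k σ).1 a (by simp [ha, hav])]
    have hv' : ∀ k, (iter (den en p) v k σ).nat v 0 = k := fun k => by cases k <;> simp [iter]
    -- Induction on the number `k` of rounds that remain. Besides its body, a round costs 6 steps
    -- for the test and 6 for the increment; the failing test at the end costs 6.
    have key : ∀ k j, j + k = σ.nat a 0 → ∃ s ≤ k * (T + 12) + 6,
        Exec en (.while (.natLt (nv v) (nv a)) (.seq p.toProg (.setNat v 0 (nv v + 1))))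
          (iter (den en p) v j σ) s (iter (den en p) v (σ.nat a 0) σ) := by
      intro k
      induction k with
      | zero =>
        intro j hj
        obtain rfl : j = σ.nat a 0 := by omega
        exact ⟨6, by simp, .while_false (by simp [ha', hv'])⟩
      | succ k ihk =>
        intro j hj
        obtain ⟨t, ht, ht'⟩ := ihk (j + 1) (by omega)
        obtain ⟨s, hs, hs'⟩ := ih hp (h.2 j (by omega))
        have hset : Exec en (.setNat v 0 (nv v + 1)) (den en p (iter (den en p) v j σ)) 6
            (iter (den en p) v (j + 1) σ) := by
          have := Exec.setNat (en := en) v 0 (nv v + 1) (den en p (iter (den en p) v j σ))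
          have hvp : (den en p (iter (den en p) v j σ)).nat v 0 = j := by
            rw [den_nat en hv, hv']
          rw [show NatExpr.cost 0 + (nv v + 1).cost + 1 = 6 from rfl] at this
          simpa [iter, hvp] using this
        refine ⟨_, ?_, .while_true (by simp [ha', hv']; omega) (.seq hs' hset) ht'⟩
        rw [htest, add_mul]
        omega
    obtain ⟨s, hs, hs'⟩ := key (σ.nat a 0) 0 (by simp)
    refine ⟨3 + s, ?_, .seq (.setNat v 0 0 σ) hs'⟩
    have h1 : σ.nat a 0 * (T + 12) ≤ X * (T + 12) := Nat.mul_le_mul_right _ h.1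
    have h2 : (p.weight + 21) * (X + 1) ^ (p.depth + 1) =
        (X + 1) * T + 21 * (X + 1) ^ (p.depth + 1) := by rw [hT]; ring
    have h3 : X + 1 ≤ (X + 1) ^ (p.depth + 1) := by
      rw [pow_succ]; exact Nat.le_mul_of_pos_left _ (one_le _)
    rw [weight, depth, h2]
    nlinarith

end LoopProg

/-! ## Recovering a low-rank matrix from polynomial syndromes -/

section Recovery

open Polynomial

variable {L : Type u} [Field L]

/-- The substitution `p(X) ↦ p(x X)`. -/
noncomputable def dilate (x : L) : L[X] →+* L[X] := compRingHom (C x * X)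

@[simp] theorem coeff_dilate (x : L) (p : L[X]) (k : ℕ) :
    (dilate x p).coeff k = p.coeff k * x ^ k := by
  simp [dilate]

theorem dilate_dilate (x y : L) (p : L[X]) : dilate x (dilate y p) = dilate (x * y) p := by
  ext k
  simp [mul_pow]
  ring

theorem natDegree_dilate_le (x : L) (p : L[X]) : (dilate x p).natDegree ≤ p.natDegree := by
  rw [natDegree_le_iff_coeff_eq_zero]
  intro k hk
  simp [coeff_eq_zero_of_natDegree_lt hk]

/-- The polynomial with the coefficients `c 0, …, c (R - 1)`. -/
noncomputable def polyOf (R : ℕ) (c : ℕ → L) : L[X] := ∑ k ∈ Finset.range R, C (c k) * X ^ k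

@[simp] theorem coeff_polyOf (R : ℕ) (c : ℕ → L) (k : ℕ) :
    (polyOf R c).coeff k = if k < R then c k else 0 := by
  simp [polyOf, coeff_C_mul, coeff_X_pow]

/-! ### Uniqueness along the last nonzero diagonal -/

/-- A Vandermonde system with as many equations as nodes. Only the weights on `S` matter, so the
number of power sums needed is the number of nonzero entries of a diagonal. -/
theorem eq_zero_of_power_sums_eq_zero {S : Finset ℕ} {x w : ℕ → L} (hx : Set.InjOn x S)
    (h : ∀ l < S.card, ∑ b ∈ S, w b * x b ^ l = 0) {b : ℕ} (hb : b ∈ S) : w b = 0 := by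
  have e := S.equivFin.symm
  have h0 := Matrix.eq_zero_of_forall_pow_sum_mul_pow_eq_zero
    (f := fun i => x (e i)) (v := fun i => w (e i))
    (fun i j hij => e.injective (Subtype.ext (hx (e i).2 (e j).2 hij)))
    (fun l => by
      rw [← h l l.2, ← Finset.sum_coe_sort S]
      exact Fintype.sum_equiv e _ _ fun i => rfl)
  simpa using congrFun h0 (e.symm ⟨b, hb⟩)

theorem exists_last_diagonal {M : ℕ → ℕ → L} {A B : ℕ} (hM : ∀ a b, M a b ≠ 0 → a < A ∧ b < B)
    (h : ∃ a b, M a b ≠ 0) :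
    ∃ D, (∃ b ≤ D, M (D - b) b ≠ 0) ∧ ∀ a b, D < a + b → M a b = 0 := by
  classical
  have hP : ∃ D ≤ A + B, ∃ b ≤ D, M (D - b) b ≠ 0 := by
    obtain ⟨a, b, hab⟩ := h
    have := hM a b hab
    exact ⟨a + b, by omega, b, by omega, by simpa using hab⟩
  obtain ⟨D, hD, hD'⟩ := hP
  refine ⟨Nat.findGreatest (fun D => ∃ b ≤ D, M (D - b) b ≠ 0) (A + B),
    Nat.findGreatest_spec (P := fun D => ∃ b ≤ D, M (D - b) b ≠ 0) hD hD', fun a b hab => ?_⟩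
  by_contra hne
  have := hM a b hne
  exact Nat.findGreatest_is_greatest hab (by omega) ⟨b, by omega, by simpa using hne⟩

/-- The rows `D - b` and columns `b` with `b ∈ S` cut out a square block that is triangular, because
to the right of its diagonal the indices add up to more than `D`. Its diagonal is nonzero, so it has
full rank; but it factors through `r` dimensions. -/
theorem card_le_of_triangular {r D : ℕ} {p q : Fin r → ℕ → L} {S : Finset ℕ}
    (hS : ∀ b ∈ S, b ≤ D ∧ ∑ k, p k (D - b) * q k b ≠ 0)
    (hD : ∀ a b, D < a + b → ∑ k, p k a * q k b = 0) : S.card ≤ r := by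
  classical
  let U : Matrix S (Fin r) L := Matrix.of fun b k => p k (D - b)
  let V : Matrix (Fin r) S L := Matrix.of fun k b => q k b
  have hdet : (U * V).det ≠ 0 := by
    rw [Matrix.det_of_isLowerTriangular (U * V) (fun i j hij => ?_)]
    · exact Finset.prod_ne_zero_iff.mpr fun b _ => by
        simpa [U, V, Matrix.mul_apply] using (hS b b.2).2
    · have hij' : (i : ℕ) < j := by simpa using hij
      have := (hS i i.2).1
      simpa [U, V, Matrix.mul_apply] using hD (D - i) j (by omega)
  have h1 : (U * V).rank = S.card := by
    rw [Matrix.rank_of_isUnit _ ((Matrix.isUnit_iff_isUnit_det _).mpr (Ne.isUnit hdet))]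
    simp
  rw [← h1]
  exact (Matrix.rank_mul_le_left _ _).trans ((Matrix.rank_le_card_width _).trans (by simp))

/-- A matrix `∑ P_ρ ⊗ W_ρ` with `r` terms vanishes if `r` of its twisted diagonal sums do. -/
theorem sum_coeff_mul_coeff_eq_zero {r A : ℕ} {g : L} (hg : g ≠ 0)
    (hA : Set.InjOn (fun a => g ^ a) (Set.Iio A)) {P W : Fin r → L[X]}
    (hP : ∀ k a, A ≤ a → (P k).coeff a = 0)
    (h : ∀ l < r, ∑ k, P k * dilate (g ^ l) (W k) = 0) (a b : ℕ) :
    ∑ k, (P k).coeff a * (W k).coeff b = 0 := by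
  classical
  by_contra hne
  let M : ℕ → ℕ → L := fun a b => ∑ k, (P k).coeff a * (W k).coeff b
  have hrow : ∀ a b, M a b ≠ 0 → a < A := fun a b hab => by
    by_contra hlt
    exact hab (Finset.sum_eq_zero fun k _ => by rw [hP k a (by omega), zero_mul])
  have hcol : ∀ a b, M a b ≠ 0 → b < (∑ k, (W k).natDegree) + 1 := fun a b hab => by
    by_contra hlt
    refine hab (Finset.sum_eq_zero fun k _ => ?_)
    have := Finset.single_le_sum (f := fun k => (W k).natDegree) (fun _ _ => Nat.zero_le _)
      (Finset.mem_univ k)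
    rw [coeff_eq_zero_of_natDegree_lt (p := W k) (by
      exact lt_of_le_of_lt this (by omega)), mul_zero]
  obtain ⟨D, ⟨b₀, hb₀, hb₀'⟩, hD⟩ := exists_last_diagonal
    (fun a b hab => ⟨hrow a b hab, hcol a b hab⟩) ⟨a, b, hne⟩
  -- The nonzero entries of the last diagonal, indexed by their columns. There are at most `r` of
  -- them, so `r` sums are enough for the Vandermonde argument.
  let S := (Finset.range (D + 1)).filter fun b => M (D - b) b ≠ 0
  have hcard : S.card ≤ r := card_le_of_triangular (p := fun k a => (P k).coeff a)
    (q := fun k b => (W k).coeff b) (D := D)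
    (fun b hb => by
      simp only [S, Finset.mem_filter, Finset.mem_range] at hb
      exact ⟨by omega, hb.2⟩) hD
  refine hb₀' (eq_zero_of_power_sums_eq_zero (S := S) (x := fun b => g ^ b)
    (w := fun b => M (D - b) b) ?_ (fun l hl => ?_)
    (by simp only [S, Finset.mem_filter, Finset.mem_range]; exact ⟨by omega, hb₀'⟩))
  · intro b hb b' hb' hbb
    simp only [S, Finset.coe_filter, Finset.mem_range, Set.mem_ofPred_eq] at hb hb'
    have h1 := hrow _ _ hb.2
    have h2 := hrow _ _ hb'.2
    have hbb' : g ^ b = g ^ b' := hbb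
    -- Only the row indices are known to lie below `A`. Since `g ^ (D - b) * g ^ b` is the same for
    -- all `b`, equal nodes in the columns give equal nodes in the rows.
    have h3 : g ^ (D - b) = g ^ (D - b') := by
      have e1 : g ^ (D - b) * g ^ b = g ^ (D - b') * g ^ b' := by
        rw [← pow_add, ← pow_add]; congr 1; omega
      rw [hbb'] at e1
      exact mul_right_cancel₀ (pow_ne_zero _ hg) e1
    have := hA (show D - b ∈ Set.Iio A from h1) (show D - b' ∈ Set.Iio A from h2) h3
    omega
  -- The coefficient of `X ^ D` in `∑ P_k(X) W_k(g^l X)` is the sum over the diagonal `a + b = D`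
  -- with the weights `g^(l b)`.
  · have h1 := congrArg (fun p => p.coeff D) (h l (lt_of_lt_of_le hl hcard))
    simp only [finsetSum_coeff, coeff_mul, coeff_dilate, coeff_zero] at h1
    rw [Finset.sum_comm, Finset.Nat.sum_antidiagonal_eq_sum_range_succ_mk,
      ← Finset.sum_range_reflect] at h1
    rw [Finset.sum_filter_of_ne fun b _ hb => left_ne_zero_of_mul hb, ← h1]
    refine Finset.sum_congr rfl fun b hb => ?_
    have hb' : b ≤ D := by simpa [Nat.lt_succ_iff] using hb
    have e1 : D + 1 - 1 - b = D - b := by omega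
    have e2 : D - (D - b) = b := by omega
    simp only [M, Nat.succ_eq_add_one, e1, e2, Finset.sum_mul]
    exact Finset.sum_congr rfl fun k _ => by rw [← pow_mul, ← pow_mul, mul_comm b l]; ring

/-- A matrix with rows in the kernel of a nonzero `g`-difference operator of order `r` vanishes if
`r` of its twisted diagonal sums do. -/
theorem rows_eq_zero {r A B : ℕ} {g : L}
    (hB : Set.InjOn (fun a => g ^ a) (Set.Iio B)) {lam : Fin (r + 1) → L[X]} (hlam : lam ≠ 0)
    {m : ℕ → L[X]} (hm : ∀ a b, (m a).coeff b ≠ 0 → a < A ∧ b < B)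
    (hker : ∀ a, ∑ i, lam i * dilate (g ^ (i : ℕ)) (m a) = 0)
    (h : ∀ l < r, ∑ a ∈ Finset.range A, X ^ a * dilate (g ^ l) (m a) = 0) (a : ℕ) : m a = 0 := by
  classical
  by_contra hne
  let M : ℕ → ℕ → L := fun a b => (m a).coeff b
  have hex : ∃ a b, M a b ≠ 0 := by
    by_contra hcon
    push Not at hcon
    exact hne (Polynomial.ext fun b => by simpa using hcon a b)
  obtain ⟨D, ⟨b₀, hb₀, hb₀'⟩, hD⟩ := exists_last_diagonal hm hex
  let S := (Finset.range (D + 1)).filter fun b => M (D - b) b ≠ 0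
  have hSinj : Set.InjOn (fun b => g ^ b) (S : Set ℕ) := hB.mono fun b hb => by
    simp only [S, Finset.coe_filter, Finset.mem_range, Set.mem_ofPred_eq] at hb
    exact (hm _ _ hb.2).2
  have hcard : S.card ≤ r := by
    obtain ⟨i₀, hi₀⟩ := Function.ne_iff.mp hlam
    obtain ⟨i₁, hi₁', hi₁⟩ := Finset.exists_max_image (Finset.univ.filter fun i => lam i ≠ 0)
      (fun i => (lam i).natDegree) ⟨i₀, by simpa using hi₀⟩
    set δ := (lam i₁).natDegree with hδ
    have hle : ∀ i, (lam i).natDegree ≤ δ := fun i => by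
      by_cases hi : lam i = 0
      · simp [hi]
      · exact hi₁ i (by simpa using hi)
    -- `δ` is the largest degree of a `lam i`, and `ℓ` collects their coefficients at `X ^ δ`. It is
    -- nonzero by the choice of `δ`, and of degree at most `r`.
    let ℓ : L[X] := ∑ i : Fin (r + 1), C ((lam i).coeff δ) * X ^ (i : ℕ)
    have hcoeff : ∀ i : Fin (r + 1), ℓ.coeff i = (lam i).coeff δ := fun i => by
      simp only [ℓ, finsetSum_coeff, coeff_C_mul, coeff_X_pow]
      rw [Finset.sum_eq_single i]
      · simp
      · intro j _ hj
        simp [Fin.val_inj, Ne.symm hj]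
      · simp
    have hℓ : ℓ ≠ 0 := fun h0 => by
      have := hcoeff i₁
      rw [h0, coeff_zero, hδ] at this
      exact (by simpa using hi₁' : lam i₁ ≠ 0) (leadingCoeff_eq_zero.mp this.symm)
    have hdeg : ℓ.natDegree ≤ r := natDegree_sum_le_of_forall_le _ _ fun i _ =>
      (natDegree_C_mul_X_pow_le _ _).trans (Nat.lt_succ_iff.mp i.2)
    have hroots : S.image (fun b => g ^ b) ⊆ ℓ.roots.toFinset := by
      intro x hx
      obtain ⟨b, hb, rfl⟩ := Finset.mem_image.mp hx
      simp only [S, Finset.mem_filter, Finset.mem_range] at hb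
      rw [Multiset.mem_toFinset, mem_roots hℓ, IsRoot]
      -- Beyond the last diagonal everything vanishes, so the entry in column `b` is the top
      -- coefficient of its row. The coefficient at `δ + b` of the operator applied to that row is
      -- then `ℓ(g ^ b)` times the entry, which makes `g ^ b` a root of `ℓ`.
      have hb1 : (m (D - b)).natDegree ≤ b := by
        rw [natDegree_le_iff_coeff_eq_zero]
        exact fun k hk => hD _ _ (by omega)
      have h1 := congrArg (fun p => p.coeff (δ + b)) (hker (D - b))
      simp only [finsetSum_coeff, coeff_zero] at h1
      simp only [ℓ, eval_finsetSum, eval_mul, eval_C, eval_pow, eval_X]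
      have h2 : (∑ i : Fin (r + 1), (lam i).coeff δ * (g ^ b) ^ (i : ℕ)) * (m (D - b)).coeff b
          = 0 := by
        rw [← h1, Finset.sum_mul]
        refine Finset.sum_congr rfl fun i _ => ?_
        rw [coeff_mul_add_eq_of_natDegree_le (hle i) ((natDegree_dilate_le _ _).trans hb1), coeff_dilate,
          ← pow_mul, ← pow_mul, mul_comm b]
        ring
      exact (mul_eq_zero.mp h2).resolve_right hb.2
    calc S.card = (S.image fun b => g ^ b).card := (Finset.card_image_of_injOn hSinj).symm
      _ ≤ ℓ.roots.toFinset.card := Finset.card_le_card hroots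
      _ ≤ ℓ.natDegree := (Multiset.toFinset_card_le _).trans (card_roots' _)
      _ ≤ r := hdeg
  refine hb₀' (eq_zero_of_power_sums_eq_zero (S := S) (x := fun b => g ^ b)
    (w := fun b => M (D - b) b) hSinj (fun l hl => ?_)
    (by simp only [S, Finset.mem_filter, Finset.mem_range]; exact ⟨by omega, hb₀'⟩))
  have h1 := congrArg (fun p => p.coeff D) (h l (lt_of_lt_of_le hl hcard))
  simp only [finsetSum_coeff, coeff_X_pow_mul', coeff_dilate, coeff_zero] at h1
  rw [Finset.sum_filter_of_ne fun b _ hb => left_ne_zero_of_mul hb, ← h1,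
    ← Finset.sum_range_reflect]
  have e1 : ∀ a ∈ Finset.range (D + 1), M (D - (D + 1 - 1 - a)) (D + 1 - 1 - a) *
      (g ^ (D + 1 - 1 - a)) ^ l =
      if a ≤ D then (m a).coeff (D - a) * (g ^ l) ^ (D - a) else 0 := fun a ha => by
    have ha' : a ≤ D := by simpa [Nat.lt_succ_iff] using ha
    have e1 : D + 1 - 1 - a = D - a := by omega
    have e2 : D - (D - a) = a := by omega
    rw [if_pos ha', e1, e2, ← pow_mul, ← pow_mul, mul_comm l]
  rw [Finset.sum_congr rfl e1]
  have hz : ∀ a, a ∉ Finset.range A →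
      (if a ≤ D then (m a).coeff (D - a) * (g ^ l) ^ (D - a) else 0) = 0 := fun a ha => by
    have : (m a).coeff (D - a) = 0 := by
      by_contra hcon
      exact ha (Finset.mem_range.mpr (hm _ _ hcon).1)
    simp [this]
  have hz' : ∀ a, a ∉ Finset.range (D + 1) →
      (if a ≤ D then (m a).coeff (D - a) * (g ^ l) ^ (D - a) else 0) = 0 := fun a ha =>
    if_neg fun hle => ha (Finset.mem_range.mpr (by omega))
  rw [Finset.sum_subset (Finset.subset_union_left (s₂ := Finset.range A)) fun a _ ha => hz' a ha,
    Finset.sum_subset (Finset.subset_union_right (s₁ := Finset.range (D + 1)))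
      fun a _ ha => hz a ha]

/-! ### Locator polynomials and the linear equations of the decoder -/

/-- Counting: there are `(r + 1) R` unknown coefficients, and `r` polynomial identities of degree
less than `R + B` amount to `r (R + B)` equations. The excess of unknowns is `R - r B > 0`. -/
theorem exists_annihilator {r B R : ℕ} (g : L) (hR : r * B < R) {Q : Fin r → L[X]}
    (hQ : ∀ k b, B ≤ b → (Q k).coeff b = 0) :
    ∃ lam : ℕ → ℕ → L, (∃ i < r + 1, ∃ k < R, lam i k ≠ 0) ∧
      ∀ ρ, ∑ i : Fin (r + 1), polyOf R (lam i) * dilate (g ^ (i : ℕ)) (Q ρ) = 0 := by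
  classical
  let ext : (Fin (r + 1) → Fin R → L) →ₗ[L] (Fin (r + 1) → L[X]) :=
    LinearMap.pi fun i => ∑ k : Fin R,
      (Polynomial.monomial (k : ℕ)) ∘ₗ (LinearMap.proj k) ∘ₗ (LinearMap.proj i)
  let Φ : (Fin (r + 1) → Fin R → L) →ₗ[L] (Fin r → Fin (R + B) → L) :=
    LinearMap.pi fun ρ => LinearMap.pi fun c => Polynomial.lcoeff L (c : ℕ) ∘ₗ
      ∑ i : Fin (r + 1), (LinearMap.mulRight L (dilate (g ^ (i : ℕ)) (Q ρ))) ∘ₗ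
        (LinearMap.proj i) ∘ₗ ext
  have hker : LinearMap.ker Φ ≠ ⊥ := LinearMap.ker_ne_bot_of_finrank_lt (by
    simp only [Module.finrank_pi_fintype, Module.finrank_self]
    simp
    nlinarith)
  obtain ⟨v, hv, hv0⟩ := Submodule.exists_mem_ne_zero_of_ne_bot hker
  have hext : ∀ i, ext v i = polyOf R (fun k => if h : k < R then v i ⟨k, h⟩ else 0) := by
    intro i
    simp only [ext, LinearMap.pi_apply, LinearMap.sum_apply, LinearMap.comp_apply,
      LinearMap.proj_apply, polyOf]
    rw [Finset.sum_range]
    exact Finset.sum_congr rfl fun k _ => by simp [C_mul_X_pow_eq_monomial]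
  obtain ⟨i, hi⟩ := Function.ne_iff.mp hv0
  obtain ⟨k, hk⟩ := Function.ne_iff.mp hi
  refine ⟨fun i k => if h : i < r + 1 ∧ k < R then v ⟨i, h.1⟩ ⟨k, h.2⟩ else 0,
    ⟨i, i.2, k, k.2, by simp only [dif_pos (And.intro i.2 k.2)]; exact hk⟩, fun ρ => ?_⟩
  have hsum : ∑ i : Fin (r + 1), polyOf R (fun k => if h : (i : ℕ) < r + 1 ∧ k < R then
        v ⟨i, h.1⟩ ⟨k, h.2⟩ else 0) * dilate (g ^ (i : ℕ)) (Q ρ) =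
      ∑ i : Fin (r + 1), ext v i * dilate (g ^ (i : ℕ)) (Q ρ) := by
    refine Finset.sum_congr rfl fun i _ => ?_
    rw [hext]
    congr 3
    funext k
    by_cases hk : k < R <;> simp [hk, i.2]
  rw [hsum]
  ext c
  by_cases hc : c < R + B
  · have := congrFun (congrFun (LinearMap.mem_ker.mp hv) ρ) ⟨c, hc⟩
    simpa [Φ] using this
  · simp only [finsetSum_coeff, coeff_zero]
    refine Finset.sum_eq_zero fun i _ => ?_
    rw [coeff_mul]
    refine Finset.sum_eq_zero fun x hx => ?_
    have hx := Finset.HasAntidiagonal.mem_antidiagonal.mp hx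
    rw [hext, coeff_polyOf, coeff_dilate]
    by_cases h1 : x.1 < R
    · rw [hQ ρ x.2 (by omega)]
      simp
    · simp [h1]

/-- Vectors annihilating the diagonal sums of the syndromes annihilate the rows of the matrix. -/
theorem annihilates_rows {r A : ℕ} {g : L} (hg : g ≠ 0)
    (hA : Set.InjOn (fun a => g ^ a) (Set.Iio A)) {P Q : Fin r → L[X]}
    (hP : ∀ k a, A ≤ a → (P k).coeff a = 0) {lam : Fin (r + 1) → L[X]}
    (h : ∀ l < r, ∑ i : Fin (r + 1), dilate (g ^ l) (lam i) *
      ∑ k, P k * dilate (g ^ (l + i)) (Q k) = 0) (a : ℕ) :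
    ∑ i, lam i * dilate (g ^ (i : ℕ)) (∑ k, C ((P k).coeff a) * Q k) = 0 := by
  -- `W k` is the operator `lam` applied to `Q k`. The hypothesis says that the twisted diagonal
  -- sums of the matrix `∑ P_k ⊗ W_k`, which has `r` terms, vanish, so this matrix is zero; row by
  -- row this is the claim.
  let W : Fin r → L[X] := fun k => ∑ i, lam i * dilate (g ^ (i : ℕ)) (Q k)
  have h1 := sum_coeff_mul_coeff_eq_zero hg hA (P := P) (W := W) hP (fun l hl => by
    rw [← h l hl]
    simp only [W, map_sum, map_mul, dilate_dilate, ← pow_add, Finset.mul_sum]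
    rw [Finset.sum_comm]
    exact Finset.sum_congr rfl fun i _ => Finset.sum_congr rfl fun k _ => by ring) a
  have hC : ∀ (x y : L), dilate x (C y) = C y := fun x y => by simp [dilate]
  have h2 : ∑ i, lam i * dilate (g ^ (i : ℕ)) (∑ k, C ((P k).coeff a) * Q k) =
      ∑ k, C ((P k).coeff a) * W k := by
    simp only [W, map_sum, map_mul, hC, Finset.mul_sum]
    rw [Finset.sum_comm]
    exact Finset.sum_congr rfl fun i _ => Finset.sum_congr rfl fun k _ => by ring
  rw [h2]
  ext b
  simpa using h1 b

theorem coeff_polyOf_mul (R : ℕ) (u : ℕ → L) (p : L[X]) (c : ℕ) :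
    (polyOf R u * p).coeff c =
      ∑ k ∈ Finset.range R, if k ≤ c then u k * p.coeff (c - k) else 0 := by
  rw [polyOf, Finset.sum_mul, finsetSum_coeff]
  refine Finset.sum_congr rfl fun k _ => ?_
  rw [mul_assoc, coeff_C_mul, coeff_X_pow_mul', mul_ite, mul_zero]

/-- Coefficient `c` of `∑ lam_i(g ^ l X) S_{l+i}(X)`, where `S_l` has the coefficients `S l`. -/
def locatorEq (g : L) (r R A : ℕ) (S lam : ℕ → ℕ → L) (l c : ℕ) : L :=
  ∑ i ∈ Finset.range (r + 1), ∑ k ∈ Finset.range R,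
    (if k ≤ c ∧ c - k < A then g ^ (l * k) * S (l + i) (c - k) else 0) * lam i k

/-- Coefficient `c` of `∑ lam_i(X) m_a(g ^ i X)`, where `m_a` has the coefficients `M a`. -/
def rowEq (g : L) (r R B : ℕ) (lam M : ℕ → ℕ → L) (a c : ℕ) : L :=
  ∑ b ∈ Finset.range B, (if b ≤ c ∧ c - b < R then
    ∑ i ∈ Finset.range (r + 1), lam i (c - b) * g ^ (i * b) else 0) * M a b

/-- Coefficient `c` of `∑ X ^ a m_a(g ^ l X) - z S_l(X)`. -/
def syndromeEq (g : L) (A B : ℕ) (S : ℕ → ℕ → L) (z : L) (M : ℕ → ℕ → L) (l c : ℕ) : L :=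
  (if c < A then -S l c else 0) * z +
    ∑ b ∈ Finset.range B, (if b ≤ c ∧ c - b < A then g ^ (l * b) else 0) * M (c - b) b

theorem rowEq_eq (g : L) (r R B : ℕ) (lam M : ℕ → ℕ → L) (a c : ℕ) :
    rowEq g r R B lam M a c = (∑ i : Fin (r + 1), polyOf R (lam i) *
      dilate (g ^ (i : ℕ)) (polyOf B (M a))).coeff c := by
  have h : ∀ i : Fin (r + 1), (polyOf R (lam i) * dilate (g ^ (i : ℕ)) (polyOf B (M a))).coeff c =
      ∑ b ∈ Finset.range B, if b ≤ c ∧ c - b < R then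
        lam i (c - b) * g ^ ((i : ℕ) * b) * M a b else 0 := fun i => by
    have h1 : dilate (g ^ (i : ℕ)) (polyOf B (M a)) =
        polyOf B fun b => M a b * (g ^ (i : ℕ)) ^ b := by
      ext k
      simp
    rw [mul_comm, h1, coeff_polyOf_mul]
    refine Finset.sum_congr rfl fun b _ => ?_
    by_cases h1 : b ≤ c <;> by_cases h2 : c - b < R <;> simp [h1, h2, pow_mul]
    ring
  rw [finsetSum_coeff, Finset.sum_congr rfl fun i _ => h i, Finset.sum_comm, rowEq]
  refine Finset.sum_congr rfl fun b _ => ?_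
  by_cases h1 : b ≤ c ∧ c - b < R
  · simp only [if_pos h1, Finset.sum_mul]
    exact Finset.sum_range fun i => lam i (c - b) * g ^ (i * b) * M a b
  · simp [h1]

theorem syndromeEq_eq (g : L) (A B : ℕ) (S : ℕ → ℕ → L) (z : L) (M : ℕ → ℕ → L) (l c : ℕ) :
    syndromeEq g A B S z M l c = (if c < A then -S l c else 0) * z +
      (∑ a ∈ Finset.range A, X ^ a * dilate (g ^ l) (polyOf B (M a))).coeff c := by
  rw [syndromeEq]
  congr 1
  simp only [finsetSum_coeff, coeff_X_pow_mul', coeff_dilate, coeff_polyOf]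
  rw [← Finset.sum_filter, ← Finset.sum_filter_of_ne (p := fun b => b ≤ c ∧ c - b < A)
    fun b _ hb => by_contra fun hn => hb (by rw [if_neg hn, zero_mul])]
  rw [← Finset.sum_filter_of_ne (s := (Finset.range A).filter fun a => a ≤ c)
    (p := fun a => c - a < B) fun a _ ha => by_contra fun hn => ha (by rw [if_neg hn, zero_mul])]
  refine Finset.sum_bij' (fun b _ => c - b) (fun a _ => c - a) ?_ ?_ ?_ ?_ ?_
  · intro b hb
    simp only [Finset.mem_filter, Finset.mem_range] at hb ⊢
    omega
  · intro b hb
    simp only [Finset.mem_filter, Finset.mem_range] at hb ⊢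
    omega
  · intro b hb
    simp only [Finset.mem_filter, Finset.mem_range] at hb ⊢
    omega
  · intro b hb
    simp only [Finset.mem_filter, Finset.mem_range] at hb ⊢
    omega
  · intro b hb
    simp only [Finset.mem_filter, Finset.mem_range] at hb
    have e : c - (c - b) = b := by omega
    rw [if_pos hb.2, e, if_pos hb.1, pow_mul]
    ring

variable {g : L} {r A B R : ℕ} {P Q : Fin r → L[X]} {S : ℕ → ℕ → L}

/-- The guard `c - k < A` in `locatorEq` loses nothing, because by `hS'` the syndrome polynomials
have no coefficients from `A` on. -/
theorem locatorEq_eq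
    (hS : ∀ l < 2 * r, ∀ c < A, S l c = (∑ k, P k * dilate (g ^ l) (Q k)).coeff c)
    (hS' : ∀ l < 2 * r, ∀ c, A ≤ c → (∑ k, P k * dilate (g ^ l) (Q k)).coeff c = 0)
    (lam : ℕ → ℕ → L) {l : ℕ} (hl : l < r) (c : ℕ) :
    locatorEq g r R A S lam l c = (∑ i : Fin (r + 1), dilate (g ^ l) (polyOf R (lam i)) *
      ∑ k, P k * dilate (g ^ (l + i)) (Q k)).coeff c := by
  rw [locatorEq, Finset.sum_range, finsetSum_coeff]
  refine Finset.sum_congr rfl fun i _ => ?_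
  have h1 : dilate (g ^ l) (polyOf R (lam i)) = polyOf R fun k => lam i k * (g ^ l) ^ k := by
    ext k
    simp
  rw [h1, coeff_polyOf_mul]
  refine Finset.sum_congr rfl fun k _ => ?_
  by_cases h2 : k ≤ c
  · by_cases h3 : c - k < A
    · rw [if_pos ⟨h2, h3⟩, if_pos h2, hS _ (by omega) _ h3, pow_mul]
      ring
    · rw [if_neg fun h => h3 h.2, if_pos h2, hS' _ (by omega) _ (by omega)]
      simp
  · simp [h2]

/-- An annihilator of all `Q k` is a locator: after the substitution `X ↦ g^l X` it annihilates
`Q_k(g^l X)`, hence also the combination of these with the coefficients `P_k`. -/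
theorem exists_locator (hR : r * B < R) (hQ : ∀ k b, B ≤ b → (Q k).coeff b = 0)
    (hS : ∀ l < 2 * r, ∀ c < A, S l c = (∑ k, P k * dilate (g ^ l) (Q k)).coeff c)
    (hS' : ∀ l < 2 * r, ∀ c, A ≤ c → (∑ k, P k * dilate (g ^ l) (Q k)).coeff c = 0) :
    ∃ lam : ℕ → ℕ → L, (∃ i < r + 1, ∃ k < R, lam i k ≠ 0) ∧
      ∀ l < r, ∀ c, locatorEq g r R A S lam l c = 0 := by
  obtain ⟨lam, h0, h⟩ := exists_annihilator g hR hQ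
  refine ⟨lam, h0, fun l hl c => ?_⟩
  rw [locatorEq_eq hS hS' lam hl]
  have h1 : ∑ i : Fin (r + 1), dilate (g ^ l) (polyOf R (lam i)) *
      ∑ k, P k * dilate (g ^ (l + i)) (Q k) =
      ∑ k, P k * dilate (g ^ l) (∑ i : Fin (r + 1), polyOf R (lam i) *
        dilate (g ^ (i : ℕ)) (Q k)) := by
    simp only [map_sum, map_mul, dilate_dilate, ← pow_add, Finset.mul_sum]
    rw [Finset.sum_comm]
    exact Finset.sum_congr rfl fun i _ => Finset.sum_congr rfl fun k _ => by ring
  rw [h1, Finset.sum_eq_zero fun k _ => by rw [h k, map_zero, mul_zero], coeff_zero]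

/-- The locator found by the decoder need not annihilate the `Q k`; what is used is that any
solution annihilates the rows of the matrix. Equations up to `T ≥ R + A` suffice, since the
coefficients beyond vanish by degree. -/
theorem rowEq_eq_zero {T : ℕ} (hT : R + A ≤ T) (hg : g ≠ 0)
    (hA : Set.InjOn (fun a => g ^ a) (Set.Iio A))
    (hP : ∀ k a, A ≤ a → (P k).coeff a = 0) (hQ : ∀ k b, B ≤ b → (Q k).coeff b = 0)
    (hS : ∀ l < 2 * r, ∀ c < A, S l c = (∑ k, P k * dilate (g ^ l) (Q k)).coeff c)
    (hS' : ∀ l < 2 * r, ∀ c, A ≤ c → (∑ k, P k * dilate (g ^ l) (Q k)).coeff c = 0)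
    {lam : ℕ → ℕ → L} (h : ∀ l < r, ∀ c < T, locatorEq g r R A S lam l c = 0) (a c : ℕ) :
    rowEq g r R B lam (fun a b => ∑ k, (P k).coeff a * (Q k).coeff b) a c = 0 := by
  rw [rowEq_eq]
  have h1 : polyOf B (fun b => ∑ k, (P k).coeff a * (Q k).coeff b) =
      ∑ k, C ((P k).coeff a) * Q k := by
    ext b
    simp only [coeff_polyOf, finsetSum_coeff, coeff_C_mul]
    split_ifs with hb
    · rfl
    · exact (Finset.sum_eq_zero fun k _ => by rw [hQ k b (by omega), mul_zero]).symm
  rw [h1, annihilates_rows hg hA hP (fun l hl => ?_), coeff_zero]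
  ext c
  rw [← locatorEq_eq hS hS' lam hl, coeff_zero]
  by_cases hc : c < T
  · exact h l hl c hc
  · refine Finset.sum_eq_zero fun i _ => Finset.sum_eq_zero fun k hk => ?_
    have := Finset.mem_range.mp hk
    rw [if_neg (by omega), zero_mul]

theorem sum_dilate_eq (hP : ∀ k a, A ≤ a → (P k).coeff a = 0)
    (hQ : ∀ k b, B ≤ b → (Q k).coeff b = 0) (x : L) :
    ∑ a ∈ Finset.range A, X ^ a *
      dilate x (polyOf B fun b => ∑ k, (P k).coeff a * (Q k).coeff b) =
      ∑ k, P k * dilate x (Q k) := by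
  have h1 : ∀ a, polyOf B (fun b => ∑ k, (P k).coeff a * (Q k).coeff b) =
      ∑ k, C ((P k).coeff a) * Q k := fun a => by
    ext b
    simp only [coeff_polyOf, finsetSum_coeff, coeff_C_mul]
    split_ifs with hb
    · rfl
    · exact (Finset.sum_eq_zero fun k _ => by rw [hQ k b (by omega), mul_zero]).symm
  have h2 : ∀ k, P k = ∑ a ∈ Finset.range A, X ^ a * C ((P k).coeff a) := fun k => by
    ext a
    simp only [finsetSum_coeff, coeff_mul_C, coeff_X_pow, ite_mul, one_mul, zero_mul,
      Finset.sum_ite_eq, Finset.mem_range]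
    split_ifs with ha
    · rfl
    · exact hP k a (by omega)
  have hC : ∀ (y : L), dilate x (C y) = C y := fun y => by simp [dilate]
  simp only [h1, map_sum, map_mul, hC, Finset.mul_sum]
  rw [Finset.sum_comm]
  refine Finset.sum_congr rfl fun k _ => ?_
  conv_rhs => rw [h2 k, Finset.sum_mul]
  exact Finset.sum_congr rfl fun a _ => by ring

theorem syndromeEq_eq_zero (hP : ∀ k a, A ≤ a → (P k).coeff a = 0)
    (hQ : ∀ k b, B ≤ b → (Q k).coeff b = 0)
    (hS : ∀ l < 2 * r, ∀ c < A, S l c = (∑ k, P k * dilate (g ^ l) (Q k)).coeff c)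
    (hS' : ∀ l < 2 * r, ∀ c, A ≤ c → (∑ k, P k * dilate (g ^ l) (Q k)).coeff c = 0)
    {l : ℕ} (hl : l < 2 * r) (c : ℕ) :
    syndromeEq g A B S 1 (fun a b => ∑ k, (P k).coeff a * (Q k).coeff b) l c = 0 := by
  rw [syndromeEq_eq, sum_dilate_eq hP hQ]
  split_ifs with hc
  · rw [hS l hl c hc]
    ring
  · rw [hS' l hl c (by omega)]
    simp

/-- The system is made homogeneous by an unknown factor `z` of the syndromes. The difference `Z - z
M` has rows annihilated by the locator and zero twisted diagonal sums, so `rows_eq_zero` applies to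
it. -/
theorem eq_mul_of_equations {T : ℕ} (hRB : R + B ≤ T) (hAB : A + B ≤ T) (hg : g ≠ 0)
    (hA : Set.InjOn (fun a => g ^ a) (Set.Iio A)) (hB : Set.InjOn (fun a => g ^ a) (Set.Iio B))
    (hRA : R + A ≤ T)
    (hP : ∀ k a, A ≤ a → (P k).coeff a = 0) (hQ : ∀ k b, B ≤ b → (Q k).coeff b = 0)
    (hS : ∀ l < 2 * r, ∀ c < A, S l c = (∑ k, P k * dilate (g ^ l) (Q k)).coeff c)
    (hS' : ∀ l < 2 * r, ∀ c, A ≤ c → (∑ k, P k * dilate (g ^ l) (Q k)).coeff c = 0)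
    {lam : ℕ → ℕ → L} (hlam0 : ∃ i < r + 1, ∃ k < R, lam i k ≠ 0)
    (hlam : ∀ l < r, ∀ c < T, locatorEq g r R A S lam l c = 0)
    {z : L} {Z : ℕ → ℕ → L} (hrow : ∀ a < A, ∀ c < T, rowEq g r R B lam Z a c = 0)
    (hsyn : ∀ l < r, ∀ c < T, syndromeEq g A B S z Z l c = 0) {a b : ℕ} (ha : a < A)
    (hb : b < B) : Z a b = z * ∑ k, (P k).coeff a * (Q k).coeff b := by
  let M : ℕ → ℕ → L := fun a b => ∑ k, (P k).coeff a * (Q k).coeff b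
  -- Nothing is known about `Z` outside the `A × B` rectangle, so the difference is cut off there.
  let m : ℕ → L[X] := fun a => if a < A then polyOf B fun b => Z a b - z * M a b else 0
  have hsub : ∀ a, polyOf B (fun b => Z a b - z * M a b) =
      polyOf B (Z a) - C z * polyOf B (M a) := fun a => by
    ext b
    simp only [coeff_polyOf, coeff_sub, coeff_C_mul]
    split_ifs <;> simp
  have hC : ∀ (x y : L), dilate x (C y) = C y := fun x y => by simp [dilate]
  have hz : m a = 0 := by
    refine rows_eq_zero (A := A) (B := B) hB (r := r) (lam := fun i => polyOf R (lam i))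
      (fun h0 => ?_) (fun a b hab => ?_) (fun a => ?_) (fun l hl => ?_) a
    · obtain ⟨i, hi, k, hk, hik⟩ := hlam0
      have := congrArg (fun p => p.coeff k) (congrFun h0 ⟨i, hi⟩)
      simp [hk, hik] at this
    · simp only [m] at hab
      split_ifs at hab with ha
      · simp only [coeff_polyOf, ne_eq, ite_eq_right_iff, not_forall] at hab
        exact ⟨ha, hab.1⟩
      · simp at hab
    · simp only [m]
      split_ifs with ha
      · ext c
        have h1 := rowEq_eq_zero hRA hg hA hP hQ hS hS' hlam a c
        rw [rowEq_eq] at h1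
        have h2 : rowEq g r R B lam Z a c = 0 := by
          by_cases hc : c < T
          · exact hrow a ha c hc
          · refine Finset.sum_eq_zero fun b hb => ?_
            have := Finset.mem_range.mp hb
            rw [if_neg (by omega), zero_mul]
        rw [rowEq_eq] at h2
        have h3 : ∑ i : Fin (r + 1), polyOf R (lam i) *
            dilate (g ^ (i : ℕ)) (polyOf B fun b => Z a b - z * M a b) =
            (∑ i : Fin (r + 1), polyOf R (lam i) * dilate (g ^ (i : ℕ)) (polyOf B (Z a))) -
            C z * ∑ i : Fin (r + 1), polyOf R (lam i) *
              dilate (g ^ (i : ℕ)) (polyOf B (M a)) := by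
          rw [Finset.mul_sum, ← Finset.sum_sub_distrib]
          refine Finset.sum_congr rfl fun i _ => ?_
          rw [hsub, map_sub, map_mul, hC]
          ring
        rw [h3, coeff_sub, coeff_C_mul, h2, h1]
        simp
      · simp
    · have h3 : ∑ a ∈ Finset.range A, X ^ a * dilate (g ^ l) (m a) =
          (∑ a ∈ Finset.range A, X ^ a * dilate (g ^ l) (polyOf B (Z a))) -
          C z * ∑ a ∈ Finset.range A, X ^ a * dilate (g ^ l) (polyOf B (M a)) := by
        rw [Finset.mul_sum, ← Finset.sum_sub_distrib]
        refine Finset.sum_congr rfl fun a ha => ?_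
        simp only [m, if_pos (Finset.mem_range.mp ha)]
        rw [hsub, map_sub, map_mul, hC]
        ring
      rw [h3]
      ext c
      have h1 := syndromeEq_eq_zero (g := g) hP hQ hS hS' (l := l) (by omega) c
      have h2 : syndromeEq g A B S z Z l c = 0 := by
        by_cases hc : c < T
        · exact hsyn l hl c hc
        · rw [syndromeEq, if_neg (by omega), zero_mul, zero_add]
          refine Finset.sum_eq_zero fun b hb => ?_
          have := Finset.mem_range.mp hb
          rw [if_neg (by omega), zero_mul]
      rw [syndromeEq_eq] at h1 h2
      rw [coeff_sub, coeff_C_mul, coeff_zero]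
      linear_combination h2 - z * h1
  have := congrArg (fun p => p.coeff b) hz
  simp only [m, if_pos ha, coeff_polyOf, if_pos hb, coeff_zero] at this
  exact sub_eq_zero.mp this

end Recovery

/-! ## The polynomials of a tensor -/

/-- The number of variables after `s` halvings. -/
def halves (d : ℕ) : ℕ → ℕ
  | 0 => d
  | s + 1 => (halves d s + 1) / 2

/-- The variable with which the variable `j` is identified after `s` halvings. -/
def varIndex (d : ℕ) : ℕ → ℕ → ℕ
  | 0, j => j
  | s + 1, j => if varIndex d s j < halves d (s + 1) then varIndex d s j
      else varIndex d s j - halves d (s + 1)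

theorem varIndex_lt {d j : ℕ} (hj : j < d) (s : ℕ) : varIndex d s j < halves d s := by
  induction s with
  | zero => exact hj
  | succ s ih =>
    rw [varIndex]
    split_ifs with h
    · exact h
    · rw [halves] at h ⊢
      omega

theorem halves_pos {d : ℕ} (hd : 1 ≤ d) (s : ℕ) : 1 ≤ halves d s := by
  induction s with
  | zero => exact hd
  | succ s ih => rw [halves]; omega

theorem halves_succ_le (d s : ℕ) : halves d (s + 1) ≤ halves d 1 := by
  induction s with
  | zero => rfl
  | succ s ih =>
    rw [halves]
    omega

theorem halves_succ_le_self {d : ℕ} (hd : 1 ≤ d) (s : ℕ) : halves d (s + 1) ≤ halves d s := by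
  have := halves_pos hd s
  rw [halves]
  omega

theorem halves_le {d : ℕ} (hd : 1 ≤ d) (s : ℕ) : halves d s ≤ d := by
  induction s with
  | zero => rfl
  | succ s ih => exact (halves_succ_le_self hd s).trans ih

theorem halves_sub_le (d s : ℕ) : halves d s - halves d (s + 1) ≤ halves d (s + 1) := by
  rw [halves]
  omega

/-- Replacing `x` by `⌈x / 2⌉` lowers `⌈lg x⌉` by one until it reaches zero. Hence `⌈lg d⌉` halvings
are exactly what it takes to be left with one variable. -/
theorem clog_halves {d : ℕ} (s : ℕ) : Nat.clog 2 (halves d s) = Nat.clog 2 d - s := by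
  induction s with
  | zero => rfl
  | succ s ih =>
    rw [halves]
    rcases Nat.lt_or_ge 1 (halves d s) with h | h
    · rw [Nat.clog_of_one_lt one_lt_two h] at ih
      have : (halves d s + 2 - 1) / 2 = (halves d s + 1) / 2 := by omega
      rw [this] at ih
      omega
    · rw [Nat.clog_of_right_le_one h] at ih
      rw [Nat.clog_of_right_le_one (by omega)]
      omega

theorem one_lt_halves_iff {d s : ℕ} : 1 < halves d s ↔ s < Nat.clog 2 d := by
  have h := clog_halves (d := d) s
  constructor
  · intro h1
    have := Nat.clog_pos one_lt_two h1
    omega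
  · intro h1
    by_contra h2
    rw [Nat.clog_of_right_le_one (by omega)] at h
    omega

theorem halves_clog {d : ℕ} (hd : 1 ≤ d) : halves d (Nat.clog 2 d) = 1 := by
  have h1 := halves_pos hd (Nat.clog 2 d)
  have h2 := (one_lt_halves_iff (d := d) (s := Nat.clog 2 d)).not.mpr (lt_irrefl _)
  omega

section LevelPolynomials

open Polynomial

variable {L : Type u} [Field L]

/-- The scaling factor of variable `j` in the substitution number `h` of level `s`. -/
def scaling (g : L) (N d r : ℕ) : ℕ → ℕ → ℕ → L
  | 0, _, _ => 1
  | s + 1, h, j => scaling g N d r s (h / (2 * r)) j *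
      if varIndex d s j < halves d (s + 1) then 1
      else (g ^ N ^ (varIndex d s j - halves d (s + 1))) ^ (h % (2 * r))

variable {n d : ℕ}

/-- The univariate polynomial of a tensor under a monomial substitution. -/
noncomputable def substPoly (x : Fin d → L) (w : Fin d → ℕ) (T : Tensor L n d) : L[X] :=
  ∑ i, C (T i * ∏ j, x j ^ (i j : ℕ)) * X ^ ∑ j, (i j : ℕ) * w j

/-- The univariate polynomial of a vector under a monomial substitution. -/
noncomputable def factorPoly (x : L) (w : ℕ) (v : Fin n → L) : L[X] :=
  ∑ a : Fin n, C (v a * x ^ (a : ℕ)) * X ^ ((a : ℕ) * w)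

theorem substPoly_sum {r : ℕ} (x : Fin d → L) (w : Fin d → ℕ) (T : Fin r → Tensor L n d) :
    substPoly x w (∑ k, T k) = ∑ k, substPoly x w (T k) := by
  simp only [substPoly, Finset.sum_apply, Finset.sum_mul, map_sum]
  rw [Finset.sum_comm]

/-- Distributivity: the monomials of a product tensor factor over the variables. A tensor of rank
`r` therefore becomes a sum of `r` products, and these can be split between any two groups of
variables. -/
theorem substPoly_pure (x : Fin d → L) (w : Fin d → ℕ) (v : Fin d → Fin n → L) :
    substPoly x w (Tensor.pure v) = ∏ j, factorPoly (x j) (w j) (v j) := by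
  simp only [factorPoly]
  rw [Finset.prod_univ_sum, Fintype.piFinset_univ, substPoly]
  refine Finset.sum_congr rfl fun i _ => ?_
  rw [Finset.prod_mul_distrib, Finset.prod_pow_eq_pow_sum, ← map_prod, Tensor.pure,
    Finset.prod_mul_distrib]

theorem natDegree_factorPoly_le (x : L) (w : ℕ) (v : Fin n → L) :
    (factorPoly x w v).natDegree ≤ (n - 1) * w :=
  natDegree_sum_le_of_forall_le _ _ fun a _ =>
    (natDegree_C_mul_X_pow_le _ _).trans (Nat.mul_le_mul_right _ (by omega))

theorem dilate_factorPoly (y x : L) (w : ℕ) (v : Fin n → L) :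
    dilate y (factorPoly x w v) = factorPoly (x * y ^ w) w v := by
  ext k
  simp only [factorPoly, coeff_dilate, finsetSum_coeff, coeff_C_mul, coeff_X_pow, Finset.sum_mul]
  refine Finset.sum_congr rfl fun a _ => ?_
  split_ifs with h
  · rw [h, mul_pow, ← pow_mul, mul_comm w]
    ring
  · simp

theorem expand_factorPoly (A : ℕ) (x : L) (w : ℕ) (v : Fin n → L) :
    expand L A (factorPoly x w v) = factorPoly x (w * A) v := by
  simp only [factorPoly, map_sum, map_mul, expand_C, map_pow, expand_X, ← pow_mul]
  refine Finset.sum_congr rfl fun a _ => ?_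
  congr 2
  ring

/-- This is why the base is `d n` and not `n`: after identifications up to `d` factors may share a
variable. Each has degree at most `(n - 1)(d n)^(e - 1)`, so together they stay below `(d n)^e`. -/
theorem natDegree_prod_factorPoly_lt (hn : 1 ≤ n) (hd : 1 ≤ d) {S : Finset (Fin d)} {e : ℕ}
    (x : Fin d → L) {w : Fin d → ℕ} (hw : ∀ j ∈ S, w j < e) (v : Fin d → Fin n → L) :
    (∏ j ∈ S, factorPoly (x j) ((d * n) ^ w j) (v j)).natDegree < (d * n) ^ e := by
  have hN : 0 < d * n := Nat.mul_pos hd hn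
  rcases S.eq_empty_or_nonempty with rfl | ⟨j₀, hj₀⟩
  · simp [hN]
  have he : 0 < e := Nat.zero_lt_of_lt (hw j₀ hj₀)
  calc (∏ j ∈ S, factorPoly (x j) ((d * n) ^ w j) (v j)).natDegree
      ≤ ∑ j ∈ S, (factorPoly (x j) ((d * n) ^ w j) (v j)).natDegree := natDegree_prod_le _ _
    _ ≤ ∑ j ∈ S, (n - 1) * (d * n) ^ (e - 1) := Finset.sum_le_sum fun j hj =>
        (natDegree_factorPoly_le _ _ _).trans (Nat.mul_le_mul_left _
          (Nat.pow_le_pow_right hN (by have := hw j hj; omega)))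
    _ ≤ d * ((n - 1) * (d * n) ^ (e - 1)) := by
        rw [Finset.sum_const, smul_eq_mul]
        exact Nat.mul_le_mul_right _ (S.card_le_univ.trans (by simp))
    _ < d * n * (d * n) ^ (e - 1) := by
        rw [← mul_assoc]
        exact Nat.mul_lt_mul_of_pos_right (Nat.mul_lt_mul_of_pos_left (by omega) hd)
          (pow_pos hN _)
    _ = (d * n) ^ e := by rw [← pow_succ']; congr 1; omega

/-- As `P` has degree less than `A`, exponents of `P(X) Q(X^A)` split uniquely into quotient and
remainder modulo `A`. The coefficients of the product are therefore the entries of the matrix `P ⊗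
Q`. -/
theorem coeff_mul_expand {A : ℕ} {P Q : L[X]} (hP : P.natDegree < A) {a : ℕ} (ha : a < A)
    (b : ℕ) : (P * expand L A Q).coeff (a + A * b) = P.coeff a * Q.coeff b := by
  have hA : 0 < A := Nat.zero_lt_of_lt ha
  rw [coeff_mul, Finset.sum_eq_single (a, A * b)]
  · rw [mul_comm A b, coeff_expand_mul hA]
  · rintro ⟨x, y⟩ hxy hne
    have hxy : x + y = a + A * b := Finset.HasAntidiagonal.mem_antidiagonal.mp hxy
    by_cases hx : x < A
    · rw [coeff_expand hA, if_neg, mul_zero]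
      rintro ⟨c, rfl⟩
      have h1 := congrArg (· % A) hxy
      simp only [Nat.add_mul_mod_self_left, Nat.mod_eq_of_lt hx, Nat.mod_eq_of_lt ha] at h1
      subst h1
      exact hne (by simp; simpa [hA.ne'] using hxy)
    · rw [coeff_eq_zero_of_natDegree_lt (by omega), zero_mul]
  · intro h
    exact absurd (Finset.HasAntidiagonal.mem_antidiagonal (n := a + A * b) (a := (a, A * b)).mpr rfl) h

/-- The univariate polynomial of a tensor for the substitution number `h` of level `s`. -/
noncomputable def levelPoly (g : L) (r s h : ℕ) (T : Tensor L n d) : L[X] :=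
  substPoly (fun j => scaling g (d * n) d r s h j) (fun j => (d * n) ^ varIndex d s j) T

theorem natDegree_levelPoly_lt (hn : 1 ≤ n) (hd : 1 ≤ d) (g : L) (r s h : ℕ) {k : ℕ}
    (v : Fin k → Fin d → Fin n → L) :
    (levelPoly g r s h (∑ l, Tensor.pure (v l))).natDegree < (d * n) ^ halves d s := by
  have hN : 0 < (d * n) ^ halves d s := pow_pos (Nat.mul_pos hd hn) _
  rw [levelPoly, substPoly_sum, Nat.lt_iff_le_pred hN]
  refine natDegree_sum_le_of_forall_le _ _ fun l _ => ?_
  rw [substPoly_pure, ← Nat.lt_iff_le_pred hN]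
  exact natDegree_prod_factorPoly_lt hn hd _ (fun j _ => varIndex_lt j.2 s) _

/-- The polynomial of level `s` and those of level `s + 1` come from the same low-rank matrix. -/
theorem exists_factors (hn : 1 ≤ n) (hd : 1 ≤ d) (g : L) {r : ℕ} (s h : ℕ)
    (v : Fin r → Fin d → Fin n → L) :
    ∃ P Q : Fin r → L[X],
      (∀ k a, (d * n) ^ halves d (s + 1) ≤ a → (P k).coeff a = 0) ∧
      (∀ k b, (d * n) ^ (halves d s - halves d (s + 1)) ≤ b → (Q k).coeff b = 0) ∧
      (∀ l < 2 * r, levelPoly g r (s + 1) (h * (2 * r) + l) (∑ k, Tensor.pure (v k)) =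
        ∑ k, P k * dilate (g ^ l) (Q k)) ∧
      ∀ a < (d * n) ^ halves d (s + 1), ∀ b,
        (levelPoly g r s h (∑ k, Tensor.pure (v k))).coeff
          (a + (d * n) ^ halves d (s + 1) * b) = ∑ k, (P k).coeff a * (Q k).coeff b := by
  classical
  set D := halves d (s + 1) with hD
  let S₁ : Finset (Fin d) := Finset.univ.filter fun j => varIndex d s j < D
  let S₂ : Finset (Fin d) := Finset.univ.filter fun j => ¬ varIndex d s j < D
  let x : Fin d → L := fun j => scaling g (d * n) d r s h j
  let P : Fin r → L[X] := fun k => ∏ j ∈ S₁, factorPoly (x j) ((d * n) ^ varIndex d s j) (v k j)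
  -- The upper variables, moved down by `D` positions. At level `s` they enter as `Q(X ^ (d n) ^
  -- D)`. At level `s + 1` a variable with exponent `(d n) ^ e` is scaled by `(g ^ (d n) ^ e) ^ l`,
  -- which is the substitution `X ↦ g^l X` in all of `Q`.
  let Q : Fin r → L[X] := fun k =>
    ∏ j ∈ S₂, factorPoly (x j) ((d * n) ^ (varIndex d s j - D)) (v k j)
  have hP : ∀ k, (P k).natDegree < (d * n) ^ D := fun k =>
    natDegree_prod_factorPoly_lt hn hd _ (fun j hj => by simpa [S₁] using hj) _
  have hQ : ∀ k, (Q k).natDegree < (d * n) ^ (halves d s - D) := fun k => by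
    refine natDegree_prod_factorPoly_lt hn hd _ (w := fun j => varIndex d s j - D)
      (fun j hj => ?_) _
    have h1 := varIndex_lt j.2 s
    have h2 : ¬ varIndex d s j < D := by simpa [S₂] using hj
    omega
  have hsplit : ∀ f : Fin d → L[X], ∏ j, f j = (∏ j ∈ S₁, f j) * ∏ j ∈ S₂, f j := fun f =>
    (Finset.prod_filter_mul_prod_filter_not Finset.univ (fun j : Fin d => varIndex d s j < D)
      f).symm
  refine ⟨P, Q, fun k a ha => coeff_eq_zero_of_natDegree_lt ((hP k).trans_le ha),
    fun k b hb => coeff_eq_zero_of_natDegree_lt ((hQ k).trans_le hb), fun l hl => ?_,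
    fun a ha b => ?_⟩
  · rw [levelPoly, substPoly_sum]
    refine Finset.sum_congr rfl fun k _ => ?_
    rw [substPoly_pure, hsplit]
    -- The substitution numbers form a tree with `2 r` branches: number `h` of one level has the
    -- children `h (2 r) + l` of the next.
    have e1 : (h * (2 * r) + l) / (2 * r) = h := by
      rw [mul_comm, Nat.mul_add_div (by omega), Nat.div_eq_of_lt hl, add_zero]
    have e2 : (h * (2 * r) + l) % (2 * r) = l := by
      rw [mul_comm, Nat.mul_add_mod, Nat.mod_eq_of_lt hl]
    congr 1
    · refine Finset.prod_congr rfl fun j hj => ?_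
      have hj' : varIndex d s j < D := by simpa [S₁] using hj
      simp [scaling, varIndex, ← hD, hj', e1, x]
    · simp only [Q, map_prod, dilate_factorPoly]
      refine Finset.prod_congr rfl fun j hj => ?_
      have hj' : ¬ varIndex d s j < D := by simpa only [S₂, Finset.mem_filter, Finset.mem_univ, true_and] using hj
      simp only [scaling, varIndex, ← hD, if_neg hj', e1, e2, x]
      rw [← pow_mul, ← pow_mul, mul_comm l]
  · have hU : levelPoly g r s h (∑ k, Tensor.pure (v k)) =
        ∑ k, P k * expand L ((d * n) ^ D) (Q k) := by
      rw [levelPoly, substPoly_sum]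
      refine Finset.sum_congr rfl fun k _ => ?_
      rw [substPoly_pure, hsplit]
      congr 1
      simp only [Q, map_prod, expand_factorPoly]
      refine Finset.prod_congr rfl fun j hj => ?_
      have hj' : ¬ varIndex d s j < D := by simpa only [S₂, Finset.mem_filter, Finset.mem_univ, true_and] using hj
      rw [← pow_add]
      congr 2
      omega
    rw [hU, finsetSum_coeff]
    exact Finset.sum_congr rfl fun k _ => coeff_mul_expand (hP k) ha b

/-- At the last level every variable has become a multiple of the same `X`. Evaluation at `y`
therefore substitutes a field element for each variable and pairs `T` with a product of vectors of
powers. These are the rank-one parity checks. -/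
theorem eval_levelPoly (hd : 1 ≤ d) (g : L) (r h : ℕ) (T : Tensor L n d) (y : L) :
    (levelPoly g r (Nat.clog 2 d) h T).eval y =
      ∑ i, T i * ∏ j : Fin d, (scaling g (d * n) d r (Nat.clog 2 d) h j * y) ^ (i j : ℕ) := by
  have hv : ∀ j : Fin d, varIndex d (Nat.clog 2 d) j = 0 := fun j => by
    have := varIndex_lt j.2 (Nat.clog 2 d)
    rw [halves_clog hd] at this
    omega
  simp only [levelPoly, substPoly, eval_finsetSum, eval_mul, eval_C, eval_pow, eval_X, hv,
    pow_zero, mul_one]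
  refine Finset.sum_congr rfl fun i _ => ?_
  simp only [mul_pow, Finset.prod_mul_distrib, Finset.prod_pow_eq_pow_sum]
  ring

/-- Each `i j` is less than `n ≤ d n`, so the exponents are expansions in base `d n` and distinct
indices give distinct monomials. -/
theorem coeff_levelPoly_zero (hd : 1 ≤ d) (g : L) (r : ℕ) (T : Tensor L n d)
    (i : Fin d → Fin n) :
    (levelPoly g r 0 0 T).coeff (∑ j, (i j : ℕ) * (d * n) ^ (j : ℕ)) = T i := by
  have hinj : ∀ i' : Fin d → Fin n, ∑ j, (i j : ℕ) * (d * n) ^ (j : ℕ) =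
      ∑ j, (i' j : ℕ) * (d * n) ^ (j : ℕ) → i = i' := by
    intro i' h
    have hle : n ≤ d * n := Nat.le_mul_of_pos_left n hd
    have h1 : finFunctionFinEquiv (fun j => Fin.castLE hle (i j)) =
        finFunctionFinEquiv (fun j => Fin.castLE hle (i' j)) := by
      ext
      simpa [finFunctionFinEquiv_apply] using h
    funext j
    have := congrFun (finFunctionFinEquiv.injective h1) j
    simpa using this
  simp only [levelPoly, substPoly, finsetSum_coeff, coeff_C_mul, coeff_X_pow, varIndex]
  rw [Finset.sum_eq_single i]
  · simp [scaling]
  · intro i' _ hne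
    rw [if_neg fun h => hne (hinj i' h).symm, mul_zero]
  · simp

end LevelPolynomials

/-! ## Basic loops -/

namespace LoopProg

variable {F : Type u} [Field F] (en : Enumeration F)

theorem loop_sum {v a acc : ℕ} {e : FieldExpr} {σ : Store F} (f : ℕ → F)
    (h : ∀ i < σ.nat a 0, ∀ τ, Store.Same [v] [acc] σ τ → τ.nat v 0 = i → e.eval en τ = f i) :
    (den en (loop v a (letF acc (fv acc + e))) σ).fld acc 0 =
      σ.fld acc 0 + ∑ i ∈ Finset.range (σ.nat a 0), f i := by
  refine den_loop en (fun k τ => τ.fld acc 0 = σ.fld acc 0 + ∑ i ∈ Finset.range k, f i)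
    (by simp) fun i hi τ hτ hv hI => ?_
  rw [Finset.sum_range_succ, ← add_assoc, ← hI, ← h i hi τ hτ hv]
  simp

/-- The premise about one round may use that cells not yet reached still have their old contents.
This is what makes updates in place possible, where a cell is read just before it is overwritten. -/
theorem loop_setF {v a A : ℕ} {idx : NatExpr} {e : FieldExpr} {σ : Store F} (pos : ℕ → ℕ)
    (f : ℕ → F) (hinj : Set.InjOn pos (Set.Iio (σ.nat a 0)))
    (h : ∀ i < σ.nat a 0, ∀ τ, Store.Same [v] [A] σ τ → τ.nat v 0 = i →
      (∀ j, (∀ i' < i, j ≠ pos i') → τ.fld A j = σ.fld A j) →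
      idx.eval τ = pos i ∧ e.eval en τ = f i) :
    (∀ i < σ.nat a 0, (den en (loop v a (setF A idx e)) σ).fld A (pos i) = f i) ∧
      ∀ j, (∀ i < σ.nat a 0, j ≠ pos i) →
        (den en (loop v a (setF A idx e)) σ).fld A j = σ.fld A j := by
  refine den_loop en (fun k τ => k ≤ σ.nat a 0 → (∀ i < k, τ.fld A (pos i) = f i) ∧
    ∀ j, (∀ i < k, j ≠ pos i) → τ.fld A j = σ.fld A j) (by simp) (fun i hi τ hτ hv hI hk => ?_)
    le_rfl
  obtain ⟨h1, h2⟩ := h i hi τ hτ hv (hI hi.le).2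
  refine ⟨fun i' hi' => ?_, fun j hj => ?_⟩
  · rcases Nat.lt_succ_iff_lt_or_eq.mp hi' with h3 | rfl
    · have : pos i' ≠ pos i := fun h4 => h3.ne (hinj (h3.trans hi) hi h4)
      simp [h1, this, (hI hi.le).1 i' h3]
    · simp [h1, h2]
  · have := hj i (Nat.lt_succ_self i)
    simp [h1, this, (hI hi.le).2 j fun i' hi' => hj i' (hi'.trans (Nat.lt_succ_self i))]

theorem loop_setN {v a A : ℕ} {idx e : NatExpr} {σ : Store F} (hvA : v ≠ A) (pos : ℕ → ℕ)
    (f : ℕ → ℕ) (hinj : Set.InjOn pos (Set.Iio (σ.nat a 0)))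
    (h : ∀ i < σ.nat a 0, ∀ τ, Store.Same [v, A] [] σ τ → τ.nat v 0 = i →
      (∀ i' < i, τ.nat A (pos i') = f i') →
      (∀ j, (∀ i' < i, j ≠ pos i') → τ.nat A j = σ.nat A j) →
      idx.eval τ = pos i ∧ e.eval τ = f i) :
    (∀ i < σ.nat a 0, (den en (loop v a (setN A idx e)) σ).nat A (pos i) = f i) ∧
      ∀ j, (∀ i < σ.nat a 0, j ≠ pos i) →
        (den en (loop v a (setN A idx e)) σ).nat A j = σ.nat A j := by
  refine den_loop en (fun k τ => k ≤ σ.nat a 0 → (∀ i < k, τ.nat A (pos i) = f i) ∧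
    ∀ j, (∀ i < k, j ≠ pos i) → τ.nat A j = σ.nat A j) (by simp [Ne.symm hvA])
    (fun i hi τ hτ hv hI hk => ?_) le_rfl
  obtain ⟨h1, h2⟩ := h i hi τ hτ hv (hI hi.le).1 (hI hi.le).2
  refine ⟨fun i' hi' => ?_, fun j hj => ?_⟩
  · rcases Nat.lt_succ_iff_lt_or_eq.mp hi' with h3 | rfl
    · have : pos i' ≠ pos i := fun h4 => h3.ne (hinj (h3.trans hi) hi h4)
      simp [h1, this, Ne.symm hvA, (hI hi.le).1 i' h3]
    · simp [h1, h2, Ne.symm hvA]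
  · have := hj i (Nat.lt_succ_self i)
    simp [h1, this, Ne.symm hvA,
      (hI hi.le).2 j fun i' hi' => hj i' (hi'.trans (Nat.lt_succ_self i))]

end LoopProg

/-! ## Null spaces -/

section NullSpace

variable {F : Type u} [Field F] {c : ℕ}

/-- The vectors orthogonal to a given row. -/
def rowKer (c : ℕ) (row : ℕ → F) : Submodule F (Fin c → F) :=
  LinearMap.ker (∑ x : Fin c, row x • (LinearMap.proj x : (Fin c → F) →ₗ[F] F))

theorem mem_rowKer {row : ℕ → F} {v : Fin c → F} :
    v ∈ rowKer c row ↔ ∑ x : Fin c, row x * v x = 0 := by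
  simp [rowKer, LinearMap.sum_apply]

/-- The vectors need not be independent. Subtracting multiples of the pivot makes all of them
orthogonal and turns the pivot into zero. If the form vanishes on all of them, the inverse of zero
is zero and nothing changes, so no case distinction is needed. -/
theorem span_eliminate (φ : (Fin c → F) →ₗ[F] F) (v : Fin c → Fin c → F) (piv : Fin c)
    (h : ∀ q, φ (v q) ≠ 0 → φ (v piv) ≠ 0) :
    Submodule.span F (Set.range fun q => v q - (φ (v q) * (φ (v piv))⁻¹) • v piv) =
      Submodule.span F (Set.range v) ⊓ LinearMap.ker φ := by
  apply le_antisymm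
  · rw [Submodule.span_le]
    rintro _ ⟨q, rfl⟩
    refine ⟨Submodule.sub_mem _ (Submodule.subset_span ⟨q, rfl⟩)
      (Submodule.smul_mem _ _ (Submodule.subset_span ⟨piv, rfl⟩)), ?_⟩
    simp only [SetLike.mem_coe, LinearMap.mem_ker, map_sub, map_smul, smul_eq_mul]
    by_cases hq : φ (v q) = 0
    · simp [hq]
    · rw [mul_assoc, inv_mul_cancel₀ (h q hq)]
      simp
  · rintro w ⟨hw, hφ⟩
    obtain ⟨co, rfl⟩ := (Submodule.mem_span_range_iff_exists_fun F).mp hw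
    have h1 : ∑ q, co q * φ (v q) = 0 := by simpa [map_sum] using hφ
    have h2 : ∑ q, co q • v q =
        ∑ q, co q • (v q - (φ (v q) * (φ (v piv))⁻¹) • v piv) := by
      simp only [smul_sub, Finset.sum_sub_distrib, smul_smul, ← mul_assoc]
      rw [← Finset.sum_smul, ← Finset.sum_mul, h1]
      simp
    rw [h2]
    exact Submodule.sum_mem _ fun q _ => Submodule.smul_mem _ _ (Submodule.subset_span ⟨q, rfl⟩)

theorem finrank_inf_ker {V : Type*} [AddCommGroup V] [Module F V] [FiniteDimensional F V]
    (W : Submodule F V) (φ : V →ₗ[F] F) {w : V} (hw : w ∈ W) (hφ : φ w ≠ 0) :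
    Module.finrank F (W ⊓ LinearMap.ker φ : Submodule F V) + 1 = Module.finrank F W := by
  have h1 := LinearMap.finrank_range_add_finrank_ker (φ.domRestrict W)
  have h2 : LinearMap.range (φ.domRestrict W) = ⊤ := by
    refine LinearMap.range_eq_top.mpr (LinearMap.surjective_of_ne_zero fun h0 => hφ ?_)
    exact congrArg (fun f => f ⟨w, hw⟩) h0
  have h3 : Module.finrank F (LinearMap.ker (φ.domRestrict W)) =
      Module.finrank F (W ⊓ LinearMap.ker φ : Submodule F V) := by
    have : LinearMap.ker (φ.domRestrict W) = (LinearMap.ker φ).comap W.subtype := rfl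
    rw [this, ← Submodule.map_comap_subtype, Submodule.finrank_map_subtype_eq]
  rw [h2, finrank_top, Module.finrank_self, h3] at h1
  omega

end NullSpace

/-! ## Names of variables

Numbers `v…`, tables of numbers `t…`, and arrays or scalars `f…` of field elements. -/

-- All names of arrays of numbers are congruent to 3 modulo 4. The simulation of an extension field
-- maps arrays to the numbers `4 a` and `4 a + 1`, so it cannot interfere with the tables it relies
-- on.
local notation "vn" => (3 : ℕ)
local notation "vd" => (7 : ℕ)
local notation "vr" => (11 : ℕ)
local notation "vN" => (15 : ℕ)
local notation "vnd" => (19 : ℕ)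
local notation "vW" => (23 : ℕ)
local notation "vR2" => (27 : ℕ)
local notation "vK" => (31 : ℕ)
local notation "vRK" => (35 : ℕ)
local notation "vN0" => (39 : ℕ)
local notation "vM" => (43 : ℕ)
local notation "vR" => (47 : ℕ)
local notation "vC" => (51 : ℕ)
local notation "vMchk" => (55 : ℕ)
local notation "vR1" => (59 : ℕ)
local notation "vTot" => (63 : ℕ)
local notation "tC" => (67 : ℕ)
local notation "vQ" => (71 : ℕ)
local notation "vX" => (75 : ℕ)
local notation "vPiv" => (79 : ℕ)
local notation "vCnt" => (83 : ℕ)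
local notation "vUsed" => (87 : ℕ)
local notation "tHalf" => (91 : ℕ)
local notation "tD" => (95 : ℕ)
local notation "tNP" => (99 : ℕ)
local notation "tW" => (103 : ℕ)
local notation "tR2" => (107 : ℕ)
local notation "tR" => (111 : ℕ)
local notation "tA" => (115 : ℕ)
local notation "tQu" => (119 : ℕ)
local notation "tRm" => (123 : ℕ)
local notation "tSd" => (127 : ℕ)
local notation "tnd" => (131 : ℕ)
local notation "vI" => (135 : ℕ)
local notation "vJ" => (139 : ℕ)
local notation "vH" => (143 : ℕ)
local notation "vKk" => (147 : ℕ)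
local notation "vL" => (151 : ℕ)
local notation "vE" => (155 : ℕ)
local notation "vE2" => (159 : ℕ)
local notation "vP" => (163 : ℕ)
local notation "vB" => (167 : ℕ)
local notation "vS" => (171 : ℕ)
local notation "vT1" => (175 : ℕ)
local notation "vT2" => (179 : ℕ)
local notation "vT3" => (183 : ℕ)
local notation "vPtr" => (187 : ℕ)
local notation "vOff" => (191 : ℕ)
local notation "vCur" => (195 : ℕ)
local notation "vDA" => (199 : ℕ)
local notation "vDB" => (203 : ℕ)
local notation "vDAB" => (207 : ℕ)
local notation "vIdx" => (211 : ℕ)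
local notation "vMc" => (215 : ℕ)
local notation "vFound" => (219 : ℕ)
local notation "vOk" => (223 : ℕ)
local notation "vY" => (227 : ℕ)
local notation "tV" => (251 : ℕ)
local notation "vL2" => (255 : ℕ)
local notation "vSt" => (263 : ℕ)
local notation "vTt" => (271 : ℕ)
local notation "vQT" => (275 : ℕ)
local notation "vQc" => (279 : ℕ)
local notation "vTD" => (283 : ℕ)
local notation "tAdd" => (287 : ℕ)
local notation "tMul" => (291 : ℕ)
local notation "tSub" => (295 : ℕ)
local notation "tInv" => (299 : ℕ)
local notation "tOt" => (303 : ℕ)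
local notation "tOq" => (307 : ℕ)
local notation "vCand" => (311 : ℕ)
local notation "vU2" => (315 : ℕ)
local notation "vW2" => (319 : ℕ)
local notation "vFw" => (323 : ℕ)
local notation "vEq" => (327 : ℕ)
local notation "tQb" => (335 : ℕ)
local notation "tRb" => (339 : ℕ)
local notation "fIn" => (0 : ℕ)
local notation "fOut" => (1 : ℕ)
local notation "fG" => (2 : ℕ)
local notation "fVec" => (3 : ℕ)
local notation "fAlpha" => (5 : ℕ)
local notation "fGam" => (6 : ℕ)
local notation "fGL" => (7 : ℕ)
local notation "fU" => (8 : ℕ)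
local notation "fU0" => (9 : ℕ)
local notation "fV" => (10 : ℕ)
local notation "fRow" => (11 : ℕ)
local notation "fDot" => (12 : ℕ)
local notation "fAcc" => (13 : ℕ)
local notation "fPr" => (14 : ℕ)
local notation "fZ" => (15 : ℕ)
local notation "fSy" => (16 : ℕ)
local notation "fLam" => (17 : ℕ)
local notation "fPw" => (18 : ℕ)
local notation "fGk" => (19 : ℕ)
local notation "fT1" => (20 : ℕ)
local notation "fT2" => (21 : ℕ)
local notation "fLst" => (22 : ℕ)
local notation "fCf" => (23 : ℕ)
local notation "fRws" => (24 : ℕ)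
local notation "fNz" => (27 : ℕ)
local notation "sizeVars" => [vn, vd, vr, vR1, vR2, vN, vnd, vW, vK, vRK, vN0, vM, vR, vC, vMchk, vTot]
local notation "fieldVars" => sizeVars ++ [vQ, vTt, vQT, vQc]

/-! ## The program for null spaces -/

namespace LoopProg

/-- The table `arr` of the multiples of `w`. -/
def multiples (arr v b w : ℕ) : LoopProg :=
  setN arr 0 0 ;; loop v b (setN arr (nv v + 1) (.get arr (nv v) + nv w))

/-- The scalar product of `fRow` with the current row of `fV`. -/
def dotRow : LoopProg :=
  letF fAcc 0 ;;
  loop vX vC (letF fAcc (fv fAcc + .get fRow (nv vX) * .get fV (.get tC (nv vQ) + nv vX)))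

/-- Store the scalar product, and the row as the pivot if it is nonzero. -/
def testRow : LoopProg :=
  dotRow ;; setF fDot (nv vQ) (fv fAcc) ;; ite (.fieldEq (fv fAcc) 0) skip (letN vPiv (nv vQ))

/-- Copy the pivot row of `fV` to the array `A`. -/
def copyPivot (A : ℕ) : LoopProg :=
  loop vX vC (setF A (nv vX) (.get fV (.get tC (nv vPiv) + nv vX)))

/-- Subtract a multiple of the pivot row from the current row. -/
def eliminate : LoopProg :=
  letF fAcc (.get fDot (nv vQ) * (.get fDot (nv vPiv))⁻¹) ;;
  loop vX vC (setF fV (.get tC (nv vQ) + nv vX)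
    (.get fV (.get tC (nv vQ) + nv vX) - fv fAcc * .get fPr (nv vX)))

/-- Restrict the space spanned by the rows of `fV` to the solutions of the equation `fRow`. -/
def addEquation : LoopProg :=
  letN vPiv 0 ;; loop vQ vC testRow ;; copyPivot fPr ;; loop vQ vC eliminate ;;
  ite (.fieldEq (.get fDot (nv vPiv)) 0) skip (letN vCnt (nv vCnt + 1))

/-- Clear the current row, or let it be a unit vector. -/
def initRow : LoopProg :=
  loop vX vC (setF fV (.get tC (nv vQ) + nv vX) 0) ;;
  ite (.natLt (nv vQ) (nv vUsed)) (setF fV (.get tC (nv vQ) + nv vQ) 1) skip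

/-- Let the rows of `fV` be the first unit vectors, followed by zeros. -/
def initSpan : LoopProg := letN vCnt 0 ;; loop vQ vC initRow

/-- The space of the vectors supported on the first coordinates. -/
def startSpan (e : NatExpr) : LoopProg := letN vUsed e ;; initSpan

/-- Let the current row be the pivot row if its current entry is nonzero. -/
def testEntry : LoopProg :=
  ite (.fieldEq (.get fV (.get tC (nv vQ) + nv vX)) 0) skip (letN vPiv (nv vQ))

/-- Copy a nonzero row of `fV` to `fZ`. -/
def pickVector : LoopProg := letN vPiv 0 ;; loop vQ vC (loop vX vC testEntry) ;; copyPivot fZ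

variable {F : Type u}

/-- The number of unknowns is `c`, and the table of offsets is in place. -/
def Square (c : ℕ) (σ : Store F) : Prop :=
  0 < c ∧ σ.nat vC 0 = c ∧ ∀ q < c, σ.nat tC q = q * c

theorem Square.of_same {c : ℕ} {σ τ : Store F} {wn wf : List ℕ} (h : Store.Same wn wf σ τ)
    (h1 : vC ∉ wn) (h2 : tC ∉ wn) (hσ : Square c σ) : Square c τ := by
  rw [Square, h.1 _ h1, h.1 _ h2]
  exact hσ

theorem mul_add_div_mod {a b i : ℕ} (hi : i < b) : (a * b + i) / b = a ∧ (a * b + i) % b = i := by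
  rw [mul_comm, Nat.mul_add_div (by omega), Nat.div_eq_of_lt hi, add_zero, Nat.mul_add_mod,
    Nat.mod_eq_of_lt hi]
  exact ⟨rfl, rfl⟩

theorem add_mul_inj {c q q' x x' : ℕ} (hx : x < c) (hx' : x' < c) (h : q * c + x = q' * c + x') :
    q = q' ∧ x = x' := by
  have h1 := mul_add_div_mod (a := q) hx
  rw [h] at h1
  have h2 := mul_add_div_mod (a := q') hx'
  exact ⟨h1.1.symm.trans h2.1, h1.2.symm.trans h2.2⟩

theorem mul_add_lt {a b i k : ℕ} (ha : a < k) (hi : i < b) : a * b + i < k * b :=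
  (Nat.add_lt_add_left hi _).trans_le (by rw [← Nat.succ_mul]; exact Nat.mul_le_mul_right b ha)

variable [Field F] (en : Enumeration F)

/-- From `σ` to `τ`, the values `f` are written to the array `A` at the pointer. -/
def Emitted (A L : ℕ) (f : ℕ → F) (σ τ : Store F) : Prop :=
  τ.nat vPtr 0 = σ.nat vPtr 0 + L ∧ (∀ x < L, τ.fld A (σ.nat vPtr 0 + x) = f x) ∧
    ∀ x < σ.nat vPtr 0, τ.fld A x = σ.fld A x

theorem Emitted.of_same {A L : ℕ} {f : ℕ → F} {wn wf : List ℕ} {σ τ υ : Store F}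
    (h : Emitted A L f τ υ) (hs : Store.Same wn wf σ τ) (hn : vPtr ∉ wn := by decide)
    (hf : A ∉ wf := by decide) : Emitted A L f σ υ := by
  rwa [Emitted, hs.1 _ hn, hs.2 _ hf] at h

/-- Output in consecutive blocks of length `L`, one for each round. Nested loops that write at a
moving pointer compose through this rule, and the final position is decoded by quotients and
remainders; `I` carries any further invariant. -/
theorem loop_emitted {σ : Store F} {v b A L : ℕ} {p : LoopProg} {f : ℕ → ℕ → F} (I : ℕ → Store F → Prop)
    (hv : v ≠ vPtr) (h0 : I 0 (σ.setNat v 0 0))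
    (h : ∀ i < σ.nat b 0, ∀ τ, Store.Same (v :: p.wn) p.wf σ τ → τ.nat v 0 = i →
      τ.nat vPtr 0 = σ.nat vPtr 0 + i * L → I i τ →
      Emitted A L (f i) τ (den en p τ) ∧ I (i + 1) ((den en p τ).setNat v 0 (i + 1))) :
    Emitted A (σ.nat b 0 * L) (fun x => f (x / L) (x % L)) σ (den en (loop v b p) σ) ∧
      I (σ.nat b 0) (den en (loop v b p) σ) := by
  refine den_loop en (fun k τ => Emitted A (k * L) (fun x => f (x / L) (x % L)) σ τ ∧ I k τ)
    ⟨by simp [Emitted, hv.symm], h0⟩ fun k hk τ hτ hvk ⟨⟨h1, h2, h3⟩, hI⟩ => ?_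
  obtain ⟨⟨g1, g2, g3⟩, g4⟩ := h k hk τ hτ hvk h1 hI
  refine ⟨⟨by simp [hv.symm, g1, h1]; ring, fun x hx => ?_, fun x hx => ?_⟩, g4⟩
  · rw [Store.fld_setNat]
    rcases Nat.lt_or_ge x (k * L) with hxk | hxk
    · rw [g3 _ (by omega), h2 x hxk]
    · obtain ⟨y, rfl⟩ := Nat.exists_eq_add_of_le hxk
      have hy : y < L := by rw [add_mul] at hx; omega
      simp only [(mul_add_div_mod hy).1, (mul_add_div_mod hy).2]
      rw [← g2 y hy, h1, add_assoc]
  · rw [Store.fld_setNat, g3 _ (by omega), h3 x hx]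

theorem den_multiples {arr v b w : ℕ} (h1 : v ≠ arr) (h2 : b ≠ arr) (h3 : w ≠ arr) (h4 : w ≠ v)
    (σ : Store F) {i : ℕ} (hi : i ≤ σ.nat b 0) :
    (den en (multiples arr v b w) σ).nat arr i = i * σ.nat w 0 := by
  rw [multiples, den_seq, den_setN]
  have h5 : (σ.setNat arr (NatExpr.eval σ 0) (NatExpr.eval σ 0)).nat b 0 = σ.nat b 0 := by
    simp [h2]
  have key := den_loop en (v := v) (a := b) (p := setN arr (nv v + 1) (.get arr (nv v) + nv w))
    (σ := σ.setNat arr (NatExpr.eval σ 0) (NatExpr.eval σ 0))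
    (fun k τ => ∀ i ≤ k, τ.nat arr i = i * σ.nat w 0) (by simp [h1.symm])
    (fun k hk τ hτ hv hI i hi => by
      have hw : τ.nat w = σ.nat w := by
        rw [hτ.1 w (by simp [wn, h3, h4])]
        funext j
        simp [h3]
      rcases Nat.le_succ_iff.mp hi with h | rfl
      · have : i ≠ k + 1 := by omega
        simp [h1.symm, hv, this, hI i h]
      · simp [h1.symm, hv, hI k le_rfl, hw]
        ring)
  rw [h5] at key
  exact key i hi

/-- Entries of the rows of a table, computed one row after the other. -/
theorem loop_rows {v b A c : ℕ} {p : LoopProg} {σ : Store F} (Z : ℕ → ℕ → F → Prop)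
    (h : ∀ q < σ.nat b 0, ∀ τ, Store.Same (v :: p.wn) p.wf σ τ → τ.nat v 0 = q →
      (∀ x, q * c ≤ x → τ.fld A x = σ.fld A x) →
      (∀ x < c, Z q x ((den en p τ).fld A (q * c + x))) ∧
      ∀ j, (∀ x < c, j ≠ q * c + x) → (den en p τ).fld A j = τ.fld A j) :
    ∀ q < σ.nat b 0, ∀ x < c, Z q x ((den en (loop v b p) σ).fld A (q * c + x)) := by
  refine (den_loop en (v := v) (a := b) (p := p) (fun k τ => (∀ q < k, ∀ x < c,
    Z q x (τ.fld A (q * c + x))) ∧ ∀ x, k * c ≤ x → τ.fld A x = σ.fld A x)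
    ⟨by simp, by simp⟩ fun k hk τ hτ hv hI => ?_).1
  obtain ⟨h1, h2⟩ := h k hk τ hτ hv hI.2
  rw [Nat.forall_lt_succ_right, Store.fld_setNat]
  refine ⟨⟨fun q hq x hx => ?_, h1⟩, fun x hx => ?_⟩
  · rw [h2 _ fun y hy e => hq.ne (add_mul_inj hx hy e).1]
    exact hI.1 q hq x hx
  · rw [add_one_mul] at hx
    rw [h2 x fun y hy e => by omega, hI.2 x (by omega)]

theorem loop_fill {v a A : ℕ} {e : FieldExpr} {σ : Store F} (f : ℕ → F)
    (h : ∀ i < σ.nat a 0, ∀ τ, Store.Same [v] [A] σ τ → τ.nat v 0 = i → e.eval en τ = f i) :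
    ∀ i < σ.nat a 0, (den en (loop v a (setF A (nv v) e)) σ).fld A i = f i :=
  (loop_setF en id f (fun _ _ _ _ h => h) fun i hi τ hτ hv _ => ⟨by simp [hv], h i hi τ hτ hv⟩).1

theorem loop_fillRow {v a A T y k : ℕ} {e : FieldExpr} {σ : Store F} (f : ℕ → F)
    (hT : σ.nat T (σ.nat y 0) = k) (h1 : v ≠ T := by decide) (h2 : v ≠ y := by decide)
    (h : ∀ i < σ.nat a 0, ∀ τ, Store.Same [v] [A] σ τ → τ.nat v 0 = i →
      τ.fld A (k + i) = σ.fld A (k + i) → e.eval en τ = f i) :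
    (∀ i < σ.nat a 0, (den en (loop v a (setF A (.get T (nv y) + nv v) e)) σ).fld A (k + i) = f i) ∧
      ∀ j, (∀ i < σ.nat a 0, j ≠ k + i) →
        (den en (loop v a (setF A (.get T (nv y) + nv v) e)) σ).fld A j = σ.fld A j :=
  loop_setF en (k + ·) f (fun _ _ _ _ h => Nat.add_left_cancel h) fun i hi τ hτ hv hA =>
    ⟨by simp [hv, hτ.1 T (by simpa using h1.symm), hτ.1 y (by simpa using h2.symm), hT],
      h i hi τ hτ hv (hA _ fun j hj => by omega)⟩

/-- The space spanned by the rows of the array `fV`. -/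
def spanOf (c : ℕ) (σ : Store F) : Submodule F (Fin c → F) :=
  Submodule.span F (Set.range fun (q x : Fin c) => σ.fld fV (q * c + x))

theorem den_dotRow {c : ℕ} {σ : Store F} (hσ : Square c σ) (hq : σ.nat vQ 0 < c) :
    (den en dotRow σ).fld fAcc 0 =
      ∑ x ∈ Finset.range c, σ.fld fRow x * σ.fld fV (σ.nat vQ 0 * c + x) := by
  have := loop_sum en (v := vX) (a := vC) (acc := fAcc) (σ := den en (letF fAcc 0) σ)
    (e := .get fRow (nv vX) * .get fV (.get tC (nv vQ) + nv vX))
    (fun x => σ.fld fRow x * σ.fld fV (σ.nat vQ 0 * c + x))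
    (fun i hi τ hτ hv => by simp [hτ.1, hτ.2, hv, hσ.2.2 _ hq])
  simp only [dotRow, den_seq, this]
  simp [hσ.2.1]

theorem den_copyPivot {c A : ℕ} {σ : Store F} (hσ : Square c σ) (hp : σ.nat vPiv 0 < c)
    (hA : fV ≠ A := by decide) :
    ∀ x < c, (den en (copyPivot A) σ).fld A x = σ.fld fV (σ.nat vPiv 0 * c + x) := by
  have := loop_fill en (v := vX) (a := vC) (A := A) (σ := σ)
    (e := .get fV (.get tC (nv vPiv) + nv vX)) (fun x => σ.fld fV (σ.nat vPiv 0 * c + x))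
    (fun i hi τ hτ hv => by simp [hτ.1, hτ.2 fV (by simpa using hA), hv, hσ.2.2 _ hp])
  rwa [hσ.2.1] at this

/-- The pivot is the last row not orthogonal to the equation, and row 0 if there is none. Then its
scalar product is zero and all rows stay as they are. The pivot row is copied before the elimination
because it is itself overwritten. -/
theorem den_addEquation_aux {c : ℕ} {σ : Store F} (hσ : Square c σ) :
    ∃ piv < c,
      let dot := fun q => ∑ x ∈ Finset.range c, σ.fld fRow x * σ.fld fV (q * c + x)
      (∀ q < c, dot q ≠ 0 → dot piv ≠ 0) ∧
      (∀ q < c, ∀ x < c, (den en addEquation σ).fld fV (q * c + x) =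
        σ.fld fV (q * c + x) - dot q * (dot piv)⁻¹ * σ.fld fV (piv * c + x)) ∧
      ((den en addEquation σ).nat vCnt 0 = σ.nat vCnt 0 + 1 ∧ dot piv ≠ 0 ∨
        (den en addEquation σ).nat vCnt 0 = σ.nat vCnt 0 ∧ dot piv = 0) := by
  let dot : ℕ → F := fun q => ∑ x ∈ Finset.range c, σ.fld fRow x * σ.fld fV (q * c + x)
  simp only [addEquation, den_seq]
  have s₀ := (Store.Same.refl [vPiv, vQ, vX] [fAcc, fDot] σ).trans (den_same en (letN vPiv 0) σ)
  have hd := den_loop en (v := vQ) (a := vC) (p := testRow) (σ := den en (letN vPiv 0) σ)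
    (fun k τ => τ.nat vPiv 0 < c ∧ (∀ q < k, τ.fld fDot q = dot q) ∧
      ∀ q < k, dot q ≠ 0 → dot (τ.nat vPiv 0) ≠ 0) (by simp [hσ.1])
    (fun k hk τ hτ hv ⟨i1, i2, i3⟩ => by
      have t := s₀.trans hτ
      have hS : Square c τ := hσ.of_same t (by decide) (by decide)
      have hk' : k < c := by simpa [hσ.2.1] using hk
      have hdot := den_dotRow en hS (by rwa [hv])
      rw [hv, t.2 _ (by decide), t.2 _ (by decide)] at hdot
      change _ = dot k at hdot
      rw [testRow, Nat.forall_lt_succ_right, Nat.forall_lt_succ_right]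
      by_cases h0 : dot k = 0
      · rw [den_seq, den_seq, den_ite_pos en (by simp [hdot, h0])]
        simp (disch := decide) [den_nat, den_fld, hdot, hv, h0]
        exact ⟨i1, fun q hq => by simpa [hq.ne] using i2 q hq, i3⟩
      · rw [den_seq, den_seq, den_ite_neg en (by simp [hdot, h0])]
        simp (disch := decide) [den_nat, den_fld, hdot, hv, h0]
        exact ⟨hk', fun q hq => by simpa [hq.ne] using i2 q hq⟩)
  have s₁ := s₀.trans (den_same en (loop vQ vC testRow) _)
  set σ₁ := den en (loop vQ vC testRow) (den en (letN vPiv 0) σ)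
  obtain ⟨i1, i2, i3⟩ := hd
  rw [s₀.1 _ (by decide), hσ.2.1] at i2 i3
  have h₁ : Square c σ₁ := hσ.of_same s₁ (by decide) (by decide)
  have hp := den_copyPivot en (A := fPr) h₁ i1
  have s₂ := (Store.Same.refl [vX] [fPr] σ₁).trans (den_same en (copyPivot fPr) σ₁)
  rw [s₁.2 fV (by decide)] at hp
  set σ₂ := den en (copyPivot fPr) σ₁
  have h₂ : Square c σ₂ := h₁.of_same s₂ (by decide) (by decide)
  have key := loop_rows en (v := vQ) (b := vC) (A := fV) (c := c) (p := eliminate) (σ := σ₂)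
    (fun q x y => y = σ.fld fV (q * c + x) -
      dot q * (dot (σ₁.nat vPiv 0))⁻¹ * σ.fld fV (σ₁.nat vPiv 0 * c + x))
    (fun q hq τ hτ hv hV => by
      rw [h₂.2.1] at hq
      have hτ' := (Store.Same.refl [vQ, vX] [fAcc, fV] σ₂).trans hτ
      have ht : τ.nat tC q = q * c := by rw [hτ'.1 _ (by decide), h₂.2.2 q hq]
      have := loop_fillRow en (v := vX) (a := vC) (A := fV) (T := tC) (y := vQ)
        (e := .get fV (.get tC (nv vQ) + nv vX) - fv fAcc * .get fPr (nv vX))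
        (σ := den en (letF fAcc (.get fDot (nv vQ) * (.get fDot (nv vPiv))⁻¹)) τ)
        (fun x => σ.fld fV (q * c + x) -
          dot q * (dot (σ₁.nat vPiv 0))⁻¹ * σ.fld fV (σ₁.nat vPiv 0 * c + x))
        (by simpa [hv] using ht) (h := fun i hi υ hυ hvi hA => by
          have hi : i < c := by simpa [hτ'.1, h₂.2.1] using hi
          simp [hυ.1, hυ.2, hvi, hv, ht, hA, hV, hτ'.2, hτ'.1, hp i hi, s₂.2, s₂.1, i2 q hq,
            i2 _ i1, s₁.2])
      simpa [eliminate, hτ'.1, h₂.2.1] using this)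
  rw [h₂.2.1] at key
  have s₃ := den_same en (loop vQ vC eliminate) σ₂
  set σ₃ := den en (loop vQ vC eliminate) σ₂
  have h0 : σ₃.fld fDot (σ₃.nat vPiv 0) = dot (σ₁.nat vPiv 0) := by
    rw [s₃.1 _ (by decide), s₃.2 _ (by decide), s₂.1 _ (by decide), s₂.2 _ (by decide), i2 _ i1]
  have hc : σ₃.nat vCnt = σ.nat vCnt := by
    rw [s₃.1 _ (by decide), s₂.1 _ (by decide), s₁.1 _ (by decide)]
  refine ⟨_, i1, i3, fun q hq x hx => ?_, ?_⟩
  · rw [den_fld en (by decide)]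
    exact key q hq x hx
  · by_cases h : dot (σ₁.nat vPiv 0) = 0
    · exact Or.inr ⟨by rw [den_ite_pos en (by simp [h0, h])]; simp [hc], h⟩
    · exact Or.inl ⟨by rw [den_ite_neg en (by simp [h0, h])]; simp [hc], h⟩

/-- The counter `vCnt` goes up exactly when the new equation is not implied by the previous ones,
and then the dimension drops by one. So dimension plus counter is invariant, which later allows a
code to be cut to a prescribed dimension. -/
theorem den_addEquation {c : ℕ} {σ : Store F} (hσ : Square c σ) :
    spanOf c (den en addEquation σ) = spanOf c σ ⊓ rowKer c (σ.fld fRow) ∧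
      Module.finrank F (spanOf c (den en addEquation σ)) + (den en addEquation σ).nat vCnt 0 =
        Module.finrank F (spanOf c σ) + σ.nat vCnt 0 := by
  obtain ⟨piv, hpiv, h1, h2, h3⟩ := den_addEquation_aux en hσ
  let φ : (Fin c → F) →ₗ[F] F :=
    ∑ x : Fin c, σ.fld fRow x • (LinearMap.proj x : (Fin c → F) →ₗ[F] F)
  let v : Fin c → Fin c → F := fun q x => σ.fld fV (q * c + x)
  have hφ : ∀ q : Fin c, φ (v q) =
      ∑ x ∈ Finset.range c, σ.fld fRow x * σ.fld fV (q * c + x) := fun q => by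
    rw [Finset.sum_range]
    simp [φ, v, LinearMap.sum_apply]
  have h4 : spanOf c (den en addEquation σ) = spanOf c σ ⊓ rowKer c (σ.fld fRow) := by
    rw [show rowKer c (σ.fld fRow) = LinearMap.ker φ from rfl, spanOf, spanOf,
      ← span_eliminate φ v ⟨piv, hpiv⟩ fun q hq => by
        rw [hφ] at hq ⊢
        exact h1 q q.2 hq]
    congr 2
    funext q x
    rw [h2 q q.2 x x.2, hφ, hφ]
    rfl
  refine ⟨h4, ?_⟩
  rcases h3 with ⟨h5, h6⟩ | ⟨h5, h6⟩
  · rw [h4, h5, ← finrank_inf_ker (spanOf c σ) φ (w := v ⟨piv, hpiv⟩)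
      (Submodule.subset_span ⟨⟨piv, hpiv⟩, rfl⟩) (by rw [hφ]; exact h6)]
    rw [show rowKer c (σ.fld fRow) = LinearMap.ker φ from rfl]
    omega
  · rw [h4, h5, inf_eq_left.mpr]
    rw [spanOf, Submodule.span_le]
    rintro _ ⟨q, rfl⟩
    change φ (v q) = 0
    rw [hφ]
    by_contra hne
    exact h1 q q.2 hne h6

theorem spanOf_congr {c : ℕ} {σ τ : Store F} (h : τ.fld fV = σ.fld fV) :
    spanOf c τ = spanOf c σ := by
  rw [spanOf, spanOf, h]

theorem den_initSpan {c : ℕ} {σ : Store F} (hσ : Square c σ) {w : Fin c → F} :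
    w ∈ spanOf c (den en initSpan σ) ↔ ∀ x : Fin c, σ.nat vUsed 0 ≤ x → w x = 0 := by
  have hfin := loop_rows en (v := vQ) (b := vC) (A := fV) (c := c) (p := initRow)
    (σ := den en (letN vCnt 0) σ) (fun q x y => y = if q = x ∧ q < σ.nat vUsed 0 then 1 else 0)
    (fun q hq τ hτ hv _ => by
      have t := ((Store.Same.refl [vCnt, vQ, vX] [fV] σ).trans (den_same en _ σ)).trans hτ
      have hq : q < c := by simpa [hσ.2.1] using hq
      have ht : τ.nat tC q = q * c := by rw [t.1 _ (by decide), hσ.2.2 q hq]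
      have := loop_fillRow en (v := vX) (a := vC) (A := fV) (T := tC) (y := vQ) (e := 0) (σ := τ)
        (fun _ => 0) (by simpa [hv] using ht) (h := fun _ _ _ _ _ _ => rfl)
      rw [t.1 vC (by decide), hσ.2.1] at this
      rw [initRow, den_seq]
      have u := den_same en (loop vX vC (setF fV (.get tC (nv vQ) + nv vX) 0)) τ
      set υ := den en (loop vX vC (setF fV (.get tC (nv vQ) + nv vX) 0)) τ
      by_cases h : q < σ.nat vUsed 0
      · rw [den_ite_pos en (by simpa (disch := decide) [u.1, t.1, hv] using h)]
        simp (disch := decide) only [den_setF, Store.fld_setFld, NatExpr.eval_add,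
          NatExpr.eval_get, NatExpr.eval_ofNat, u.1, hv, ht, FieldExpr.eval_one, h, and_true,
          true_and, Nat.add_left_cancel_iff]
        refine ⟨fun x hx => ?_, fun j hj => ?_⟩
        · rw [this.1 x hx]
          exact if_congr eq_comm rfl rfl
        · rw [if_neg (hj q hq), this.2 j hj]
      · rw [den_ite_neg en (by simpa (disch := decide) [u.1, t.1, hv] using h)]
        simpa [h] using this)
  have hC : (den en (letN vCnt 0) σ).nat vC 0 = c := by simp [hσ.2.1]
  rw [hC] at hfin
  rw [initSpan, den_seq]
  constructor
  · intro hw x hx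
    obtain ⟨co, rfl⟩ := (Submodule.mem_span_range_iff_exists_fun F).mp hw
    rw [Finset.sum_apply]
    refine Finset.sum_eq_zero fun q _ => ?_
    rw [Pi.smul_apply, hfin q q.2 x x.2, if_neg (by omega), smul_zero]
  · intro hw
    refine (Submodule.mem_span_range_iff_exists_fun F).mpr ⟨w, funext fun x => ?_⟩
    rw [Finset.sum_apply, Finset.sum_eq_single x]
    · rw [Pi.smul_apply, hfin x x.2 x x.2]
      by_cases hx : (x : ℕ) < σ.nat vUsed 0
      · simp [hx]
      · simp [hw x (by omega)]
    · intro q _ hq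
      rw [Pi.smul_apply, hfin q q.2 x x.2, if_neg fun h => hq (Fin.ext h.1), smul_zero]
    · simp

/-- All systems of the decoder live in the same `c × c` array. A system with fewer unknowns starts
with the remaining coordinates set to zero. -/
theorem den_startSpan {c u : ℕ} {e : NatExpr} {σ : Store F} (hσ : Square c σ) (hu : e.eval σ = u)
    (w : ℕ → F) : (fun x : Fin c => w x) ∈ spanOf c (den en (startSpan e) σ) ↔
      ∀ x < c, u ≤ x → w x = 0 := by
  have h : Store.Same [vUsed] [] σ _ := den_same en (letN vUsed e) σ
  rw [startSpan, den_seq, den_initSpan en (hσ.of_same h (by decide) (by decide))]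
  simp only [den_setN, Store.nat_setNat, NatExpr.eval_ofNat, true_and, if_true, hu]
  exact ⟨fun h x hx => h ⟨x, hx⟩, fun h x => h x x.2⟩

/-- The rows generate the space, so a nonzero space has a nonzero row; the search for a nonzero
entry remembers the row of the last one found. -/
theorem den_pickVector {c : ℕ} {σ : Store F} (hσ : Square c σ) :
    (fun x : Fin c => (den en pickVector σ).fld fZ x) ∈ spanOf c σ ∧
      (spanOf c σ ≠ ⊥ → ∃ x < c, (den en pickVector σ).fld fZ x ≠ 0) := by
  simp only [pickVector, den_seq]
  have s := (Store.Same.refl [vPiv, vQ, vX] [fZ] σ).trans (den_same en (letN vPiv 0) σ)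
  have key := den_loop en (v := vQ) (a := vC) (p := loop vX vC testEntry)
    (σ := den en (letN vPiv 0) σ)
    (fun k τ => τ.nat vPiv 0 < c ∧ ((∃ q < k, ∃ x < c, σ.fld fV (q * c + x) ≠ 0) →
      ∃ x < c, σ.fld fV (τ.nat vPiv 0 * c + x) ≠ 0)) (by simp [hσ.1])
    (fun k hk τ hτ hv hI => by
      have t := s.trans hτ
      have hk : k < c := by simpa [hσ.2.1] using hk
      have inner := den_loop en (v := vX) (a := vC) (p := testEntry) (σ := τ)
        (fun l υ => υ.nat vPiv 0 < c ∧ (((∃ q < k, ∃ x < c, σ.fld fV (q * c + x) ≠ 0) ∨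
          ∃ x < l, σ.fld fV (k * c + x) ≠ 0) →
          ∃ x < c, σ.fld fV (υ.nat vPiv 0 * c + x) ≠ 0)) (by simpa using hI)
        (fun l hl υ hυ hvυ hJ => by
          rw [t.1 _ (by decide), hσ.2.1] at hl
          have u := t.trans hυ
          have hQ : υ.nat vQ 0 = k := by rw [hυ.1 _ (by decide), hv]
          have ht : υ.nat tC k = k * c := by rw [u.1 _ (by decide), hσ.2.2 k hk]
          by_cases h0 : σ.fld fV (k * c + l) = 0
          · rw [testEntry, den_ite_pos en (by simpa [u.2, hQ, ht, hvυ] using h0)]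
            simpa [Nat.exists_lt_succ_right, h0, -Order.lt_add_one_iff] using hJ
          · rw [testEntry, den_ite_neg en (by simpa [u.2, hQ, ht, hvυ] using h0)]
            exact ⟨by simpa [hQ] using hk, fun _ => ⟨l, hl, by simpa [hQ] using h0⟩⟩)
      rw [t.1 _ (by decide), hσ.2.1] at inner
      simpa [Nat.exists_lt_succ_right, -Order.lt_add_one_iff] using inner)
  have hC : (den en (letN vPiv 0) σ).nat vC 0 = c := by simp [hσ.2.1]
  rw [hC] at key
  have s₁ := s.trans (den_same en (loop vQ vC (loop vX vC testEntry)) _)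
  have hset := den_copyPivot en (A := fZ) (hσ.of_same s₁ (by decide) (by decide)) key.1
  rw [s₁.2 fV (by decide)] at hset
  constructor
  · exact Submodule.subset_span ⟨⟨_, key.1⟩, funext fun x => (hset x x.2).symm⟩
  · intro hne
    obtain ⟨x, hx, hx'⟩ := key.2 (by
      by_contra hcon
      push Not at hcon
      refine hne (Submodule.span_eq_bot.mpr ?_)
      rintro _ ⟨q, rfl⟩
      exact funext fun x => hcon q q.2 x x.2)
    exact ⟨x, hx, by rwa [hset x hx]⟩

/-- Impose the equations that `fill` writes to `fRow` for all values of the two counters. -/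
def equations (p₁ p₂ : ℕ) (fill : LoopProg) : LoopProg :=
  loop vE p₁ (loop vE2 p₂ (fill ;; addEquation))

/-- The linear form `fRow`, evaluated at `w`. -/
def rowDot (c : ℕ) (w : ℕ → F) (σ : Store F) : F := ∑ x : Fin c, σ.fld fRow x * w x

theorem rowDot_of_eq {c : ℕ} {w : ℕ → F} {σ τ : Store F} (h : τ.fld fRow = σ.fld fRow) :
    rowDot c w τ = rowDot c w σ := by rw [rowDot, rowDot, h]

theorem rowDot_add {c p : ℕ} (hp : p < c) (w : ℕ → F) (σ : Store F) (x : F) :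
    rowDot c w (σ.setFld fRow p (σ.fld fRow p + x)) = rowDot c w σ + x * w p := by
  rw [rowDot, rowDot, ← Finset.sum_sdiff (Finset.subset_univ {(⟨p, hp⟩ : Fin c)}),
    ← Finset.sum_sdiff (Finset.subset_univ {(⟨p, hp⟩ : Fin c)}), Finset.sum_singleton,
    Finset.sum_singleton, add_assoc]
  refine congrArg₂ _ (Finset.sum_congr rfl fun y hy => ?_) (by simp [add_mul])
  have : (y : ℕ) ≠ p := fun h => by simp [Fin.ext_iff, h] at hy
  simp [this]

/-- Solutions are tested against one fixed vector `w`, and the program that fills `fRow` is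
specified only by the value of the linear form at `w`. The form never has to be written out, and one
proof serves all systems. -/
theorem den_equations {c p₁ p₂ : ℕ} {fill : LoopProg} {σ : Store F} (hσ : Square c σ) {w : ℕ → F}
    (val : ℕ → ℕ → F) (hrow : ∀ i < σ.nat p₁ 0, ∀ j < σ.nat p₂ 0, ∀ τ,
      Store.Same (equations p₁ p₂ fill).wn (equations p₁ p₂ fill).wf σ τ →
      τ.nat vE 0 = i → τ.nat vE2 0 = j → rowDot c w (den en fill τ) = val i j)
    (h3 : ∀ a ∈ [vC, tC, p₁, p₂], a ∉ (equations p₁ p₂ fill).wn := by decide) (h4 : fV ∉ fill.wf := by decide)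
    (h5 : vE ∉ fill.wn ++ addEquation.wn := by decide) :
    (fun x : Fin c => w x) ∈ spanOf c (den en (equations p₁ p₂ fill) σ) ↔
      (fun x : Fin c => w x) ∈ spanOf c σ ∧
      ∀ i < σ.nat p₁ 0, ∀ j < σ.nat p₂ 0, val i j = 0 := by
  refine den_loop en (v := vE) (a := p₁) (fun k τ => k ≤ σ.nat p₁ 0 →
    ((fun x : Fin c => w x) ∈ spanOf c τ ↔
    (fun x : Fin c => w x) ∈ spanOf c σ ∧ ∀ i < k, ∀ j < σ.nat p₂ 0, val i j = 0))
    (by simp [spanOf]) (fun k hk τ hτ hv hI _ => ?_) le_rfl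
  have t := (Store.Same.refl _ _ σ).trans hτ (fun _ h => h) (fun _ h => h)
  have inner := den_loop en (v := vE2) (a := p₂) (p := fill ;; addEquation) (σ := τ)
    (fun l υ => l ≤ σ.nat p₂ 0 → ((fun x : Fin c => w x) ∈ spanOf c υ ↔
      (fun x : Fin c => w x) ∈ spanOf c τ ∧ ∀ j < l, val k j = 0)) (by simp [spanOf])
    (fun l hl υ hυ hvυ hJ hl' => by
      have u := t.trans hυ (fun _ => List.mem_cons_of_mem _) (fun _ h => h)
      have hvE : υ.nat vE 0 = k := by
        rw [hυ.1 _ (by simpa only [wn, List.mem_cons, not_or] using ⟨by decide, h5⟩), hv]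
      have hSq : Square c (den en fill υ) := (hσ.of_same u (h3 _ (by simp)) (h3 _ (by simp))).of_same
        (den_same en fill υ)
        (fun h => h3 vC (by simp) (by simp [equations, wn, h]))
        (fun h => h3 tC (by simp) (by simp [equations, wn, h]))
      have hr := hrow k hk l (by omega) υ u hvE hvυ
      change _ ∈ spanOf c (den en addEquation (den en fill υ)) ↔ _
      rw [(den_addEquation en hSq).1,
        spanOf_congr (den_fld en h4 υ), Submodule.mem_inf, hJ (by omega), mem_rowKer, and_assoc,
        Nat.forall_lt_succ_right]
      exact and_congr_right fun _ => and_congr_right fun _ => hr ▸ Iff.rfl)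
  rw [t.1 _ (h3 _ (by simp))] at inner
  change _ ∈ spanOf c (den en (loop vE2 p₂ (fill ;; addEquation)) τ) ↔ _
  rw [inner le_rfl, hI hk.le, and_assoc,
    Nat.forall_lt_succ_right]

end LoopProg

/-! ## Arithmetic programs -/

namespace LoopProg

/-- No loop bound is written to after the loop has started. -/
def settled : LoopProg → Bool
  | skip => true
  | setN _ _ _ => true
  | setF _ _ _ => true
  | seq p q => p.settled && q.settled && decide (∀ a ∈ p.bds, a ∉ q.wn)
  | ite b p q => (ite b p q).static
  | loop v a p => (loop v a p).static

/-- The product of `b` and `y`. -/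
def mulProg (dst v b y : ℕ) : LoopProg :=
  letN dst 0 ;; loop v b (letN dst (nv dst + nv y))

/-- The power of `b` with exponent `e`. -/
def powProg (dst t v w b e : ℕ) : LoopProg :=
  letN dst 1 ;; loop v e (mulProg t w b dst ;; letN dst (nv t))

/-- The tables of `⌈y / 2⌉`. -/
def halfTable : LoopProg :=
  setN tHalf 0 0 ;; setN tHalf 1 1 ;;
  loop vX vd (setN tHalf (nv vX + 2) (.get tHalf (nv vX) + 1))

/-- The numbers of variables of the levels. -/
def halvesTable : LoopProg :=
  setN tD 0 (nv vd) ;; loop vX vd (setN tD (nv vX + 1) (.get tHalf (.get tD (nv vX))))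

/-- The number of levels. -/
def clogProg : LoopProg :=
  letN vK 0 ;;
  loop vX vd (ite (.natLt 1 (.get tD (nv vX))) (letN vK (nv vK + 1)) skip)

/-- The powers of `nv vN`. -/
def powTable : LoopProg :=
  setN tNP 0 1 ;;
  loop vX vd (letN vT2 (.get tNP (nv vX)) ;; mulProg vT1 vY vN vT2 ;;
    setN tNP (nv vX + 1) (nv vT1))

/-- The quotients and remainders of division by `w`. -/
def divTable (qu rm v b w : ℕ) : LoopProg :=
  setN qu 0 0 ;; setN rm 0 0 ;;
  loop v b (ite (.natLt (.get rm (nv v) + 1) (nv w))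
    (setN rm (nv v + 1) (.get rm (nv v) + 1) ;; setN qu (nv v + 1) (.get qu (nv v)))
    (setN rm (nv v + 1) 0 ;; setN qu (nv v + 1) (.get qu (nv v) + 1)))

theorem mulProg_wn (dst v b y : ℕ) : (mulProg dst v b y).wn = [dst, v, dst] := rfl
theorem powProg_wn (dst t v w b e : ℕ) : (powProg dst t v w b e).wn = [dst, v, t, w, t, dst] := rfl
theorem divTable_wn (qu rm v b w : ℕ) :
    (divTable qu rm v b w).wn = [qu, rm, v, rm, qu, rm, qu] := rfl

variable {F : Type u} [Field F] (en : Enumeration F)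

/-- A loop bound that is not written to after its loop has started can be read off the final memory.
Bounds computed by the program itself are thus controlled by its specification. -/
theorem boundsLe_of_settled {X : ℕ} {p : LoopProg} {σ : Store F} (h : p.settled = true)
    (hX : ∀ a ∈ p.bds, (den en p σ).nat a 0 ≤ X) : p.BoundsLe en X σ := by
  have hst : ∀ {q : LoopProg}, q.static = true → (∀ a ∈ q.bds, (den en q σ).nat a 0 ≤ X) →
      q.BoundsLe en X σ := fun {q} hq hqX => by
    have h2 := hq
    simp only [static, Bool.and_eq_true, decide_eq_true_eq] at h2
    refine boundsLe_of_static en hq fun a ha => ?_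
    rw [← den_nat en (h2.2 a ha)]
    exact hqX a ha
  induction p generalizing σ with
  | skip => trivial
  | setN a i x => trivial
  | setF a i x => trivial
  | seq p q ihp ihq =>
    simp only [settled, Bool.and_eq_true, decide_eq_true_eq] at h
    simp only [bds, List.mem_append, den_seq] at hX
    have hst' : ∀ (υ : Store F) {q : LoopProg}, q.static = true →
        (∀ a ∈ q.bds, (den en q υ).nat a 0 ≤ X) → q.BoundsLe en X υ := fun υ {q} hq hqX => by
      have h2 := hq
      simp only [static, Bool.and_eq_true, decide_eq_true_eq] at h2
      refine boundsLe_of_static en hq fun a ha => ?_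
      rw [← den_nat en (h2.2 a ha)]
      exact hqX a ha
    refine ⟨ihp h.1.1 (fun a ha => ?_) (hst' σ), ihq h.1.2 (fun a ha => hX a (Or.inr ha))
      (hst' _)⟩
    rw [← den_nat en (h.2 a ha)]
    exact hX a (Or.inl ha)
  | ite b p q ihp ihq => exact hst h hX
  | loop v a p ih => exact hst h hX

theorem den_mulProg {dst v b y : ℕ} (h1 : dst ≠ v) (h2 : dst ≠ b) (h3 : dst ≠ y) (h4 : v ≠ y)
    (σ : Store F) : (den en (mulProg dst v b y) σ).nat dst 0 = σ.nat b 0 * σ.nat y 0 := by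
  rw [mulProg, den_seq]
  have key := den_loop en (v := v) (a := b) (p := letN dst (nv dst + nv y))
    (σ := den en (letN dst 0) σ) (fun k τ => τ.nat dst 0 = k * σ.nat y 0) (by simp [h1])
    (fun k hk τ hτ hv hI => by
      have hy : τ.nat y 0 = σ.nat y 0 := by
        rw [hτ.1 y (by simp [wn, h3.symm, h4.symm])]
        simp [h3.symm]
      simp [h1, hI, hy]
      ring)
  simpa [h2.symm] using key

theorem den_powProg {dst t v w b e : ℕ} (h : [dst, t, v, w, b, e].Nodup) (σ : Store F) :
    (den en (powProg dst t v w b e) σ).nat dst 0 = σ.nat b 0 ^ σ.nat e 0 := by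
  simp only [List.nodup_cons, List.mem_cons, List.not_mem_nil, or_false, not_or] at h
  obtain ⟨⟨h1, h2, h3, h4, h5⟩, ⟨h6, h7, h8, h9⟩, ⟨h10, h11, h12⟩, ⟨h13, h14⟩, h15, -⟩ := h
  rw [powProg, den_seq]
  have key := den_loop en (v := v) (a := e) (p := mulProg t w b dst ;; letN dst (nv t))
    (σ := den en (letN dst 1) σ) (fun k τ => τ.nat dst 0 = σ.nat b 0 ^ k) (by simp [h2])
    (fun k hk τ hτ hv hI => by
      have hb : τ.nat b 0 = σ.nat b 0 := by
        rw [hτ.1 b (by simp [wn, mulProg_wn, Ne.symm h4, Ne.symm h8, Ne.symm h11, Ne.symm h13])]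
        simp [Ne.symm h4]
      have := den_mulProg en (dst := t) (v := w) (b := b) (y := dst) h7 h8 (Ne.symm h1)
        (Ne.symm h3) τ
      simp only [den_seq, den_setN, Store.nat_setNat, NatExpr.eval_ofNat, NatExpr.eval_get, this,
        hI, hb]
      simp [h2, pow_succ, mul_comm])
  simpa [Ne.symm h5] using key

theorem den_halfTable (σ : Store F) {i : ℕ} (hi : i ≤ σ.nat vd 0 + 1) :
    (den en halfTable σ).nat tHalf i = (i + 1) / 2 := by
  simp only [halfTable, den_seq]
  set σ₀ := den en (setN tHalf 1 1) (den en (setN tHalf 0 0) σ) with hσ₀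
  have key := den_loop en (v := vX) (a := vd)
    (p := setN tHalf (nv vX + 2) (.get tHalf (nv vX) + 1)) (σ := σ₀)
    (fun k τ => ∀ i ≤ k + 1, τ.nat tHalf i = (i + 1) / 2)
    (fun i hi => by interval_cases i <;> simp [hσ₀])
    (fun k hk τ hτ hv hI i hi => by
      by_cases h : i = k + 2
      · subst h
        simp [hv, hI k (by omega)]
        omega
      · simp [hv, h, hI i (by omega)])
  exact key i (by simpa [hσ₀] using hi)

theorem den_halvesTable {σ : Store F} {d : ℕ} (hd : 1 ≤ d) (hσ : σ.nat vd 0 = d)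
    (h : ∀ i ≤ d, σ.nat tHalf i = (i + 1) / 2) {i : ℕ} (hi : i ≤ d) :
    (den en halvesTable σ).nat tD i = halves d i := by
  simp only [halvesTable, den_seq]
  have key := den_loop en (v := vX) (a := vd)
    (p := setN tD (nv vX + 1) (.get tHalf (.get tD (nv vX)))) (σ := den en (setN tD 0 (nv vd)) σ)
    (fun k τ => ∀ i ≤ k, τ.nat tD i = halves d i) (by simp [hσ, halves])
    (fun k hk τ hτ hv hI i hi => by
      have ht : τ.nat tHalf = σ.nat tHalf := by
        rw [hτ.1 _ (by simp [wn])]; funext j; simp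
      by_cases hik : i = k + 1
      · subst hik
        simp [hv, hI k le_rfl, ht, h _ (halves_le hd k), halves]
      · simp [hv, hik, hI i (by omega)])
  exact key i (by simpa [hσ] using hi)

theorem clog_two_le {d : ℕ} : Nat.clog 2 d ≤ d :=
  Nat.clog_le_of_le_pow Nat.lt_two_pow_self.le

/-- The number of variables exceeds 1 exactly at the first `⌈lg d⌉` levels, so it is enough to count
those levels; `d` rounds are more than enough. -/
theorem den_clogProg {σ : Store F} {d : ℕ} (hσ : σ.nat vd 0 = d)
    (h : ∀ i ≤ d, σ.nat tD i = halves d i) :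
    (den en clogProg σ).nat vK 0 = Nat.clog 2 d := by
  simp only [clogProg, den_seq]
  have key := den_loop en (v := vX) (a := vd)
    (p := ite (.natLt 1 (.get tD (nv vX))) (letN vK (nv vK + 1)) skip)
    (σ := den en (letN vK 0) σ)
    (fun k τ => τ.nat vK 0 = min k (Nat.clog 2 d)) (by simp)
    (fun k hk τ hτ hv hI => by
      have hk' : k < d := by simpa [hσ] using hk
      have ht : τ.nat tD = σ.nat tD := by
        rw [hτ.1 _ (by simp [wn])]; funext j; simp
      by_cases hik : 1 < halves d k
      · rw [den_ite_pos en (by simpa [hv, ht, h k hk'.le] using hik)]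
        have := one_lt_halves_iff.mp hik
        simp [hI]
        omega
      · rw [den_ite_neg en (by simpa [hv, ht, h k hk'.le] using hik)]
        have := one_lt_halves_iff.not.mp hik
        simp [hI]
        omega)
  have := clog_two_le (d := d)
  have h2 : (den en (letN vK 0) σ).nat vd 0 = d := by simp [hσ]
  rw [h2] at key
  rw [key]
  omega

theorem den_powTable {σ : Store F} {i : ℕ} (hi : i ≤ σ.nat vd 0) :
    (den en powTable σ).nat tNP i = σ.nat vN 0 ^ i := by
  simp only [powTable, den_seq]
  have key := den_loop en (v := vX) (a := vd)
    (p := letN vT2 (.get tNP (nv vX)) ;; mulProg vT1 vY vN vT2 ;; setN tNP (nv vX + 1) (nv vT1))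
    (σ := den en (setN tNP 0 1) σ)
    (fun k τ => ∀ i ≤ k, τ.nat tNP i = σ.nat vN 0 ^ i) (by simp)
    (fun k hk τ hτ hv hI i hi => by
      have ht : τ.nat vN 0 = σ.nat vN 0 := by
        rw [hτ.1 _ (by simp [wn, mulProg_wn])]; simp
      have h1 := den_mulProg en (dst := vT1) (v := vY) (b := vN) (y := vT2) (by simp) (by simp)
        (by simp) (by simp) (den en (letN vT2 (.get tNP (nv vX))) τ)
      have h2 : (den en (mulProg vT1 vY vN vT2) (den en (letN vT2 (.get tNP (nv vX))) τ)).nat tNP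
          = τ.nat tNP := by
        rw [den_nat en (by simp [mulProg_wn])]; funext j; simp
      have h3 : (den en (mulProg vT1 vY vN vT2) (den en (letN vT2 (.get tNP (nv vX))) τ)).nat vX 0
          = k := by
        rw [den_nat en (by simp [mulProg_wn])]; simp [hv]
      simp only [den_seq, den_setN (i := nv vX + 1), Store.nat_setNat, NatExpr.eval_get,
        NatExpr.eval_add, NatExpr.eval_ofNat, h1, h2, h3]
      by_cases hik : i = k + 1
      · subst hik
        simp [ht, hv, hI k le_rfl, pow_succ, mul_comm]
      · simp [hik, hI i (by omega)])
  exact key i (by simpa using hi)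

theorem den_divTable {qu rm v b w : ℕ} (h : [qu, rm, v, b, w].Nodup) (σ : Store F)
    (hw : 0 < σ.nat w 0) {i : ℕ} (hi : i ≤ σ.nat b 0) :
    (den en (divTable qu rm v b w) σ).nat qu i = i / σ.nat w 0 ∧
      (den en (divTable qu rm v b w) σ).nat rm i = i % σ.nat w 0 := by
  simp only [List.nodup_cons, List.mem_cons, List.not_mem_nil, or_false, not_or] at h
  obtain ⟨⟨h1, h2, h3, h4⟩, ⟨h5, h6, h7⟩, ⟨h8, h9⟩, h10, -⟩ := h
  simp only [divTable, den_seq]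
  set m := σ.nat w 0 with hm
  set σ₀ := den en (setN rm 0 0) (den en (setN qu 0 0) σ) with hσ₀
  have hw₀ : σ₀.nat w 0 = m := by simp [hσ₀, Ne.symm h4, Ne.symm h7, hm]
  have hb₀ : σ₀.nat b 0 = σ.nat b 0 := by simp [hσ₀, Ne.symm h3, Ne.symm h6]
  set p := ite (.natLt (.get rm (nv v) + 1) (nv w))
    (setN rm (nv v + 1) (.get rm (nv v) + 1) ;; setN qu (nv v + 1) (.get qu (nv v)))
    (setN rm (nv v + 1) 0 ;; setN qu (nv v + 1) (.get qu (nv v) + 1)) with hp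
  have key := den_loop en (v := v) (a := b) (p := p) (σ := σ₀)
    (fun k τ => ∀ i ≤ k, τ.nat qu i = i / m ∧ τ.nat rm i = i % m)
    (by simp [hσ₀, h1, h2, h5])
    (fun k hk τ hτ hv hI i hi => by
      have hwτ : τ.nat w 0 = m := by
        rw [hτ.1 w (by simp [hp, wn, Ne.symm h4, Ne.symm h7, Ne.symm h9]), hw₀]
      have hq := (hI k le_rfl).1
      have hr := (hI k le_rfl).2
      have hdm := Nat.div_add_mod k m
      have hlt := Nat.mod_lt k hw
      by_cases hc : k % m + 1 < m
      · have e : k + 1 = (k % m + 1) + m * (k / m) := by omega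
        have e1 : (k + 1) / m = k / m := by
          rw [e, Nat.add_mul_div_left _ _ hw, Nat.div_eq_of_lt hc, zero_add]
        have e2 : (k + 1) % m = k % m + 1 := by
          conv_lhs => rw [e]
          rw [Nat.add_mul_mod_self_left, Nat.mod_eq_of_lt hc]
        rw [hp, den_ite_pos en (by simpa [hv, hr, hwτ] using hc)]
        by_cases hik : i = k + 1
        · subst hik
          simp [hv, hr, hq, h1, h2, h5, Ne.symm h1, Ne.symm h5, e1, e2]
        · simp [hv, h1, h2, h5, Ne.symm h1, Ne.symm h5, hik, hI i (by omega)]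
      · have e : k + 1 = m * (k / m + 1) := by rw [mul_add]; omega
        have e1 : (k + 1) / m = k / m + 1 := by rw [e, Nat.mul_div_cancel_left _ hw]
        have e2 : (k + 1) % m = 0 := by rw [e, Nat.mul_mod_right]
        rw [hp, den_ite_neg en (by simpa [hv, hr, hwτ] using hc)]
        by_cases hik : i = k + 1
        · subst hik
          simp [hv, hq, h1, h2, h5, Ne.symm h1, Ne.symm h5, e1, e2]
        · simp [hv, h1, h2, h5, Ne.symm h1, Ne.symm h5, hik, hI i (by omega)])
  rw [hb₀] at key
  exact key i hi

/-! ### The parameters of the codes and the tables of their multiples -/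

/-- Compute the sizes from `n`, `d` and `r`. -/
def sizes : LoopProg :=
  letN vn (.get 0 0) ;; letN vd (.get 0 1) ;; letN vr (.get 0 2) ;;
  letN vR2 (nv vr + nv vr) ;; letN vR1 (nv vr + 1) ;;
  mulProg vN vX vd vn ;; powProg vnd vT1 vX vY vn vd ;; powProg vW vT1 vX vY vN vd ;;
  halfTable ;; halvesTable ;; clogProg ;; powTable ;;
  powProg vRK vT1 vX vY vR2 vK ;; letN vN0 (.get tNP (.get tD 1)) ;; mulProg vM vX vN0 vN0 ;;
  mulProg vR vX vr vW ;; letN vR (nv vR + 1) ;; mulProg vC vX vR1 vR ;; letN vC (nv vC + 1) ;;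
  mulProg vMchk vX vRK vN ;; mulProg vTot vX vRK vW

/-- The tables of multiples, quotients and remainders. -/
def tables : LoopProg :=
  multiples tC vX vC vC ;; multiples tW vX vRK vW ;; multiples tR2 vX vRK vR2 ;;
  multiples tR vX vC vR ;; multiples tSd vX vRK vd ;; multiples tnd vX vMchk vnd ;;
  divTable tQu tRm vX vnd vn

/-- Compute all parameters from `n`, `d` and `r`. -/
def prelude : LoopProg := sizes ;; tables

/-- The sizes are in place. -/
structure Sizes (n d r : ℕ) (σ : Store F) : Prop where
  n_eq : σ.nat vn 0 = n
  d_eq : σ.nat vd 0 = d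
  r_eq : σ.nat vr 0 = r
  N_eq : σ.nat vN 0 = d * n
  nd_eq : σ.nat vnd 0 = n ^ d
  W_eq : σ.nat vW 0 = (d * n) ^ d
  R2_eq : σ.nat vR2 0 = 2 * r
  K_eq : σ.nat vK 0 = Nat.clog 2 d
  RK_eq : σ.nat vRK 0 = (2 * r) ^ Nat.clog 2 d
  N0_eq : σ.nat vN0 0 = (d * n) ^ halves d 1
  M_eq : σ.nat vM 0 = (d * n) ^ halves d 1 * (d * n) ^ halves d 1
  R_eq : σ.nat vR 0 = r * (d * n) ^ d + 1
  C_eq : σ.nat vC 0 = (r + 1) * (r * (d * n) ^ d + 1) + 1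
  Mchk_eq : σ.nat vMchk 0 = (2 * r) ^ Nat.clog 2 d * (d * n)
  R1_eq : σ.nat vR1 0 = r + 1
  Tot_eq : σ.nat vTot 0 = (2 * r) ^ Nat.clog 2 d * (d * n) ^ d
  tD_eq : ∀ i ≤ d, σ.nat tD i = halves d i
  tNP_eq : ∀ i ≤ d, σ.nat tNP i = (d * n) ^ i

/-- The parameters are in place. -/
structure Params (n d r : ℕ) (σ : Store F) : Prop extends Sizes n d r σ where
  tC_eq : ∀ i ≤ (r + 1) * (r * (d * n) ^ d + 1) + 1,
    σ.nat tC i = i * ((r + 1) * (r * (d * n) ^ d + 1) + 1)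
  tW_eq : ∀ i ≤ (2 * r) ^ Nat.clog 2 d, σ.nat tW i = i * (d * n) ^ d
  tR2_eq : ∀ i ≤ (2 * r) ^ Nat.clog 2 d, σ.nat tR2 i = i * (2 * r)
  tR_eq : ∀ i ≤ (r + 1) * (r * (d * n) ^ d + 1) + 1, σ.nat tR i = i * (r * (d * n) ^ d + 1)
  tSd_eq : ∀ i ≤ (2 * r) ^ Nat.clog 2 d, σ.nat tSd i = i * d
  tnd_eq : ∀ i ≤ (2 * r) ^ Nat.clog 2 d * (d * n), σ.nat tnd i = i * n ^ d
  tQu_eq : ∀ i ≤ n ^ d, σ.nat tQu i = i / n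
  tRm_eq : ∀ i ≤ n ^ d, σ.nat tRm i = i % n

theorem Sizes.of_same {n d r : ℕ} {σ τ : Store F} {wn wf : List ℕ} (h : Store.Same wn wf σ τ)
    (hw : ∀ a ∈ [vn, vd, vr, vN, vnd, vW, vR2, vK, vRK, vN0, vM, vR, vC, vMchk, vR1, vTot, tD,
      tNP], a ∉ wn) (hσ : Sizes n d r σ) : Sizes n d r τ := by
  simp only [List.mem_cons, List.not_mem_nil, or_false, forall_eq_or_imp, forall_eq] at hw
  obtain ⟨h1, h2, h3, h4, h5, h6, h7, h8, h9, h10, h11, h12, h13, h14, h15, h16, h17, h18⟩ := hw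
  cases hσ
  constructor
  all_goals rw [h.1 _ (by assumption)]; assumption

theorem Params.of_same {n d r : ℕ} {σ τ : Store F} {wn wf : List ℕ} (h : Store.Same wn wf σ τ)
    (hw : ∀ a ∈ [vn, vd, vr, vN, vnd, vW, vR2, vK, vRK, vN0, vM, vR, vC, vMchk, vR1, vTot, tD,
      tNP, tC, tW, tR2, tR, tSd, tnd, tQu, tRm], a ∉ wn) (hσ : Params n d r σ) : Params n d r τ := by
  refine ⟨hσ.toSizes.of_same h fun a ha => hw a (by revert a; decide), ?_, ?_, ?_, ?_, ?_, ?_, ?_, ?_⟩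
  all_goals rw [h.1 _ (hw _ (by decide))]
  exacts [hσ.tC_eq, hσ.tW_eq, hσ.tR2_eq, hσ.tR_eq, hσ.tSd_eq, hσ.tnd_eq, hσ.tQu_eq, hσ.tRm_eq]

theorem den_sizes {n d r : ℕ} (hd : 2 ≤ d) {σ : Store F} (h0 : σ.nat 0 0 = n)
    (h1 : σ.nat 0 1 = d) (h2 : σ.nat 0 2 = r) : Sizes n d r (den en sizes σ) := by
  have hT : ∀ τ : Store F, τ.nat vd 0 = d → ∀ i ≤ d,
      (den en halvesTable (den en halfTable τ)).nat tD i = halves d i := fun τ hτ i hi =>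
    den_halvesTable en (by omega) (by rw [den_nat en (by decide), hτ])
      (fun i hi => den_halfTable en τ (by omega)) hi
  have hK : ∀ τ : Store F, τ.nat vd 0 = d →
      (den en clogProg (den en halvesTable (den en halfTable τ))).nat vK 0 = Nat.clog 2 d :=
    fun τ hτ => den_clogProg en (by simp (disch := decide) only [den_nat, hτ]) (hT τ hτ)
  have h3 := fun τ hτ => hT τ hτ 1 (by omega)
  have hl := halves_le (show 1 ≤ d by omega)
  simp only [sizes, den_seq]
  constructor
  all_goals try intro i hi
  all_goals simp (disch := first | decide | simp (disch := decide) [den_nat, *] <;> done | fail)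
    [den_nat, den_mulProg, den_powProg, den_powTable, two_mul, *]

theorem den_prelude {n d r : ℕ} (hn : 1 ≤ n) (hd : 2 ≤ d) {σ : Store F} (h0 : σ.nat 0 0 = n)
    (h1 : σ.nat 0 1 = d) (h2 : σ.nat 0 2 = r) : Params n d r (den en prelude σ) := by
  have h := den_sizes en hd h0 h1 h2
  rw [prelude, den_seq]
  set τ := den en sizes σ
  refine ⟨h.of_same (den_same en tables τ) (by decide), ?_, ?_, ?_, ?_, ?_, ?_, ?_, ?_⟩ <;>
    intro i hi <;> simp only [tables, den_seq] <;>
    simp (disch := first | decide | simp (disch := decide) [den_nat, h.n_eq, h.nd_eq, h.C_eq, h.RK_eq, h.Mchk_eq, hi] <;> omega | fail)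
      [den_nat, den_multiples, den_divTable, h.C_eq, h.W_eq, h.R2_eq, h.R_eq, h.d_eq, h.nd_eq, h.n_eq]

end LoopProg

/-! ## The program for the parity checks -/

namespace LoopProg

/-- The table of `g ^ (N ^ v)`. -/
def gammaTable : LoopProg :=
  setF fGam 0 (fv fG) ;;
  loop vX vd (letF fT1 1 ;; loop vY vN (letF fT1 (fv fT1 * .get fGam (nv vX))) ;;
    setF fGam (nv vX + 1) (fv fT1))

/-- The scaling factor of the next level for the entry `vL` of the row `vH` and the variable `vJ`. -/
def scalingEntry : LoopProg :=
  ite (.natLt (.get tV (nv vJ)) (nv vDA))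
    (setF fT2 (nv vPtr) (.get fAlpha (.get tSd (nv vH) + nv vJ)))
    (setF fT2 (nv vPtr) (.get fAlpha (.get tSd (nv vH) + nv vJ) * .get fPw (nv vJ)) ;;
      setF fPw (nv vJ) (.get fPw (nv vJ) * .get fGam (.get tV (nv vJ) - nv vDA))) ;;
  letN vPtr (nv vPtr + 1)

/-- The scaling factors of the next level that come from the row `vH`. -/
def scalingRow : LoopProg :=
  loop vJ vd (setF fPw (nv vJ) 1) ;; loop vL vR2 (loop vJ vd scalingEntry)

/-- One step of the recursion for the scaling factors. -/
def scalingStep : LoopProg :=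
  letN vDA (.get tD (nv vS + 1)) ;; letN vPtr 0 ;; loop vH vRK scalingRow ;;
  loop vX vMchk (setF fAlpha (nv vX) (.get fT2 (nv vX))) ;;
  loop vJ vd (ite (.natLt (.get tV (nv vJ)) (nv vDA)) skip
    (setN tV (nv vJ) (.get tV (nv vJ) - nv vDA)))

/-- The scaling factors of the last level. -/
def scalings : LoopProg :=
  gammaTable ;;
  loop vJ vd (setN tV (nv vJ) (nv vJ)) ;; loop vJ vd (setF fAlpha (nv vJ) 1) ;;
  loop vS vK scalingStep

/-- The next power of the base point. -/
def factorEntry : LoopProg :=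
  setF fVec (nv vPtr) (fv fT2) ;; letF fT2 (fv fT2 * fv fT1) ;; letN vPtr (nv vPtr + 1)

/-- The factor with number `vJ` of a parity check. -/
def factorRow : LoopProg :=
  letF fT1 (.get fAlpha (.get tSd (nv vH) + nv vJ) * fv fGk) ;; letF fT2 1 ;; loop vI vn factorEntry

/-- The factors of a parity check. -/
def factorRows : LoopProg := loop vJ vd factorRow ;; letF fGk (fv fGk * fv fG)

/-- The factors of the parity checks. -/
def factors : LoopProg := letN vPtr 0 ;; loop vH vRK (letF fGk 1 ;; loop vKk vN factorRows)

/-- Multiply by an entry of the next factor. -/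
def productStep : LoopProg :=
  letF fT1 (fv fT1 * .get fVec (nv vOff + .get tRm (nv vCur))) ;;
  letN vCur (.get tQu (nv vCur)) ;; letN vOff (nv vOff + nv vn)

/-- The entry `vP` of a tensor with given factors. -/
def productEntry : LoopProg :=
  letN vCur (nv vP) ;; letN vOff (nv vT1) ;; letF fT1 1 ;; loop vJ vd productStep ;;
  setF fOut (nv vPtr) (fv fT1) ;; letN vPtr (nv vPtr + 1)

/-- The tensors with the given factors. -/
def products : LoopProg :=
  letN vPtr 0 ;; letN vT1 0 ;; loop vH vMc (loop vP vnd productEntry ;; letN vT1 (nv vT1 + nv vN))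

variable {F : Type u}

theorem Params.square {n d r : ℕ} {σ : Store F} (h : Params n d r σ) :
    Square ((r + 1) * (r * (d * n) ^ d + 1) + 1) σ :=
  ⟨Nat.succ_pos _, h.C_eq, fun q hq => h.tC_eq q hq.le⟩

variable [Field F] (en : Enumeration F)

/-- Each entry is the previous one raised to the power `N`, computed by `N` multiplications, since
`g ^ N ^ (k + 1) = (g ^ N ^ k) ^ N`. -/
theorem den_gammaTable {σ : Store F} {i : ℕ} (hi : i ≤ σ.nat vd 0) :
    (den en gammaTable σ).fld fGam i = σ.fld fG 0 ^ σ.nat vN 0 ^ i := by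
  simp only [gammaTable, den_seq]
  have key := den_loop en (v := vX) (a := vd)
    (p := letF fT1 1 ;; loop vY vN (letF fT1 (fv fT1 * .get fGam (nv vX))) ;;
      setF fGam (nv vX + 1) (fv fT1))
    (σ := den en (setF fGam 0 (fv fG)) σ)
    (fun k τ => ∀ i ≤ k, τ.fld fGam i = σ.fld fG 0 ^ σ.nat vN 0 ^ i) (by simp)
    (fun k hk τ hτ hv hI => by
      have hN : τ.nat vN 0 = σ.nat vN 0 := by
        rw [hτ.1 _ (by simp [wn])]; simp
      set τ₁ := den en (letF fT1 1) τ with hτ₁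
      have inner := den_loop en (v := vY) (a := vN)
        (p := letF fT1 (fv fT1 * .get fGam (nv vX))) (σ := τ₁)
        (fun l υ => υ.fld fT1 0 = (σ.fld fG 0 ^ σ.nat vN 0 ^ k) ^ l) (by simp [hτ₁])
        (fun l hl υ hυ hvυ hJ => by
          have h1 : υ.fld fGam k = σ.fld fG 0 ^ σ.nat vN 0 ^ k := by
            rw [hυ.2 _ (by simp [wf]), ← hI k le_rfl]; simp [hτ₁]
          have h2 : υ.nat vX 0 = k := by
            rw [hυ.1 _ (by simp [wn])]; simp [hτ₁, hv]
          simp [hJ, h2, h1, pow_succ])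
      have hN₁ : τ₁.nat vN 0 = σ.nat vN 0 := by simp [hτ₁, hN]
      rw [hN₁] at inner
      intro i hi
      set υ := den en (loop vY vN (letF fT1 (fv fT1 * .get fGam (nv vX)))) τ₁ with hυ
      have h1 : υ.fld fGam = τ.fld fGam := by
        rw [hυ, den_fld en (by simp [wf])]; funext j; simp [hτ₁]
      have h2 : υ.nat vX 0 = k := by
        rw [hυ, den_nat en (by simp [wn])]; simp [hτ₁, hv]
      simp only [den_seq]
      rw [← hτ₁, ← hυ]
      by_cases hik : i = k + 1
      · subst hik
        simp [h2, inner, pow_succ, ← pow_mul]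
      · simp [h2, hik, h1, hI i (by omega)])
  exact key i (by simpa using hi)

/-- The state of the recursion for the scaling factors. -/
def ScalingsAt (g : F) (n d r s : ℕ) (σ : Store F) : Prop :=
  (∀ j < d, σ.nat tV j = varIndex d s j) ∧
    ∀ h < (2 * r) ^ s, ∀ j < d, σ.fld fAlpha (h * d + j) = scaling g (d * n) d r s h j

/-- The values are written in the order row, exponent `l`, variable. This is the order of the
children `h (2 r) + l` of row `h`. The array `fPw` holds the current power `γ_j ^ l` and is reset to
1 for each row. -/
theorem den_scalingRows {n d r D : ℕ} {v : ℕ → ℕ} {γ : ℕ → F} {σ : Store F} (hP : Params n d r σ)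
    (hV : ∀ j < d, σ.nat tV j = v j) (hD : σ.nat vDA 0 = D)
    (hG : ∀ j < d, D ≤ v j → σ.fld fGam (v j - D) = γ j) :
    Emitted fT2 ((2 * r) ^ Nat.clog 2 d * (2 * r * d)) (fun x =>
      σ.fld fAlpha (x / (2 * r * d) * d + x % (2 * r * d) % d) *
        if v (x % (2 * r * d) % d) < D then 1 else γ (x % (2 * r * d) % d) ^ (x % (2 * r * d) / d)) σ
      (den en (loop vH vRK scalingRow) σ) := by
  let f (h l j : ℕ) : F := σ.fld fAlpha (h * d + j) * if v j < D then 1 else γ j ^ l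
  have key := loop_emitted en (v := vH) (b := vRK) (A := fT2) (L := 2 * r * d) (σ := σ)
    (p := scalingRow) (f := fun h y => f h (y / d) (y % d)) (fun _ _ => True) (by decide) trivial
    fun h hh τ hτ hvh _ _ => ⟨?_, trivial⟩
  · rw [hP.RK_eq] at key
    exact key.1
  rw [hP.RK_eq] at hh
  have hset := loop_setF en (v := vJ) (a := vd) (A := fPw) (idx := nv vJ) (e := 1) (σ := τ)
    id (fun _ => 1) (fun _ _ _ _ h => h) (fun i hi υ hυ hvi _ => by simp [hvi])
  rw [(hP.of_same hτ (by decide)).d_eq] at hset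
  have s := den_same en (loop vJ vd (setF fPw (nv vJ) 1)) τ
  rw [scalingRow, den_seq]
  set τ₁ := den en (loop vJ vd (setF fPw (nv vJ) 1)) τ
  have t := hτ.trans s
  have hP₁ := hP.of_same t (by decide)
  have key := loop_emitted en (v := vL) (b := vR2) (A := fT2) (L := d) (σ := τ₁)
    (p := loop vJ vd scalingEntry) (f := f h) (fun l υ => ∀ j < d, υ.fld fPw j =
      if v j < D then 1 else γ j ^ l) (by decide) (by simpa using hset.1)
    fun l hl υ hυ hvl _ hI => ?_
  · rw [hP₁.R2_eq] at key
    exact key.1.of_same s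
  have u := t.trans hυ
  -- While the variables are run through, those already passed have their powers advanced to `l + 1`
  -- and the others are still at `l`.
  have key := loop_emitted en (v := vJ) (b := vd) (A := fT2) (L := 1) (σ := υ) (p := scalingEntry)
    (f := fun j _ => f h l j) (fun i ω => ∀ j < d, ω.fld fPw j =
      if v j < D then 1 else γ j ^ (if j < i then l + 1 else l)) (by decide) (by simpa using hI)
    fun j hj ω hω hvj _ hI => ?_
  · rw [(hP.of_same u (by decide)).d_eq] at key
    exact ⟨by simpa using key.1, fun j hj => by simpa [hj] using key.2 j hj⟩
  rw [(hP.of_same u (by decide)).d_eq] at hj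
  have w := u.trans hω
  have hPω := hP.of_same w (by decide)
  have hH : ω.nat vH 0 = h := by simp (disch := decide) only [hω.1, hυ.1, s.1, hvh]
  have hp := hI j hj
  rw [if_neg (lt_irrefl j)] at hp
  have hA : ω.fld fAlpha = σ.fld fAlpha := w.2 _ (by decide)
  have hDω : ω.nat vDA 0 = D := by rw [w.1 _ (by decide), hD]
  have hVω : ω.nat tV j = v j := by rw [w.1 _ (by decide), hV j hj]
  have hlt : ∀ k, k ≠ j → (k < j + 1 ↔ k < j) := fun k hk => by omega
  rw [scalingEntry, den_seq]
  by_cases hc : v j < D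
  · rw [den_ite_pos en (by simpa [hvj, hVω, hDω] using hc)]
    refine ⟨⟨by simp, fun x hx => ?_, fun x hx => ?_⟩, fun k hk => ?_⟩
    · simp [Nat.lt_one_iff.mp hx, hH, hvj, hPω.tSd_eq h hh.le, hA, f, hc]
    · simp [hx.ne]
    · by_cases hkj : k = j
      · simp [hkj, hp, hc]
      · simpa [hlt k hkj] using hI k hk
  · rw [den_ite_neg en (by simpa [hvj, hVω, hDω] using hc)]
    refine ⟨⟨by simp, fun x hx => ?_, fun x hx => ?_⟩, fun k hk => ?_⟩
    · simp [Nat.lt_one_iff.mp hx, hH, hvj, hPω.tSd_eq h hh.le, hA, f, hc, hp]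
    · simp [hx.ne]
    · by_cases hkj : k = j
      · simp [hkj, hp, hc, hvj, hVω, hDω, w.2 fGam (by decide), hG j hj (by omega), pow_succ]
      · simpa [hlt k hkj, hvj, hkj] using hI k hk

/-- At level `s` only the first `(2 r) ^ s` rows have a meaning. The loops run over the number of
rows of the last level nevertheless, so that their bounds are fixed; the surplus rows are never
referred to. -/
theorem den_scalingStep {n d r s : ℕ} {g : F} (hn : 1 ≤ n) (hr : 1 ≤ r) {σ : Store F}
    (hP : Params n d r σ) (hs : σ.nat vS 0 = s) (hsK : s < Nat.clog 2 d)
    (hG : ∀ i ≤ d, σ.fld fGam i = g ^ (d * n) ^ i)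
    (hσ : ScalingsAt g n d r s σ) : ScalingsAt g n d r (s + 1) (den en scalingStep σ) := by
  obtain ⟨hV, hA⟩ := hσ
  have hKd : Nat.clog 2 d ≤ d := clog_two_le
  set D := halves d (s + 1) with hD
  simp only [scalingStep, den_seq]
  set σ₀ := den en (letN vPtr 0) (den en (letN vDA (.get tD (nv vS + 1))) σ) with hσ₀
  have s₀ : Store.Same scalingStep.wn scalingStep.wf σ σ₀ :=
    (Store.Same.refl _ _ σ).trans (den_same en (letN vDA (.get tD (nv vS + 1)) ;; letN vPtr 0) σ)
  have hD₀ : σ₀.nat vDA 0 = D := by simp [hσ₀, hs, hP.tD_eq (s + 1) (by omega), hD]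
  have hV₀ : ∀ j < d, σ₀.nat tV j = varIndex d s j := by simpa [hσ₀] using hV
  have hA₀ : σ₀.fld fAlpha = σ.fld fAlpha := rfl
  have hptr : σ₀.nat vPtr 0 = 0 := by simp [hσ₀]
  have hP₀ := hP.of_same s₀ (by decide)
  have h1 := den_scalingRows en hP₀ hV₀ hD₀ (γ := fun j => g ^ (d * n) ^ (varIndex d s j - D))
    fun j hj hle => hG _ (by
      have := varIndex_lt hj s
      have := halves_le (show 1 ≤ d by omega) s
      omega)
  have s₁ := den_same en (loop vH vRK scalingRow) σ₀
  set σ₁ := den en (loop vH vRK scalingRow) σ₀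
  clear_value σ₀ σ₁
  have h2 := loop_setF en (v := vX) (a := vMchk) (A := fAlpha) (idx := nv vX)
    (e := .get fT2 (nv vX)) (σ := σ₁) id (fun x => σ₁.fld fT2 x) (fun _ _ _ _ h => h)
    (fun i hi υ hυ hvi _ => by simp [hvi, hυ.2])
  rw [(hP₀.of_same s₁ (by decide)).Mchk_eq] at h2
  have s₂ := den_same en (loop vX vMchk (setF fAlpha (nv vX) (.get fT2 (nv vX)))) σ₁
  set σ₂ := den en (loop vX vMchk (setF fAlpha (nv vX) (.get fT2 (nv vX)))) σ₁
  clear_value σ₂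
  have h3 := den_loop en (v := vJ) (a := vd)
    (p := ite (.natLt (.get tV (nv vJ)) (nv vDA)) skip
      (setN tV (nv vJ) (.get tV (nv vJ) - nv vDA))) (σ := σ₂)
    (fun k τ => ∀ j < d, τ.nat tV j = varIndex d (if j < k then s + 1 else s) j)
    (by simpa (disch := decide) [s₂.1, s₁.1] using hV₀)
    (fun k hk τ hτ hv hI j hj => by
      rw [s₂.1 _ (by decide), s₁.1 _ (by decide), hP₀.d_eq] at hk
      have hDτ : τ.nat vDA 0 = D := by simp (disch := decide) only [hτ.1, s₂.1, s₁.1, hD₀]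
      have hk1 := hI k hk
      rw [if_neg (lt_irrefl k)] at hk1
      have hIj := hI j hj
      by_cases hc : varIndex d s k < D
      · rw [den_ite_pos en (by simpa [hv, hk1, hDτ] using hc)]
        by_cases hjk : j = k
        · simp [hjk, hk1, varIndex, ← hD, hc]
        · simpa [show j < k + 1 ↔ j < k by omega] using hIj
      · rw [den_ite_neg en (by simpa [hv, hk1, hDτ] using hc)]
        by_cases hjk : j = k
        · simp [hjk, hv, hk1, hDτ, varIndex, ← hD, hc]
        · simpa [hjk, hv, show j < k + 1 ↔ j < k by omega] using hIj)
  rw [s₂.1 _ (by decide), s₁.1 _ (by decide), hP₀.d_eq] at h3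
  refine ⟨fun j hj => by simpa [hj] using h3 j hj, fun h hh j hj => ?_⟩
  have hd : 0 < 2 * r * d := Nat.mul_pos (by omega) (by omega)
  have hh' : h < (2 * r) ^ Nat.clog 2 d := hh.trans_le (Nat.pow_le_pow_right (by omega) hsK)
  -- Only `(2 r) ^ ⌈lg d⌉ * (d n)` values are copied back. Because `n ≥ 1`, this covers all rows of
  -- the level.
  have e1 : h * d + j < (2 * r) ^ Nat.clog 2 d * (d * n) :=
    (mul_add_lt hh' hj).trans_le (Nat.mul_le_mul_left _ (Nat.le_mul_of_pos_right d hn))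
  have e2 : h * d + j = h / (2 * r) * (2 * r * d) + (h % (2 * r) * d + j) := by
    conv_lhs => rw [← Nat.div_add_mod' h (2 * r)]
    ring
  have e3 := mul_add_lt (Nat.mod_lt h (show 0 < 2 * r by omega)) hj
  have e4 := h1.2.1 (h * d + j) ((mul_add_lt hh' hj).trans_le
    (Nat.mul_le_mul_left _ (Nat.le_mul_of_pos_left d (by omega))))
  rw [den_fld en (by decide), show h * d + j = id (h * d + j) from rfl, h2.1 _ e1]
  rw [hptr, zero_add] at e4
  rw [e4, e2]
  simp only [(mul_add_div_mod e3).1, (mul_add_div_mod e3).2, (mul_add_div_mod hj).1,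
    (mul_add_div_mod hj).2]
  rw [hA₀, hA _ (Nat.div_lt_of_lt_mul (by rwa [← pow_succ'])) j hj, scaling]

theorem same_of_eq {p : LoopProg} {σ τ : Store F} (h : τ = den en p σ) :
    Store.Same p.wn p.wf σ τ := h ▸ den_same en p σ

theorem den_scalings {n d r : ℕ} (hn : 1 ≤ n) (hr : 1 ≤ r) {σ : Store F} (hP : Params n d r σ) :
    ScalingsAt (σ.fld fG 0) n d r (Nat.clog 2 d) (den en scalings σ) := by
  simp only [scalings, den_seq]
  set σ₁ := den en gammaTable σ with hσ₁
  have s₁ : Store.Same _ _ σ σ₁ := den_same en gammaTable σ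
  have hP₁ : Params n d r σ₁ := hP.of_same s₁ (by decide)
  have hG₁ : ∀ i ≤ d, σ₁.fld fGam i = σ.fld fG 0 ^ (d * n) ^ i := fun i hi => by
    rw [hσ₁, den_gammaTable en (by rw [hP.d_eq]; exact hi), hP.N_eq]
  clear_value σ₁
  have hset := loop_setN en (v := vJ) (a := vd) (A := tV) (idx := nv vJ) (e := nv vJ) (σ := σ₁)
    (by simp) id id (fun _ _ _ _ h => h) (fun i _ τ _ hv _ _ => by simp [hv])
  have s₂ := den_same en (loop vJ vd (setN tV (nv vJ) (nv vJ))) σ₁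
  set σ₂ := den en (loop vJ vd (setN tV (nv vJ) (nv vJ))) σ₁ with hσ₂
  clear_value σ₂
  have hP₂ : Params n d r σ₂ := hP₁.of_same s₂ (by decide)
  have hset' := loop_setF en (v := vJ) (a := vd) (A := fAlpha) (idx := nv vJ) (e := 1) (σ := σ₂)
    id (fun _ => 1) (fun _ _ _ _ h => h) (fun i _ τ _ hv _ => by simp [hv])
  have s₃ := den_same en (loop vJ vd (setF fAlpha (nv vJ) 1)) σ₂
  set σ₃ := den en (loop vJ vd (setF fAlpha (nv vJ) 1)) σ₂ with hσ₃
  clear_value σ₃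
  have hP₃ : Params n d r σ₃ := hP₂.of_same s₃ (by decide)
  rw [hP₁.d_eq] at hset
  rw [hP₂.d_eq] at hset'
  have h0 : ScalingsAt (σ.fld fG 0) n d r 0 σ₃ := by
    refine ⟨fun j hj => ?_, fun h hh j hj => ?_⟩
    · rw [s₃.1 _ (by decide), show j = id j from rfl, hset.1 j hj]
      rfl
    · obtain rfl : h = 0 := by simpa using hh
      rw [zero_mul, zero_add, show j = id j from rfl, hset'.1 j hj]
      rfl
  have key := den_loop en (v := vS) (a := vK) (p := scalingStep) (σ := σ₃)
    (fun s τ => s ≤ Nat.clog 2 d → ScalingsAt (σ.fld fG 0) n d r s τ)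
    (fun _ => by simpa [ScalingsAt] using h0)
    (fun s hs τ hτ hv hI hs' => by
      have hPτ : Params n d r τ := hP₃.of_same hτ (by decide)
      have := den_scalingStep en hn hr hPτ hv hs' (fun i hi => by
        rw [hτ.2 _ (by decide), s₃.2 _ (by decide), s₂.2 _ (by decide),
          hG₁ i hi]) (hI (by omega))
      simpa [ScalingsAt] using this)
  rw [hP₃.K_eq] at key
  exact key le_rfl

theorem den_factors {n d r : ℕ} {σ : Store F} (hP : Params n d r σ)
    (hσ : ScalingsAt (σ.fld fG 0) n d r (Nat.clog 2 d) σ) {h k j i : ℕ}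
    (hh : h < (2 * r) ^ Nat.clog 2 d) (hk : k < d * n) (hj : j < d) (hi : i < n) :
    (den en factors σ).fld fVec (((h * (d * n) + k) * d + j) * n + i) =
      (scaling (σ.fld fG 0) (d * n) d r (Nat.clog 2 d) h j * σ.fld fG 0 ^ k) ^ i := by
  set g := σ.fld fG 0 with hg
  let f (h k j i : ℕ) : F := (scaling g (d * n) d r (Nat.clog 2 d) h j * g ^ k) ^ i
  rw [factors, den_seq]
  set σ₀ := den en (letN vPtr 0) σ with hσ₀
  have s₀ : Store.Same factors.wn factors.wf σ σ₀ :=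
    (Store.Same.refl _ _ σ).trans (den_same en (letN vPtr 0) σ)
  have hptr : σ₀.nat vPtr 0 = 0 := by simp [hσ₀]
  clear_value σ₀
  have key := loop_emitted en (v := vH) (b := vRK) (A := fVec) (L := d * n * (d * n)) (σ := σ₀)
    (p := letF fGk 1 ;; loop vKk vN factorRows)
    (f := fun h x => f h (x / (d * n)) (x % (d * n) / n) (x % (d * n) % n))
    (fun _ _ => True) (by decide) trivial fun h hh τ hτ hvh _ _ => ⟨?_, trivial⟩
  · rw [(hP.of_same s₀ (by decide)).RK_eq] at key
    have e1 := mul_add_lt hj hi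
    have e2 := mul_add_lt hk e1
    rw [show ((h * (d * n) + k) * d + j) * n + i =
      h * (d * n * (d * n)) + (k * (d * n) + (j * n + i)) by ring]
    have := key.1.2.1 _ (mul_add_lt hh e2)
    simp only [hptr, zero_add, (mul_add_div_mod e2).1, (mul_add_div_mod e2).2,
      (mul_add_div_mod e1).1, (mul_add_div_mod e1).2, (mul_add_div_mod hi).1,
      (mul_add_div_mod hi).2] at this
    exact this
  rw [(hP.of_same s₀ (by decide)).RK_eq] at hh
  have t := s₀.trans hτ
  rw [den_seq]
  have s₁ := den_same en (letF fGk 1) τ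
  set τ₁ := den en (letF fGk 1) τ with hτ₁
  have key := loop_emitted en (v := vKk) (b := vN) (A := fVec) (L := d * n) (σ := τ₁)
    (p := factorRows) (f := fun k x => f h k (x / n) (x % n)) (fun k υ => υ.fld fGk 0 = g ^ k)
    (by decide) (by simp [hτ₁]) fun k hk υ hυ hvk _ hI => ?_
  · rw [((hP.of_same t (by decide)).of_same s₁ (by decide)).N_eq] at key
    exact key.1.of_same s₁
  have u := (t.trans s₁).trans hυ
  rw [factorRows, den_seq]
  have key := loop_emitted en (v := vJ) (b := vd) (A := fVec) (L := n) (σ := υ)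
    (p := factorRow) (f := f h k) (fun _ _ => True)
    (by decide) trivial fun j hj ω hω hvj _ _ => ⟨?_, trivial⟩
  · rw [(hP.of_same u (by decide)).d_eq] at key
    refine ⟨by simpa [Emitted] using key.1, ?_⟩
    simp (disch := decide) [den_fld, hI, u.2, ← hg, pow_succ]
  rw [(hP.of_same u (by decide)).d_eq] at hj
  have hP₁ := hP.of_same (u.trans hω) (by decide)
  set β := scaling g (d * n) d r (Nat.clog 2 d) h j * g ^ k with hβ
  have s₂ := den_same en (letF fT1 (.get fAlpha (.get tSd (nv vH) + nv vJ) * fv fGk) ;; letF fT2 1) ω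
  set ω₁ := den en (letF fT1 (.get fAlpha (.get tSd (nv vH) + nv vJ) * fv fGk) ;; letF fT2 1) ω
    with hω₁
  have hT1 : ω₁.fld fT1 0 = β := by
    have hH : ω.nat vH 0 = h := by simp (disch := decide) only [hω.1, hυ.1, s₁.1, hvh]
    simp [hω₁, hvj, hH, hP₁.tSd_eq h hh.le, (u.trans hω).2 fAlpha (by decide), hσ.2 h hh j hj,
      hω.2 fGk (by decide), hI, hβ]
  have key := loop_emitted en (v := vI) (b := vn) (A := fVec) (L := 1) (σ := ω₁)
    (p := factorEntry) (f := fun i _ => f h k j i) (fun i χ => χ.fld fT2 0 = β ^ i)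
    (by decide) (by simp [hω₁]) fun i hi χ hχ hvi _ hI => ?_
  · rw [(hP₁.of_same s₂ (by decide)).n_eq] at key
    have := key.1.of_same s₂
    simp only [mul_one, Nat.div_one] at this
    exact this
  refine ⟨⟨by simp [factorEntry], fun x hx => ?_, fun x hx => by simp [factorEntry, hx.ne]⟩,
    by simp [factorEntry, hI, hχ.2 fT1 (by decide), hT1, pow_succ]⟩
  simp [factorEntry, Nat.lt_one_iff.mp hx, hI, f, hβ]

/-- The digits `p / n ^ j % n` of the position are obtained by repeated lookups in the tables of
quotients and remainders, as the machine has no division; position `p` is thereby read as a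
multi-index. -/
theorem den_products {n d r mc : ℕ} {σ : Store F} (hP : Params n d r σ)
    (hmc : σ.nat vMc 0 = mc) {a p : ℕ} (ha : a < mc) (hp : p < n ^ d) :
    (den en products σ).fld fOut (a * n ^ d + p) =
      ∏ j ∈ Finset.range d, σ.fld fVec ((a * d + j) * n + p / n ^ j % n) := by
  set V := σ.fld fVec with hV
  let f (a p : ℕ) : F := ∏ j ∈ Finset.range d, V ((a * d + j) * n + p / n ^ j % n)
  simp only [products, den_seq]
  set σ₀ := den en (letN vT1 0) (den en (letN vPtr 0) σ) with hσ₀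
  have s₀ : Store.Same products.wn products.wf σ σ₀ :=
    (Store.Same.refl _ _ σ).trans (den_same en (letN vPtr 0 ;; letN vT1 0) σ)
  have hptr : σ₀.nat vPtr 0 = 0 := by simp [hσ₀]
  have hmc₀ : σ₀.nat vMc 0 = mc := by rw [s₀.1 _ (by decide), hmc]
  have key := loop_emitted en (v := vH) (b := vMc) (A := fOut) (L := n ^ d) (σ := σ₀)
    (p := loop vP vnd productEntry ;; letN vT1 (nv vT1 + nv vN)) (f := f)
    (fun k τ => τ.nat vT1 0 = k * (d * n)) (by decide) (by simp [hσ₀])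
    fun k hk τ hτ hvk _ hI => ?_
  · rw [hmc₀] at key
    have := key.1.2.1 _ (mul_add_lt ha hp)
    simpa only [hptr, zero_add, (mul_add_div_mod hp).1, (mul_add_div_mod hp).2] using this
  have t := s₀.trans hτ
  have hPτ := hP.of_same t (by decide)
  rw [den_seq]
  have key := loop_emitted en (v := vP) (b := vnd) (A := fOut) (L := 1) (σ := τ)
    (p := productEntry) (f := fun p _ => f k p) (fun _ _ => True) (by decide) trivial
    fun p hp υ hυ hvp _ _ => ⟨?_, trivial⟩
  · rw [hPτ.nd_eq] at key
    refine ⟨by simpa [Emitted] using key.1, ?_⟩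
    simp (disch := decide) [den_nat, hI, hPτ.N_eq, add_one_mul]
  rw [hPτ.nd_eq] at hp
  set υ₁ := den en (letN vCur (nv vP) ;; letN vOff (nv vT1) ;; letF fT1 1) υ with hυ₁
  have u := den_same en (letN vCur (nv vP) ;; letN vOff (nv vT1) ;; letF fT1 1) υ
  have w := (t.trans hυ).trans u
  have hM := den_loop en (v := vJ) (a := vd) (p := productStep) (σ := υ₁)
    (fun j ω => ω.nat vCur 0 = p / n ^ j ∧ ω.nat vOff 0 = (k * d + j) * n ∧
      ω.fld fT1 0 = ∏ j ∈ Finset.range j, V ((k * d + j) * n + p / n ^ j % n))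
    (by simp [hυ₁, hvp, hυ.1 vT1 (by decide), hI, mul_assoc])
    (fun j hj ω hω hvω hIω => by
      have x := w.trans hω
      have hPω := hP.of_same x (by decide)
      have hle : p / n ^ j ≤ n ^ d := (Nat.div_le_self _ _).trans hp.le
      refine ⟨?_, ?_, ?_⟩
      · simp [productStep, hIω.1, hPω.tQu_eq _ hle, Nat.div_div_eq_div_mul, pow_succ]
      · simp [productStep, hIω.2.1, hPω.n_eq]
        ring
      · rw [Finset.prod_range_succ, ← hIω.2.2]
        simp [productStep, hIω.1, hIω.2.1, hPω.tRm_eq _ hle, x.2 fVec (by decide), hV])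
  rw [(hP.of_same w (by decide)).d_eq] at hM
  set υ₂ := den en (loop vJ vd productStep) υ₁
  have v : Store.Same _ _ υ υ₂ := den_same en ((letN vCur (nv vP) ;; letN vOff (nv vT1) ;;
    letF fT1 1) ;; loop vJ vd productStep) υ
  have hv := v.1 vPtr (by decide)
  change Emitted fOut 1 _ υ (den en (setF fOut (nv vPtr) (fv fT1) ;; letN vPtr (nv vPtr + 1)) υ₂)
  refine ⟨by simp [hv], fun x hx => ?_, fun x hx => by simp [hv, hx.ne, v.2 fOut (by decide)]⟩
  simp [Nat.lt_one_iff.mp hx, hv, hM.2.2, f]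

end LoopProg

/-! ## The linear systems of the decoder -/

namespace LoopProg

/-- Add `x` to an entry of the row `fRow`. -/
def addToRow (i : NatExpr) (x : FieldExpr) : LoopProg := setF fRow i (.get fRow i + x)

/-- Clear the row `fRow`. -/
def zeroRow : LoopProg := loop vX vC (setF fRow (nv vX) 0)

/-- Go to the next power of an element. -/
def nextPower : LoopProg := letF fT1 (fv fT1 * .get fGL (nv vE))

/-- One coefficient of an equation for the locator polynomials. -/
def locatorEntry : LoopProg :=
  ite (.and (.natLe (nv vKk) (nv vE2)) (.natLt (nv vE2 - nv vKk) (nv vDA)))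
    (addToRow (.get tR (nv vI) + nv vKk) (fv fT1 *
      .get fU (.get tW (.get tR2 (nv vH) + (nv vE + nv vI)) + (nv vE2 - nv vKk)))) skip ;;
  nextPower

/-- The equations for the locator polynomials. -/
def locatorFill : LoopProg :=
  zeroRow ;; loop vI vR1 (letF fT1 1 ;; loop vKk vR locatorEntry)

/-- One summand of the value of a locator polynomial. -/
def rowEntry : LoopProg :=
  letF fT1 (fv fT1 + .get fLam (.get tR (nv vI) + (nv vE2 - nv vB)) * fv fT2) ;;
  letF fT2 (fv fT2 * .get fGL (nv vB))

/-- One coefficient of an equation for the rows. -/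
def rowStep : LoopProg :=
  letF fT1 0 ;; letF fT2 1 ;; loop vI vR1 rowEntry ;;
  ite (.and (.natLt (nv vB) (nv vDB))
      (.and (.natLe (nv vB) (nv vE2)) (.natLt (nv vE2 - nv vB) (nv vR))))
    (addToRow (nv vE + .get tA (nv vB) + 1) (fv fT1)) skip

/-- The equations that the locator polynomials impose on the rows of the coefficient matrix. -/
def rowFill : LoopProg :=
  zeroRow ;; ite (.natLt (nv vE) (nv vDA)) (loop vB vW rowStep) skip

/-- One coefficient of an equation for the coefficient matrix. -/
def syndromeEntry : LoopProg :=
  ite (.and (.natLt (nv vB) (nv vDB))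
      (.and (.natLe (nv vB) (nv vE2)) (.natLt (nv vE2 - nv vB) (nv vDA))))
    (addToRow ((nv vE2 - nv vB) + .get tA (nv vB) + 1) (fv fT1)) skip ;;
  nextPower

/-- The equations that the syndromes impose on the coefficient matrix. -/
def syndromeFill : LoopProg :=
  zeroRow ;;
  ite (.natLt (nv vE2) (nv vDA))
    (addToRow 0 (0 - .get fU (.get tW (.get tR2 (nv vH) + nv vE) + nv vE2))) skip ;;
  letF fT1 1 ;; loop vB vW syndromeEntry

/-- Find locator polynomials. -/
def solveLocator : LoopProg :=
  startSpan (.get tR (nv vR1)) ;; equations vr vC locatorFill ;; pickVector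

/-- Find a multiple of the coefficient matrix. -/
def solveRows : LoopProg :=
  startSpan (nv vDAB + 1) ;; equations vW vC rowFill ;; equations vr vC syndromeFill ;; pickVector

variable {F : Type u} [Field F] (en : Enumeration F) {g : F} {r R A B W c : ℕ} {S : ℕ → ℕ → F}
  {σ : Store F}

/-- The data of one step of the recursion of the decoder. -/
structure LevelState (g : F) (r R A B W c : ℕ) (S : ℕ → ℕ → F) (σ : Store F) : Prop where
  square : Square c σ
  r_eq : σ.nat vr 0 = r
  R1_eq : σ.nat vR1 0 = r + 1
  R_eq : σ.nat vR 0 = R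
  W_eq : σ.nat vW 0 = W
  DA_eq : σ.nat vDA 0 = A
  DB_eq : σ.nat vDB 0 = B
  DAB_eq : σ.nat vDAB 0 = A * B
  GL_eq : ∀ x ≤ c, σ.fld fGL x = g ^ x
  tR_eq : ∀ i ≤ r + 1, σ.nat tR i = i * R
  tA_eq : ∀ i ≤ W, σ.nat tA i = i * A
  S_eq : ∀ m < 2 * r, ∀ x < A, σ.fld fU (σ.nat tW (σ.nat tR2 (σ.nat vH 0) + m) + x) = S m x

theorem LevelState.of_same {τ : Store F} {wn wf : List ℕ} (h : Store.Same wn wf σ τ)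
    (hσ : LevelState g r R A B W c S σ)
    (hw : ∀ a ∈ [vC, tC, vr, vR1, vR, vW, vDA, vDB, vDAB, tR, tA, tW, tR2, vH], a ∉ wn := by decide)
    (hf : ∀ a ∈ [fGL, fU], a ∉ wf := by decide) : LevelState g r R A B W c S τ := by
  refine ⟨hσ.1.of_same h (hw _ (by decide)) (hw _ (by decide)), ?_, ?_, ?_, ?_, ?_, ?_, ?_, ?_, ?_,
    ?_, ?_⟩
  all_goals simp only [h.1 vr (hw _ (by decide)), h.1 vR1 (hw _ (by decide)),
    h.1 vR (hw _ (by decide)), h.1 vW (hw _ (by decide)), h.1 vDA (hw _ (by decide)),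
    h.1 vDB (hw _ (by decide)), h.1 vDAB (hw _ (by decide)), h.1 tR (hw _ (by decide)),
    h.1 tA (hw _ (by decide)), h.1 tW (hw _ (by decide)), h.1 tR2 (hw _ (by decide)),
    h.1 vH (hw _ (by decide)), h.2 fGL (hf _ (by decide)), h.2 fU (hf _ (by decide))]
  exacts [hσ.2, hσ.3, hσ.4, hσ.5, hσ.6, hσ.7, hσ.8, hσ.9, hσ.10, hσ.11, hσ.12]

theorem den_zeroRow (hc : σ.nat vC 0 = c) (w : ℕ → F) : rowDot c w (den en zeroRow σ) = 0 := by
  have h := loop_fill en (v := vX) (a := vC) (A := fRow) (e := 0) (σ := σ) (fun _ => 0)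
    (fun _ _ _ _ _ => rfl)
  rw [hc] at h
  exact Finset.sum_eq_zero fun x _ => by rw [zeroRow, h x x.2, zero_mul]

theorem den_ite_addToRow {T : Test} {i : NatExpr} {e : FieldExpr} {z : F}
    {w : ℕ → F} (h : T.Holds en σ → i.eval σ < c ∧ e.eval en σ * w (i.eval σ) = z)
    (h' : ¬ T.Holds en σ → z = 0) :
    rowDot c w (den en (ite T (addToRow i e) skip) σ) = rowDot c w σ + z := by
  by_cases hT : T.Holds en σ
  · rw [den_ite_pos en hT, ← (h hT).2]
    exact rowDot_add (h hT).1 w σ _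
  · rw [den_ite_neg en hT, h' hT, add_zero, den_skip]

theorem loop_rowDot {v b : ℕ} {p : LoopProg} {w : ℕ → F} (f : ℕ → F) (I : ℕ → Store F → Prop)
    (h0 : I 0 (σ.setNat v 0 0))
    (h : ∀ i < σ.nat b 0, ∀ τ, Store.Same (v :: p.wn) p.wf σ τ → τ.nat v 0 = i → I i τ →
      rowDot c w (den en p τ) = rowDot c w τ + f i ∧ I (i + 1) ((den en p τ).setNat v 0 (i + 1))) :
    rowDot c w (den en (loop v b p) σ) = rowDot c w σ + ∑ i ∈ Finset.range (σ.nat b 0), f i :=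
  (den_loop en (fun k τ => rowDot c w τ = rowDot c w σ + ∑ i ∈ Finset.range k, f i ∧ I k τ)
    ⟨by simp [rowDot], h0⟩ fun k hk τ hτ hv hI => by
      have := h k hk τ hτ hv hI.2
      rw [Finset.sum_range_succ, ← add_assoc, ← hI.1]
      exact this).1

theorem sum_range_ite (h : B ≤ W) (f : ℕ → F) :
    ∑ b ∈ Finset.range W, (if b < B then f b else 0) = ∑ b ∈ Finset.range B, f b := by
  rw [← Finset.sum_subset (Finset.range_mono h) fun b _ hb => if_neg fun h => hb (by simpa using h)]
  exact Finset.sum_congr rfl fun b hb => if_pos (by simpa using hb)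

/-- The unknown coefficient `k` of locator polynomial `i` has position `i R + k`, and `fT1` runs
through the powers `(g^l)^k`. -/
theorem den_locatorFill (hσ : LevelState g r R A B W c S σ) (hRc : (r + 1) * R ≤ c) {l e : ℕ}
    (hl : l < r) (hlc : l ≤ c) (hE : σ.nat vE 0 = l) (hE2 : σ.nat vE2 0 = e) (w : ℕ → F) :
    rowDot c w (den en locatorFill σ) =
      locatorEq g r R A S (fun i k => w (i * R + k)) l e := by
  have s := (Store.Same.refl locatorFill.wn locatorFill.wf σ).trans (den_same en zeroRow σ)
  have key := loop_rowDot en (v := vI) (b := vR1) (p := letF fT1 1 ;; loop vKk vR locatorEntry)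
    (σ := den en zeroRow σ) (c := c) (w := w) (fun i => ∑ k ∈ Finset.range R,
      (if k ≤ e ∧ e - k < A then g ^ (l * k) * S (l + i) (e - k) else 0) * w (i * R + k))
    (fun _ _ => True) trivial (fun i hi τ hτ hv _ => by
      have t := s.trans hτ |>.trans (den_same en (letF fT1 1) τ)
      have hL := hσ.of_same t
      rw [s.1 _ (by decide), hσ.R1_eq] at hi
      have inner := loop_rowDot en (v := vKk) (b := vR) (p := locatorEntry) (c := c) (w := w)
        (σ := den en (letF fT1 1) τ) (fun k =>
          (if k ≤ e ∧ e - k < A then g ^ (l * k) * S (l + i) (e - k) else 0) * w (i * R + k))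
        (fun k υ => υ.fld fT1 0 = (g ^ l) ^ k) (by simp) (fun k hk υ hυ hvυ hT => by
          rw [hL.R_eq] at hk
          have hI : υ.nat vI 0 = i := by rw [hυ.1 _ (by decide), ← hv]; rfl
          have u := t.trans hυ
          have hpos := (mul_add_lt hi hk).trans_le hRc
          refine ⟨(rowDot_of_eq (den_fld en (p := nextPower) (by decide) _)).trans
            (den_ite_addToRow en (fun hc => ?_) fun hc => ?_), by
            simp (disch := decide) [nextPower, locatorEntry, den_fld, den_nat, u.1, u.2, hE,
              hσ.GL_eq l hlc, hT, pow_succ]⟩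
          · simp (disch := decide) [hvυ, u.1, hE2, hσ.DA_eq] at hc
            simp (disch := decide) [hvυ, hI, u.1, u.2, hE, hE2, hσ.tR_eq i (by omega), hpos,
              hσ.S_eq (l + i) (by omega) (e - k) hc.2, hT, hc, pow_mul]
          · simp (disch := decide) [hvυ, u.1, hE2, hσ.DA_eq] at hc
            rw [if_neg fun h => (hc h.1).not_gt h.2, zero_mul])
      rw [hL.R_eq] at inner
      exact ⟨inner, trivial⟩)
  rw [s.1 _ (by decide), hσ.R1_eq, den_zeroRow en hσ.square.2.1, zero_add] at key
  exact key

/-- Position 0 of the vector of unknowns is reserved for the homogenizing factor, and the matrix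
entry `(a, b)` sits at `a + b A + 1`. With this layout the unknowns are, up to the shift by one, the
coefficients of the polynomial of the level, in order. -/
theorem den_rowFill (hσ : LevelState g r R A B W c S σ) (hABc : A * B < c) (hBW : B ≤ W)
    (hBc : B ≤ c) {lam : ℕ → ℕ → F}
    (hlam : ∀ i < r + 1, ∀ k < R, σ.fld fLam (i * R + k) = lam i k) {a e : ℕ} (ha : a < A)
    (hE : σ.nat vE 0 = a) (hE2 : σ.nat vE2 0 = e) (w : ℕ → F) :
    rowDot c w (den en rowFill σ) = rowEq g r R B lam (fun a b => w (a + b * A + 1)) a e := by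
  have s := (Store.Same.refl rowFill.wn rowFill.wf σ).trans (den_same en zeroRow σ)
  rw [rowFill, den_seq, den_ite_pos en (by simpa (disch := decide) [s.1, hE, hσ.DA_eq] using ha)]
  have key := loop_rowDot en (v := vB) (b := vW) (p := rowStep) (σ := den en zeroRow σ) (c := c)
    (w := w) (fun b => if b < B then (if b ≤ e ∧ e - b < R then
      ∑ i ∈ Finset.range (r + 1), lam i (e - b) * g ^ (i * b) else 0) * w (a + b * A + 1) else 0)
    (fun _ _ => True) trivial (fun b hb τ hτ hv _ => by
      have t := s.trans hτ |>.trans (den_same en (letF fT1 0 ;; letF fT2 1) τ)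
      rw [s.1 _ (by decide), hσ.W_eq] at hb
      have hL := hσ.of_same t
      -- The accumulated sum is computed for every `b`, but it is claimed to be correct only where
      -- the guard lets it be used.
      have inner := fun (hB : b < B) (hR : e - b < R) => den_loop en (v := vI) (a := vR1)
        (p := rowEntry) (σ := den en (letF fT1 0 ;; letF fT2 1) τ)
        (fun i υ => υ.fld fT1 0 = ∑ i ∈ Finset.range i, lam i (e - b) * g ^ (i * b) ∧
          υ.fld fT2 0 = g ^ (i * b)) (by simp) (fun i hi υ hυ hvυ hJ => by
            have u := t.trans hυ
            have hBv : υ.nat vB 0 = b := by rw [hυ.1 _ (by decide), ← hv]; rfl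
            rw [hL.R1_eq] at hi
            rw [Finset.sum_range_succ, ← hJ.1]
            constructor <;> simp (disch := decide) [rowEntry, hvυ, u.1, u.2, hE2, hBv, hσ.tR_eq i (by omega),
              hlam i hi _ hR, hJ.2, hσ.GL_eq b (by omega), add_one_mul, pow_add])
      have v := den_same en (loop vI vR1 rowEntry) (den en (letF fT1 0 ;; letF fT2 1) τ)
      have u := t.trans v
      set υ := den en (loop vI vR1 rowEntry) (den en (letF fT1 0 ;; letF fT2 1) τ)
      have hBv : υ.nat vB 0 = b := by rw [v.1 _ (by decide), ← hv]; rfl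
      refine ⟨(den_ite_addToRow en (σ := υ) (fun hc => ?_) fun hc => ?_).trans
        (congrArg (· + _) (rowDot_of_eq ?_)), trivial⟩
      · simp (disch := decide) [hBv, u.1, hE2, hσ.DB_eq, hσ.R_eq] at hc
        have := inner hc.1 hc.2.2
        rw [hL.R1_eq] at this
        have hpos := mul_add_lt hc.1 ha
        rw [mul_comm B] at hpos
        simp (disch := decide) [hBv, u.1, hE, hσ.tA_eq b hb.le, this.1, hc]
        omega
      · simp (disch := decide) [hBv, u.1, hE2, hσ.DB_eq, hσ.R_eq] at hc
        split_ifs with x y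
        exacts [absurd y.2 (hc x y.1).not_gt, zero_mul _, rfl]
      · rw [v.2 _ (by decide), den_fld en (by decide)])
  rw [s.1 _ (by decide), hσ.W_eq, den_zeroRow en hσ.square.2.1, zero_add, sum_range_ite hBW] at key
  exact key

theorem den_syndromeFill (hσ : LevelState g r R A B W c S σ) (hABc : A * B < c) (hBW : B ≤ W)
    {l e : ℕ} (hl : l < r) (hlc : l ≤ c) (hE : σ.nat vE 0 = l) (hE2 : σ.nat vE2 0 = e)
    (w : ℕ → F) : rowDot c w (den en syndromeFill σ) =
      syndromeEq g A B S (w 0) (fun a b => w (a + b * A + 1)) l e := by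
  have s := (Store.Same.refl syndromeFill.wn syndromeFill.wf σ).trans (den_same en zeroRow σ)
  have h0 := den_ite_addToRow en (σ := den en zeroRow σ) (c := c) (w := w)
    (T := .natLt (nv vE2) (nv vDA)) (i := 0)
    (e := 0 - .get fU (.get tW (.get tR2 (nv vH) + nv vE) + nv vE2))
    (z := (if e < A then -S l e else 0) * w 0) (fun hc => by
      simp (disch := decide) [s.1, hE2, hσ.DA_eq] at hc
      simp (disch := decide) [s.1, s.2, hE, hE2, hc, hσ.square.1, hσ.S_eq l (by omega) e hc]) (fun hc => by
      simp (disch := decide) [s.1, hE2, hσ.DA_eq] at hc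
      simp [hc.not_gt])
  simp only [syndromeFill, den_seq]
  have s₁ := den_same en (ite (.natLt (nv vE2) (nv vDA))
    (addToRow 0 (0 - .get fU (.get tW (.get tR2 (nv vH) + nv vE) + nv vE2))) skip) (den en zeroRow σ)
  set σ₁ := den en (ite (.natLt (nv vE2) (nv vDA))
    (addToRow 0 (0 - .get fU (.get tW (.get tR2 (nv vH) + nv vE) + nv vE2))) skip) (den en zeroRow σ)
  have t := (s.trans s₁).trans (den_same en (letF fT1 1) σ₁)
  have key := loop_rowDot en (v := vB) (b := vW) (p := syndromeEntry) (σ := den en (letF fT1 1) σ₁)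
    (c := c) (w := w) (fun b => if b < B then (if b ≤ e ∧ e - b < A then g ^ (l * b) else 0) *
        w (e - b + b * A + 1) else 0) (fun b τ => τ.fld fT1 0 = (g ^ l) ^ b) (by simp)
    (fun b hb τ hτ hv hT => by
      have u := t.trans hτ
      rw [t.1 _ (by decide), hσ.W_eq] at hb
      refine ⟨(rowDot_of_eq (den_fld en (p := nextPower) (by decide) _)).trans
        (den_ite_addToRow en (fun hc => ?_) fun hc => ?_), by
        simp (disch := decide) [nextPower, syndromeEntry, den_fld, den_nat, u.1, u.2, hE,
          hσ.GL_eq l hlc, hT, pow_succ]⟩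
      · simp (disch := decide) [hv, u.1, hE2, hσ.DB_eq, hσ.DA_eq] at hc
        have hpos := mul_add_lt hc.1 hc.2.2
        rw [mul_comm B] at hpos
        simp (disch := decide) [hv, u.1, hE2, hσ.tA_eq b hb.le, hT, hc, pow_mul]
        omega
      · simp (disch := decide) [hv, u.1, hE2, hσ.DB_eq, hσ.DA_eq] at hc
        split_ifs with x y
        exacts [absurd y.2 (hc x y.1).not_gt, zero_mul _, rfl])
  rw [t.1 _ (by decide), hσ.W_eq, rowDot_of_eq (σ := σ₁) (den_fld en (by decide) _), h0,
    den_zeroRow en hσ.square.2.1, zero_add, sum_range_ite hBW] at key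
  exact key

end LoopProg

/-! ## One step of the decoder -/

namespace LoopProg

/-- Copy the solution to `fLam`. -/
def copyLam : LoopProg := loop vX vC (setF fLam (nv vX) (.get fZ (nv vX)))

/-- Normalize the solution and store it. -/
def storeU (A : ℕ) : LoopProg :=
  loop vX vW (setF A (.get tW (nv vH) + nv vX) (.get fZ (nv vX + 1) * (.get fZ 0)⁻¹))

/-- Compute the coefficients of one polynomial of a level. -/
def levelBody : LoopProg := solveLocator ;; copyLam ;; solveRows ;; storeU fU0

/-- The sizes of a level. -/
def levelSizes : LoopProg :=
  letN vL2 (nv vK - 1 - nv vS) ;;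
  letN vDA (.get tNP (.get tD (nv vL2 + 1))) ;;
  letN vDB (.get tNP (.get tD (nv vL2) - .get tD (nv vL2 + 1))) ;;
  letN vDAB (.get tNP (.get tD (nv vL2))) ;;
  multiples tA vX vW vDA

/-- Go to the next level. -/
def copyU : LoopProg := loop vX vTot (setF fU (nv vX) (.get fU0 (nv vX)))

/-- Compute the coefficients of all polynomials of a level from those of the next one. -/
def levelStep : LoopProg := levelSizes ;; loop vH vRK levelBody ;; copyU

variable {F : Type u} [Field F] (en : Enumeration F) {g : F} {r R A B W c : ℕ} {S : ℕ → ℕ → F}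
  {σ : Store F}

/-- A system given by its support and a property `P` is solved by the chosen vector, and that vector
is nonzero if any nonzero solution exists. Vectors are functions on `ℕ` so that they can be read
directly from the memory. -/
theorem pickVector_spec {c used : ℕ} {σ : Store F} (hσ : Square c σ) (P : (ℕ → F) → Prop)
    (hspan : ∀ w : ℕ → F, (fun x : Fin c => w x) ∈ spanOf c σ ↔
      (∀ x < c, used ≤ x → w x = 0) ∧ P w) :
    (∀ x < c, used ≤ x → (den en pickVector σ).fld fZ x = 0) ∧
      P ((den en pickVector σ).fld fZ) ∧
      ((∃ w : ℕ → F, (∃ x < c, w x ≠ 0) ∧ (∀ x < c, used ≤ x → w x = 0) ∧ P w) →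
        ∃ x < c, (den en pickVector σ).fld fZ x ≠ 0) := by
  obtain ⟨h1, h2⟩ := den_pickVector en hσ
  obtain ⟨h3, h4⟩ := (hspan _).mp h1
  refine ⟨h3, h4, fun ⟨w, ⟨x, hx, hne⟩, hw⟩ => h2 fun hbot => hne ?_⟩
  have h5 := (hspan w).mpr hw
  rw [hbot, Submodule.mem_bot] at h5
  exact congrFun h5 ⟨x, hx⟩

theorem exists_table (B A : ℕ) (M : ℕ → ℕ → F) : ∃ f : ℕ → F,
    (∀ b < B, ∀ a < A, f (b * A + a) = M b a) ∧ ∀ x, B * A ≤ x → f x = 0 :=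
  ⟨fun x => if x < B * A then M (x / A) (x % A) else 0, fun b hb a ha => by
    simp only [mul_add_lt hb ha, (mul_add_div_mod ha).1, (mul_add_div_mod ha).2, if_true],
    fun x hx => if_neg (by omega)⟩

/-- The existence of a locator makes the solution space nonzero, so the chosen vector is nonzero. It
vanishes outside the first `(r + 1) R` positions, hence the nonzero entry is a coefficient of some
locator polynomial. -/
theorem den_solveLocator (hσ : LevelState g r R A B W c S σ) (hRc : (r + 1) * R ≤ c) (hrc : r ≤ c)
    (h : ∃ lam : ℕ → ℕ → F, (∃ i < r + 1, ∃ k < R, lam i k ≠ 0) ∧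
      ∀ l < r, ∀ e, locatorEq g r R A S lam l e = 0) :
    (∃ i < r + 1, ∃ k < R, (den en solveLocator σ).fld fZ (i * R + k) ≠ 0) ∧
      ∀ l < r, ∀ e < c, locatorEq g r R A S
        (fun i k => (den en solveLocator σ).fld fZ (i * R + k)) l e = 0 := by
  rw [solveLocator, den_seq, den_seq]
  have h₁ := hσ.of_same (den_same en (startSpan (.get tR (nv vR1))) σ)
  have hspan := den_startSpan en hσ.square (u := (r + 1) * R)
    (show NatExpr.eval σ (.get tR (nv vR1)) = _ by simp [hσ.R1_eq, hσ.tR_eq (r + 1) le_rfl])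
  set σ₁ := den en (startSpan (.get tR (nv vR1))) σ
  obtain ⟨k1, k2, k3⟩ := pickVector_spec en (used := (r + 1) * R)
    (h₁.of_same (den_same en (equations vr vC locatorFill) σ₁)).square
    (fun w => ∀ l < r, ∀ e < c, locatorEq g r R A S (fun i k => w (i * R + k)) l e = 0) fun w => by
    have := den_equations en (fill := locatorFill) h₁.square (p₁ := vr) (p₂ := vC) (w := w)
      (locatorEq g r R A S (fun i k => w (i * R + k))) (fun l hl e he τ hτ hE hE2 => by
        rw [h₁.r_eq] at hl
        exact den_locatorFill en (h₁.of_same hτ) hRc hl (by omega) hE hE2 w)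
    rw [this, hspan, h₁.r_eq, h₁.square.2.1]
  refine ⟨?_, k2⟩
  obtain ⟨lam, ⟨i, hi, k, hk, hne⟩, hlam⟩ := h
  obtain ⟨f, hf, hf0⟩ := exists_table (r + 1) R lam
  obtain ⟨x, hx, hxne⟩ := k3 ⟨f, ⟨_, (mul_add_lt hi hk).trans_le hRc, by rwa [hf i hi k hk]⟩,
    fun x _ => hf0 x, fun l hl e he => by
      rw [← hlam l hl e, locatorEq, locatorEq]
      refine Finset.sum_congr rfl fun i hi => Finset.sum_congr rfl fun k hk => ?_
      rw [hf i (by simpa using hi) k (by simpa using hk)]⟩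
  have hxu : x < (r + 1) * R := by
    by_contra hcon
    exact hxne (k1 x hx (by omega))
  refine ⟨x / R, Nat.div_lt_of_lt_mul (by rwa [mul_comm]), x % R, Nat.mod_lt _ (by omega), ?_⟩
  rwa [Nat.div_add_mod']

/-- The solution space is the line through the true matrix `M` with homogenizing factor 1; the
hypothesis `hrow` is the uniqueness, `h1` and `h2` say that `M` is a solution. -/
theorem den_solveRows (hσ : LevelState g r R A B W c S σ) (hAB : A * B < c) (hAW : A ≤ W)
    (hBW : B ≤ W) (hBc : B ≤ c) (hrc : r ≤ c) {lam M : ℕ → ℕ → F}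
    (hlam : ∀ i < r + 1, ∀ k < R, σ.fld fLam (i * R + k) = lam i k)
    (hrow : ∀ {z : F} {Z : ℕ → ℕ → F}, (∀ a < A, ∀ e < c, rowEq g r R B lam Z a e = 0) →
      (∀ l < r, ∀ e < c, syndromeEq g A B S z Z l e = 0) →
      ∀ {a b}, a < A → b < B → Z a b = z * M a b)
    (h1 : ∀ a < A, ∀ e < c, rowEq g r R B lam M a e = 0)
    (h2 : ∀ l < r, ∀ e < c, syndromeEq g A B S 1 M l e = 0) :
    (den en solveRows σ).fld fZ 0 ≠ 0 ∧
      (∀ a < A, ∀ b < B, (den en solveRows σ).fld fZ (a + b * A + 1) =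
        (den en solveRows σ).fld fZ 0 * M a b) ∧
      ∀ x < c, A * B < x → (den en solveRows σ).fld fZ x = 0 := by
  simp only [solveRows, den_seq]
  have s₁ := den_same en (startSpan (nv vDAB + 1)) σ
  have h₁ := hσ.of_same s₁
  have hspan := den_startSpan en hσ.square (u := A * B + 1)
    (show NatExpr.eval σ (nv vDAB + 1) = _ by simp [hσ.DAB_eq])
  set σ₁ := den en (startSpan (nv vDAB + 1)) σ
  have h₂ := h₁.of_same (den_same en (equations vW vC rowFill) σ₁)
  have hspan₂ : ∀ w : ℕ → F,
      (fun x : Fin c => w x) ∈ spanOf c (den en (equations vW vC rowFill) σ₁) ↔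
      (∀ x < c, A * B + 1 ≤ x → w x = 0) ∧
        ∀ a < A, ∀ e < c, rowEq g r R B lam (fun a b => w (a + b * A + 1)) a e = 0 := fun w => by
    rw [den_equations en (fill := rowFill) h₁.square (p₁ := vW) (p₂ := vC) (w := w)
      -- The loop over `a` runs up to `W`, the same bound at all levels; for `a ≥ A` the zero
      -- equation is imposed.
      (fun a e => if a < A then rowEq g r R B lam (fun a b => w (a + b * A + 1)) a e else 0)
      (fun a ha e he τ hτ hE hE2 => by
        have h₄ := h₁.of_same hτ
        by_cases hc : a < A
        · rw [if_pos hc]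
          refine den_rowFill en h₄ hAB hBW hBc (lam := lam) ?_ hc hE hE2 w
          rwa [hτ.2 _ (by decide), s₁.2 _ (by decide)]
        · rw [if_neg hc, rowFill, den_seq, den_ite_neg en, den_skip,
            den_zeroRow en h₄.square.2.1 w]
          simpa (disch := decide) [den_nat, hE, h₄.DA_eq] using hc), hspan, h₁.W_eq, h₁.square.2.1]
    refine and_congr_right fun _ => ⟨fun h a ha e he => ?_, fun h a ha e he => ?_⟩
    · simpa [ha] using h a (by omega) e he
    · split_ifs with hc
      exacts [h a hc e he, rfl]
  set σ₂ := den en (equations vW vC rowFill) σ₁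
  have h₃ := h₂.of_same (den_same en (equations vr vC syndromeFill) σ₂)
  obtain ⟨k1, ⟨k2, k3⟩, k4⟩ := pickVector_spec en h₃.square (used := A * B + 1)
    (fun w => (∀ a < A, ∀ e < c, rowEq g r R B lam (fun a b => w (a + b * A + 1)) a e = 0) ∧
      ∀ l < r, ∀ e < c, syndromeEq g A B S (w 0) (fun a b => w (a + b * A + 1)) l e = 0)
    fun w => by
    rw [den_equations en (fill := syndromeFill) h₂.square (p₁ := vr) (p₂ := vC) (w := w)
      (syndromeEq g A B S (w 0) (fun a b => w (a + b * A + 1))) (fun l hl e he τ hτ hE hE2 => by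
        rw [h₂.r_eq] at hl
        exact den_syndromeFill en (h₂.of_same hτ) hAB hBW hl (by omega) hE hE2 w),
      hspan₂, and_assoc, h₂.r_eq, h₂.square.2.1]
  set σ₃ := den en (equations vr vC syndromeFill) σ₂
  have hZ : ∀ a < A, ∀ b < B, (den en pickVector σ₃).fld fZ (a + b * A + 1) =
      (den en pickVector σ₃).fld fZ 0 * M a b := fun a ha b hb => hrow k2 k3 ha hb
  -- If the factor `z` were zero, all entries `z M a b` would be zero, and so would be the chosen
  -- vector. But it is nonzero, since `M` provides a nonzero solution.
  refine ⟨fun h0 => ?_, hZ, k1⟩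
  obtain ⟨f, hf, hf0⟩ := exists_table B A fun b a => M a b
  have hf' : ∀ a < A, ∀ b < B, f (a + b * A) = M a b := fun a ha b hb => by
    rw [add_comm, hf b hb a ha]
  -- The solution given by `M`: the factor 1 at position 0, followed by the entries of `M`.
  obtain ⟨x, hx, hne⟩ := k4 ⟨fun x => Nat.casesOn x 1 f, ⟨0, hσ.square.1, one_ne_zero⟩,
    fun x _ hx' => by
      obtain ⟨y, rfl⟩ := Nat.exists_eq_succ_of_ne_zero (show x ≠ 0 by omega)
      exact hf0 y (by rw [mul_comm]; omega),
    fun a ha e he => by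
      rw [← h1 a ha e he, rowEq, rowEq]
      exact Finset.sum_congr rfl fun b hb => congrArg _ (hf' a ha b (Finset.mem_range.mp hb)),
    fun l hl e he => by
      rw [← h2 l hl e he, syndromeEq, syndromeEq]
      refine congrArg₂ _ rfl (Finset.sum_congr rfl fun b hb => ?_)
      by_cases hc : b ≤ e ∧ e - b < A
      · exact congrArg _ (hf' _ hc.2 b (Finset.mem_range.mp hb))
      · rw [if_neg hc, zero_mul, zero_mul]⟩
  apply hne
  by_cases hx0 : x = 0
  · rw [hx0, h0]
  by_cases hxu : A * B + 1 ≤ x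
  · exact k1 x hx hxu
  have hA : 0 < A := Nat.pos_of_ne_zero fun h => by rw [h, zero_mul] at hxu; omega
  have := hZ ((x - 1) % A) (Nat.mod_lt _ hA) ((x - 1) / A) (Nat.div_lt_of_lt_mul (by omega))
  rwa [h0, zero_mul, Nat.mod_add_div', show x - 1 + 1 = x by omega] at this

theorem den_storeU {A k : ℕ} (hW : σ.nat vW 0 = W) (hk : σ.nat tW (σ.nat vH 0) = k)
    (hA : fZ ≠ A := by decide) :
    (∀ x < W, (den en (storeU A) σ).fld A (k + x) = σ.fld fZ (x + 1) * (σ.fld fZ 0)⁻¹) ∧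
      ∀ y, (∀ x < W, y ≠ k + x) → (den en (storeU A) σ).fld A y = σ.fld A y := by
  have := loop_fillRow en (v := vX) (a := vW) (A := A) (e := .get fZ (nv vX + 1) * (.get fZ 0)⁻¹)
    (fun x => σ.fld fZ (x + 1) * (σ.fld fZ 0)⁻¹) hk (h := fun i _ τ hτ hv _ => by simp [hv, hτ.2, hA])
  rwa [hW] at this

/-- No assumption on the contents is made, because the loop also passes through surplus rows without
meaning; they must not disturb the rows computed before. -/
theorem levelBody_frame {k : ℕ} (hW : σ.nat vW 0 = W) (hk : σ.nat tW (σ.nat vH 0) = k) :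
    ∀ y, (∀ x < W, y ≠ k + x) → (den en levelBody σ).fld fU0 y = σ.fld fU0 y := fun y h => by
  simp only [levelBody, den_seq]
  have s := ((Store.Same.refl (solveLocator ;; copyLam ;; solveRows).wn
    (solveLocator ;; copyLam ;; solveRows).wf σ).trans (den_same en solveLocator σ) |>.trans
    (den_same en copyLam _)).trans (den_same en solveRows _)
  rw [← s.2 fU0 (by decide)]
  exact (den_storeU en (by rw [s.1 _ (by decide), hW])
    (by rw [s.1 tW (by decide), s.1 vH (by decide), hk])).2 y h

/-- Two linear systems in succession: a locator from the `2 r` syndromes, then the matrix from the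
locator and the first `r` syndromes. After division by the factor `z` the entries are those of `∑
P_k ⊗ Q_k`. -/
theorem den_levelBody {k : ℕ} (hσ : LevelState g r R A B W c S σ) (hAB : A * B ≤ W) (hAW : A ≤ W)
    (hBW : B ≤ W) (hWc : 2 * W < c) (hRc : (r + 1) * R ≤ c) (hRW : R + W ≤ c) (hrc : r ≤ c)
    (hR : r * B < R) (hg : g ≠ 0) (hA : Set.InjOn (fun a => g ^ a) (Set.Iio A))
    (hB : Set.InjOn (fun a => g ^ a) (Set.Iio B)) {P Q : Fin r → Polynomial F}
    (hP : ∀ k a, A ≤ a → (P k).coeff a = 0) (hQ : ∀ k b, B ≤ b → (Q k).coeff b = 0)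
    (hS : ∀ l < 2 * r, ∀ e < A, S l e = (∑ k, P k * dilate (g ^ l) (Q k)).coeff e)
    (hS' : ∀ l < 2 * r, ∀ e, A ≤ e → (∑ k, P k * dilate (g ^ l) (Q k)).coeff e = 0)
    (hk : σ.nat tW (σ.nat vH 0) = k) :
    ∀ x < W, (den en levelBody σ).fld fU0 (k + x) =
      if x < A * B then ∑ k, (P k).coeff (x % A) * (Q k).coeff (x / A) else 0 := by
  simp only [levelBody, den_seq]
  obtain ⟨hlam0, hlam⟩ := den_solveLocator en hσ hRc hrc (exists_locator hR hQ hS hS')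
  have s₁ := den_same en solveLocator σ
  set σ₁ := den en solveLocator σ
  have h₁ := hσ.of_same s₁
  have hset := loop_fill en (v := vX) (a := vC) (A := fLam) (e := .get fZ (nv vX)) (σ := σ₁)
    (σ₁.fld fZ) (fun i _ τ hτ hv => by simp [hv, hτ.2])
  have s₂ := den_same en copyLam σ₁
  rw [← copyLam, h₁.square.2.1] at hset
  set σ₂ := den en copyLam σ₁
  obtain ⟨z1, z2, z3⟩ := den_solveRows en (M := fun a b => ∑ k, (P k).coeff a * (Q k).coeff b)
    (h₁.of_same s₂) (by omega) hAW hBW (by omega) hrc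
    (fun i hi k hk => hset _ ((mul_add_lt hi hk).trans_le hRc))
    (fun {z Z} hrow hsyn {a b} ha hb => eq_mul_of_equations (T := c) (by omega) (by omega) hg hA
      hB (by omega) hP hQ hS hS' hlam0 hlam hrow hsyn ha hb)
    (fun a _ e _ => rowEq_eq_zero (T := c) (by omega) hg hA hP hQ hS hS' hlam a e)
    (fun l hl e _ => syndromeEq_eq_zero hP hQ hS hS' (by omega) e)
  have s₃ := ((Store.Same.refl levelBody.wn levelBody.wf σ).trans s₁ |>.trans s₂).trans
    (den_same en solveRows σ₂)
  set σ₃ := den en solveRows σ₂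
  intro x hx
  rw [(den_storeU en (by rw [s₃.1 _ (by decide), hσ.W_eq])
    (by rw [s₃.1 tW (by decide), s₃.1 vH (by decide), hk])).1 x hx]
  split_ifs with hc
  · have hA0 : 0 < A := Nat.pos_of_ne_zero fun h => by rw [h, zero_mul] at hc; omega
    have h5 := z2 (x % A) (Nat.mod_lt _ hA0) (x / A) (Nat.div_lt_of_lt_mul hc)
    rw [Nat.mod_add_div'] at h5
    rw [h5]
    field_simp
  · rw [z3 (x + 1) (by omega) (by omega), zero_mul]

/-- The element is nonzero, and its first powers are different from one. -/
def Good (N₀ : ℕ) (g : F) : Prop := g ≠ 0 ∧ ∀ k < N₀, 0 < k → g ^ k ≠ 1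

theorem Good.injOn {N₀ A : ℕ} {g : F} (hg : Good N₀ g) (hA : A ≤ N₀) :
    Set.InjOn (fun a => g ^ a) (Set.Iio A) := by
  have key : ∀ a b : ℕ, a < b → b < N₀ → g ^ a ≠ g ^ b := fun a b hab hb h => by
    have h1 : g ^ b = g ^ a * g ^ (b - a) := by rw [← pow_add]; congr 1; omega
    rw [h1] at h
    exact hg.2 (b - a) (by omega) (by omega)
      (mul_left_cancel₀ (pow_ne_zero a hg.1) (by rw [mul_one]; exact h.symm))
  intro a ha b hb hab
  simp only [Set.mem_Iio] at ha hb
  rcases lt_trichotomy a b with h | h | h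
  · exact absurd hab (key a b h (by omega))
  · exact h
  · exact absurd hab.symm (key b a h (by omega))

-- One level upwards: `exists_factors` supplies the low-rank matrix behind a polynomial and its
-- children, `den_levelBody` recovers it, and its entries are the coefficients of the polynomial.
-- The counter `vS` increases while the level `s` decreases.
open Polynomial in
theorem den_levelStep {n d r s : ℕ} (hn : 1 ≤ n) (hd : 1 ≤ d) (hr : 1 ≤ r) {g : F}
    (hg : Good ((d * n) ^ halves d 1) g) {σ : Store F} (hP : Params n d r σ)
    (hS : σ.nat vS 0 = Nat.clog 2 d - 1 - s) (hs : s < Nat.clog 2 d)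
    (hGL : ∀ x ≤ (r + 1) * (r * (d * n) ^ d + 1) + 1, σ.fld fGL x = g ^ x)
    (v : Fin r → Fin d → Fin n → F)
    (hU : ∀ h < (2 * r) ^ (s + 1), ∀ x < (d * n) ^ d, σ.fld fU (h * (d * n) ^ d + x) =
      (levelPoly g r (s + 1) h (∑ k, Tensor.pure (v k))).coeff x) :
    ∀ h < (2 * r) ^ s, ∀ x < (d * n) ^ d, (den en levelStep σ).fld fU (h * (d * n) ^ d + x) =
      (levelPoly g r s h (∑ k, Tensor.pure (v k))).coeff x := by
  have hN : 0 < d * n := Nat.mul_pos hd hn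
  have hdd : d * n = 1 ∨ 1 < d * n := by omega
  have hKd : Nat.clog 2 d ≤ d := clog_two_le
  set W := (d * n) ^ d with hW
  -- As `B ≤ W` at every level, this one value satisfies `r B < R` throughout; `c` leaves room both
  -- for the `(r + 1) R` coefficients of a locator and for the degrees of all equations.
  set R := r * W + 1 with hR
  set c := (r + 1) * R + 1 with hc
  set A := (d * n) ^ halves d (s + 1) with hA
  set B := (d * n) ^ (halves d s - halves d (s + 1)) with hB
  have hABs : A * B = (d * n) ^ halves d s := by
    rw [hA, hB, ← pow_add]
    congr 1
    have := halves_succ_le_self hd s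
    omega
  have hAW : A ≤ W := Nat.pow_le_pow_right hN (halves_le hd _)
  have hBW : B ≤ W := Nat.pow_le_pow_right hN ((Nat.sub_le _ _).trans (halves_le hd _))
  have hABW : A * B ≤ W := by rw [hABs]; exact Nat.pow_le_pow_right hN (halves_le hd _)
  -- Both sides of the matrix are bounded by the size at the first halving. This is the only
  -- requirement on the powers of `g`, and the reason for the exponent `halves d 1`.
  have hAN : A ≤ (d * n) ^ halves d 1 := Nat.pow_le_pow_right hN (halves_succ_le d s)
  have hBN : B ≤ (d * n) ^ halves d 1 :=
    Nat.pow_le_pow_right hN ((halves_sub_le d s).trans (halves_succ_le d s))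
  have hWR : W < R := by
    have := Nat.le_mul_of_pos_left W hr
    omega
  have hRR : 2 * R ≤ (r + 1) * R := Nat.mul_le_mul_right _ (by omega)
  have hrR : r + 1 ≤ (r + 1) * R := Nat.le_mul_of_pos_right _ (by omega)
  have hrB : r * B < R := by
    have := Nat.mul_le_mul_left r hBW
    omega
  have tD1 := hP.tD_eq s (by omega)
  have tD2 := hP.tD_eq (s + 1) (by omega)
  have tN1 := hP.tNP_eq (halves d s) (halves_le hd _)
  have tN2 := hP.tNP_eq (halves d (s + 1)) (halves_le hd _)
  have tN3 := hP.tNP_eq (halves d s - halves d (s + 1)) ((Nat.sub_le _ _).trans (halves_le hd _))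
  have hL2 : Nat.clog 2 d - 1 - (Nat.clog 2 d - 1 - s) = s := by omega
  have s₂ := den_same en levelSizes σ
  have hP₂ := hP.of_same s₂ (by decide)
  have hDA : (den en levelSizes σ).nat vDA 0 = A := by
    simp (disch := decide) [levelSizes, den_nat, hP.K_eq, hS, hL2, tD2, tN2, hA]
  have hDB : (den en levelSizes σ).nat vDB 0 = B := by
    simp (disch := decide) [levelSizes, den_nat, hP.K_eq, hS, hL2, tD1, tD2, tN3, hB]
  have hDAB : (den en levelSizes σ).nat vDAB 0 = A * B := by
    simp (disch := decide) [levelSizes, den_nat, hP.K_eq, hS, hL2, tD1, tN1, hABs]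
  have htA : ∀ i ≤ W, (den en levelSizes σ).nat tA i = i * A := fun i hi => by
    simp (disch := first | decide | simp [hP.W_eq] <;> exact hi | fail)
      [levelSizes, den_multiples, hP.K_eq, hS, hL2, tD2, tN2, hA]
  simp only [levelStep, den_seq]
  set σ₂ := den en levelSizes σ
  have hpow : (2 * r) ^ (s + 1) ≤ (2 * r) ^ Nat.clog 2 d := Nat.pow_le_pow_right (by omega) hs
  have hpow' : (2 * r) ^ s * (2 * r) = (2 * r) ^ (s + 1) := (pow_succ _ _).symm
  have hpows : (2 * r) ^ s ≤ (2 * r) ^ (s + 1) := Nat.pow_le_pow_right (by omega) (by omega)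
  have hdeg : ∀ s h, ∀ x, (d * n) ^ halves d s ≤ x →
      (levelPoly g r s h (∑ k, Tensor.pure (v k))).coeff x = 0 := fun s h x hx =>
    coeff_eq_zero_of_natDegree_lt ((natDegree_levelPoly_lt hn hd g r s h v).trans_le hx)
  have key := loop_rows en (v := vH) (b := vRK) (A := fU0) (c := W) (p := levelBody) (σ := σ₂)
    (fun h x y => h < (2 * r) ^ s → y = (levelPoly g r s h (∑ k, Tensor.pure (v k))).coeff x)
    (fun k hk τ hτ hv _ => by
      rw [hP₂.RK_eq] at hk
      have hPτ := hP₂.of_same hτ (by decide)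
      have hkW : τ.nat tW (τ.nat vH 0) = k * W := by rw [hv, hPτ.tW_eq k hk.le]
      refine ⟨fun x hx hks => ?_, levelBody_frame en hPτ.W_eq hkW⟩
      obtain ⟨P, Q, hPc, hQc, hPQ, hcoeff⟩ := exists_factors hn hd g s k v
      have hL : LevelState g r R A B W c (fun m x =>
          (levelPoly g r (s + 1) (k * (2 * r) + m) (∑ k, Tensor.pure (v k))).coeff x) τ :=
        { square := hPτ.square
          r_eq := hPτ.r_eq
          R1_eq := hPτ.R1_eq
          R_eq := hPτ.R_eq
          W_eq := hPτ.W_eq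
          DA_eq := by rw [hτ.1 _ (by decide), hDA]
          DB_eq := by rw [hτ.1 _ (by decide), hDB]
          DAB_eq := by rw [hτ.1 _ (by decide), hDAB]
          GL_eq := by rwa [hτ.2 _ (by decide), s₂.2 _ (by decide)]
          tR_eq := fun i hi => hPτ.tR_eq i (hi.trans (hrR.trans (Nat.le_succ _)))
          tA_eq := by rwa [hτ.1 _ (by decide)]
          S_eq := fun m hm x hx => by
            have := (mul_add_lt hks hm).trans_eq hpow'
            rw [hv, hPτ.tR2_eq k hk.le, hPτ.tW_eq _ (by omega), hτ.2 _ (by decide),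
              s₂.2 _ (by decide)]
            exact hU _ this x (hx.trans_le hAW) }
      rw [den_levelBody en hL hABW hAW hBW (by omega) (by omega) (by omega) (by omega)
        hrB hg.1 (hg.injOn hAN) (hg.injOn hBN) hPc hQc
        (fun l hl e _ => by simp only [hPQ l hl])
        (fun l hl e he => by rw [← hPQ l hl]; exact hdeg _ _ _ he) hkW x hx]
      split_ifs with hxc
      · rw [← hcoeff _ (Nat.mod_lt x (pow_pos hN _)), Nat.mod_add_div]
      · rw [hdeg s k x (by rw [← hABs]; omega)])
  rw [hP₂.RK_eq] at key
  have hP₃ := hP₂.of_same (den_same en (loop vH vRK levelBody) σ₂) (by decide)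
  set σ₃ := den en (loop vH vRK levelBody) σ₂
  have hset := loop_fill en (v := vX) (a := vTot) (A := fU) (e := .get fU0 (nv vX)) (σ := σ₃)
    (σ₃.fld fU0) (fun i _ τ hτ hv => by simp [hv, hτ.2])
  rw [hP₃.Tot_eq] at hset
  intro h hh x hx
  rw [← key h (by omega) x hx hh]
  exact hset _ (mul_add_lt (by omega) hx)

end LoopProg

/-! ## The decoder -/

/-- The index of the digits `p / n ^ j % n` in base `N`. -/
def digitSum (n N e p : ℕ) : ℕ := ∑ j ∈ Finset.range e, p / n ^ j % n * N ^ j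

theorem digitSum_succ (n N e p : ℕ) :
    digitSum n N (e + 1) p = p % n + N * digitSum n N e (p / n) := by
  rw [digitSum, Finset.sum_range_succ', digitSum, Finset.mul_sum, add_comm]
  congr 1
  · simp
  · refine Finset.sum_congr rfl fun j _ => ?_
    rw [pow_succ', pow_succ', ← Nat.div_div_eq_div_mul]
    ring

theorem digitSum_lt {n N : ℕ} (hn : 0 < n) (hnN : n ≤ N) (e p : ℕ) : digitSum n N e p < N ^ e := by
  induction e generalizing p with
  | zero => simp [digitSum]
  | succ e ih =>
    rw [digitSum_succ, pow_succ']
    have h1 := Nat.mod_lt p hn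
    have h2 := Nat.mul_le_mul_left N (ih (p / n))
    rw [Nat.mul_succ] at h2
    omega

/-- For `p < n ^ d` the quotient `p / n` has top digit zero, so the number of digits need not shrink
in the recursion. This allows the table to be filled from its own earlier entries. -/
theorem digitSum_eq {n N d p : ℕ} (hp : p < n ^ d) :
    digitSum n N d p = p % n + N * digitSum n N d (p / n) := by
  rw [← digitSum_succ, digitSum, digitSum, Finset.sum_range_succ, Nat.div_eq_of_lt hp, Nat.zero_mod,
    zero_mul, add_zero]

namespace Tensor

variable {n d : ℕ}

theorem pos_lt (i : Fin d → Fin n) : pos i < n ^ d := (finFunctionFinEquiv i).2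

theorem pos_div_mod (i : Fin d → Fin n) (j : Fin d) : pos i / n ^ (j : ℕ) % n = i j := by
  have := finFunctionFinEquiv_symm_apply_val (finFunctionFinEquiv i) j
  rw [Equiv.symm_apply_apply] at this
  exact this.symm

theorem digitSum_pos (N : ℕ) (i : Fin d → Fin n) :
    digitSum n N d (pos i) = ∑ j, (i j : ℕ) * N ^ (j : ℕ) := by
  rw [digitSum, Finset.sum_range]
  simp_rw [pos_div_mod]

theorem sum_pos {M : Type*} [AddCommMonoid M] (f : ℕ → M) :
    ∑ p ∈ Finset.range (n ^ d), f p = ∑ i : Fin d → Fin n, f (pos i) := by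
  rw [Finset.sum_range]
  exact (Fintype.sum_equiv finFunctionFinEquiv _ _ fun i => rfl).symm

/-- The factors of a parity check. -/
def checkFactor {F : Type u} [Field F] (g : F) (n d r a : ℕ) (j : Fin d) (i : Fin n) : F :=
  (scaling g (d * n) d r (Nat.clog 2 d) (a / (d * n)) j * g ^ (a % (d * n))) ^ (i : ℕ)

end Tensor

/-! ### The last level: interpolation from the syndromes -/

namespace LoopProg

/-- The powers of the element `fG`. -/
def powerTable : LoopProg :=
  setF fGL 0 1 ;; loop vX vC (setF fGL (nv vX + 1) (.get fGL (nv vX) * fv fG))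

/-- One summand of the value of a polynomial of the last level. -/
def baseEntry : LoopProg := addToRow (nv vB + 1) (fv fT1) ;; nextPower

/-- The equations for the interpolation of a polynomial of the last level. -/
def baseFill : LoopProg :=
  zeroRow ;; (addToRow 0 (0 - .get fSy (nv vE)) ;; letF fT1 1) ;; loop vB vN baseEntry

/-- One syndrome. -/
def baseSyndrome : LoopProg :=
  letF fT1 0 ;;
  loop vP vnd (letF fT1 (fv fT1 + .get fOut (.get tnd (nv vT1) + nv vP) * .get fIn (nv vP))) ;;
  setF fSy (nv vKk) (fv fT1) ;; letN vT1 (nv vT1 + 1)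

/-- Solve for the coefficients of a polynomial of the last level. -/
def solveBase : LoopProg := startSpan (nv vN + 1) ;; equations vN vU2 baseFill ;; pickVector

/-- One polynomial of the last level. -/
def baseBody : LoopProg := loop vKk vN baseSyndrome ;; solveBase ;; storeU fU

/-- The polynomials of the last level. -/
def baseStep : LoopProg := letN vT1 0 ;; loop vH vRK baseBody

/-- The places of the entries of the tensor among the coefficients. -/
def places : LoopProg :=
  multiples tOt vX vW vN ;; setN vIdx 0 0 ;;
  loop vP vnd (setN vIdx (nv vP) (.get tRm (nv vP) + .get tOt (.get vIdx (.get tQu (nv vP)))))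

/-- Subtract the error. -/
def subtractError : LoopProg :=
  loop vP vnd (setF fOut (nv vP) (.get fIn (nv vP) - .get fU (.get vIdx (nv vP))))

/-- The parity checks. -/
def checks : LoopProg := scalings ;; factors ;; letN vMc (nv vMchk) ;; products

/-- The decoder, given a suitable element `fG`. -/
def decoder : LoopProg :=
  checks ;; letN vU2 1 ;; powerTable ;; baseStep ;; loop vS vK levelStep ;; places ;; subtractError

variable {F : Type u} [Field F] (en : Enumeration F)

theorem den_powerTable {σ : Store F} {x : ℕ} (hx : x ≤ σ.nat vC 0) :
    (den en powerTable σ).fld fGL x = σ.fld fG 0 ^ x :=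
  den_loop en (v := vX) (a := vC) (σ := den en (setF fGL 0 1) σ)
    (fun k τ => ∀ x ≤ k, τ.fld fGL x = σ.fld fG 0 ^ x) (by simp)
    (fun k hk τ hτ hv hI x hx => by
      have hG : τ.fld fG 0 = σ.fld fG 0 := by rw [hτ.2 _ (by decide)]; simp
      by_cases hxk : x = k + 1
      · simp [hxk, hv, hI k le_rfl, hG, pow_succ]
      · simp [hv, hxk, hI x (by omega)]) x hx

theorem den_baseFill {c N k : ℕ} {σ : Store F} (hc : Square c σ) (hN : σ.nat vN 0 = N)
    (hNc : N < c) (hvE : σ.nat vE 0 = k) (w : ℕ → F) :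
    rowDot c w (den en baseFill σ) =
      -σ.fld fSy k * w 0 + ∑ b ∈ Finset.range N, σ.fld fGL k ^ b * w (b + 1) := by
  have s := (Store.Same.refl baseFill.wn baseFill.wf σ).trans (den_same en zeroRow σ)
  have h0 := rowDot_add hc.1 w (den en zeroRow σ) (0 - σ.fld fSy k)
  rw [den_zeroRow en hc.2.1, zero_add, zero_sub] at h0
  have t := s.trans (den_same en (addToRow 0 (0 - .get fSy (nv vE)) ;; letF fT1 1) _)
  rw [baseFill, den_seq, den_seq]
  have key := loop_rowDot en (v := vB) (b := vN) (p := baseEntry) (c := c) (w := w)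
    (σ := den en (addToRow 0 (0 - .get fSy (nv vE)) ;; letF fT1 1) (den en zeroRow σ))
    (fun b => σ.fld fGL k ^ b * w (b + 1)) (fun b τ => τ.fld fT1 0 = σ.fld fGL k ^ b) (by simp)
    (fun b hb τ hτ hv hT => by
      have u := t.trans hτ
      rw [t.1 _ (by decide), hN] at hb
      refine ⟨(rowDot_of_eq (den_fld en (p := nextPower) (by decide) _)).trans
        ((rowDot_add (by simp [hv]; omega) w τ _).trans (by simp [hv, hT])), by
        simp (disch := decide) [nextPower, baseEntry, den_fld, den_nat, u.1, u.2, hvE, hT,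
          pow_succ]⟩)
  rw [t.1 _ (by decide), hN] at key
  rw [key, ← h0]
  refine congrArg (· + _) (rowDot_of_eq ?_)
  funext j
  simp (disch := decide) [addToRow, s.1, s.2, hvE]

-- Interpolation at the points `g^k`, written as a homogeneous system with a factor for the
-- prescribed values, so that the solver for null spaces can be reused. The second counter of
-- `equations` is idle here: its bound `vU2` is 1.
open Polynomial in
theorem den_solveBase {c N : ℕ} {g : F} {σ : Store F} (hc : Square c σ) (hN : σ.nat vN 0 = N)
    (hU2 : σ.nat vU2 0 = 1) (hNc : N < c) (hGL : ∀ x ≤ c, σ.fld fGL x = g ^ x)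
    (hinj : Set.InjOn (fun a => g ^ a) (Set.Iio N)) {f : F[X]} (hf : ∀ b, N ≤ b → f.coeff b = 0)
    (hSy : ∀ k < N, σ.fld fSy k = f.eval (g ^ k)) (x : ℕ) (hx : x + 1 < c) :
    (den en solveBase σ).fld fZ (x + 1) * ((den en solveBase σ).fld fZ 0)⁻¹ = f.coeff x := by
  rw [solveBase, den_seq, den_seq]
  have s := den_same en (startSpan (nv vN + 1)) σ
  have h₁ := hc.of_same s (by decide) (by decide)
  have hspan := den_startSpan en hc (u := N + 1)
    (show NatExpr.eval σ (nv vN + 1) = _ by simp [hN])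
  set σ₁ := den en (startSpan (nv vN + 1)) σ
  set P : (ℕ → F) → Prop := fun w => ∀ k < N,
    -f.eval (g ^ k) * w 0 + ∑ b ∈ Finset.range N, (g ^ k) ^ b * w (b + 1) = 0 with hP
  obtain ⟨k1, k2, k3⟩ := pickVector_spec en (used := N + 1) (h₁.of_same
    (den_same en (equations vN vU2 baseFill) σ₁) (by decide) (by decide)) P fun w => by
    rw [den_equations en (fill := baseFill) h₁ (p₁ := vN) (p₂ := vU2) (w := w)
      (fun k e => -f.eval (g ^ k) * w 0 + ∑ b ∈ Finset.range N, (g ^ k) ^ b * w (b + 1))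
      (fun k hk e he τ hτ hvE hvE2 => by
        have t := (Store.Same.refl solveBase.wn solveBase.wf σ).trans s |>.trans hτ
        rw [s.1 _ (by decide), hN] at hk
        rw [den_baseFill en (h₁.of_same hτ (by decide) (by decide))
          (by rw [t.1 _ (by decide), hN]) hNc hvE, t.2 fSy (by decide), t.2 fGL (by decide),
          hGL k (by omega), hSy k hk]),
      hspan, s.1 _ (by decide), s.1 _ (by decide), hN, hU2]
    simp [hP]
  have hdeg : f.natDegree < N ∨ f = 0 := by
    by_contra! h
    exact h.2 (leadingCoeff_eq_zero.mp (hf _ h.1))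
  have hsum : ∀ y, ∑ b ∈ Finset.range N, y ^ b * f.coeff b = f.eval y := fun y => by
    rcases hdeg with h | h
    · rw [eval_eq_sum_range' h]
      exact Finset.sum_congr rfl fun _ _ => mul_comm _ _
    · simp [h]
  -- The difference from the multiple of `f` is a polynomial of degree less than `N` with the `N`
  -- distinct zeros `g^k`.
  have huniq : ∀ w, P w → ∀ b < N, w (b + 1) = w 0 * f.coeff b := fun w hw b hb => by
    have hp : polyOf N (fun b => w (b + 1) - w 0 * f.coeff b) = 0 := by
      refine eq_zero_of_natDegree_lt_card_of_eval_eq_zero _ (ι := Fin N)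
        (f := fun k => g ^ (k : ℕ)) (fun i j hij => Fin.ext (hinj i.2 j.2 hij)) (fun k => ?_) ?_
      · rw [← hw k k.2, ← hsum, polyOf]
        simp only [eval_finsetSum, eval_mul, eval_C, eval_pow, eval_X, neg_mul, Finset.sum_mul,
          ← Finset.sum_neg_distrib, ← Finset.sum_add_distrib]
        exact Finset.sum_congr rfl fun _ _ => by ring
      · rw [Fintype.card_fin, Nat.lt_iff_le_pred (by omega), natDegree_le_iff_coeff_eq_zero]
        intro b hb
        rw [coeff_polyOf, if_neg (by omega)]
    have := congrArg (fun p => p.coeff b) hp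
    simp only [coeff_polyOf, if_pos hb, coeff_zero] at this
    exact sub_eq_zero.mp this
  have hZ := huniq _ k2
  set σ₂ := den en pickVector (den en (equations vN vU2 baseFill) σ₁)
  -- A zero factor would force the chosen vector to be zero, although the coefficients of `f` with
  -- factor 1 are a nonzero solution.
  have hZ0 : σ₂.fld fZ 0 ≠ 0 := fun h0 => by
    obtain ⟨y, hy, hne⟩ := k3 ⟨fun x => Nat.casesOn x 1 f.coeff, ⟨0, hc.1, one_ne_zero⟩,
      fun x _ hx' => by
        obtain ⟨y, rfl⟩ := Nat.exists_eq_succ_of_ne_zero (show x ≠ 0 by omega)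
        exact hf y (by omega),
      fun k hk => by simp [hsum]⟩
    apply hne
    obtain _ | y := y
    · exact h0
    by_cases hyN : N ≤ y
    · exact k1 _ hy (by omega)
    · rw [hZ y (by omega), h0, zero_mul]
  by_cases hxN : x < N
  · rw [hZ x hxN]
    field_simp
  · rw [k1 (x + 1) hx (by omega), zero_mul, hf x (by omega)]

theorem den_baseSyndromes {n d r h : ℕ} {σ : Store F} (hP : Params n d r σ)
    (hh : h < (2 * r) ^ Nat.clog 2 d) (hT : σ.nat vT1 0 = h * (d * n)) :
    (∀ k < d * n, (den en (loop vKk vN baseSyndrome) σ).fld fSy k = ∑ p ∈ Finset.range (n ^ d),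
      σ.fld fOut ((h * (d * n) + k) * n ^ d + p) * σ.fld fIn p) ∧
    (den en (loop vKk vN baseSyndrome) σ).nat vT1 0 = (h + 1) * (d * n) := by
  have key := den_loop en (v := vKk) (a := vN) (p := baseSyndrome) (σ := σ)
    (fun k τ => (∀ k' < k, τ.fld fSy k' = ∑ p ∈ Finset.range (n ^ d),
      σ.fld fOut ((h * (d * n) + k') * n ^ d + p) * σ.fld fIn p) ∧
      τ.nat vT1 0 = h * (d * n) + k) (by simp [hT])
    (fun k hk τ hτ hv hI => by
      rw [hP.N_eq] at hk
      have hPτ := hP.of_same hτ (by decide)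
      have hle := (mul_add_lt hh hk).le
      have hsum := loop_sum en (v := vP) (a := vnd) (acc := fT1)
        (e := .get fOut (.get tnd (nv vT1) + nv vP) * .get fIn (nv vP)) (σ := den en (letF fT1 0) τ)
        (fun p => σ.fld fOut ((h * (d * n) + k) * n ^ d + p) * σ.fld fIn p)
        (fun i hi υ hυ hvi => by
          simp (disch := decide) [hυ.1, hυ.2, hvi, hI.2, hPτ.tnd_eq _ hle, hτ.2])
      rw [den_nat en (by decide), hPτ.nd_eq] at hsum
      simp at hsum
      rw [Nat.forall_lt_succ_right]
      refine ⟨⟨fun k' hk' => ?_, ?_⟩, ?_⟩ <;>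
      simp (disch := decide) [baseSyndrome, den_nat, den_fld, hv, hI.2, hsum, add_assoc]
      rw [if_neg (by omega), hI.1 k' hk'])
  rw [hP.N_eq, ← add_one_mul] at key
  exact key

open Polynomial in
theorem den_baseStep {n d r : ℕ} {g : F} (hn : 1 ≤ n) (hd : 2 ≤ d) (hr : 1 ≤ r)
    (hg : Good ((d * n) ^ halves d 1) g) {σ : Store F} (hP : Params n d r σ)
    (hU2 : σ.nat vU2 0 = 1)
    (hGL : ∀ x ≤ (r + 1) * (r * (d * n) ^ d + 1) + 1, σ.fld fGL x = g ^ x) {f : ℕ → F[X]}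
    (hf : ∀ h b, d * n ≤ b → (f h).coeff b = 0)
    (hSy : ∀ h < (2 * r) ^ Nat.clog 2 d, ∀ k < d * n, ∑ p ∈ Finset.range (n ^ d),
      σ.fld fOut ((h * (d * n) + k) * n ^ d + p) * σ.fld fIn p = (f h).eval (g ^ k)) :
    ∀ h < (2 * r) ^ Nat.clog 2 d, ∀ x < (d * n) ^ d,
      (den en baseStep σ).fld fU (h * (d * n) ^ d + x) = (f h).coeff x := by
  have hNW : d * n ≤ (d * n) ^ d := Nat.le_self_pow (by omega) _
  have hWc : (d * n) ^ d + 1 < (r + 1) * (r * (d * n) ^ d + 1) + 1 := by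
    have h1 := Nat.le_mul_of_pos_left ((d * n) ^ d) hr
    have h2 : 2 * (r * (d * n) ^ d + 1) ≤ (r + 1) * (r * (d * n) ^ d + 1) :=
      Nat.mul_le_mul_right _ (by omega)
    omega
  have s := (Store.Same.refl baseStep.wn baseStep.wf σ).trans (den_same en (letN vT1 0) σ)
  have hP₀ := hP.of_same s (by decide)
  have key := den_loop en (v := vH) (a := vRK) (p := baseBody) (σ := den en (letN vT1 0) σ)
    (fun k τ => (∀ h < k, ∀ x < (d * n) ^ d,
      τ.fld fU (h * (d * n) ^ d + x) = (f h).coeff x) ∧ τ.nat vT1 0 = k * (d * n))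
    (by simp)
    (fun k hk τ hτ hv hI => by
      rw [hP₀.RK_eq] at hk
      have t := s.trans hτ
      have hPτ := hP.of_same t (by decide)
      obtain ⟨h1, h2⟩ := den_baseSyndromes en hPτ hk hI.2
      simp only [baseBody, den_seq]
      have s₁ := den_same en (loop vKk vN baseSyndrome) τ
      have t₁ := t.trans s₁
      set τ₁ := den en (loop vKk vN baseSyndrome) τ
      have hP₁ := hPτ.of_same s₁ (by decide)
      have h3 := den_solveBase en (g := g) (f := f k) hP₁.square hP₁.N_eq
        (by rw [t₁.1 _ (by decide), hU2]) (by omega) (by rwa [t₁.2 _ (by decide)])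
        (hg.injOn (Nat.le_self_pow (by have := halves_pos (show 1 ≤ d by omega) 1; omega) _))
        (hf k) (fun i hi => by
          rw [h1 i hi, t.2 fOut (by decide), t.2 fIn (by decide), hSy k hk i hi])
      have s₂ := den_same en solveBase τ₁
      set τ₂ := den en solveBase τ₁
      have hP₂ := hP₁.of_same s₂ (by decide)
      have hset := den_storeU en (A := fU) hP₂.W_eq (show τ₂.nat tW (τ₂.nat vH 0) = _ by
        rw [s₂.1 vH (by decide), s₁.1 vH (by decide), hv, hP₂.tW_eq k hk.le])
      rw [Nat.forall_lt_succ_right]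
      refine ⟨⟨fun h hh x hx => ?_, fun x hx => ?_⟩, ?_⟩
      · rw [Store.fld_setNat, hset.2 _ fun x' hx' h4 => hh.ne (add_mul_inj hx hx' h4).1,
          s₂.2 _ (by decide), s₁.2 _ (by decide), hI.1 h hh x hx]
      · rw [Store.fld_setNat, hset.1 x hx, h3 x (by omega)]
      · rw [Store.nat_setNat, if_neg (by simp), den_nat en (by decide), s₂.1 _ (by decide), h2])
  rw [hP₀.RK_eq] at key
  exact key.1

/-- Position `p` in base `n` and the exponent of its monomial in base `d n` have the same digits.
The exponents follow the recursion `p % n + (d n) · (exponent of p / n)`. -/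
theorem den_places {n d r : ℕ} (hn : 1 ≤ n) (hd : 1 ≤ d) {σ : Store F} (hP : Params n d r σ)
    {p : ℕ} (hp : p < n ^ d) :
    (den en places σ).nat vIdx p = digitSum n (d * n) d p := by
  simp only [places, den_seq]
  have hm : ∀ i ≤ (d * n) ^ d, (den en (multiples tOt vX vW vN) σ).nat tOt i = i * (d * n) :=
    fun i hi => by
    rw [den_multiples en (by decide) (by decide) (by decide) (by decide) _ (by rwa [hP.W_eq]),
      hP.N_eq]
  have s := (Store.Same.refl places.wn places.wf σ).trans (den_same en (multiples tOt vX vW vN) σ)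
  set σ₁ := den en (multiples tOt vX vW vN) σ
  have t := s.trans (den_same en (setN vIdx 0 0) σ₁)
  have h00 : digitSum n (d * n) d 0 = 0 := by simp [digitSum]
  have key := den_loop en (v := vP) (a := vnd)
    (p := setN vIdx (nv vP) (.get tRm (nv vP) + .get tOt (.get vIdx (.get tQu (nv vP)))))
    (σ := den en (setN vIdx 0 0) σ₁) (fun k τ => τ.nat vIdx 0 = 0 ∧
      ∀ p < k, τ.nat vIdx p = digitSum n (d * n) d p) (by simp)
    (fun k hk τ hτ hv hI => by
      rw [t.1 _ (by decide), hP.nd_eq] at hk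
      have hPτ := hP.of_same (t.trans hτ) (by decide)
      -- The entry for `k / n` is already in the table, since `k / n < k` except for `k = 0`, where
      -- the initial zero serves, and for `n = 1`, where `k = 0` is the only position.
      have hidx : τ.nat vIdx (k / n) = digitSum n (d * n) d (k / n) := by
        rcases Nat.eq_zero_or_pos k with rfl | hk0
        · rw [Nat.zero_div, hI.1, h00]
        · by_cases hn1 : n = 1
          · rw [hn1, one_pow] at hk
            omega
          · exact hI.2 _ (Nat.div_lt_self hk0 (by omega))
      have hval : k % n + digitSum n (d * n) d (k / n) * (d * n) = digitSum n (d * n) d k := by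
        rw [digitSum_eq hk, mul_comm (d * n)]
      have hle := (digitSum_lt hn (Nat.le_mul_of_pos_left n hd) d (k / n)).le
      have hnew : (den en (setN vIdx (nv vP)
          (.get tRm (nv vP) + .get tOt (.get vIdx (.get tQu (nv vP))))) τ).nat vIdx k =
          digitSum n (d * n) d k := by
        have hmτ : τ.nat tOt = σ₁.nat tOt := by
          rw [hτ.1 _ (by decide), den_nat en (by decide)]
        simp [hv, hPτ.tRm_eq k hk.le, hPτ.tQu_eq k hk.le, hidx, hmτ, hm _ hle, hval]
      have hold : ∀ p, p ≠ k → (den en (setN vIdx (nv vP)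
          (.get tRm (nv vP) + .get tOt (.get vIdx (.get tQu (nv vP))))) τ).nat vIdx p =
          τ.nat vIdx p := fun p hp => by simp [hv, hp]
      rw [Nat.forall_lt_succ_right]
      refine ⟨?_, fun p hp => (hold p hp.ne).trans (hI.2 p hp), hnew⟩
      by_cases hk0 : k = 0
      · subst hk0
        exact hnew.trans h00
      · exact (hold 0 (Ne.symm hk0)).trans hI.1)
  rw [t.1 _ (by decide), hP.nd_eq] at key
  exact key.2 p hp

theorem den_checks_factor {n d r : ℕ} (hr : 1 ≤ r) {σ : Store F} (hP : Params n d r σ)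
    {a : ℕ} (ha : a < (2 * r) ^ Nat.clog 2 d * (d * n)) (j : Fin d) (i : Fin n) :
    (den en checks σ).fld fVec ((a * d + j) * n + i) =
      Tensor.checkFactor (σ.fld fG 0) n d r a j i := by
  simp only [checks, den_seq]
  have h1 := den_scalings en i.pos hr hP
  have s₁ := den_same en scalings σ
  rw [← s₁.2 fG (by decide)] at h1 ⊢
  rw [den_fld en (by decide), den_fld en (by decide), Tensor.checkFactor]
  have h3 := den_factors en (hP.of_same s₁ (by decide)) h1
    (Nat.div_lt_of_lt_mul (by rwa [mul_comm])) (Nat.mod_lt a (Nat.mul_pos j.pos i.pos)) j.2 i.2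
  rwa [Nat.div_add_mod'] at h3

theorem den_checks {n d r : ℕ} (hr : 1 ≤ r) {σ : Store F} (hP : Params n d r σ)
    {a : ℕ} (ha : a < (2 * r) ^ Nat.clog 2 d * (d * n)) (i : Fin d → Fin n) :
    (den en checks σ).fld fOut (a * n ^ d + Tensor.pos i) =
      Tensor.pure (Tensor.checkFactor (σ.fld fG 0) n d r a) i := by
  have h1 := fun j i => den_checks_factor en hr hP ha j i
  simp only [checks, den_seq] at h1 ⊢
  have s := den_same en (scalings ;; factors ;; letN vMc (nv vMchk)) σ
  simp only [den_seq] at s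
  have hP₁ := hP.of_same s (by decide)
  rw [den_products en hP₁ (by simpa using hP₁.Mchk_eq) ha (Tensor.pos_lt i), Tensor.pure,
    Finset.prod_range]
  refine Finset.prod_congr rfl fun j _ => ?_
  rw [Tensor.pos_div_mod, ← h1, den_fld en (p := products) (by decide)]

-- The error is written with exactly `r` product terms, and the code word enters only through the
-- vanishing of its inner products with the checks. The decoder computes the coefficients of the
-- level 0 polynomial of the error, which are its entries, and subtracts them.
open Polynomial in
theorem den_decoder {n d r : ℕ} {g : F} (hn : 1 ≤ n) (hd : 2 ≤ d) (hr : 1 ≤ r)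
    (hg : Good ((d * n) ^ halves d 1) g) {σ : Store F} (hP : Params n d r σ)
    (hG : σ.fld fG 0 = g) {Y T : Tensor F n d} (v : Fin r → Fin d → Fin n → F)
    (hY : Y = T + ∑ k, Tensor.pure (v k)) (hin : ∀ i, σ.fld fIn (Tensor.pos i) = Y i)
    (hT : ∀ a < (2 * r) ^ Nat.clog 2 d * (d * n),
      Tensor.inner T (Tensor.pure (Tensor.checkFactor g n d r a)) = 0) (i : Fin d → Fin n) :
    (den en decoder σ).fld fOut (Tensor.pos i) = T i := by
  simp only [decoder, den_seq]
  have h1 : ∀ {a}, a < (2 * r) ^ Nat.clog 2 d * (d * n) → ∀ i : Fin d → Fin n, _ :=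
    fun {a} => den_checks en hr hP (a := a)
  have s₁ := (Store.Same.refl decoder.wn decoder.wf σ).trans (den_same en checks σ) |>.trans
    (den_same en (letN vU2 1) _)
  have hU₁ : (den en (letN vU2 1) (den en checks σ)).nat vU2 0 = 1 := by simp
  have hO₁ : (den en (letN vU2 1) (den en checks σ)).fld fOut = (den en checks σ).fld fOut :=
    den_fld en (by decide) _
  set σ₁ := den en (letN vU2 1) (den en checks σ)
  have h₁ : σ₁.fld fG = σ.fld fG ∧ σ₁.fld fIn = σ.fld fIn := by
    simp (disch := decide) [σ₁, den_fld]
  have hP₁ := hP.of_same s₁ (by decide)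
  have hGL : ∀ x ≤ (r + 1) * (r * (d * n) ^ d + 1) + 1, (den en powerTable σ₁).fld fGL x = g ^ x :=
    fun x hx => by rw [den_powerTable en (by rwa [hP₁.C_eq]), h₁.1, hG]
  have s₃ := den_same en powerTable σ₁
  set σ₃ := den en powerTable σ₁
  have hP₃ := hP₁.of_same s₃ (by decide)
  have hin₃ : ∀ i, σ₃.fld fIn (Tensor.pos i) = Y i := by rwa [s₃.2 _ (by decide), h₁.2]
  have hsyn : ∀ h < (2 * r) ^ Nat.clog 2 d, ∀ k < d * n, ∑ p ∈ Finset.range (n ^ d),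
      σ₃.fld fOut ((h * (d * n) + k) * n ^ d + p) * σ₃.fld fIn p =
      (levelPoly g r (Nat.clog 2 d) h (∑ k, Tensor.pure (v k))).eval (g ^ k) := by
    intro h hh k hk
    have ha := mul_add_lt hh hk
    rw [Tensor.sum_pos, eval_levelPoly (by omega)]
    have h2 := hT _ ha
    rw [Tensor.inner] at h2
    set chk := Tensor.pure (Tensor.checkFactor g n d r (h * (d * n) + k)) with hchk
    -- The syndrome of the received tensor splits; the part of the code word is zero, and the part
    -- of the error is a value of its polynomial at the last level.
    refine Eq.trans (b := (∑ i, T i * chk i) + ∑ i, (∑ k, Tensor.pure (v k)) i * chk i) ?_ ?_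
    · rw [← Finset.sum_add_distrib]
      refine Finset.sum_congr rfl fun i _ => ?_
      rw [hin₃, s₃.2 _ (by decide), hO₁, h1 ha i, hG, hY, Pi.add_apply]
      ring
    · rw [h2, zero_add]
      refine Finset.sum_congr rfl fun i _ => congrArg _ ?_
      simp only [hchk, Tensor.pure, Tensor.checkFactor, (mul_add_div_mod hk).1,
        (mul_add_div_mod hk).2]
  have h4 := den_baseStep en hn hd hr hg hP₃ (by rw [s₃.1 _ (by decide), hU₁]) hGL
    (f := fun h => levelPoly g r (Nat.clog 2 d) h (∑ k, Tensor.pure (v k)))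
    (fun h b hb => coeff_eq_zero_of_natDegree_lt ((natDegree_levelPoly_lt hn (by omega) g r _ h
      v).trans_le (by rwa [halves_clog (by omega), pow_one]))) hsyn
  have s₄ := den_same en baseStep σ₃
  set σ₄ := den en baseStep σ₃
  have hP₄ := hP₃.of_same s₄ (by decide)
  -- The invariant after `k` rounds: the polynomials of level `⌈lg d⌉ - k` are known.
  have h5 := den_loop en (v := vS) (a := vK) (p := levelStep) (σ := σ₄)
    (fun k τ => k ≤ Nat.clog 2 d → ∀ h < (2 * r) ^ (Nat.clog 2 d - k), ∀ x < (d * n) ^ d,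
      τ.fld fU (h * (d * n) ^ d + x) =
        (levelPoly g r (Nat.clog 2 d - k) h (∑ k, Tensor.pure (v k))).coeff x)
    (fun _ => by simpa using h4)
    (fun k hk τ hτ hv hI hk' => by
      have hI := hI (by omega)
      rw [show Nat.clog 2 d - k = Nat.clog 2 d - (k + 1) + 1 by omega] at hI
      simpa using den_levelStep en hn (by omega) hr hg (hP₄.of_same hτ (by decide))
        (by rw [hv]; omega) (by omega)
        (by rwa [hτ.2 _ (by decide), s₄.2 _ (by decide)]) v hI)
  rw [hP₄.K_eq] at h5
  -- At level 0 a single polynomial is left, and `digitSum` gives the place of the entry with index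
  -- `i` among its coefficients.
  have h6 := h5 le_rfl 0 (by simp) (digitSum n (d * n) d (Tensor.pos i))
    (digitSum_lt hn (Nat.le_mul_of_pos_left n (by omega)) _ _)
  have s₅ := den_same en (loop vS vK levelStep) σ₄
  set σ₅ := den en (loop vS vK levelStep) σ₄
  have hP₅ := hP₄.of_same s₅ (by decide)
  have h7 := den_places en hn (by omega) hP₅ (Tensor.pos_lt i)
  have s₆ := den_same en places σ₅
  set σ₆ := den en places σ₅
  have h8 := loop_fill en (v := vP) (a := vnd) (A := fOut)
    (e := .get fIn (nv vP) - .get fU (.get vIdx (nv vP))) (σ := σ₆)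
    (fun p => σ₆.fld fIn p - σ₆.fld fU (σ₆.nat vIdx p))
    (fun p _ τ hτ hv => by simp [hv, hτ.1, hτ.2]) (Tensor.pos i)
    (by rw [(hP₅.of_same s₆ (by decide)).nd_eq]; exact Tensor.pos_lt i)
  rw [h7, s₆.2 _ (by decide), s₆.2 _ (by decide)] at h8
  rw [zero_mul, zero_add, Nat.sub_self] at h6
  rw [subtractError, h8, h6, Tensor.digitSum_pos, coeff_levelPoly_zero (by omega),
    s₅.2 _ (by decide), s₄.2 _ (by decide), hin₃, hY]
  simp

end LoopProg

/-! ## The search for an element of large order -/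

namespace LoopProg

/-- Compare one power with `1`. -/
def testPower : LoopProg :=
  ite (.and (.natLt 0 (nv vY)) (.fieldEq (fv fT2) 1)) (letN vOk 0) skip ;;
  letF fT2 (fv fT2 * fv fT1)

/-- Test one element. -/
def testElement : LoopProg :=
  (ite (.fieldEq (fv fT1) 0) (letN vOk 0) (letN vOk 1) ;; letF fT2 1) ;; loop vY vN0 testPower

/-- Test one element and go to the next one. -/
def searchStep : LoopProg :=
  testElement ;; ite (.natEq (nv vOk) 1) (letF fG (fv fT1) ;; letN vFound 1) skip ;;
  letF fT1 (.next (fv fT1))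

/-- Test the first elements of the enumeration. -/
def search : LoopProg := (letN vFound 0 ;; letF fT1 .first) ;; loop vX vM searchStep

variable {F : Type u} [Field F] (en : Enumeration F)

theorem den_testElement {N₀ : ℕ} {σ : Store F} (hN : σ.nat vN0 0 = N₀) :
    (den en testElement σ).nat vOk 0 = 1 ↔ Good N₀ (σ.fld fT1 0) := by
  rw [testElement, den_seq, Good]
  set x := σ.fld fT1 0 with hx
  have s := den_same en (ite (.fieldEq (fv fT1) 0) (letN vOk 0) (letN vOk 1) ;; letF fT2 1) σ
  have key := den_loop en (v := vY) (a := vN0) (p := testPower)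
    (σ := den en (ite (.fieldEq (fv fT1) 0) (letN vOk 0) (letN vOk 1) ;; letF fT2 1) σ)
    (fun l τ => τ.fld fT2 0 = x ^ l ∧ (τ.nat vOk 0 = 1 ↔ x ≠ 0 ∧ ∀ k < l, 0 < k → x ^ k ≠ 1))
    (by
      rw [den_seq]
      by_cases h0 : x = 0
      · rw [den_ite_pos en (by simpa [hx] using h0)]
        simp [h0]
      · rw [den_ite_neg en (by simpa [hx] using h0)]
        simp [h0])
    (fun l hl τ hτ hv hI => by
      have hT : τ.fld fT1 0 = x := by rw [hτ.2 _ (by decide), s.2 _ (by decide)]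
      rw [Nat.forall_lt_succ_right, ← and_assoc, ← hI.2, testPower, den_seq]
      by_cases hc : 0 < l ∧ x ^ l = 1
      · rw [den_ite_pos en (by simpa [hv, hI.1] using hc)]
        simp [hI.1, hT, pow_succ, hc]
      · rw [den_ite_neg en (by simpa [hv, hI.1] using hc)]
        simp [hI.1, hT, pow_succ]
        exact fun _ h h' => hc ⟨h, h'⟩)
  rw [s.1 _ (by decide), hN] at key
  exact key.2

/-- The alternative is kept: either a good element has been stored, or none of the elements tested
is good. The second case is turned into a bound for the size of the field by `exists_good`. -/
theorem den_search {N₀ : ℕ} {σ : Store F} (hN : σ.nat vN0 0 = N₀) :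
    ((den en search σ).nat vFound 0 = 1 ∧ Good N₀ ((den en search σ).fld fG 0)) ∨
    ((den en search σ).nat vFound 0 = 0 ∧
      ∀ x < σ.nat vM 0, ¬ Good N₀ (en.next^[x] en.first)) := by
  rw [search, den_seq]
  have s := den_same en (letN vFound 0 ;; letF fT1 .first) σ
  have key := den_loop en (v := vX) (a := vM) (p := searchStep)
    (σ := den en (letN vFound 0 ;; letF fT1 .first) σ)
    (fun k τ => τ.fld fT1 0 = en.next^[k] en.first ∧
      ((τ.nat vFound 0 = 1 ∧ Good N₀ (τ.fld fG 0)) ∨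
        (τ.nat vFound 0 = 0 ∧ ∀ x < k, ¬ Good N₀ (en.next^[x] en.first))))
    (by simp)
    (fun k hk τ hτ hv hI => by
      have hG := den_testElement en (σ := τ) (N₀ := N₀)
        (by rw [hτ.1 _ (by decide), s.1 _ (by decide), hN])
      have u := den_same en testElement τ
      simp only [searchStep, den_seq]
      set υ := den en testElement τ
      have hT : υ.fld fT1 0 = en.next^[k] en.first := by rw [u.2 _ (by decide), hI.1]
      rw [hI.1] at hG
      rw [Nat.forall_lt_succ_right, Function.iterate_succ_apply']
      by_cases hc : υ.nat vOk 0 = 1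
      · rw [den_ite_pos en (by simp [hc])]
        exact ⟨by simp [hT], Or.inl ⟨by simp, by simpa [hT] using hG.mp hc⟩⟩
      · rw [den_ite_neg en (by
          intro h
          simp only [Test.holds_and, Test.holds_not, Test.holds_natLt, NatExpr.eval_get,
            NatExpr.eval_ofNat] at h
          omega)]
        simp (disch := decide) [hT, u.1, u.2, mt hG.mpr hc]
        exact hI.2)
  rw [s.1 _ (by decide)] at key
  exact key.2

end LoopProg

section Existence

open Polynomial

variable {F : Type u} (en : Enumeration F)

/-- A finite field has at most as many elements as its enumeration has members. -/
theorem Enumeration.surjective [Finite F] (x : F) : ∃ i < Nat.card F, en.next^[i] en.first = x := by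
  have := Fintype.ofFinite F
  have hinj : Function.Injective fun i : Fin (Nat.card F) => en.next^[(i : ℕ)] en.first :=
    fun i j h => Fin.ext (en.distinct i j
      (by rw [ENat.card_eq_coe_natCard]; exact_mod_cast i.2)
      (by rw [ENat.card_eq_coe_natCard]; exact_mod_cast j.2) h)
  obtain ⟨i, hi⟩ := ((Fintype.bijective_iff_injective_and_card _).mpr
    ⟨hinj, by simp [Nat.card_eq_fintype_card]⟩).2 x
  exact ⟨i, i.2, hi⟩

variable [Field F]

/-- Either the field has at least `N₀²` elements, and then the elements that fail are too few to
fill the first `N₀²` places, being roots of one polynomial. Or it is finite with more than `N₀` and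
fewer than `N₀²` elements; then the enumeration reaches a generator of the multiplicative group in
time. -/
theorem exists_good {N₀ : ℕ} (h2 : 2 ≤ N₀) (hF : (N₀ : ℕ∞) < ENat.card F) :
    ∃ x < N₀ * N₀, LoopProg.Good N₀ (en.next^[x] en.first) := by
  by_cases hM : ((N₀ * N₀ : ℕ) : ℕ∞) ≤ ENat.card F
  · by_contra hcon
    push Not at hcon
    -- Every element that is not good is a root of `p`, whose degree is at most `1 + (N₀ - 1) N₀ <
    -- N₀²` because `N₀ ≥ 2`.
    let p : F[X] := X * ∏ k ∈ Finset.Ico 1 N₀, (X ^ k - 1)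
    have hp : p ≠ 0 := mul_ne_zero X_ne_zero (Finset.prod_ne_zero_iff.mpr fun k hk =>
      X_pow_sub_C_ne_zero (Nat.pos_of_ne_zero (by simp at hk; omega)) 1)
    refine hp (eq_zero_of_natDegree_lt_card_of_eval_eq_zero p (ι := Fin (N₀ * N₀))
      (f := fun i => en.next^[(i : ℕ)] en.first) (fun i j h => Fin.ext (en.distinct i j
        (lt_of_lt_of_le (by exact_mod_cast i.2) hM) (lt_of_lt_of_le (by exact_mod_cast j.2) hM) h))
      (fun i => ?_) ?_)
    · have h1 := hcon i i.2
      by_cases h0 : en.next^[(i : ℕ)] en.first = 0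
      · simp [p, h0]
      · rw [LoopProg.Good] at h1
        push Not at h1
        obtain ⟨k, hkN, hk, hk1⟩ := h1 h0
        rw [eval_mul, eval_prod, Finset.prod_eq_zero (Finset.mem_Ico.mpr ⟨hk, hkN⟩), mul_zero]
        simp [hk1]
    · have h1 : p.natDegree ≤ 1 + ∑ k ∈ Finset.Ico 1 N₀, N₀ := by
        refine natDegree_mul_le.trans (add_le_add natDegree_X_le
          ((natDegree_prod_le _ _).trans (Finset.sum_le_sum fun k hk => ?_)))
        refine (natDegree_X_pow_sub_C (n := k) (r := (1 : F))).le.trans ?_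
        exact (Finset.mem_Ico.mp hk).2.le
      rw [Finset.sum_const, Nat.card_Ico, smul_eq_mul, Nat.sub_mul, one_mul] at h1
      rw [Fintype.card_fin]
      have := Nat.mul_le_mul_right N₀ h2
      omega
  · push Not at hM
    have hfin : Finite F := by
      by_contra h
      rw [not_finite_iff_infinite] at h
      simp at hM
    rw [ENat.card_eq_coe_natCard] at hM hF
    have hM' : Nat.card F < N₀ * N₀ := by exact_mod_cast hM
    have hF' : N₀ < Nat.card F := by exact_mod_cast hF
    -- A generator has order `|F| - 1 ≥ N₀`, so no smaller positive power of it is 1.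
    obtain ⟨g, hg⟩ := IsCyclic.exists_generator (α := Fˣ)
    have hord : orderOf (g : F) = Nat.card F - 1 := by
      rw [orderOf_units, orderOf_eq_card_of_forall_mem_zpowers hg, Nat.card_units]
    obtain ⟨i, hi, hi'⟩ := en.surjective (g : F)
    refine ⟨i, hi.trans hM', ?_⟩
    rw [hi']
    refine ⟨g.ne_zero, fun k hkN hk h1 => ?_⟩
    have := Nat.le_of_dvd hk (orderOf_dvd_of_pow_eq_one h1)
    omega

end Existence

/-! ## Parity checks of a code of prescribed dimension -/

namespace LoopProg

/-- Use the parity check number `vH` as an equation. -/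
def copyRow : LoopProg :=
  loop vY vnd (setF fRow (nv vY) (.get fOut (.get tnd (nv vH) + nv vY)))

/-- Use the unit tensor number `vH` as an equation, and append it to the list of parity checks. -/
def appendUnit : LoopProg :=
  (loop vY vnd (setF fRow (nv vY) 0) ;; setF fRow (nv vH) 1) ;;
  loop vY vnd (setF fOut (nv vPtr + nv vY) (.get fRow (nv vY))) ;;
  letN vPtr (nv vPtr + nv vnd) ;; letN vT3 (nv vT3 + 1)

/-- Append a unit tensor to the list of parity checks, unless there are enough of them. -/
def unitStep : LoopProg :=
  ite (.natLt (nv vCnt) (nv vMchk)) (appendUnit ;; addEquation) skip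

/-- Set up the space of all tensors. -/
def initTensors : LoopProg :=
  (letN vC (nv vnd) ;; letN vUsed (nv vnd)) ;; multiples tC vX vC vC ;; initSpan

/-- Append unit tensors to the list of parity checks, until the number of independent ones is as
large as that of the given ones. -/
def extendChecks : LoopProg :=
  loop vH vMchk (copyRow ;; addEquation) ;;
  (letN vPtr (.get tnd (nv vMchk)) ;; letN vT3 (nv vMchk)) ;; loop vH vnd unitStep ;;
  setN 1 0 (nv vT3)

variable {F : Type u} [Field F] (en : Enumeration F)

/-- The rows of `fV` span the solutions of the first `m` equations in `fOut`. -/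
structure Solved (c m : ℕ) (σ : Store F) : Prop where
  square : Square c σ
  finrank_add : Module.finrank F (spanOf c σ) + σ.nat vCnt 0 = c
  mem_iff : ∀ w, w ∈ spanOf c σ ↔ ∀ a < m, ∑ x : Fin c, σ.fld fOut (a * c + x) * w x = 0

theorem Solved.of_same {c m : ℕ} {σ τ : Store F} {wn wf : List ℕ} (s : Store.Same wn wf σ τ)
    (h3 : ∀ a < m, ∀ x < c, τ.fld fOut (a * c + x) = σ.fld fOut (a * c + x)) (h : Solved c m σ)
    (h1 : ∀ a ∈ [vC, tC, vCnt], a ∉ wn := by decide) (h2 : fV ∉ wf := by decide) :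
    Solved c m τ := by
  have e : spanOf c τ = spanOf c σ := by rw [spanOf, spanOf, s.2 _ h2]
  refine ⟨h.square.of_same s (h1 _ (by decide)) (h1 _ (by decide)), by
    rw [e, s.1 _ (h1 _ (by decide))]; exact h.finrank_add, fun w => ?_⟩
  rw [e, h.mem_iff]
  refine forall₂_congr fun a ha => ?_
  rw [Finset.sum_congr rfl fun (x : Fin c) _ => by rw [← h3 a ha x x.2]]

theorem Solved.setCounter {c m : ℕ} {σ : Store F} (k : ℕ) (h : Solved c m σ) :
    Solved c m (σ.setNat vH 0 k) := by
  have s : Store.Same [vH] [] σ (σ.setNat vH 0 k) :=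
    ⟨fun a ha => funext fun i => by simp_all [Store.setNat], fun _ _ => rfl⟩
  exact h.of_same s fun _ _ _ _ => rfl

/-- The count rises by at most one with each equation, so that it cannot jump over the desired
number. -/
theorem Solved.addEquation {c m : ℕ} {σ : Store F} (h : Solved c m σ)
    (hrow : ∀ x < c, σ.fld fRow x = σ.fld fOut (m * c + x)) :
    Solved c (m + 1) (den en addEquation σ) ∧
      (den en addEquation σ).nat vCnt 0 ≤ σ.nat vCnt 0 + 1 := by
  have s := den_same en LoopProg.addEquation σ
  obtain ⟨h1, h2⟩ := den_addEquation en h.square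
  refine ⟨⟨h.square.of_same s (by decide) (by decide), by rw [h2, h.finrank_add], fun w => ?_⟩, by
    obtain ⟨_, _, -, -, h | h⟩ := den_addEquation_aux en h.square <;> omega⟩
  rw [h1, Submodule.mem_inf, h.mem_iff, mem_rowKer, s.2 fOut (by decide),
    Finset.sum_congr rfl fun (x : Fin c) _ => by rw [hrow x x.2], Nat.forall_lt_succ_right]

theorem Solved.initTensors {c : ℕ} {σ : Store F} (hc : 0 < c) (h : σ.nat vnd 0 = c) :
    Solved c 0 (den en initTensors σ) := by
  simp only [LoopProg.initTensors, den_seq]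
  set σ₁ := den en (letN vUsed (nv vnd)) (den en (letN vC (nv vnd)) σ)
  have h₁ : σ₁.nat vC 0 = c ∧ σ₁.nat vUsed 0 = c := by simp [σ₁, h]
  have s := den_same en (multiples tC vX vC vC) σ₁
  have hS : Square c (den en (multiples tC vX vC vC) σ₁) :=
    ⟨hc, by rw [s.1 _ (by decide), h₁.1], fun q hq => by
      rw [den_multiples en (by decide) (by decide) (by decide) (by decide) _
        (by rw [h₁.1]; exact hq.le), h₁.1]⟩
  set σ₂ := den en (multiples tC vX vC vC) σ₁
  have h4 : ∀ w, w ∈ spanOf c (den en initSpan σ₂) := fun w =>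
    (den_initSpan en hS).mpr fun x hx => by
      rw [s.1 _ (by decide), h₁.2] at hx
      omega
  refine ⟨hS.of_same (den_same en initSpan σ₂) (by decide) (by decide), ?_, fun w => by simp [h4]⟩
  rw [(Submodule.eq_top_iff').mpr h4, finrank_top, Module.finrank_fin_fun]
  have : (den en initSpan σ₂).nat vCnt 0 = 0 := by
    rw [initSpan, den_seq, den_nat en (by decide)]
    simp
  omega

theorem den_appendUnit {c m k : ℕ} {σ : Store F} (hnd : σ.nat vnd 0 = c) (hk : σ.nat vH 0 = k)
    (hptr : σ.nat vPtr 0 = m * c) :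
    (den en appendUnit σ).nat vPtr 0 = (m + 1) * c ∧
    (den en appendUnit σ).nat vT3 0 = σ.nat vT3 0 + 1 ∧
    (∀ a < m, ∀ x < c, (den en appendUnit σ).fld fOut (a * c + x) = σ.fld fOut (a * c + x)) ∧
    ∀ x < c, (den en appendUnit σ).fld fOut (m * c + x) = (if x = k then 1 else 0) ∧
      (den en appendUnit σ).fld fRow x = if x = k then 1 else 0 := by
  rw [appendUnit, den_seq]
  have s := den_same en (loop vY vnd (setF fRow (nv vY) 0) ;; setF fRow (nv vH) 1) σ
  have hrow : ∀ x < c, (den en (loop vY vnd (setF fRow (nv vY) 0) ;; setF fRow (nv vH) 1) σ).fld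
      fRow x = if x = k then 1 else 0 := fun x hx => by
    have := loop_fill en (v := vY) (a := vnd) (A := fRow) (e := 0) (σ := σ) (fun _ => 0)
      (fun _ _ _ _ _ => rfl) x (by rwa [hnd])
    simp (disch := decide) [den_nat, hk, this]
  set σ₁ := den en (loop vY vnd (setF fRow (nv vY) 0) ;; setF fRow (nv vH) 1) σ
  have h1 := loop_setF en (v := vY) (a := vnd) (A := fOut) (idx := nv vPtr + nv vY)
    (e := .get fRow (nv vY)) (σ := σ₁) (fun x => m * c + x) (σ₁.fld fRow)
    (fun _ _ _ _ h => Nat.add_left_cancel h) (fun i _ τ hτ hv _ => by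
      simp (disch := decide) [hv, hτ.1, hτ.2, s.1, hptr])
  rw [s.1 _ (by decide), hnd] at h1
  simp (disch := decide) only [den_seq, den_setN, Store.nat_setNat, NatExpr.eval_get,
    NatExpr.eval_add, NatExpr.eval_ofNat, Store.fld_setNat, den_nat, den_fld, s.1, hptr, hnd]
  refine ⟨by simp [add_mul], by simp, fun a ha x hx => ?_, fun x hx => ⟨?_, hrow x hx⟩⟩
  · rw [h1.2 _ fun i hi he => absurd (add_mul_inj hx hi he).1 ha.ne, s.2 _ (by decide)]
  · rw [h1.1 x hx, hrow x hx]

/-- The given checks may be dependent. Unit tensors are added until the number of independent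
equations reaches `M`. If all unit tensors are used up first, the solution space is zero, in
agreement with the truncated difference `c - M`. -/
theorem den_extendChecks {c M : ℕ} {σ : Store F}
    (hσ : Solved c 0 σ) (hnd : σ.nat vnd 0 = c) (hM : σ.nat vMchk 0 = M)
    (ht : ∀ i ≤ M, σ.nat tnd i = i * c) :
    ∃ m ≥ M, (den en extendChecks σ).nat 1 0 = m ∧
      (∀ a < M, ∀ x < c, (den en extendChecks σ).fld fOut (a * c + x) =
        σ.fld fOut (a * c + x)) ∧
      (∀ a, M ≤ a → a < m → ∃ k < c, ∀ x < c,
        (den en extendChecks σ).fld fOut (a * c + x) = if x = k then 1 else 0) ∧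
      ∃ W : Submodule F (Fin c → F), Module.finrank F W = c - M ∧
        ∀ w, w ∈ W ↔ ∀ a < m, ∑ x : Fin c,
          (den en extendChecks σ).fld fOut (a * c + x) * w x = 0 := by
  simp only [extendChecks, den_seq]
  have key := den_loop en (v := vH) (a := vMchk) (p := copyRow ;; addEquation) (σ := σ)
    (fun k τ => Solved c k τ ∧ τ.nat vCnt 0 ≤ k)
    ⟨hσ.setCounter 0, by
      have := hσ.finrank_add
      have h2 : spanOf c σ = ⊤ := Submodule.eq_top_iff'.mpr fun w => (hσ.mem_iff w).mpr (by simp)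
      rw [h2, finrank_top, Module.finrank_fin_fun] at this
      simp; omega⟩
    (fun k hk τ hτ hv hI => by
      have h1 := loop_fill en (v := vY) (a := vnd) (A := fRow)
        (e := .get fOut (.get tnd (nv vH) + nv vY)) (σ := τ) (fun x => τ.fld fOut (k * c + x))
        (fun i _ υ hυ hv' => by
          simp (disch := decide) [hv', hυ.1, hv, hυ.2, hτ.1, ht k (by omega)])
      rw [hτ.1 vnd (by decide), hnd] at h1
      have s := den_same en copyRow τ
      obtain ⟨h2, h3⟩ := (hI.1.of_same s fun a _ x _ => by rw [s.2 _ (by decide)]).addEquation en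
        fun x hx => by rw [s.2 fOut (by decide)]; exact h1 x hx
      rw [s.1 vCnt (by decide)] at h3
      exact ⟨h2.setCounter _, h3.trans (Nat.add_le_add_right hI.2 1)⟩)
  have s := (Store.Same.refl extendChecks.wn extendChecks.wf σ).trans
    (den_same en (loop vH vMchk (copyRow ;; addEquation)) σ)
  rw [hM] at key
  have hO := den_fld en (p := loop vH vMchk (copyRow ;; addEquation)) (a := fOut) (by decide) σ
  set σ₁ := den en (loop vH vMchk (copyRow ;; addEquation)) σ
  set σ₂ := den en (letN vT3 (nv vMchk)) (den en (letN vPtr (.get tnd (nv vMchk))) σ₁)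
  have s₂ : Store.Same _ _ σ₁ σ₂ :=
    den_same en (letN vPtr (.get tnd (nv vMchk)) ;; letN vT3 (nv vMchk)) σ₁
  have hP₂ : σ₂.nat vPtr 0 = M * c := by simp (disch := decide) [σ₂, s.1, hM, ht M le_rfl]
  have hT₂ : σ₂.nat vT3 0 = M := by simp (disch := decide) [σ₂, s.1, hM]
  have hO₂ : σ₂.fld fOut = σ.fld fOut := by rw [s₂.2 _ (by decide), hO]
  have hC₂ : σ₂.nat vCnt 0 ≤ M := by rw [s₂.1 _ (by decide)]; exact key.2
  have hS₂ := key.1.of_same s₂ fun a _ x _ => by rw [s₂.2 _ (by decide)]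
  have t := s.trans s₂
  clear_value σ₂
  -- Besides the bookkeeping, the invariant says: as long as the count is below `M`, each of the
  -- first `k` unit tensors has been imposed, so the solutions vanish in the first `k` coordinates.
  have fin := den_loop en (v := vH) (a := vnd) (p := unitStep) (σ := σ₂)
    (fun k τ => ∃ m ≥ M, Solved c m τ ∧ τ.nat vPtr 0 = m * c ∧ τ.nat vT3 0 = m ∧
      τ.nat vCnt 0 ≤ M ∧ (τ.nat vCnt 0 < M → ∀ w ∈ spanOf c τ, ∀ x : Fin c, (x : ℕ) < k → w x = 0) ∧
      (∀ a < M, ∀ x < c, τ.fld fOut (a * c + x) = σ.fld fOut (a * c + x)) ∧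
      ∀ a, M ≤ a → a < m → ∃ k < c, ∀ x < c, τ.fld fOut (a * c + x) = if x = k then 1 else 0)
    ⟨M, le_rfl, hS₂.setCounter 0, by simp [hP₂], by simp [hT₂], by simp [hC₂], by simp,
      by simp [hO₂], fun a h1 h2 => by omega⟩
    (fun k hk τ hτ hv hI => by
      have u := t.trans hτ
      rw [t.1 _ (by decide), hnd] at hk
      obtain ⟨m, hm, h1, h2, h3, h4, h5, h6, h7⟩ := hI
      by_cases hlt : τ.nat vCnt 0 < M
      · rw [unitStep, den_ite_pos en (by simpa (disch := decide) [u.1, hM] using hlt), den_seq]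
        obtain ⟨g1, g2, g3, g4⟩ := den_appendUnit en (by rw [u.1 _ (by decide), hnd]) hv h2
        have w₁ := den_same en appendUnit τ
        obtain ⟨e1, e2⟩ := (h1.of_same w₁ g3).addEquation en
          fun x hx => (g4 x hx).2.trans (g4 x hx).1.symm
        have w₂ := den_same en addEquation (den en appendUnit τ)
        rw [w₁.1 vCnt (by decide)] at e2
        rw [← w₂.2 fOut (by decide)] at g3 g4
        set υ := den en addEquation (den en appendUnit τ)
        refine ⟨m + 1, by omega, e1.setCounter _,
          by simp (disch := decide) [w₂.1, g1], by simp (disch := decide) [w₂.1, g2, h3],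
          by simp; omega, fun _ w hw x hx => ?_, fun a ha x hx => ?_, fun a ha ha' => ?_⟩
        · have hw' := (e1.mem_iff w).mp hw
          rcases Nat.lt_succ_iff_lt_or_eq.mp hx with h | rfl
          · refine h5 hlt w ((h1.mem_iff w).mpr fun a ha => ?_) x h
            rw [← hw' a (by omega)]
            exact Finset.sum_congr rfl fun y _ => by rw [g3 a ha y y.2]
          · have h8 := hw' m (by omega)
            rw [Finset.sum_congr rfl fun (y : Fin c) _ => by rw [(g4 y y.2).1]] at h8
            simpa [Fin.val_inj] using h8
        · rw [Store.fld_setNat, g3 a (by omega) x hx, h6 a ha x hx]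
        · rw [Store.fld_setNat]
          rcases Nat.lt_succ_iff_lt_or_eq.mp ha' with h | rfl
          · obtain ⟨k', hk', h8⟩ := h7 a ha h
            exact ⟨k', hk', fun x hx => by rw [g3 a h x hx, h8 x hx]⟩
          · exact ⟨k, hk, fun x hx => (g4 x hx).1⟩
      · rw [unitStep, den_ite_neg en (by simpa (disch := decide) [u.1, hM] using hlt), den_skip]
        exact ⟨m, hm, h1.setCounter _, h2, h3, h4, fun h => absurd h hlt, h6, h7⟩)
  rw [t.1 _ (by decide), hnd] at fin
  set σ₃ := den en (loop vH vnd unitStep) σ₂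
  obtain ⟨m, hm, h1, h2, h3, h4, h5, h6, h7⟩ := fin
  refine ⟨m, hm, by simp [h3], by simpa using h6, by simpa using h7, spanOf c σ₃, ?_,
    by simpa using h1.mem_iff⟩
  have h8 := h1.finrank_add
  -- Either the count is still short, and all coordinates of every solution vanish, or it is exactly
  -- `M`, and the dimension is `c - M`.
  rcases h4.lt_or_eq with h | h
  · have : spanOf c σ₃ = ⊥ := (Submodule.eq_bot_iff _).mpr fun w hw =>
      funext fun x => h5 h w hw x x.2
    rw [this, finrank_bot] at h8 ⊢
    omega
  · omega

end LoopProg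

/-! ## Programs that do not read a given array -/

/-- The expression does not read the field array `a`. -/
def FieldExpr.avoids (a : ℕ) : FieldExpr → Bool
  | zero => true
  | one => true
  | get b _ => decide (b ≠ a)
  | add x y => x.avoids a && y.avoids a
  | sub x y => x.avoids a && y.avoids a
  | mul x y => x.avoids a && y.avoids a
  | inv x => x.avoids a
  | first => true
  | next x => x.avoids a

/-- The test does not read the field array `a`. -/
def Test.avoids (a : ℕ) : Test → Bool
  | natLt _ _ => true
  | fieldEq x y => x.avoids a && y.avoids a
  | not b => b.avoids a
  | and b c => b.avoids a && c.avoids a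

/-- The program does not read the field array `a`. -/
def LoopProg.avoids (a : ℕ) : LoopProg → Bool
  | skip => true
  | setN _ _ _ => true
  | setF _ _ x => x.avoids a
  | seq p q => p.avoids a && q.avoids a
  | ite b p q => b.avoids a && p.avoids a && q.avoids a
  | loop _ _ p => p.avoids a

/-- The stores agree except on the field array `a`. -/
def Store.AgreeOff {F : Type u} (a : ℕ) (σ τ : Store F) : Prop :=
  σ.nat = τ.nat ∧ ∀ b ≠ a, σ.fld b = τ.fld b

section Agree

variable {F : Type u} {a : ℕ} {σ τ : Store F}

theorem Store.AgreeOff.setNat (h : σ.AgreeOff a τ) (b i v : ℕ) :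
    (σ.setNat b i v).AgreeOff a (τ.setNat b i v) :=
  ⟨by simp only [Store.setNat, h.1], h.2⟩

theorem Store.AgreeOff.natExpr (h : σ.AgreeOff a τ) (x : NatExpr) : x.eval σ = x.eval τ := by
  induction x with
  | lit k => rfl
  | get b i ih => simp only [NatExpr.eval, ih, h.1]
  | add x y hx hy => simp only [NatExpr.eval, hx, hy]
  | sub x y hx hy => simp only [NatExpr.eval, hx, hy]

variable [Field F] (en : Enumeration F)

theorem Store.AgreeOff.fieldExpr (h : σ.AgreeOff a τ) {x : FieldExpr} (hx : x.avoids a = true) :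
    x.eval en σ = x.eval en τ := by
  induction x with
  | get b i =>
    simp only [FieldExpr.avoids, decide_eq_true_eq] at hx
    simp only [FieldExpr.eval, h.natExpr, h.2 b hx]
  | _ => simp_all [FieldExpr.avoids, FieldExpr.eval]

theorem Store.AgreeOff.test (h : σ.AgreeOff a τ) {b : Test} (hb : b.avoids a = true) :
    b.Holds en σ ↔ b.Holds en τ := by
  induction b with
  | natLt x y => simp only [Test.Holds, h.natExpr]
  | fieldEq x y =>
    simp only [Test.avoids, Bool.and_eq_true] at hb
    simp only [Test.Holds, h.fieldExpr en hb.1, h.fieldExpr en hb.2]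
  | _ => simp_all [Test.avoids, Test.Holds]

/-- The setup runs once on the zero input to construct the checks, and again on a received tensor to
decode. It has to find the same element of the field and the same extension both times, which holds
because it does not read the input array. -/
theorem LoopProg.den_agreeOff {p : LoopProg} (hp : p.avoids a = true) (h : σ.AgreeOff a τ) :
    (den en p σ).AgreeOff a (den en p τ) := by
  induction p generalizing σ τ with
  | skip => exact h
  | setN b i x =>
    rw [den, den, h.natExpr i, h.natExpr x]
    exact h.setNat _ _ _
  | setF b i x =>
    rw [den, den, h.natExpr i, h.fieldExpr en hp]
    exact ⟨h.1, fun c hc => by simp only [Store.setFld, h.2 c hc]⟩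
  | seq p q ihp ihq =>
    simp only [avoids, Bool.and_eq_true] at hp
    exact ihq hp.2 (ihp hp.1 h)
  | ite b p q ihp ihq =>
    simp only [avoids, Bool.and_eq_true] at hp
    by_cases hb : b.Holds en σ
    · rw [den_ite_pos en hb, den_ite_pos en ((h.test en hp.1.1).mp hb)]
      exact ihp hp.1.2 h
    · rw [den_ite_neg en hb, den_ite_neg en (fun h' => hb ((h.test en hp.1.1).mpr h'))]
      exact ihq hp.2 h
  | loop v b p ih =>
    rw [den, den, h.1]
    induction τ.nat b 0 with
    | zero => exact h.setNat _ _ _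
    | succ k ihk => exact (ih hp ihk).setNat _ _ _

end Agree

/-! ## Rank, codes and decoding -/

namespace Tensor

variable {F : Type u} [Field F] {n d : ℕ}

@[simp] theorem pure_zero (hd : 1 ≤ d) : pure (0 : Fin d → Fin n → F) = 0 :=
  funext fun _ => Finset.prod_eq_zero (Finset.mem_univ ⟨0, hd⟩) rfl

theorem pure_unit (k : Fin d → Fin n) (i : Fin d → Fin n) :
    pure (fun j x => if x = k j then (1 : F) else 0) i = if i = k then 1 else 0 := by
  by_cases h : i = k
  · simp [pure, h]
  · rw [if_neg h]
    obtain ⟨j, hj⟩ := Function.ne_iff.mp h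
    exact Finset.prod_eq_zero (Finset.mem_univ j) (if_neg hj)

theorem exists_pure_neg (hd : 1 ≤ d) (v : Fin d → Fin n → F) : ∃ w, pure w = -pure v := by
  refine ⟨Function.update v ⟨0, hd⟩ (-v ⟨0, hd⟩), funext fun i => ?_⟩
  rw [Pi.neg_apply, pure, pure, ← Finset.mul_prod_erase _ _ (Finset.mem_univ ⟨0, hd⟩),
    ← Finset.mul_prod_erase (a := ⟨0, hd⟩) _ (fun j => v j (i j)) (Finset.mem_univ _),
    Function.update_self, ← neg_mul]
  refine congrArg _ (Finset.prod_congr rfl fun j hj => ?_)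
  rw [Function.update_of_ne (Finset.ne_of_mem_erase hj)]

theorem pos_injective : Function.Injective (pos : (Fin d → Fin n) → ℕ) := fun _ _ h =>
  finFunctionFinEquiv.injective (Fin.ext h)

theorem exists_pos {p : ℕ} (hp : p < n ^ d) : ∃ i : Fin d → Fin n, pos i = p :=
  ⟨finFunctionFinEquiv.symm ⟨p, hp⟩, by rw [pos, Equiv.apply_symm_apply]⟩

theorem exists_sum_pure (hd : 1 ≤ d) (T : Tensor F n d) :
    ∃ (s : ℕ) (v : Fin s → Fin d → Fin n → F), T = ∑ l, pure (v l) := by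
  let e := Fintype.equivFin (Fin d → Fin n)
  refine ⟨_, fun l j x => (if j = ⟨0, hd⟩ then T (e.symm l) else 1) *
    if x = e.symm l j then 1 else 0, funext fun i => ?_⟩
  rw [Finset.sum_apply, ← e.sum_comp]
  simp only [pure, Finset.prod_mul_distrib, Equiv.symm_apply_apply]
  have h (k : Fin d → Fin n) : ∏ j, (if i j = k j then (1 : F) else 0) = if i = k then 1 else 0 :=
    pure_unit k i
  simp [h]

theorem exists_sum_pure_of_rank_le (hd : 1 ≤ d) {e : ℕ} {T : Tensor F n d} (h : rank T ≤ e) :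
    ∃ v : Fin e → Fin d → Fin n → F, T = ∑ l, pure (v l) := by
  obtain ⟨v, hv⟩ : ∃ v : Fin (rank T) → Fin d → Fin n → F, T = ∑ l, pure (v l) :=
    Nat.sInf_mem (s := {s | ∃ v : Fin s → Fin d → Fin n → F, T = ∑ l, pure (v l)})
      (exists_sum_pure hd T)
  obtain ⟨k, rfl⟩ := Nat.exists_eq_add_of_le h
  refine ⟨Fin.append v 0, ?_⟩
  rw [Fin.sum_univ_add]
  simp only [Fin.append_left, Fin.append_right, Pi.zero_apply]
  rw [← hv, Finset.sum_eq_zero fun l _ => pure_zero hd, add_zero]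

theorem rank_sum_pure_le {s : ℕ} (v : Fin s → Fin d → Fin n → F) : rank (∑ l, pure (v l)) ≤ s :=
  Nat.sInf_le ⟨v, rfl⟩

/-- Two code words whose difference is a sum of `2 r` product tensors have a common received word:
half of the difference is moved to each side. A decoder cannot output both. -/
theorem Corrects.isRankMetricCode (hd : 1 ≤ d) {en : Enumeration F} {p : Prog} {r t : ℕ}
    {C : Submodule F (Tensor F n d)} (h : Corrects en p r t r C) :
    IsRankMetricCode C (Module.finrank F C) (2 * r + 1) := by
  refine ⟨rfl, fun S hS T hT hST => ?_⟩
  by_contra hlt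
  obtain ⟨v, hv⟩ := exists_sum_pure_of_rank_le (e := r + r) hd (by omega : rank (S - T) ≤ r + r)
  -- The first `r` terms serve as the error added to `T`, the negatives of the last `r` as the error
  -- added to `S`; a negated product tensor is again one.
  rw [Fin.sum_univ_add] at hv
  choose w hw using fun l : Fin r => exists_pure_neg hd (v (Fin.natAdd r l))
  obtain ⟨_, -, τ, -, hτ⟩ := h (S + ∑ l, pure (w l))
  refine hST (funext fun i => ?_)
  rw [← hτ S hS _ (rank_sum_pure_le w) rfl i]
  refine hτ T hT _ (rank_sum_pure_le fun l => v (Fin.castAdd r l)) ?_ i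
  simp only [hw, Finset.sum_neg_distrib]
  rw [← sub_eq_iff_eq_add', add_sub_right_comm, hv]
  simp

theorem finrank_codeOf_ge {m : ℕ} (H : Fin m → Tensor F n d) :
    n ^ d ≤ Module.finrank F (codeOf H) + m := by
  let φ : Tensor F n d →ₗ[F] Fin m → F :=
    { toFun := fun T a => inner T (H a)
      map_add' := fun S T => funext fun a => by simp [inner, add_mul, Finset.sum_add_distrib]
      map_smul' := fun x T => funext fun a => by simp [inner, mul_assoc, Finset.mul_sum] }
  have h1 := LinearMap.finrank_range_add_finrank_ker φ
  have h2 : LinearMap.ker φ = codeOf H := by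
    ext T
    exact ⟨fun h a => congrFun h a, fun h => funext h⟩
  have h3 := Submodule.finrank_le (LinearMap.range φ)
  rw [h2, Module.finrank_fintype_fun_eq_card, Fintype.card_fun, Fintype.card_fin, Fintype.card_fin]
    at h1
  rw [Module.finrank_fin_fun] at h3
  omega

/-- The code is the null space computed by the program, after the indices are flattened by
`finFunctionFinEquiv`. -/
theorem finrank_codeOf_eq {m : ℕ} (H : Fin m → Tensor F n d) {h : ℕ → F}
    (hH : ∀ (a : Fin m) i, h (a * n ^ d + pos i) = H a i) {W : Submodule F (Fin (n ^ d) → F)}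
    (hW : ∀ w, w ∈ W ↔ ∀ a < m, ∑ x : Fin (n ^ d), h (a * n ^ d + x) * w x = 0) :
    Module.finrank F (codeOf H) = Module.finrank F W := by
  let e : Tensor F n d ≃ₗ[F] (Fin (n ^ d) → F) :=
    LinearEquiv.funCongrLeft F F finFunctionFinEquiv.symm
  have : codeOf H = W.comap e.toLinearMap := by
    ext T
    rw [Submodule.mem_comap, hW]
    have key (a : Fin m) : ∑ x : Fin (n ^ d), h (a * n ^ d + x) * e.toLinearMap T x =
        inner T (H a) := by
      rw [inner]
      refine Fintype.sum_equiv finFunctionFinEquiv.symm _ _ fun x => ?_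
      rw [mul_comm, ← hH, pos, Equiv.apply_symm_apply]
      rfl
    exact ⟨fun hT a ha => (key ⟨a, ha⟩).trans (hT _), fun hT a => (key a).symm.trans (hT a a.2)⟩
  rw [this, Submodule.comap_equiv_eq_map_symm]
  exact (e.symm.submoduleMap W).finrank_eq.symm

theorem input_fld_pos (r : ℕ) (Y : Tensor F n d) (i : Fin d → Fin n) :
    (input r Y).fld 0 (pos i) = Y i := by
  have h : (0 : ℕ) = 0 ∧ pos i < n ^ d := ⟨rfl, pos_lt i⟩
  change (if h : (0 : ℕ) = 0 ∧ pos i < n ^ d then Y (finFunctionFinEquiv.symm ⟨pos i, h.2⟩)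
    else 0) = Y i
  rw [dif_pos h]
  exact congrArg Y (finFunctionFinEquiv.symm_apply_apply i)

theorem input_agreeOff (r : ℕ) (Y Y' : Tensor F n d) : (input r Y).AgreeOff 0 (input r Y') :=
  ⟨rfl, fun b hb => by simp [input, hb]⟩

theorem checkFactor_ne_zero (hn : 1 ≤ n) (g : F) (r a : ℕ) (j : Fin d) :
    (checkFactor g n d r a j : Fin n → F) ≠ 0 := fun h => by
  have := congrFun h ⟨0, hn⟩
  simp [checkFactor] at this

end Tensor

/-! ## Running times -/

namespace LoopProg

variable {F : Type u} [Field F] (en : Enumeration F)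

theorem den_prelude_input {n d r : ℕ} (hn : 1 ≤ n) (hd : 2 ≤ d) (Y : Tensor F n d) :
    Params n d r (den en prelude (Tensor.input r Y)) :=
  den_prelude en hn hd (by simp [Tensor.input]) (by simp [Tensor.input]) (by simp [Tensor.input])

/-- The size in which the running times are polynomial. -/
def size (n d r : ℕ) : ℕ := (2 * n * d) ^ d * (2 * r) ^ Nat.clog 2 d

section Size

variable {n d r : ℕ}

theorem rank_le_size (hn : 1 ≤ n) (hd : 2 ≤ d) : 2 * r ≤ size n d r ∧ (2 * r) ^ Nat.clog 2 d ≤ size n d r := by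
  have h1 : 1 ≤ (2 * n * d) ^ d := Nat.one_le_pow _ _ (by positivity)
  have h2 : 2 * r ≤ (2 * r) ^ Nat.clog 2 d :=
    Nat.le_self_pow (Nat.clog_pos (by norm_num) hd).ne' _
  have h3 := Nat.le_mul_of_pos_left ((2 * r) ^ Nat.clog 2 d) h1
  exact ⟨h2.trans h3, h3⟩

theorem base_le_size (hn : 1 ≤ n) (hd : 2 ≤ d) (hr : 1 ≤ r) : (2 * n * d) ^ d ≤ size n d r ∧ (d * n) ^ d ≤ size n d r ∧
    n ^ d ≤ size n d r ∧ d * n ≤ size n d r ∧ (d * n) ^ halves d 1 ≤ size n d r := by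
  have h0 : (2 * n * d) ^ d ≤ size n d r := Nat.le_mul_of_pos_right _ (by positivity)
  have h1 : d * n ≤ 2 * n * d := by nlinarith [Nat.zero_le (d * n)]
  have h2 : (d * n) ^ d ≤ size n d r := (Nat.pow_le_pow_left h1 d).trans h0
  have hN : 0 < d * n := Nat.mul_pos (by omega) hn
  exact ⟨h0, h2, (Nat.pow_le_pow_left (Nat.le_mul_of_pos_left n (by omega)) d).trans h2,
    (Nat.le_self_pow (by omega) _).trans h2,
    (Nat.pow_le_pow_right hN (halves_le (by omega) 1)).trans h2⟩

theorem size_ge (hn : 1 ≤ n) (hd : 2 ≤ d) (hr : 1 ≤ r) : 16 ≤ size n d r := by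
  have h1 : 2 * n * d ≥ 4 := by nlinarith
  have h2 : 4 ^ 2 ≤ (2 * n * d) ^ d :=
    (Nat.pow_le_pow_left h1 2).trans (Nat.pow_le_pow_right (by omega) hd)
  exact h2.trans (base_le_size hn hd hr).1

/-- The fourth power is needed for the number of unknowns, `(r + 1)(r (d n)^d + 1) + 1`. It is of
the order of a cube, and one further factor, which is at least 16, absorbs the constants. -/
theorem Params.bounds_le (hn : 1 ≤ n) (hd : 2 ≤ d) (hr : 1 ≤ r)
    {G : Type u} {σ : Store G} (hP : Params n d r σ) :
    ∀ a ∈ sizeVars,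
      σ.nat a 0 ≤ size n d r ^ 4 := by
  obtain ⟨h1, h2⟩ := rank_le_size hn hd (r := r)
  obtain ⟨-, h3, h4, h5, h6⟩ := base_le_size hn hd hr
  have h7 := size_ge hn hd hr
  set B := size n d r with hB
  have e1 : B ≤ B ^ 4 := Nat.le_self_pow (by norm_num) _
  have e2 : B * B ≤ B ^ 4 := by rw [← sq]; exact Nat.pow_le_pow_right (by omega) (by norm_num)
  have h8 : n ≤ d * n := Nat.le_mul_of_pos_left n (by omega)
  have h9 : d ≤ d * n := Nat.le_mul_of_pos_right d hn
  have hK : Nat.clog 2 d ≤ d := clog_two_le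
  have hR : r * (d * n) ^ d + 1 ≤ B * B := by
    have := Nat.mul_le_mul (by omega : r ≤ B) h3
    nlinarith [Nat.mul_le_mul_left r h3]
  have hC : (r + 1) * (r * (d * n) ^ d + 1) + 1 ≤ B ^ 4 := by
    have := Nat.mul_le_mul (by omega : r + 1 ≤ B) hR
    have e3 : B * (B * B) * 2 ≤ B ^ 4 := by
      calc _ ≤ B * (B * B) * B := Nat.mul_le_mul_left _ (by omega)
        _ = _ := by ring
    nlinarith [Nat.mul_le_mul_left (r + 1) hR]
  simp only [List.mem_cons, List.not_mem_nil, or_false, forall_eq_or_imp, forall_eq, hP.n_eq,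
    hP.d_eq, hP.r_eq, hP.R1_eq, hP.R2_eq, hP.N_eq, hP.nd_eq, hP.W_eq, hP.K_eq, hP.RK_eq, hP.N0_eq,
    hP.M_eq, hP.R_eq, hP.C_eq, hP.Mchk_eq, hP.Tot_eq]
  exact ⟨by omega, by omega, by omega, by omega, by omega, by omega, by omega, by omega, by omega,
    by omega, by omega, (Nat.mul_le_mul h6 h6).trans e2, hR.trans e2, hC,
    (Nat.mul_le_mul h2 h5).trans e2, (Nat.mul_le_mul h2 h3).trans e2⟩

/-- With loop bounds at most `size ^ k`, the time is at most `weight` times `size` to the power `(k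
+ 1) * depth`. A single constant `c` dominates both the factor and the exponent, and it depends on
the program alone. -/
theorem exists_exec_poly (hn : 1 ≤ n) (hd : 2 ≤ d) (hr : 1 ≤ r)
    {p : LoopProg} {σ : Store F} {c k : ℕ} (hp : p.ok = true)
    (h : p.BoundsLe en (size n d r ^ k) σ) (hc : p.weight + (k + 1) * p.depth ≤ c) :
    ∃ s ≤ polyBound c n d r, Exec en p.toProg σ s (den en p σ) := by
  obtain ⟨s, hs, h1⟩ := exists_exec en hp h
  refine ⟨s, hs.trans ?_, h1⟩
  have h7 := size_ge hn hd hr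
  rw [polyBound]
  change _ ≤ c * size n d r ^ c
  have h2 : size n d r ^ k + 1 ≤ size n d r ^ (k + 1) := by
    rw [pow_succ]
    have := Nat.one_le_pow k (size n d r) (by omega)
    nlinarith
  calc _ ≤ p.weight * (size n d r ^ (k + 1)) ^ p.depth :=
        Nat.mul_le_mul_left _ (Nat.pow_le_pow_left h2 _)
    _ ≤ _ := by
        rw [← pow_mul]
        exact Nat.mul_le_mul (by omega) (Nat.pow_le_pow_right (by omega) (by omega))

end Size

theorem polyBound_mono {c c' : ℕ} (h : c ≤ c') {n d r : ℕ} (hn : 1 ≤ n) (hd : 2 ≤ d) (hr : 1 ≤ r) :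
    polyBound c n d r ≤ polyBound c' n d r := by
  have h7 : 16 ≤ (2 * n * d) ^ d * (2 * r) ^ Nat.clog 2 d := size_ge hn hd hr
  exact Nat.mul_le_mul h (Nat.pow_le_pow_right (by omega) h)

end LoopProg

/-! ## Large fields -/

namespace LoopProg

/-- The parameters and a suitable element `fG`. -/
def setup : LoopProg := prelude ;; search

/-- The parity checks over large fields. -/
def largeChecks : LoopProg := (setup ;; checks) ;; initTensors ;; extendChecks

/-- The decoder over large fields. -/
def largeDecoder : LoopProg := setup ;; decoder

theorem extend_settled : (initTensors ;; extendChecks).settled = true := by decide +kernel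
theorem largeDecoder_settled : largeDecoder.settled = true := by decide +kernel
theorem largeChecks_ok : largeChecks.ok = true := by decide +kernel
theorem largeDecoder_ok : largeDecoder.ok = true := by decide +kernel

variable {F : Type u} [Field F] (en : Enumeration F)

theorem den_setup {n d r : ℕ} (hn : 1 ≤ n) (hd : 2 ≤ d) (Y : Tensor F n d) :
    Params n d r (den en setup (Tensor.input r Y)) ∧
    (((den en setup (Tensor.input r Y)).nat vFound 0 = 1 ∧
        Good ((d * n) ^ halves d 1) ((den en setup (Tensor.input r Y)).fld fG 0)) ∨
      ((den en setup (Tensor.input r Y)).nat vFound 0 = 0 ∧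
        ENat.card F ≤ ((d * n) ^ halves d 1 : ℕ))) ∧
    (den en setup (Tensor.input r Y)).fld fIn = (Tensor.input r Y).fld fIn := by
  have hP := den_prelude_input en (r := r) hn hd Y
  have h1 := den_search en (hP.N0_eq)
  have s : Store.Same search.wn search.wf _ _ :=
    den_same en search (den en prelude (Tensor.input r Y))
  have hF : (den en prelude (Tensor.input r Y)).fld fIn = (Tensor.input r Y).fld fIn :=
    den_fld en (by decide) _
  rw [setup, den_seq]
  refine ⟨hP.of_same s (by decide), h1.imp id fun h => ⟨h.1, ?_⟩, by rw [s.2 _ (by decide), hF]⟩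
  by_contra hlt
  obtain ⟨x, hx, hx'⟩ := exists_good en (N₀ := (d * n) ^ halves d 1) (by
    have h2 : 2 ≤ d * n := by nlinarith
    exact h2.trans (Nat.le_self_pow (by have := halves_pos (d := d) (by omega) 1; omega) _))
    (not_le.mp hlt)
  exact h.2 x (by rwa [hP.M_eq]) hx'

/-- The element found on input `n, d, r`. -/
noncomputable def root (n d r : ℕ) : F :=
  (den en setup (Tensor.input r (0 : Tensor F n d))).fld fG 0

/-- The element found does not depend on the received tensor, so the decoder uses the one from which
the checks were built. -/
theorem den_setup_root {n d r : ℕ} (Y : Tensor F n d) :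
    (den en setup (Tensor.input r Y)).fld fG 0 = root en n d r ∧
    (den en setup (Tensor.input r Y)).nat = (den en setup (Tensor.input r (0 : Tensor F n d))).nat := by
  have h := den_agreeOff en (p := setup) (a := fIn) (by decide +kernel)
    (Tensor.input_agreeOff r Y (0 : Tensor F n d))
  exact ⟨congrFun (h.2 fG (by simp)) 0, h.1⟩

theorem setup_bounds {n d r : ℕ} (hn : 1 ≤ n) (hd : 2 ≤ d) (hr : 1 ≤ r) {σ : Store F}
    {p : LoopProg} (hp : p.settled = true) (hP : Params n d r (den en p σ))
    (h : ∀ a ∈ p.bds, a ∈ sizeVars ∨ (den en p σ).nat a 0 ≤ size n d r ^ 4) :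
    p.BoundsLe en (size n d r ^ 4) σ :=
  boundsLe_of_settled en hp fun a ha =>
    (h a ha).elim (hP.bounds_le hn hd hr a) id

/-- The decoder corrects errors, given a suitable element. -/
theorem den_decoder_of_mem {n d r : ℕ} {g : F} (hn : 1 ≤ n) (hd : 2 ≤ d) (hr : 1 ≤ r)
    (hg : Good ((d * n) ^ halves d 1) g) {σ : Store F} (hP : Params n d r σ)
    (hG : σ.fld fG 0 = g) {T E : Tensor F n d} (hE : Tensor.rank E ≤ r)
    (hin : ∀ i, σ.fld fIn (Tensor.pos i) = (T + E) i)
    (hT : ∀ a < (2 * r) ^ Nat.clog 2 d * (d * n),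
      Tensor.inner T (Tensor.pure (Tensor.checkFactor g n d r a)) = 0) (i : Fin d → Fin n) :
    (den en decoder σ).fld fOut (Tensor.pos i) = T i := by
  obtain ⟨v, hv⟩ := Tensor.exists_sum_pure_of_rank_le (by omega) hE
  exact den_decoder en hn hd hr hg hP hG v (by rw [← hv]) hin hT i

theorem decoder_params {n d r : ℕ} {σ : Store F} (hP : Params n d r σ) :
    Params n d r (den en decoder σ) ∧ (den en decoder σ).nat vMc 0 = σ.nat vMchk 0 ∧
      (den en decoder σ).nat vU2 0 = 1 := by
  refine ⟨hP.of_same (den_same en decoder σ) (by decide +kernel), ?_, ?_⟩ <;>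
  simp (disch := decide +kernel) [decoder, checks, den_nat]

theorem decoder_bounds {n d r : ℕ} (hn : 1 ≤ n) (hd : 2 ≤ d) (hr : 1 ≤ r) {p : LoopProg}
    {σ : Store F} (hP : Params n d r (den en p σ)) (hs : (p ;; decoder).settled = true)
    (hb : ∀ a ∈ (p ;; decoder).bds, a ∈ sizeVars ∨ a = vMc ∨ a = vU2) :
    (p ;; decoder).BoundsLe en (size n d r ^ 4) σ := by
  obtain ⟨h1, h2, h3⟩ := decoder_params en hP
  refine setup_bounds en hn hd hr hs (by rwa [den_seq]) fun a ha => (hb a ha).imp id ?_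
  rw [den_seq]
  rintro (rfl | rfl)
  · exact h2.le.trans (hP.bounds_le hn hd hr vMchk (by simp))
  · exact h3.trans_le (Nat.one_le_pow _ _ (by have := size_ge hn hd hr; omega))

theorem largeDecoder_bounds {n d r : ℕ} (hn : 1 ≤ n) (hd : 2 ≤ d) (hr : 1 ≤ r) (Y : Tensor F n d) :
    largeDecoder.BoundsLe en (size n d r ^ 4) (Tensor.input r Y) :=
  decoder_bounds en hn hd hr (den_setup en hn hd Y).1 largeDecoder_settled (by decide +kernel)

/-- The code is cut out by the checks over `F` itself together with the appended unit tensors. The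
decoder ignores the latter: orthogonality to the first `M` checks is all that it needs. -/
theorem exists_large_field_code : ∃ (c : ℕ) (con dec : Prog), ∀ (F : Type u) [Field F]
    (en : Enumeration F) (n d r : ℕ), 1 ≤ n → 2 ≤ d → 1 ≤ r →
    (((2 * n * d) ^ d : ℕ) : ℕ∞) < ENat.card F →
    ∃ (m : ℕ) (H : Fin m → Tensor F n d),
      Tensor.IsExplicitCode en con dec r (polyBound c n d r)
        (n ^ d - d * n * (2 * r) ^ Nat.clog 2 d) H ∧ ∀ a, Tensor.IsRankOne (H a) := by
  obtain ⟨c, hc₁, hc₂⟩ : ∃ c, largeChecks.weight + (4 + 1) * largeChecks.depth ≤ c ∧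
      largeDecoder.weight + (4 + 1) * largeDecoder.depth ≤ c :=
    ⟨_, le_max_left _ _, le_max_right _ _⟩
  refine ⟨c, largeChecks.toProg, largeDecoder.toProg, fun F _ en n d r hn hd hr hF => ?_⟩
  have hN : 0 < d * n := Nat.mul_pos (by omega) hn
  have h1 (Y : Tensor F n d) : Params n d r (den en setup (Tensor.input r Y)) ∧
      Good ((d * n) ^ halves d 1) (root en n d r) ∧
      (den en setup (Tensor.input r Y)).fld fIn = (Tensor.input r Y).fld fIn := by
    obtain ⟨h1, h2, h3⟩ := den_setup en (r := r) hn hd Y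
    refine ⟨h1, ?_, h3⟩
    rcases h2 with h2 | h2
    · rw [← (den_setup_root en Y).1]
      exact h2.2
    -- The search cannot fail here, since `N₀ ≤ (d n)^d ≤ (2 n d)^d < |F|`.
    · refine absurd (hF.trans_le h2.2) (not_lt.mpr (Nat.cast_le.mpr ?_))
      exact (Nat.pow_le_pow_right hN (halves_le (by omega) 1)).trans
        (Nat.pow_le_pow_left (by nlinarith) d)
  set M := (2 * r) ^ Nat.clog 2 d * (d * n) with hM
  obtain ⟨hP, hg, -⟩ := h1 0
  set σ := den en setup (Tensor.input r (0 : Tensor F n d)) with hσ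
  have hP₁ := hP.of_same (den_same en checks σ) (by decide)
  set σ₁ := den en checks σ with hσ₁
  have hO₁ : ∀ a < M, ∀ i, σ₁.fld fOut (a * n ^ d + Tensor.pos i) =
      Tensor.pure (Tensor.checkFactor (root en n d r) n d r a) i := fun a ha i => by
    rw [hσ₁, den_checks en hr hP ha, hσ, (den_setup_root en 0).1]
  have s₂ := den_same en initTensors σ₁
  have hS := Solved.initTensors en (Nat.pow_pos hn) hP₁.nd_eq
  have hlarge : den en largeChecks (Tensor.input r (0 : Tensor F n d)) =
    den en extendChecks (den en initTensors σ₁) := by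
    rw [largeChecks, den_seq, den_seq, den_seq, hσ₁]
  set σ₂ := den en initTensors σ₁ with hσ₂
  obtain ⟨m, hm, g1, g2, g3, W, g4, g5⟩ := den_extendChecks en (M := M) hS
    (by rw [s₂.1 _ (by decide), hP₁.nd_eq]) (by rw [s₂.1 _ (by decide), hP₁.Mchk_eq])
    (by rw [s₂.1 _ (by decide)]; exact hP₁.tnd_eq)
  rw [s₂.2 fOut (by decide)] at g2
  set τ := den en extendChecks σ₂ with hτ
  have s₃ := den_same en extendChecks σ₂
  rw [← hτ] at s₃
  clear_value τ σ₂ σ₁ σ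
  have hbase : ∀ a < M, ∀ i, τ.fld fOut (a * n ^ d + Tensor.pos i) =
      Tensor.pure (Tensor.checkFactor (root en n d r) n d r a) i := fun a ha i => by
    rw [g2 a ha _ (Tensor.pos_lt i), hO₁ a ha]
  -- The parity checks are defined as what the construction has written; their form is recovered
  -- afterwards from `hbase` and `g3`.
  let H : Fin m → Tensor F n d := fun a i => τ.fld fOut (a * n ^ d + Tensor.pos i)
  have hcor : Tensor.Corrects en largeDecoder.toProg r (polyBound c n d r) r (Tensor.codeOf H) := by
    intro Y
    obtain ⟨s, hs, hs'⟩ := exists_exec_poly en hn hd hr (c := c) largeDecoder_ok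
      (largeDecoder_bounds en hn hd hr Y) hc₂
    refine ⟨s, hs, _, hs', fun T hT E hE hY i => ?_⟩
    rw [largeDecoder, den_seq]
    refine den_decoder_of_mem en hn hd hr hg (h1 Y).1 (den_setup_root en Y).1 hE (fun i => ?_)
      (fun a ha => ?_) i
    · rw [(h1 Y).2.2, Tensor.input_fld_pos, hY]
    · rw [← hT ⟨a, ha.trans_le hm⟩]
      exact congrArg _ (funext fun i => (hbase a ha i).symm)
  have hfin : Module.finrank F (Tensor.codeOf H) = n ^ d - d * n * (2 * r) ^ Nat.clog 2 d := by
    rw [Tensor.finrank_codeOf_eq H (h := τ.fld fOut) (fun _ _ => rfl) g5, g4, hM, mul_comm]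
  refine ⟨m, H, ⟨hfin ▸ hcor.isRankMetricCode (one_le_two.trans hd), ?_, hcor⟩, fun a => ?_⟩
  · have hb : largeChecks.BoundsLe en (size n d r ^ 4) (Tensor.input r (0 : Tensor F n d)) := by
      have hb := largeDecoder_bounds en hn hd hr (0 : Tensor F n d)
      refine ⟨⟨hb.1, hb.2.1⟩, boundsLe_of_settled en extend_settled ?_⟩
      rw [den_seq, den_seq, ← hσ, ← hσ₁, ← hσ₂, ← hτ]
      have hbds : ∀ a ∈ (initTensors ;; extendChecks).bds, a = vnd ∨ a = vMchk ∨ a = vC := by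
        decide +kernel
      intro a ha
      rcases hbds a ha with rfl | rfl | rfl
      iterate 2
        rw [s₃.1 _ (by decide +kernel), s₂.1 _ (by decide)]
        exact hP₁.bounds_le hn hd hr _ (by decide)
      · rw [s₃.1 _ (by decide +kernel), hS.square.2.1, ← hP₁.nd_eq]
        exact hP₁.bounds_le hn hd hr vnd (by simp)
    obtain ⟨s, hs, hs'⟩ := exists_exec_poly en hn hd hr (c := c) largeChecks_ok hb hc₁
    rw [hlarge] at hs'
    exact ⟨s, hs, τ, hs', g1, fun a i => rfl⟩
  · by_cases ha : (a : ℕ) < M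
    · exact ⟨_, Tensor.checkFactor_ne_zero hn _ r a, funext fun i => hbase a ha i⟩
    · obtain ⟨x, hx, h⟩ := g3 a (not_lt.mp ha) a.2
      obtain ⟨k, rfl⟩ := Tensor.exists_pos hx
      refine ⟨fun j y => if y = k j then 1 else 0, fun j h => ?_, funext fun i => ?_⟩
      · have := congrFun h (k j)
        simp at this
      · rw [Tensor.pure_unit]
        change τ.fld fOut (a * n ^ d + Tensor.pos i) = _
        rw [h _ (Tensor.pos_lt i)]
        exact if_congr Tensor.pos_injective.eq_iff rfl rfl

end LoopProg

/-! ## Extensions of finite fields -/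

section Extensions

open Polynomial

variable {F : Type u} [Field F]

/-- The coordinates of the powers of `a` with respect to `1, a, …, a ^ (t - 1)`, if
`a ^ t = ∑ c l • a ^ l`. -/
def powerCoord (t : ℕ) (c : ℕ → F) : ℕ → ℕ → F
  | 0, l => if l = 0 then 1 else 0
  | i + 1, l => (if 0 < l then powerCoord t c i (l - 1) else 0) + powerCoord t c i (t - 1) * c l

/-- Multiplication by `a` shifts the coordinates, and the overflow at `a ^ t` is rewritten by the
relation. The relation is all that is used of `a`, so the same recursion describes powers in every
algebra where it holds. -/
theorem sum_powerCoord {A : Type*} [CommRing A] [Algebra F A] {t : ℕ} (ht : 0 < t) {c : ℕ → F}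
    {a : A} (ha : a ^ t = ∑ l ∈ Finset.range t, c l • a ^ l) (i : ℕ) :
    a ^ i = ∑ l ∈ Finset.range t, powerCoord t c i l • a ^ l := by
  obtain ⟨s, rfl⟩ := Nat.exists_eq_succ_of_ne_zero ht.ne'
  induction i with
  | zero => rw [Finset.sum_eq_single_of_mem 0 (by simp) fun l _ hl => by simp [powerCoord, hl]]
            simp [powerCoord]
  | succ i ih =>
    simp only [powerCoord, add_smul, mul_smul, Finset.sum_add_distrib, ← Finset.smul_sum, ← ha]
    rw [pow_succ, ih, Finset.sum_mul, Finset.sum_range_succ, Finset.sum_range_succ' (fun l =>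
      (if 0 < l then powerCoord _ c i (l - 1) else 0) • a ^ l)]
    simp [pow_succ]

/-- The powers of `a`, as described by `powerCoord`, are periodic with period exactly `m`. -/
def IsPeriod (t : ℕ) (c : ℕ → F) (m : ℕ) : Prop :=
  (∀ l < t, powerCoord t c m l = powerCoord t c 0 l) ∧
    ∀ k, 0 < k → k < m → ∃ l < t, powerCoord t c k l ≠ powerCoord t c 0 l

/-- The coefficients come from the minimal polynomial of a generator `a` of the multiplicative group
of an extension of degree `t`. Since `1, a, …, a^(t-1)` are independent, `a^k = 1` can be read off
the coordinates, so the period is the order of the group. -/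
theorem exists_isPeriod [Finite F] {t : ℕ} (ht : 0 < t) :
    ∃ c : ℕ → F, IsPeriod t c (Nat.card F ^ t - 1) := by
  obtain ⟨p, hp⟩ := CharP.exists F
  have : Fact p.Prime := ⟨CharP.char_is_prime F p⟩
  have : NeZero t := ⟨ht.ne'⟩
  let L := FiniteField.Extension F p t
  have hcard : Nat.card L = Nat.card F ^ t := FiniteField.natCard_extension F p t
  have : Finite L := Module.finite_of_finite F
  obtain ⟨a, ha⟩ := IsCyclic.exists_generator (α := Lˣ)
  have hord : orderOf (a : L) = Nat.card F ^ t - 1 := by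
    rw [orderOf_units, orderOf_eq_card_of_forall_mem_zpowers ha, Nat.card_units, hcard]
  have htop : IntermediateField.adjoin F {(a : L)} = ⊤ := by
    refine eq_top_iff.mpr fun y _ => ?_
    by_cases hy : y = 0
    · rw [hy]; exact zero_mem _
    · obtain ⟨k, hk⟩ := ha (Units.mk0 y hy)
      have := congrArg Units.val hk
      simp only [Units.val_mk0, Units.val_zpow_eq_zpow_val] at this
      rw [← this]
      exact zpow_mem (IntermediateField.mem_adjoin_simple_self F _) k
  have hdeg : (minpoly F (a : L)).natDegree = t := by
    rw [(Field.primitive_element_iff_minpoly_natDegree_eq F (a : L)).mp htop]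
    exact FiniteField.finrank_extension F p t
  have hint : IsIntegral F (a : L) := IsIntegral.of_finite F _
  have hli : LinearIndependent F fun l : Fin t => (a : L) ^ (l : ℕ) := by
    have := linearIndependent_pow (K := F) (a : L)
    rwa [hdeg] at this
  refine ⟨fun l => -(minpoly F (a : L)).coeff l, ?_⟩
  set c := fun l => -(minpoly F (a : L)).coeff l with hc
  have hrel : (a : L) ^ t = ∑ l ∈ Finset.range t, c l • (a : L) ^ l := by
    have h1 := minpoly.aeval F (a : L)
    rw [aeval_eq_sum_range, hdeg, Finset.sum_range_succ] at h1
    have h2 := (minpoly.monic hint).coeff_natDegree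
    rw [hdeg] at h2
    rw [h2, one_smul, add_comm] at h1
    rw [eq_neg_of_add_eq_zero_left h1]
    simp [hc]
  have key (k : ℕ) : (a : L) ^ k = 1 ↔ ∀ l < t, powerCoord t c k l = powerCoord t c 0 l := by
    constructor
    · intro h l hl
      rw [← pow_zero (a : L), sum_powerCoord ht hrel k, sum_powerCoord ht hrel 0,
        Finset.sum_range, Finset.sum_range] at h
      exact hli.eq_coords_of_eq (f := fun l : Fin t => powerCoord t c k l)
        (g := fun l : Fin t => powerCoord t c 0 l) h ⟨l, hl⟩
    · intro h
      rw [← pow_zero (a : L), sum_powerCoord ht hrel k, sum_powerCoord ht hrel 0]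
      exact Finset.sum_congr rfl fun l hl => by rw [h l (Finset.mem_range.mp hl)]
  refine ⟨(key _).mp (hord ▸ pow_orderOf_eq_one _), fun k hk hk' => ?_⟩
  by_contra! h
  exact absurd (Nat.le_of_dvd hk (orderOf_dvd_of_pow_eq_one ((key k).mpr h))) (by omega)

/-- A finite extension field of `F` in coordinates, with nonzero elements `x ^ i`, `i < m`. -/
structure PowerField (F : Type u) [Field F] (t m : ℕ) (c : ℕ → F) where
  carrier : Type u
  [field : Field carrier]
  [algebra : Algebra F carrier]
  x : carrier
  vec : carrier ≃ₗ[F] (Fin t → F)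
  vec_pow : ∀ i l, vec (x ^ i) l = powerCoord t c i l
  vec_algebraMap : ∀ y l, vec (algebraMap F carrier y) l = if (l : ℕ) = 0 then y else 0
  sum_vec : ∀ y, y = ∑ l, vec y l • x ^ (l : ℕ)
  pow_eq : x ^ m = 1
  pow_ne : ∀ k, 0 < k → k < m → x ^ k ≠ 1
  exists_pow : ∀ y ≠ 0, ∃ i < m, x ^ i = y

attribute [instance] PowerField.field PowerField.algebra

/-- Irreducibility is not tested. In `F[X]` modulo the polynomial given by `c`, the class `x` of the
variable has order `q^t - 1`. Its powers are that many different units, so they exhaust the nonzero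
elements, and the quotient is a field. -/
theorem exists_powerField [Finite F] {t : ℕ} (ht : 0 < t) {c : ℕ → F}
    (hc : IsPeriod t c (Nat.card F ^ t - 1)) :
    Nonempty (PowerField F t (Nat.card F ^ t - 1) c) := by
  set m := Nat.card F ^ t - 1 with hm
  have hF : 1 < Nat.card F := Finite.one_lt_card
  have hm2 : 0 < m := by
    have := Nat.le_self_pow ht.ne' (Nat.card F)
    omega
  let s : F[X] := ∑ l ∈ Finset.range t, C (c l) * X ^ l
  have hs : s.degree < (X ^ t : F[X]).degree := by
    rw [degree_X_pow]
    exact (degree_sum_le _ _).trans_lt ((Finset.sup_lt_iff (WithBot.bot_lt_coe t)).mpr fun l hl =>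
      (degree_C_mul_X_pow_le l _).trans_lt (WithBot.coe_lt_coe.mpr (by simpa using hl)))
  let g : F[X] := X ^ t - s
  have hg : g.Monic := (monic_X_pow t).sub_of_left hs
  have hdeg : g.natDegree = t := by
    rw [natDegree_eq_of_degree_eq (degree_sub_eq_left_of_degree_lt hs), natDegree_X_pow]
  let A := AdjoinRoot g
  let x : A := AdjoinRoot.root g
  let b : Module.Basis (Fin t) F A := (AdjoinRoot.powerBasis' hg).basis.reindex (finCongr hdeg)
  have hb (l : Fin t) : b l = x ^ (l : ℕ) := by
    rw [Module.Basis.reindex_apply, PowerBasis.basis_eq_pow]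
    rfl
  have hrel : x ^ t = ∑ l ∈ Finset.range t, c l • x ^ l := by
    have h1 : AdjoinRoot.mk g g = 0 := AdjoinRoot.mk_self
    have h2 : AdjoinRoot.mk g g = x ^ t - ∑ l ∈ Finset.range t, c l • x ^ l := by
      simp only [g, s, map_sub, map_sum, map_mul, map_pow, AdjoinRoot.mk_X, AdjoinRoot.mk_C,
        Algebra.smul_def]
      rfl
    rw [h2] at h1
    exact sub_eq_zero.mp h1
  have hvec (i : ℕ) (l : Fin t) : b.equivFun (x ^ i) l = powerCoord t c i l := by
    have h1 : x ^ i = ∑ l : Fin t, powerCoord t c i l • b l := by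
      simp only [hb]
      rw [sum_powerCoord ht hrel i, Finset.sum_range]
    rw [h1, ← b.equivFun_symm_apply fun l : Fin t => powerCoord t c i l,
      LinearEquiv.apply_symm_apply]
  have key (k : ℕ) : x ^ k = 1 ↔ ∀ l < t, powerCoord t c k l = powerCoord t c 0 l := by
    rw [← pow_zero x, ← b.equivFun.injective.eq_iff, funext_iff]
    simp only [hvec]
    exact ⟨fun h l hl => h ⟨l, hl⟩, fun h l => h l l.2⟩
  have hone : x ^ m = 1 := (key m).mpr hc.1
  have hne : ∀ k, 0 < k → k < m → x ^ k ≠ 1 := fun k h1 h2 h3 => by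
    obtain ⟨l, hl, h4⟩ := hc.2 k h1 h2
    exact h4 ((key k).mp h3 l hl)
  have hfin : Finite A := Finite.of_equiv _ b.equivFun.symm.toEquiv
  have := Fintype.ofFinite A
  have := Fintype.ofFinite F
  classical
  have hcard : Fintype.card A = m + 1 := by
    rw [Fintype.card_congr b.equivFun.toEquiv, Fintype.card_fun, Fintype.card_fin,
      ← Nat.card_eq_fintype_card]
    omega
  have hunit : IsUnit x := .of_pow_eq_one hone hm2.ne'
  have : Nontrivial A := Fintype.one_lt_card_iff_nontrivial.mp (by omega)
  have hord : orderOf x = m := by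
    refine (orderOf_eq_iff hm2).mpr ⟨hone, fun k hk hk' => hne k hk' hk⟩
  -- The quotient has `m + 1` elements, and the `m` distinct powers of `x` avoid zero.
  have hpow : ∀ y : A, y ≠ 0 → ∃ i < m, x ^ i = y := fun y hy => by
    have h1 : (Finset.range m).image (x ^ ·) = Finset.univ.erase (0 : A) := by
      refine Finset.eq_of_subset_of_card_le (fun z hz => ?_) ?_
      · obtain ⟨i, -, rfl⟩ := Finset.mem_image.mp hz
        exact Finset.mem_erase.mpr ⟨(hunit.pow i).ne_zero, Finset.mem_univ _⟩
      · rw [Finset.card_erase_of_mem (Finset.mem_univ _), Finset.card_univ, hcard,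
          Finset.card_image_of_injOn (fun i hi j hj h => ?_), Finset.card_range]
        · omega
        · exact pow_injOn_Iio_orderOf (by simpa [hord] using hi) (by simpa [hord] using hj) h
    have h2 : y ∈ (Finset.range m).image (x ^ ·) := by rw [h1]; simp [hy]
    simpa using h2
  have hfield : IsField A := ⟨⟨0, 1, zero_ne_one⟩, mul_comm, fun {y} hy => by
    obtain ⟨i, -, rfl⟩ := hpow y hy
    obtain ⟨z, hz⟩ := (hunit.pow i).exists_right_inv
    exact ⟨z, hz⟩⟩
  let _ : Field A := hfield.toField
  exact ⟨{ carrier := A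
           x := x
           vec := b.equivFun
           vec_pow := hvec
           vec_algebraMap := fun y l => by
             rw [Algebra.algebraMap_eq_smul_one, map_smul, Pi.smul_apply, ← pow_zero x]
             refine (congrArg (y • ·) (hvec 0 l)).trans ?_
             simp [powerCoord]
           sum_vec := fun y => by simpa only [hb] using (b.sum_equivFun y).symm
           pow_eq := hone
           pow_ne := hne
           exists_pow := hpow }⟩

end Extensions

/-! ## Simulation of computations over an extension field -/

/-- Addresses in the simulation: array `a` of numbers becomes array `4 * a`. -/
def NatExpr.simulate : NatExpr → NatExpr
  | lit k => lit k
  | get a i => get (4 * a) i.simulate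
  | add x y => add x.simulate y.simulate
  | sub x y => sub x.simulate y.simulate

/-- The code of a field element: array `a` of field elements becomes array `4 * a + 1`. -/
def FieldExpr.simulate : FieldExpr → NatExpr
  | zero => nv vQc
  | one => 0
  | get a i => .get (4 * a + 1) i.simulate
  | add x y => .get tAdd (.get tOq x.simulate + y.simulate)
  | sub x y => .get tSub (.get tOq x.simulate + y.simulate)
  | mul x y => .get tMul (.get tOq x.simulate + y.simulate)
  | inv x => .get tInv (.get tOq x.simulate)
  | first => 0
  | next _ => 0

/-- The simulation of a test. -/
def Test.simulate : Test → Test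
  | natLt x y => .natLt x.simulate y.simulate
  | fieldEq x y => .natEq x.simulate y.simulate
  | not b => .not b.simulate
  | and b c => .and b.simulate c.simulate

/-- The expression does not use the enumeration. -/
def FieldExpr.plain : FieldExpr → Bool
  | zero => true
  | one => true
  | get _ _ => true
  | add x y => x.plain && y.plain
  | sub x y => x.plain && y.plain
  | mul x y => x.plain && y.plain
  | inv x => x.plain
  | first => false
  | next _ => false

/-- The test does not use the enumeration. -/
def Test.plain : Test → Bool
  | natLt _ _ => true
  | fieldEq x y => x.plain && y.plain
  | not b => b.plain
  | and b c => b.plain && c.plain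

namespace LoopProg

/-- The simulation of a program. -/
def simulate : LoopProg → LoopProg
  | skip => skip
  | setN a i x => setN (4 * a) i.simulate x.simulate
  | setF a i x => setN (4 * a + 1) i.simulate x.simulate
  | seq p q => seq p.simulate q.simulate
  | ite b p q => ite b.simulate p.simulate q.simulate
  | loop v a p => loop (4 * v) (4 * a) p.simulate

/-- The program does not use the enumeration. -/
def plain : LoopProg → Bool
  | skip => true
  | setN _ _ _ => true
  | setF _ _ x => x.plain
  | seq p q => p.plain && q.plain
  | ite b p q => b.plain && p.plain && q.plain
  | loop _ _ p => p.plain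

end LoopProg

section Simulation

variable {F : Type u} {K : Type u} {D : ℕ → K} {Q : ℕ}

/-- The store `τ` over `F` represents the store `σ` over `K`; its other contents are those of
`τ₀`. -/
structure Simulates (D : ℕ → K) (Q : ℕ) (τ₀ : Store F) (σ : Store K) (τ : Store F) : Prop where
  nat : ∀ a i, τ.nat (4 * a) i = σ.nat a i
  fld : ∀ a i, τ.nat (4 * a + 1) i < Q ∧ D (τ.nat (4 * a + 1) i) = σ.fld a i
  rest : ∀ a, a % 4 = 3 → τ.nat a = τ₀.nat a
  fld_eq : τ.fld = τ₀.fld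

namespace Simulates

variable {τ₀ τ : Store F} {σ : Store K}

theorem setNat (h : Simulates D Q τ₀ σ τ) (a i v : ℕ) : Simulates D Q τ₀ (σ.setNat a i v) (τ.setNat (4 * a) i v) := by
  refine ⟨fun b j => ?_, fun b j => ?_, fun b hb => funext fun j => ?_, h.fld_eq⟩
  · simp [h.nat]
  · have : 4 * b + 1 ≠ 4 * a := by omega
    simpa [this] using h.fld b j
  · have : b ≠ 4 * a := by omega
    simp [this, h.rest b hb]

theorem setFld (h : Simulates D Q τ₀ σ τ) (a i : ℕ) {v : ℕ} (hv : v < Q) :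
    Simulates D Q τ₀ (σ.setFld a i (D v)) (τ.setNat (4 * a + 1) i v) := by
  refine ⟨fun b j => ?_, fun b j => ?_, fun b hb => funext fun j => ?_, h.fld_eq⟩
  · have : 4 * b ≠ 4 * a + 1 := by omega
    simp [this, h.nat]
  · by_cases hb : b = a ∧ j = i
    · simp [hb, hv]
    · simpa [hb] using h.fld b j
  · have : b ≠ 4 * a + 1 := by omega
    simp [this, h.rest b hb]

theorem natExpr (h : Simulates D Q τ₀ σ τ) (x : NatExpr) : x.simulate.eval τ = x.eval σ := by
  induction x with
  | lit k => rfl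
  | get a i ih => simp only [NatExpr.simulate, NatExpr.eval, ih, h.nat]
  | add x y hx hy => simp only [NatExpr.simulate, NatExpr.eval, hx, hy]
  | sub x y hx hy => simp only [NatExpr.simulate, NatExpr.eval, hx, hy]

end Simulates

variable [Field K]

/-- The tables for the arithmetic of `K`, whose elements are `D 0, …, D (Q - 1)`. -/
structure Tables (D : ℕ → K) (Q : ℕ) (σ : Store F) : Prop where
  inj : ∀ i < Q, ∀ j < Q, D i = D j → i = j
  zero : σ.nat vQc 0 < Q ∧ D (σ.nat vQc 0) = 0
  one : D 0 = 1
  add : ∀ i < Q, ∀ j < Q, σ.nat tAdd (σ.nat tOq i + j) < Q ∧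
    D (σ.nat tAdd (σ.nat tOq i + j)) = D i + D j
  sub : ∀ i < Q, ∀ j < Q, σ.nat tSub (σ.nat tOq i + j) < Q ∧
    D (σ.nat tSub (σ.nat tOq i + j)) = D i - D j
  mul : ∀ i < Q, ∀ j < Q, σ.nat tMul (σ.nat tOq i + j) < Q ∧
    D (σ.nat tMul (σ.nat tOq i + j)) = D i * D j
  inv : ∀ i < Q, σ.nat tInv (σ.nat tOq i) < Q ∧ D (σ.nat tInv (σ.nat tOq i)) = (D i)⁻¹

namespace Simulates

variable {τ₀ τ : Store F} {σ : Store K}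

/-- Each arithmetic operation becomes a lookup at `i Q + j`. Keeping all codes below `Q` is part of
the claim, as the tables are correct only there. -/
theorem fieldExpr (h : Simulates D Q τ₀ σ τ) (hT : Tables D Q τ₀) (en : Enumeration K)
    {x : FieldExpr} (hx : x.plain = true) : x.simulate.eval τ < Q ∧
    D (x.simulate.eval τ) = x.eval en σ := by
  induction x with
  | zero => simpa [FieldExpr.simulate, FieldExpr.eval, h.rest] using hT.zero
  | one => exact ⟨(Nat.zero_le _).trans_lt hT.zero.1, hT.one⟩
  | get a i => simpa [FieldExpr.simulate, FieldExpr.eval, h.natExpr] using h.fld a (i.eval σ)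
  | first => simp [FieldExpr.plain] at hx
  | next => simp [FieldExpr.plain] at hx
  | inv x ih =>
    have h1 := ih hx
    simpa [FieldExpr.simulate, FieldExpr.eval, h.rest, h1.2] using hT.inv _ h1.1
  | add x y ihx ihy =>
    simp only [FieldExpr.plain, Bool.and_eq_true] at hx
    have h1 := ihx hx.1
    have h2 := ihy hx.2
    simpa [FieldExpr.simulate, FieldExpr.eval, h.rest, h1.2, h2.2] using hT.add _ h1.1 _ h2.1
  | sub x y ihx ihy =>
    simp only [FieldExpr.plain, Bool.and_eq_true] at hx
    have h1 := ihx hx.1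
    have h2 := ihy hx.2
    simpa [FieldExpr.simulate, FieldExpr.eval, h.rest, h1.2, h2.2] using hT.sub _ h1.1 _ h2.1
  | mul x y ihx ihy =>
    simp only [FieldExpr.plain, Bool.and_eq_true] at hx
    have h1 := ihx hx.1
    have h2 := ihy hx.2
    simpa [FieldExpr.simulate, FieldExpr.eval, h.rest, h1.2, h2.2] using hT.mul _ h1.1 _ h2.1

theorem test [Field F] (h : Simulates D Q τ₀ σ τ) (hT : Tables D Q τ₀) (en : Enumeration K)
    (enF : Enumeration F) {b : Test}
    (hb : b.plain = true) : b.simulate.Holds enF τ ↔ b.Holds en σ := by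
  induction b with
  | natLt x y => simp only [Test.simulate, Test.Holds, h.natExpr]
  | fieldEq x y =>
    simp only [Test.plain, Bool.and_eq_true] at hb
    have h1 := h.fieldExpr hT en hb.1
    have h2 := h.fieldExpr hT en hb.2
    simp only [Test.simulate, Test.holds_and, Test.holds_not, Test.holds_natLt, not_lt,
      Test.holds_fieldEq, ← h1.2, ← h2.2]
    exact ⟨fun e => by rw [le_antisymm e.1 e.2], fun e => by
      rw [hT.inj _ h1.1 _ h2.1 e]; exact ⟨le_rfl, le_rfl⟩⟩
  | not b ih => simp only [Test.simulate, Test.Holds, ih hb]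
  | and b c ihb ihc =>
    simp only [Test.plain, Bool.and_eq_true] at hb
    simp only [Test.simulate, Test.Holds, ihb hb.1, ihc hb.2]

/-- A simulated program writes only to arrays `4 a` and `4 a + 1`, hence never to the tables. Loop
bounds are numbers and are copied literally, so the bounds on the running time carry over too.
Programs that call the enumeration are excluded, since there are no tables for it. -/
theorem den [Field F] (h : Simulates D Q τ₀ σ τ) (hT : Tables D Q τ₀) (en : Enumeration K)
    (enF : Enumeration F) {X : ℕ} {p : LoopProg} (hp : p.plain = true) :
    Simulates D Q τ₀ (p.den en σ) (p.simulate.den enF τ) ∧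
      (p.BoundsLe en X σ → p.simulate.BoundsLe enF X τ) := by
  induction p generalizing σ τ with
  | skip => exact ⟨h, id⟩
  | setN a i x =>
    refine ⟨?_, id⟩
    simp only [LoopProg.simulate, LoopProg.den_setN, h.natExpr]
    exact h.setNat _ _ _
  | setF a i x =>
    refine ⟨?_, id⟩
    have h1 := h.fieldExpr hT en hp
    simp only [LoopProg.simulate, LoopProg.den_setN, LoopProg.den_setF, h.natExpr, ← h1.2]
    exact h.setFld _ _ h1.1
  | seq p q ihp ihq =>
    simp only [LoopProg.plain, Bool.and_eq_true] at hp
    have h1 := ihp h hp.1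
    have h2 := ihq h1.1 hp.2
    exact ⟨h2.1, fun hb => ⟨h1.2 hb.1, h2.2 hb.2⟩⟩
  | ite b p q ihp ihq =>
    simp only [LoopProg.plain, Bool.and_eq_true] at hp
    have hb := h.test hT en enF hp.1.1
    have h1 := ihp h hp.1.2
    have h2 := ihq h hp.2
    refine ⟨?_, fun hB => ⟨fun g => h1.2 (hB.1 (hb.mp g)), fun g => h2.2 (hB.2 (g ∘ hb.mpr))⟩⟩
    by_cases g : b.Holds en σ
    · rw [LoopProg.den_ite_pos en g, LoopProg.simulate, LoopProg.den_ite_pos enF (hb.mpr g)]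
      exact h1.1
    · rw [LoopProg.den_ite_neg en g, LoopProg.simulate, LoopProg.den_ite_neg enF (g ∘ hb.mp)]
      exact h2.1
  | loop v a p ih =>
    have key (k : ℕ) : Simulates D Q τ₀ (LoopProg.iter (p.den en) v k σ)
        (LoopProg.iter (p.simulate.den enF) (4 * v) k τ) := by
      induction k with
      | zero => exact h.setNat _ _ _
      | succ k ihk => exact (ih ihk hp).1.setNat _ _ _
    refine ⟨?_, fun hB => ⟨(h.nat a 0).trans_le hB.1, fun i hi => (ih (key i) hp).2 (hB.2 i ?_)⟩⟩
    · rw [LoopProg.simulate, LoopProg.den, LoopProg.den, h.nat]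
      exact key _
    · rwa [← h.nat]

end Simulates

end Simulation

/-- An enumeration of a finite type. -/
theorem Enumeration.nonempty_of_finite (K : Type u) [Nonempty K] [Finite K] :
    Nonempty (Enumeration K) := by
  let e := Finite.equivFin K
  have : NeZero (Nat.card K) := ⟨Nat.card_pos.ne'⟩
  have key (i : ℕ) : (fun x => e.symm (e x + 1))^[i] (e.symm 0) = e.symm (Fin.ofNat _ i) := by
    induction i with
    | zero => rfl
    | succ i ih =>
      rw [Function.iterate_succ_apply', ih, Equiv.apply_symm_apply]
      congr 1
      ext
      simp [Fin.val_add, Fin.ofNat]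
  refine ⟨⟨e.symm 0, fun x => e.symm (e x + 1), fun i j hi hj h => ?_⟩⟩
  rw [ENat.card_eq_coe_natCard] at hi hj
  rw [key, key] at h
  have := congrArg Fin.val (e.symm.injective h)
  simpa [Fin.ofNat, Nat.mod_eq_of_lt (show i < Nat.card K by exact_mod_cast hi),
    Nat.mod_eq_of_lt (show j < Nat.card K by exact_mod_cast hj)] using this

/-! ## The extension field as a table -/

namespace LoopProg

/-- List the elements of a small field, without repetitions. -/
def listField : LoopProg :=
  letN vQ 0 ;; letF fT1 .first ;;
  loop vX vN0 (
    letN vEq 0 ;;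
    loop vY vN0 (skip ;; ite (.and (.natLt (nv vY) (nv vQ))
      (.fieldEq (.get fLst (nv vY)) (fv fT1))) (letN vEq 1) skip) ;;
    ite (.natEq (nv vEq) 0) (setF fLst (nv vQ) (fv fT1) ;; letN vQ (nv vQ + 1)) skip ;;
    letF fT1 (.next (fv fT1)))

/-- The degree `vTt` and the order `vQT` of an extension with more than `vN0` elements. -/
def fieldSizes : LoopProg :=
  letN vTt 0 ;; letN vQT 1 ;;
  loop vX vN0 (ite (.natLe (nv vQT) (nv vN0))
    (mulProg vW2 vY vQ vQT ;; letN vQT (nv vW2) ;; letN vTt (nv vTt + 1)) skip)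

/-- Offsets, and the table of the number of which `fNz` is nonzero. -/
def fieldOffsets : LoopProg :=
  letN vQc (nv vQT - 1) ;; multiples tOt vX vQT vTt ;; multiples tOq vX vQT vQT ;;
  divTable tQb tRb vX vQT vQ ;; loop vL vTt (setF fNz (nv vL) 1) ;; setF fNz 0 0

/-- Compare two rows of length `vTt`. -/
def sameRow (a b : FieldExpr) : LoopProg :=
  letN vEq 1 ;; loop vY vTt (skip ;; ite (.not (.fieldEq a b)) (letN vEq 0) skip)

/-- The last among the first rows of `fRws` that is equal to the row given by `e`. -/
def lookup (b : ℕ) (e : FieldExpr) : LoopProg :=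
  letN vSt 0 ;; loop vX b (sameRow (.get fRws (.get tOt (nv vX) + nv vY)) e ;;
    ite (.natEq (nv vEq) 1) (letN vSt (nv vX)) skip)

/-- The coefficients with number `vCand`. -/
def coefficients : LoopProg :=
  letN vCur (nv vCand) ;;
  loop vJ vTt (setF fCf (nv vJ) (.get fLst (.get tRb (nv vCur))) ;; letN vCur (.get tQb (nv vCur)))

/-- The coordinates of powers. -/
def powerRows : LoopProg :=
  loop vL vTt (setF fRws (nv vL) (1 - .get fNz (nv vL))) ;;
  loop vX vQc (letF fT1 (.get fRws (.get tOt (nv vX) + (nv vTt - 1))) ;;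
    loop vL vTt (setF fRws (.get tOt (nv vX + 1) + nv vL)
      (.get fNz (nv vL) * .get fRws (.get tOt (nv vX) + (nv vL - 1)) + fv fT1 * .get fCf (nv vL))))

/-- Test for the largest possible period. -/
def testPeriod : LoopProg :=
  lookup vQc (.get fRws (nv vY)) ;;
  sameRow (.get fRws (.get tOt (nv vQc) + nv vY)) (.get fRws (nv vY)) ;;
  ite (.and (.natEq (nv vEq) 1) (.natEq (nv vSt) 0)) (letN vFw 1) skip

/-- Find coefficients that define a field with a primitive element. -/
def findField : LoopProg :=
  letN vFw 0 ;; loop vCand vQT (ite (.natEq (nv vFw) 0) (coefficients ;; powerRows ;; testPeriod) skip)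

variable {F : Type u} [Field F] (en : Enumeration F)

/-- The last index with the property wins. The same rule serves searches, where its value is stored,
and comparisons, where only a flag is set. -/
theorem loop_ite {v b x : ℕ} {body : LoopProg} {B : Test} {e : NatExpr} {σ : Store F}
    (hx : x ∉ v :: body.wn) (P : ℕ → Prop) (f : ℕ → ℕ)
    (h : ∀ i < σ.nat b 0, ∀ τ, Store.Same (v :: x :: body.wn) body.wf σ τ → τ.nat v 0 = i →
      (B.Holds en (den en body τ) ↔ P i) ∧ e.eval (den en body τ) = f i) :
    (∃ i < σ.nat b 0, (P i ∧ ∀ j < σ.nat b 0, i < j → ¬ P j) ∧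
      (den en (loop v b (body ;; ite B (letN x e) skip)) σ).nat x 0 = f i) ∨
    ((∀ i < σ.nat b 0, ¬ P i) ∧
      (den en (loop v b (body ;; ite B (letN x e) skip)) σ).nat x 0 = σ.nat x 0) := by
  simp only [List.mem_cons, not_or] at hx
  refine den_loop en (fun k τ => (∃ i < k, (P i ∧ ∀ j < k, i < j → ¬ P j) ∧ τ.nat x 0 = f i) ∨
    ((∀ i < k, ¬ P i) ∧ τ.nat x 0 = σ.nat x 0)) (Or.inr ⟨by simp, by simp [hx.1]⟩)
    fun k hk τ hτ hv hI => ?_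
  have h1 := h k hk τ ⟨fun a ha => hτ.1 a (by
    simp only [wn, List.mem_cons, List.mem_append, List.not_mem_nil, not_or] at ha ⊢; tauto),
    fun a ha => hτ.2 a (by simp only [wf, List.append_nil]; exact ha)⟩ hv
  have h2 : (den en body τ).nat x = τ.nat x := den_nat en hx.2 τ
  by_cases hP : P k
  · rw [den_seq, den_ite_pos en (h1.1.mpr hP)]
    exact Or.inl ⟨k, by omega, ⟨hP, fun j _ _ => by omega⟩, by simp [hx.1, h1.2]⟩
  · rw [den_seq, den_ite_neg en (fun h => hP (h1.1.mp h))]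
    rcases hI with ⟨i, hi, h3, h4⟩ | ⟨h3, h4⟩
    · refine Or.inl ⟨i, by omega, ⟨h3.1, fun j hj hij => ?_⟩, by simp [hx.1, h2, h4]⟩
      rcases Nat.lt_succ_iff_lt_or_eq.mp hj with h5 | rfl
      exacts [h3.2 j h5 hij, hP]
    · refine Or.inr ⟨fun i hi => ?_, by simp [hx.1, h2, h4]⟩
      rcases Nat.lt_succ_iff_lt_or_eq.mp hi with h5 | rfl
      exacts [h3 i h5, hP]

/-- The loop makes `N₀ ≥ |F|` steps, and nothing is known about the enumeration after it has
exhausted the field. Repetitions are therefore skipped, and the length of the list is the number of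
elements. -/
theorem den_listField {N₀ : ℕ} {σ : Store F} (hN : σ.nat vN0 0 = N₀)
    (hF : ENat.card F ≤ N₀) :
    ∃ _ : Finite F, (den en listField σ).nat vQ 0 = Nat.card F ∧
      ∀ y, ∃ i < Nat.card F, (den en listField σ).fld fLst i = y := by
  have hfin : Finite F := by
    by_contra h
    rw [not_finite_iff_infinite] at h
    simp at hF
  refine ⟨hfin, ?_⟩
  rw [ENat.card_eq_coe_natCard] at hF
  have hF' : Nat.card F ≤ N₀ := by exact_mod_cast hF
  simp only [listField, den_seq]
  set σ₁ := den en (letF fT1 .first) (den en (letN vQ 0) σ) with hσ₁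
  have hN₁ : σ₁.nat vN0 0 = N₀ := by simp [hσ₁, hN]
  have key := den_loop en (v := vX) (a := vN0) (p := letN vEq 0 ;;
    loop vY vN0 (skip ;; ite (.and (.natLt (nv vY) (nv vQ))
      (.fieldEq (.get fLst (nv vY)) (fv fT1))) (letN vEq 1) skip) ;;
    ite (.natEq (nv vEq) 0) (setF fLst (nv vQ) (fv fT1) ;; letN vQ (nv vQ + 1)) skip ;;
    letF fT1 (.next (fv fT1))) (σ := σ₁)
    (fun k τ => τ.fld fT1 0 = en.next^[k] en.first ∧ τ.nat vQ 0 ≤ k ∧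
      Set.InjOn (τ.fld fLst) (Set.Iio (τ.nat vQ 0)) ∧
      ∀ i < k, ∃ j < τ.nat vQ 0, τ.fld fLst j = en.next^[i] en.first)
    (by simp [hσ₁])
    (fun k hk τ hτ hv ⟨h1, h2, h3, h4⟩ => by
      set x := en.next^[k] en.first with hx
      have hxs : en.next x = en.next^[k + 1] en.first := by rw [Function.iterate_succ_apply']
      simp only [den_seq]
      set τ₁ := den en (letN vEq 0) τ with hτ₁
      have s₁ : Store.Same [vEq] [] τ τ₁ := same_of_eq en hτ₁
      have hNτ : τ₁.nat vN0 0 = N₀ := by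
        rw [s₁.1 _ (by simp), hτ.1 _ (by simp [wn]), hN₁]
      have g := loop_ite en (v := vY) (b := vN0) (x := vEq) (body := skip) (e := 1)
        (B := .and (.natLt (nv vY) (nv vQ)) (.fieldEq (.get fLst (nv vY)) (fv fT1))) (σ := τ₁)
        (by simp [wn]) (fun i => i < τ.nat vQ 0 ∧ τ.fld fLst i = x) (fun _ => 1)
        (fun i _ υ hυ hvi => by simp [hυ.1, hυ.2, hvi, wn, wf, s₁.1, s₁.2, h1])
      have s₂ : Store.Same [vY, vEq] [] τ₁ _ := den_same en (loop vY vN0 (skip ;;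
        ite (.and (.natLt (nv vY) (nv vQ)) (.fieldEq (.get fLst (nv vY)) (fv fT1)))
          (letN vEq 1) skip)) τ₁
      set τ₂ := den en (loop vY vN0 (skip ;; ite (.and (.natLt (nv vY) (nv vQ))
        (.fieldEq (.get fLst (nv vY)) (fv fT1))) (letN vEq 1) skip)) τ₁ with hτ₂
      clear_value τ₂
      have hEq₁ : τ₁.nat vEq 0 = 0 := by simp [hτ₁]
      rw [hNτ, hEq₁] at g
      have hQ₂ : τ₂.nat vQ 0 = τ.nat vQ 0 := by rw [s₂.1 _ (by simp), s₁.1 _ (by simp)]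
      have hL₂ : τ₂.fld = τ.fld := funext fun a => by rw [s₂.2 _ (by simp), s₁.2 _ (by simp)]
      rw [hN₁] at hk
      rcases g with ⟨i, hi, ⟨hP, -⟩, hE⟩ | ⟨hP, hE⟩
      · rw [den_ite_neg en (by simp [hE])]
        refine ⟨by simp [hL₂, h1, hxs], by simp [hQ₂]; omega, fun i hi j hj hij => by
            simp [hQ₂, hL₂] at hi hj hij; exact h3 hi hj hij, fun l hl => ?_⟩
        rcases Nat.lt_succ_iff_lt_or_eq.mp hl with h | rfl
        · simpa [hQ₂, hL₂] using h4 l h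
        · exact ⟨i, by simpa [hQ₂] using hP.1, by simpa [hL₂] using hP.2⟩
      · rw [den_ite_pos en (by simp [hE])]
        have hnot : ∀ i < τ.nat vQ 0, τ.fld fLst i ≠ x := fun i hi he => hP i (by omega) ⟨hi, he⟩
        refine ⟨by simp [hL₂, h1, hxs], by simp [hQ₂]; omega, ?_, fun l hl => ?_⟩
        · intro i hi j hj hij
          simp only [den_seq, den_setN, den_setF, Store.fld_setNat, Store.fld_setFld, hL₂, h1,
            NatExpr.eval_get, NatExpr.eval_ofNat, hQ₂, Set.mem_Iio, FieldExpr.eval_get] at hi hj hij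
          simp [hQ₂] at hi hj
          by_cases hi' : i = τ.nat vQ 0 <;> by_cases hj' : j = τ.nat vQ 0
          · omega
          · simp [hi', hj'] at hij
            exact absurd hij.symm (hnot j (by omega))
          · simp [hi', hj'] at hij
            exact absurd hij (hnot i (by omega))
          · simp [hi', hj'] at hij
            exact h3 (show i < τ.nat vQ 0 by omega) (show j < τ.nat vQ 0 by omega) hij
        · rcases Nat.lt_succ_iff_lt_or_eq.mp hl with h | rfl
          · obtain ⟨j, hj, hj'⟩ := h4 l h
            exact ⟨j, by simp [hQ₂]; omega, by simp [hQ₂, hL₂, hj.ne, hj']⟩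
          · exact ⟨τ.nat vQ 0, by simp [hQ₂], by simp [hQ₂, hL₂, h1, hx]⟩)
  rw [hN₁] at key
  obtain ⟨-, -, h3, h4⟩ := key
  set τ := den en (loop vX vN0 _) σ₁ with hτ
  have hsurj : ∀ y, ∃ j < τ.nat vQ 0, τ.fld fLst j = y := fun y => by
    obtain ⟨i, hi, rfl⟩ := en.surjective y
    exact h4 i (by omega)
  have hcard : τ.nat vQ 0 = Nat.card F := by
    have hb : Function.Bijective fun j : Fin (τ.nat vQ 0) => τ.fld fLst j :=
      ⟨fun i j h => Fin.ext (h3 i.2 j.2 h), fun y => by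
        obtain ⟨j, hj, h⟩ := hsurj y
        exact ⟨⟨j, hj⟩, h⟩⟩
    rw [← Nat.card_congr (Equiv.ofBijective _ hb), Nat.card_fin]
  exact ⟨hcard, by rwa [← hcard]⟩

/-- `t` is the least exponent with `q^t > N₀`. Then `q^(t-1) ≤ N₀`, which bounds `t` logarithmically
and gives `q^t ≤ q N₀ ≤ N₀²`. The search ends within `N₀` rounds because `q^(N₀) > N₀`. -/
theorem den_fieldSizes {N₀ q : ℕ} {σ : Store F} (hN : σ.nat vN0 0 = N₀) (hq : σ.nat vQ 0 = q)
    (h2 : 2 ≤ q) (hqN : q ≤ N₀) :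
    ∃ t, 0 < t ∧ (den en fieldSizes σ).nat vTt 0 = t ∧ (den en fieldSizes σ).nat vQT 0 = q ^ t ∧
      N₀ < q ^ t ∧ 2 ^ (t - 1) ≤ N₀ ∧ q ^ t ≤ N₀ * N₀ := by
  simp only [fieldSizes, den_seq]
  set σ₁ := den en (letN vQT 1) (den en (letN vTt 0) σ) with hσ₁
  have hN₁ : σ₁.nat vN0 0 = N₀ := by simp [hσ₁, hN]
  have key := den_loop en (v := vX) (a := vN0) (p := ite (.natLe (nv vQT) (nv vN0))
    (mulProg vW2 vY vQ vQT ;; letN vQT (nv vW2) ;; letN vTt (nv vTt + 1)) skip) (σ := σ₁)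
    (fun k τ => τ.nat vQT 0 = q ^ τ.nat vTt 0 ∧ (k ≤ τ.nat vTt 0 ∨ N₀ < q ^ τ.nat vTt 0) ∧
      (0 < τ.nat vTt 0 → q ^ (τ.nat vTt 0 - 1) ≤ N₀)) (by simp [hσ₁])
    (fun k hk τ hτ hv ⟨h1, h3, h4⟩ => by
      have e1 : τ.nat vN0 0 = N₀ := by rw [hτ.1 _ (by simp [wn, mulProg]), hN₁]
      have e2 : τ.nat vQ 0 = q := by
        rw [hτ.1 _ (by simp [wn, mulProg])]; simp [hσ₁, hq]
      by_cases hle : q ^ τ.nat vTt 0 ≤ N₀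
      · rw [den_ite_pos en (by simpa [e1, h1] using hle)]
        have hm := den_mulProg en (dst := vW2) (v := vY) (b := vQ) (y := vQT) (by simp) (by simp)
          (by simp) (by simp) τ
        have hT : (den en (mulProg vW2 vY vQ vQT) τ).nat vTt = τ.nat vTt :=
          den_nat en (by simp [wn, mulProg]) τ
        simp only [den_seq, den_setN, Store.nat_setNat, NatExpr.eval_get, NatExpr.eval_ofNat,
          NatExpr.eval_add]
        simp [hm, hT, e2, h1, pow_succ', hle]
        omega
      · rw [den_ite_neg en (by simpa [e1, h1] using hle)]
        simpa [h1] using ⟨Or.inr (by omega), h4⟩)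
  rw [hN₁] at key
  set τ := den en (loop vX vN0 _) σ₁ with hτ
  obtain ⟨h1, h3, h4⟩ := key
  have hlt : N₀ < q ^ τ.nat vTt 0 := h3.elim (fun h => h.trans_lt (Nat.lt_pow_self (by omega))) id
  have hpos : 0 < τ.nat vTt 0 := Nat.pos_of_ne_zero fun h0 => by rw [h0] at hlt; simp at hlt; omega
  refine ⟨_, hpos, rfl, h1, hlt, (Nat.pow_le_pow_left h2 _).trans (h4 hpos), ?_⟩
  calc q ^ τ.nat vTt 0 = q ^ (τ.nat vTt 0 - 1) * q := by
        rw [← pow_succ, Nat.sub_add_cancel hpos]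
    _ ≤ _ := Nat.mul_le_mul (h4 hpos) hqN

end LoopProg

/-! ## The search for the extension field -/

namespace LoopProg

theorem findField_wn : findField.wn = [vFw, vCand, vCur, vJ, vCur, vL, vX, vL, vSt, vX, vEq, vY, vEq,
    vSt, vEq, vY, vEq, vFw] := rfl
theorem findField_wf : findField.wf = [fCf, fRws, fT1, fRws] := rfl

/-- The sizes and offsets for the extension field are in place. -/
structure Sized {F : Type u} [Field F] (q t Q : ℕ) (σ : Store F) : Prop where
  t_eq : σ.nat vTt 0 = t
  Q_eq : σ.nat vQT 0 = Q
  m_eq : σ.nat vQc 0 = Q - 1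
  ot : ∀ i ≤ Q, σ.nat tOt i = i * t
  oq : ∀ i ≤ Q, σ.nat tOq i = i * Q
  qb : ∀ i ≤ Q, σ.nat tQb i = i / q
  rb : ∀ i ≤ Q, σ.nat tRb i = i % q
  nz : ∀ l < t, σ.fld fNz l = if l = 0 then 0 else 1

variable {F : Type u} [Field F] (en : Enumeration F) {q t Q : ℕ} {σ : Store F}

theorem Sized.of_same {τ : Store F} {wn wf : List ℕ} (s : Store.Same wn wf σ τ)
    (h1 : ∀ a ∈ [vTt, vQT, vQc, tOt, tOq, tQb, tRb], a ∉ wn) (h2 : fNz ∉ wf)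
    (h : Sized q t Q σ) : Sized q t Q τ := by
  simp only [List.mem_cons, List.not_mem_nil, or_false, forall_eq_or_imp, forall_eq] at h1
  obtain ⟨g1, g2, g3, g4, g5, g6, g7⟩ := h1
  obtain ⟨f1, f2, f3, f4, f5, f6, f7, f8⟩ := h
  constructor
  case nz => rwa [s.2 _ h2]
  all_goals rw [s.1 _ (by assumption)]; assumption

theorem den_fieldOffsets (ht : σ.nat vTt 0 = t) (hQ : σ.nat vQT 0 = Q) (hq : σ.nat vQ 0 = q)
    (h0 : 0 < q) : Sized q t Q (den en fieldOffsets σ) := by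
  simp only [fieldOffsets, den_seq]
  set σ₁ := den en (letN vQc (nv vQT - 1)) σ with hσ₁
  have s₁ : Store.Same [vQc] [] σ σ₁ := same_of_eq en hσ₁
  have h1 : σ₁.nat vQc 0 = Q - 1 := by simp [hσ₁, hQ]
  clear_value σ₁
  have h2 : ∀ i ≤ Q, _ := fun i hi => den_multiples en (arr := tOt) (v := vX) (b := vQT) (w := vTt)
    (by simp) (by simp) (by simp) (by simp) σ₁ (i := i) (by rwa [s₁.1 _ (by simp), hQ])
  have s₂ : Store.Same [tOt, vX, tOt] [] σ₁ (den en (multiples tOt vX vQT vTt) σ₁) :=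
    den_same en (multiples tOt vX vQT vTt) σ₁
  set σ₂ := den en (multiples tOt vX vQT vTt) σ₁
  clear_value σ₂
  have h3 : ∀ i ≤ Q, _ := fun i hi => den_multiples en (arr := tOq) (v := vX) (b := vQT) (w := vQT)
    (by simp) (by simp) (by simp) (by simp) σ₂ (i := i)
    (by rwa [s₂.1 _ (by simp), s₁.1 _ (by simp), hQ])
  have s₃ : Store.Same [tOq, vX, tOq] [] σ₂ (den en (multiples tOq vX vQT vQT) σ₂) :=
    den_same en (multiples tOq vX vQT vQT) σ₂
  set σ₃ := den en (multiples tOq vX vQT vQT) σ₂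
  clear_value σ₃
  have hq₃ : σ₃.nat vQ 0 = q := by
    rw [s₃.1 _ (by simp), s₂.1 _ (by simp), s₁.1 _ (by simp), hq]
  have h4 : ∀ i ≤ Q, _ := fun i hi => den_divTable en (qu := tQb) (rm := tRb) (v := vX) (b := vQT)
    (w := vQ) (by simp) σ₃ (by rwa [hq₃]) (i := i)
    (by rwa [s₃.1 _ (by simp), s₂.1 _ (by simp), s₁.1 _ (by simp), hQ])
  have s₄ := den_same en (divTable tQb tRb vX vQT vQ) σ₃
  rw [divTable_wn] at s₄
  set σ₄ := den en (divTable tQb tRb vX vQT vQ) σ₃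
  clear_value σ₄
  have h5 := loop_setF en (v := vL) (a := vTt) (A := fNz) (idx := nv vL) (e := 1) (σ := σ₄) id
    (fun _ => 1) (fun _ _ _ _ h => h) (fun i _ τ _ hv _ => by simp [hv])
  have ht₄ : σ₄.nat vTt 0 = t := by
    rw [s₄.1 _ (by simp), s₃.1 _ (by simp), s₂.1 _ (by simp), s₁.1 _ (by simp), ht]
  rw [ht₄] at h5
  have s₅ : Store.Same [vL] [fNz] σ₄ (den en (loop vL vTt (setF fNz (nv vL) 1)) σ₄) :=
    den_same en (loop vL vTt (setF fNz (nv vL) 1)) σ₄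
  set σ₅ := den en (loop vL vTt (setF fNz (nv vL) 1)) σ₄
  clear_value σ₅
  refine ⟨?_, ?_, ?_, fun i hi => ?_, fun i hi => ?_, fun i hi => ?_, fun i hi => ?_,
    fun l hl => ?_⟩
  · simp [s₅.1, ht₄]
  · simp [s₅.1, s₄.1, s₃.1, s₂.1, s₁.1, hQ]
  · simp [s₅.1, s₄.1, s₃.1, s₂.1, h1]
  · simp [s₅.1, s₄.1, s₃.1, h2 i hi, s₁.1, ht]
  · simp [s₅.1, s₄.1, h3 i hi, s₂.1, s₁.1, hQ]
  · simp [s₅.1, (h4 i hi).1, hq₃]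
  · simp [s₅.1, (h4 i hi).2, hq₃]
  · have := h5.1 l hl
    by_cases h0 : l = 0 <;> simp_all

theorem den_sameRow {a b : FieldExpr} {f g : ℕ → F} (ht : σ.nat vTt 0 = t)
    (h : ∀ l < t, ∀ τ, Store.Same [vY, vEq] [] σ τ → τ.nat vY 0 = l →
      a.eval en τ = f l ∧ b.eval en τ = g l) :
    (den en (sameRow a b) σ).nat vEq 0 = 1 ↔ ∀ l < t, f l = g l := by
  rw [sameRow, den_seq]
  set σ₁ := den en (letN vEq 1) σ with hσ₁
  have s₁ : Store.Same [vEq] [] σ σ₁ := same_of_eq en hσ₁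
  have ht₁ : σ₁.nat vTt 0 = t := by rw [s₁.1 _ (by simp), ht]
  have key := loop_ite en (v := vY) (b := vTt) (x := vEq) (body := skip) (e := 0) (σ := σ₁)
    (B := .not (.fieldEq a b)) (by simp [wn]) (fun l => f l ≠ g l) (fun _ => 0)
    (fun l hl τ hτ hv => by
      have := h l (by rwa [← ht₁]) τ ⟨fun c hc => by
        rw [hτ.1 c hc, s₁.1 c (by simp at hc ⊢; tauto)], fun c _ => by
        rw [hτ.2 c (by simp [wf]), s₁.2 c (by simp)]⟩ hv
      simp [this])
  rw [ht₁] at key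
  rcases key with ⟨i, hi, ⟨h1, -⟩, h2⟩ | ⟨h1, h2⟩
  · rw [h2]
    exact iff_of_false (by simp) fun h3 => h1 (h3 i hi)
  · rw [h2]
    exact iff_of_true (by simp [hσ₁]) fun l hl => not_not.mp (h1 l hl)

theorem den_lookup {b B : ℕ} {e : FieldExpr} {f : ℕ → F} (hS : Sized q t Q σ)
    (hb : σ.nat b 0 = B) (hB : B ≤ Q)
    (h : ∀ l < t, ∀ τ, Store.Same [vSt, vX, vEq, vY] [] σ τ → τ.nat vY 0 = l → e.eval en τ = f l)
    (hb' : b ≠ vSt := by simp) :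
    (∃ i < B, ((∀ l < t, σ.fld fRws (i * t + l) = f l) ∧
        ∀ j < B, i < j → ¬ ∀ l < t, σ.fld fRws (j * t + l) = f l) ∧
      (den en (lookup b e) σ).nat vSt 0 = i) ∨
      ((∀ i < B, ¬ ∀ l < t, σ.fld fRws (i * t + l) = f l) ∧
        (den en (lookup b e) σ).nat vSt 0 = 0) := by
  rw [lookup, den_seq]
  set σ₁ := den en (letN vSt 0) σ with hσ₁
  have s₁ : Store.Same [vSt] [] σ σ₁ := same_of_eq en hσ₁
  have hb₁ : σ₁.nat b 0 = B := by rw [s₁.1 _ (by simpa using hb'), hb]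
  have h0 : σ₁.nat vSt 0 = 0 := by simp [hσ₁]
  clear_value σ₁
  have key := loop_ite en (v := vX) (b := b) (x := vSt) (e := nv vX) (σ := σ₁)
    (body := sameRow (.get fRws (.get tOt (nv vX) + nv vY)) e) (B := .natEq (nv vEq) 1)
    (by simp [wn, sameRow]) (fun i => ∀ l < t, σ.fld fRws (i * t + l) = f l) (fun i => i)
    (fun i hi τ hτ hv => by
      simp only [sameRow, wn, wf, List.append_nil, List.nil_append, List.cons_append] at hτ
      have h1 := den_sameRow en (t := t) (σ := τ) (a := .get fRws (.get tOt (nv vX) + nv vY))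
        (b := e) (f := fun l => σ.fld fRws (i * t + l)) (g := f)
        (by rw [hτ.1 _ (by simp), s₁.1 _ (by simp), hS.t_eq]) (fun l hl υ hυ hvl => by
          refine ⟨?_, h l hl υ ⟨fun c hc => ?_, fun c _ => ?_⟩ hvl⟩
          · simp [hυ.1, hυ.2, hτ.1, hτ.2, s₁.1, s₁.2, hv, hvl, hS.ot i (by omega)]
          · simp only [List.mem_cons, List.not_mem_nil, or_false, not_or] at hc
            rw [hυ.1 c (by simp [hc]), hτ.1 c (by simp [hc]), s₁.1 c (by simp [hc])]
          · rw [hυ.2 c (by simp), hτ.2 c (by simp), s₁.2 c (by simp)])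
      refine ⟨?_, by
        rw [NatExpr.eval_get, den_nat en (by simp [sameRow, wn])]; exact hv⟩
      rw [← h1]
      simp only [Test.natEq, Test.holds_and, Test.holds_not, Test.holds_natLt, NatExpr.eval_get,
        NatExpr.eval_ofNat]
      omega)
  rwa [hb₁, h0] at key

/-- A candidate is a number below `q^t`; its digits in base `q` choose the coefficients from the
list of elements. -/
theorem den_coefficients (hS : Sized q t Q σ) (h : σ.nat vCand 0 ≤ Q) {j : ℕ}
    (hj : j < t) : (den en coefficients σ).fld fCf j =
      σ.fld fLst (σ.nat vCand 0 / q ^ j % q) := by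
  rw [coefficients, den_seq]
  set x := σ.nat vCand 0 with hx
  set σ₁ := den en (letN vCur (nv vCand)) σ with hσ₁
  have s₁ : Store.Same [vCur] [] σ σ₁ := same_of_eq en hσ₁
  have key := den_loop en (v := vJ) (a := vTt) (σ := σ₁)
    (p := setF fCf (nv vJ) (.get fLst (.get tRb (nv vCur))) ;; letN vCur (.get tQb (nv vCur)))
    (fun k τ => τ.nat vCur 0 = x / q ^ k ∧
      ∀ j < k, τ.fld fCf j = σ.fld fLst (x / q ^ j % q)) (by simp [hσ₁, hx])
    (fun k hk τ hτ hv ⟨h1, h2⟩ => by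
      simp only [wn, wf, List.nil_append, List.append_nil] at hτ
      have hle : x / q ^ k ≤ Q := (Nat.div_le_self _ _).trans h
      refine ⟨by simp [h1, hτ.1, s₁.1, hS.qb _ hle, Nat.div_div_eq_div_mul, pow_succ],
        fun j hj => ?_⟩
      rcases Nat.lt_succ_iff_lt_or_eq.mp hj with h3 | rfl
      · simp [hv, h3.ne, h2 j h3]
      · simp [hv, h1, hτ.1, hτ.2, s₁.1, s₁.2, hS.rb _ hle])
  rw [s₁.1 _ (by simp), hS.t_eq] at key
  exact key.2 j hj

/-- For `l = 0` the truncated `l - 1` points to a wrong cell; the factor `fNz`, which is zero there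
and one elsewhere, removes that term without a test. -/
theorem den_powerRows (hS : Sized q t Q σ) (ht : 0 < t) {i l : ℕ} (hi : i < Q) (hl : l < t) :
    (den en powerRows σ).fld fRws (i * t + l) = powerCoord t (σ.fld fCf) i l := by
  rw [powerRows, den_seq]
  have h0 := loop_setF en (v := vL) (a := vTt) (A := fRws) (idx := nv vL)
    (e := 1 - .get fNz (nv vL)) (σ := σ) id (fun l => 1 - σ.fld fNz l) (fun _ _ _ _ h => h)
    (fun i _ τ hτ hv _ => by simp [hv, hτ.2])
  rw [hS.t_eq] at h0
  have s₁ : Store.Same [vL] [fRws] σ _ :=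
    den_same en (loop vL vTt (setF fRws (nv vL) (1 - .get fNz (nv vL)))) σ
  set σ₁ := den en (loop vL vTt (setF fRws (nv vL) (1 - .get fNz (nv vL)))) σ
  clear_value σ₁
  have key := den_loop en (v := vX) (a := vQc) (σ := σ₁)
    (p := letF fT1 (.get fRws (.get tOt (nv vX) + (nv vTt - 1))) ;;
      loop vL vTt (setF fRws (.get tOt (nv vX + 1) + nv vL)
        (.get fNz (nv vL) * .get fRws (.get tOt (nv vX) + (nv vL - 1)) + fv fT1 * .get fCf (nv vL))))
    (fun k τ => ∀ i ≤ k, ∀ l < t, τ.fld fRws (i * t + l) = powerCoord t (σ.fld fCf) i l)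
    (fun i hi l hl => by
      obtain rfl : i = 0 := by omega
      have := h0.1 l hl
      simp only [id] at this
      rw [den_fld en (p := letN vX 0) (by simp [wf]) σ₁ |>.symm] at this
      simp only [den_setN, Store.fld_setNat] at this
      rw [Store.fld_setNat, zero_mul, zero_add, this, hS.nz l hl, powerCoord]
      by_cases h : l = 0 <;> simp [h])
    (fun k hk τ hτ hv hI i hi l hl => by
      simp only [wn, wf, List.nil_append, List.cons_append] at hτ
      have hSτ : Sized q t Q τ := (hS.of_same s₁ (by simp) (by simp)).of_same hτ (by simp) (by simp)
      rw [s₁.1 _ (by simp), hS.m_eq] at hk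
      rw [den_seq]
      set τ₁ := den en (letF fT1 (.get fRws (.get tOt (nv vX) + (nv vTt - 1)))) τ with hτ₁
      have u₁ : Store.Same [] [fT1] τ τ₁ := same_of_eq en hτ₁
      have hT : τ₁.fld fT1 0 = powerCoord t (σ.fld fCf) k (t - 1) := by
        rw [← hI k le_rfl _ (by omega)]
        simp [hτ₁, hv, hSτ.ot k (by omega), hSτ.t_eq]
      clear_value τ₁
      have h1 := loop_setF en (v := vL) (a := vTt) (A := fRws)
        (idx := .get tOt (nv vX + 1) + nv vL) (σ := τ₁) (e := .get fNz (nv vL) *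
          .get fRws (.get tOt (nv vX) + (nv vL - 1)) + fv fT1 * .get fCf (nv vL))
        (fun l => (k + 1) * t + l) (fun l => powerCoord t (σ.fld fCf) (k + 1) l)
        (fun _ _ _ _ h => Nat.add_left_cancel h) (fun l hl υ hυ hvl hj => by
          rw [u₁.1 _ (by simp), hSτ.t_eq] at hl
          -- Row `k` is still intact while row `k + 1` is being written, because the cells of
          -- different rows are disjoint.
          have h3 := hj (k * t + (l - 1)) (fun i' hi' h => by
            have := (add_mul_inj (c := t) (by omega) (by omega) h).1
            omega)
          rw [u₁.2 _ (by simp), hI k le_rfl _ (by omega)] at h3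
          have h4 : υ.fld fNz l = if l = 0 then 0 else 1 := by
            rw [hυ.2 _ (by simp), u₁.2 _ (by simp), hSτ.nz l hl]
          have h5 : υ.fld fCf l = σ.fld fCf l := by
            rw [hυ.2 _ (by simp), u₁.2 _ (by simp), hτ.2 _ (by simp), s₁.2 _ (by simp)]
          have h6 : υ.fld fT1 0 = _ := (congrFun (hυ.2 fT1 (by simp)) 0).trans hT
          refine ⟨by simp [hυ.1, u₁.1, hv, hvl, hSτ.ot (k + 1) (by omega)], ?_⟩
          simp only [FieldExpr.eval_add, FieldExpr.eval_mul, FieldExpr.eval_get, NatExpr.eval_add,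
            NatExpr.eval_sub, NatExpr.eval_get, NatExpr.eval_ofNat, hvl, h4, h5, h6, hυ.1 vX, hv,
            hυ.1 tOt, u₁.1, hSτ.ot k (by omega), h3, powerCoord, List.mem_cons, List.not_mem_nil,
            not_false_eq_true, or_false, Nat.reduceEqDiff]
          by_cases h0 : l = 0
          · simp [h0]
          · simp [h0, Nat.pos_of_ne_zero h0])
      rw [u₁.1 _ (by simp), hSτ.t_eq] at h1
      rw [Store.fld_setNat]
      rcases Nat.le_succ_iff.mp hi with h2 | rfl
      · rw [h1.2 _ fun l' hl' h => by
          have := (add_mul_inj hl hl' h).1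
          omega, u₁.2 _ (by simp), hI i h2 l hl]
      · exact h1.1 l hl)
  rw [s₁.1 _ (by simp), hS.m_eq] at key
  exact key i (by omega) l hl

/-- The lookup returns the last row below `m = Q - 1` that equals row 0. It is row 0 itself exactly
when there is no earlier return, and the comparison of row `m` with row 0 confirms the period. -/
theorem den_testPeriod (hS : Sized q t Q σ) (hQ : 2 ≤ Q) {c : ℕ → F}
    (hR : ∀ i < Q, ∀ l < t, σ.fld fRws (i * t + l) = powerCoord t c i l) (hF : σ.nat vFw 0 = 0) :
    (den en testPeriod σ).nat vFw 0 = 1 ∧ IsPeriod t c (Q - 1) ∨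
      (den en testPeriod σ).nat vFw 0 = 0 ∧ ¬ IsPeriod t c (Q - 1) := by
  have hR0 (l : ℕ) (hl : l < t) := hR 0 (by omega) l hl
  simp only [zero_mul, zero_add] at hR0
  simp only [testPeriod, den_seq]
  have h1 := den_lookup en (b := vQc) (e := .get fRws (nv vY)) (f := powerCoord t c 0) hS hS.m_eq
    (by omega) (fun l hl τ hτ hv => by simp [hv, hτ.2, hR0 l hl])
  have s₁ : Store.Same [vSt, vX, vEq, vY, vEq, vSt] [] σ _ :=
    den_same en (lookup vQc (.get fRws (nv vY))) σ
  set σ₁ := den en (lookup vQc (.get fRws (nv vY))) σ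
  clear_value σ₁
  have h2 := den_sameRow en (a := .get fRws (.get tOt (nv vQc) + nv vY)) (b := .get fRws (nv vY))
    (t := t) (σ := σ₁) (f := powerCoord t c (Q - 1)) (g := powerCoord t c 0)
    (by rw [s₁.1 _ (by simp), hS.t_eq]) (fun l hl τ hτ hv => by
      simp [hv, hτ.1, hτ.2, s₁.1, s₁.2, hR0 l hl, hS.m_eq, hS.ot (Q - 1) (by omega),
        hR (Q - 1) (by omega) l hl])
  have s₂ : Store.Same [vEq, vY, vEq] [] σ₁ _ :=
    den_same en (sameRow (.get fRws (.get tOt (nv vQc) + nv vY)) (.get fRws (nv vY))) σ₁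
  set σ₂ := den en (sameRow (.get fRws (.get tOt (nv vQc) + nv vY)) (.get fRws (nv vY))) σ₁
  clear_value σ₂
  have hF₂ : σ₂.nat vFw 0 = 0 := by rw [s₂.1 _ (by simp), s₁.1 _ (by simp), hF]
  have h3 : σ₂.nat vSt 0 = 0 ↔ ∀ k, 0 < k → k < Q - 1 →
      ∃ l < t, powerCoord t c k l ≠ powerCoord t c 0 l := by
    rw [s₂.1 _ (by simp)]
    rcases h1 with ⟨i, hi, ⟨h1, h1'⟩, h5⟩ | ⟨h1, -⟩
    · rw [h5]
      refine ⟨fun h k hk hk' => ?_, fun h => ?_⟩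
      · have := h1' k hk' (by omega)
        push Not at this
        obtain ⟨l, hl, h6⟩ := this
        exact ⟨l, hl, by rwa [← hR k (by omega) l hl]⟩
      · by_contra h0
        obtain ⟨l, hl, h6⟩ := h i (Nat.pos_of_ne_zero h0) hi
        exact h6 (by rw [← hR i (by omega) l hl, h1 l hl])
    · exact absurd (fun l hl => by rw [hR 0 (by omega) l hl]) (h1 0 (by omega))
  have h4 : IsPeriod t c (Q - 1) ↔ σ₂.nat vEq 0 = 1 ∧ σ₂.nat vSt 0 = 0 := by rw [h2, h3, IsPeriod]
  by_cases h : IsPeriod t c (Q - 1)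
  · have := h4.mp h
    rw [den_ite_pos en (by simp [this])]
    exact Or.inl ⟨by simp, h⟩
  · have := h4.not.mp h
    rw [den_ite_neg en (by
      simp only [Test.natEq, Test.holds_and, Test.holds_not, Test.holds_natLt, NatExpr.eval_get,
        NatExpr.eval_ofNat]
      omega)]
    exact Or.inr ⟨hF₂, h⟩

end LoopProg

/-! ## The arithmetic of the extension field -/

section PowerField

variable {F : Type u} [Field F] {t m : ℕ} {c c' : ℕ → F}

theorem powerCoord_congr (h : ∀ l < t, c l = c' l) (i : ℕ) :
    ∀ l < t, powerCoord t c i l = powerCoord t c' i l := by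
  induction i with
  | zero => exact fun l _ => rfl
  | succ i ih =>
    exact fun l hl => by rw [powerCoord, powerCoord, ih _ (by omega), h l hl, ih (t - 1) (by omega)]

theorem IsPeriod.congr (h : ∀ l < t, c l = c' l) (hc : IsPeriod t c m) : IsPeriod t c' m := by
  have h1 := powerCoord_congr h
  refine ⟨fun l hl => by rw [← h1 _ l hl, ← h1 _ l hl, hc.1 l hl], fun k hk hk' => ?_⟩
  obtain ⟨l, hl, h2⟩ := hc.2 k hk hk'
  exact ⟨l, hl, by rwa [← h1 _ l hl, ← h1 _ l hl]⟩

namespace PowerField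

variable (P : PowerField F t m c)

/-- The element with code `i`: the codes of the nonzero elements are their exponents. -/
def dec (i : ℕ) : P.carrier := if i < m then P.x ^ i else 0

theorem dec_lt {i : ℕ} (h : i < m) : P.dec i = P.x ^ i := if_pos h

@[simp] theorem dec_self : P.dec m = 0 := if_neg (lt_irrefl m)

theorem x_ne_zero (hm : 0 < m) : P.x ≠ 0 := fun h => by
  have := P.pow_eq
  rw [h, zero_pow hm.ne'] at this
  exact zero_ne_one this

theorem dec_inj {i j : ℕ} (hi : i < m + 1) (hj : j < m + 1) (h : P.dec i = P.dec j) : i = j := by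
  wlog hij : i ≤ j generalizing i j
  · exact (this hj hi h.symm (by omega)).symm
  by_contra hne
  have hm : 0 < m := by omega
  have h0 : P.x ^ i ≠ 0 := pow_ne_zero _ (P.x_ne_zero hm)
  rw [P.dec_lt (by omega)] at h
  by_cases hjm : j < m
  · rw [P.dec_lt hjm, ← Nat.sub_add_cancel hij, pow_add] at h
    exact P.pow_ne (j - i) (by omega) (by omega) (mul_right_cancel₀ h0 (h.symm.trans (one_mul _).symm))
  · rw [dec, if_neg hjm] at h
    exact h0 h

theorem exists_dec (y : P.carrier) : ∃ i < m + 1, P.dec i = y := by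
  by_cases hy : y = 0
  · exact ⟨m, by omega, by rw [dec_self, hy]⟩
  · obtain ⟨i, hi, h⟩ := P.exists_pow y hy
    exact ⟨i, by omega, by rw [P.dec_lt hi, h]⟩

end PowerField

end PowerField

namespace LoopProg

/-- Fill the table `A`, with offsets `T`, by values computed by `body`. -/
def fill (b₁ b₂ T A : ℕ) (body : LoopProg) : LoopProg :=
  loop vI b₁ (loop vJ b₂ (body ;; setN A (.get T (nv vI) + nv vJ) (nv vSt)))

/-- Put zeros after the last power. -/
def zeroPower : LoopProg := loop vL vTt (setF fRws (.get tOt (nv vQc) + nv vL) 0)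

/-- The code of the product. -/
def mulCode : LoopProg :=
  ite (.and (.natLt (nv vI) (nv vQc)) (.natLt (nv vJ) (nv vQc)))
    (ite (.natLt (nv vI + nv vJ) (nv vQc)) (letN vSt (nv vI + nv vJ))
      (letN vSt (nv vI + nv vJ - nv vQc)))
    (letN vSt (nv vQc))

/-- The code of the inverse. -/
def invCode : LoopProg :=
  ite (.and (.natLt 0 (nv vI)) (.natLt (nv vI) (nv vQc))) (letN vSt (nv vQc - nv vI))
    (letN vSt (nv vI))

/-- A coordinate of the element with code `x`. -/
abbrev coord (x : NatExpr) : FieldExpr := .get fRws (.get tOt x + nv vY)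

/-- The tables of the arithmetic operations. -/
def arithmetic : LoopProg :=
  fill vQT vQT tOq tAdd (lookup vQT (coord (nv vI) + coord (nv vJ))) ;;
  fill vQT vQT tOq tSub (lookup vQT (coord (nv vI) - coord (nv vJ))) ;;
  fill vQT vQT tOq tMul mulCode ;; fill vQT vQT tOq tInv invCode

/-- The extension field. -/
def fieldTables : LoopProg :=
  listField ;; fieldSizes ;; fieldOffsets ;; findField ;; zeroPower ;; arithmetic

variable {F : Type u} [Field F] (en : Enumeration F) {q t m : ℕ} {c : ℕ → F} {σ : Store F}

/-- Once a candidate has succeeded, the remaining rounds do nothing, so the rows of its powers stay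
in place. The search succeeds because suitable coefficients exist and every vector of coefficients
occurs among the candidates. -/
theorem den_findField [Finite F] (hS : Sized (Nat.card F) t (Nat.card F ^ t) σ) (ht : 0 < t)
    (hL : ∀ y, ∃ i < Nat.card F, σ.fld fLst i = y) :
    ∃ c, IsPeriod t c (Nat.card F ^ t - 1) ∧ ∀ i < Nat.card F ^ t, ∀ l < t,
      (den en findField σ).fld fRws (i * t + l) = powerCoord t c i l := by
  set q := Nat.card F with hq
  have hq1 : 1 < q := Finite.one_lt_card
  have hQ : 2 ≤ q ^ t := hq1.trans_le (Nat.le_self_pow ht.ne' q)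
  rw [findField, den_seq]
  set σ₁ := den en (letN vFw 0) σ with hσ₁
  have s₁ : Store.Same [vFw] [] σ σ₁ := same_of_eq en hσ₁
  have hF₁ : σ₁.nat vFw 0 = 0 := by simp [hσ₁]
  have hS₁ := hS.of_same s₁ (by simp) (by simp)
  clear_value σ₁
  let cand (x j : ℕ) := σ.fld fLst (x / q ^ j % q)
  have key := den_loop en (v := vCand) (a := vQT) (σ := σ₁)
    (p := ite (.natEq (nv vFw) 0) (coefficients ;; powerRows ;; testPeriod) skip)
    (fun k τ => (τ.nat vFw 0 = 1 ∧ ∃ c, IsPeriod t c (q ^ t - 1) ∧ ∀ i < q ^ t, ∀ l < t,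
        τ.fld fRws (i * t + l) = powerCoord t c i l) ∨
      (τ.nat vFw 0 = 0 ∧ ∀ x < k, ¬ IsPeriod t (cand x) (q ^ t - 1))) (by simp [hF₁])
    (fun k hk τ hτ hv hI => by
      have e : findField.wn = vFw :: vCand ::
        (ite (.natEq (nv vFw) 0) (coefficients ;; powerRows ;; testPeriod) skip).wn := rfl
      replace hτ : Store.Same findField.wn findField.wf σ τ := ⟨fun a ha => by
        rw [e, List.mem_cons, not_or] at ha
        rw [hτ.1 a ha.2, s₁.1 a (by simpa using ha.1)], fun a ha => by
        rw [hτ.2 a ha, s₁.2 a (by simp)]⟩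
      rw [findField_wn, findField_wf] at hτ
      rw [hS₁.Q_eq] at hk
      rcases hI with ⟨h1, h2⟩ | ⟨h1, h2⟩
      · rw [den_ite_neg en (by simp [h1])]
        exact Or.inl ⟨by simp [h1], h2⟩
      · rw [den_ite_pos en (by simp [h1])]
        have hSτ := hS.of_same hτ (by simp) (by simp)
        simp only [den_seq]
        have g1 : ∀ j < t, (den en coefficients τ).fld fCf j = cand k j := fun j hj => by
          rw [den_coefficients en hSτ (by rw [hv]; exact hk.le) hj, hv, hτ.2 _ (by simp)]
        have u₁ : Store.Same [vCur, vJ, vCur] [fCf] τ (den en coefficients τ) :=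
          den_same en coefficients τ
        set τ₁ := den en coefficients τ
        clear_value τ₁
        have g2 : ∀ i < q ^ t, ∀ l < t, _ := fun i hi l hl =>
          den_powerRows en (hSτ.of_same u₁ (by simp) (by simp)) ht hi hl
        have u₂ : Store.Same [vL, vX, vL] [fRws, fT1, fRws] τ₁ (den en powerRows τ₁) :=
          den_same en powerRows τ₁
        set τ₂ := den en powerRows τ₁
        clear_value τ₂
        have hF₂ : τ₂.nat vFw 0 = 0 := by rw [u₂.1 _ (by simp), u₁.1 _ (by simp), h1]
        have hS₂ := (hSτ.of_same u₁ (by simp) (by simp)).of_same u₂ (by simp) (by simp)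
        have u₃ : (den en testPeriod τ₂).fld fRws = τ₂.fld fRws := den_fld en (by simp [testPeriod,
          lookup, sameRow, wf]) τ₂
        rcases den_testPeriod en hS₂ hQ g2 hF₂ with ⟨h3, h4⟩ | ⟨h3, h4⟩
        · exact Or.inl ⟨by simp [h3], _, h4, by simpa [u₃] using g2⟩
        · refine Or.inr ⟨by simp [h3], fun x hx h5 => ?_⟩
          rcases Nat.lt_succ_iff_lt_or_eq.mp hx with h6 | rfl
          · exact h2 x h6 h5
          · exact h4 (h5.congr fun l hl => (g1 l hl).symm))
  rw [hS₁.Q_eq] at key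
  rcases key with ⟨-, h⟩ | ⟨-, h⟩
  · exact h
  · exfalso
    -- The number of the candidate whose digits select the coefficients `c`; it would have passed
    -- the test.
    obtain ⟨c, hc⟩ := exists_isPeriod (F := F) ht
    choose f hf hf' using hL
    let i : Fin t → Fin q := fun j => ⟨f (c j), hf _⟩
    refine h (Tensor.pos i) (Tensor.pos_lt i) (hc.congr fun l hl => ?_)
    change _ = σ.fld fLst (Tensor.pos i / q ^ l % q)
    rw [Tensor.pos_div_mod i ⟨l, hl⟩, hf']

/-- The rule for `fill`. -/
theorem den_fill {b₁ b₂ T A : ℕ} {body : LoopProg} (R : ℕ → ℕ → ℕ → Prop)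
    (hw : ∀ a ∈ [vI, vJ, b₂, T, A], a ∉ body.wn) (hA : A ∉ [vI, vJ, b₂, T, vSt])
    (hb : b₂ ∉ [vI, vJ]) (hT : T ∉ [vI, vJ])
    (hinj : ∀ i < σ.nat b₁ 0, ∀ j < σ.nat b₂ 0, ∀ i' < σ.nat b₁ 0, ∀ j' < σ.nat b₂ 0,
      σ.nat T i + j = σ.nat T i' + j' → i = i' ∧ j = j')
    (h : ∀ i < σ.nat b₁ 0, ∀ j < σ.nat b₂ 0, ∀ τ,
      Store.Same (vI :: vJ :: A :: body.wn) body.wf σ τ → τ.nat vI 0 = i → τ.nat vJ 0 = j →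
      R i j ((den en body τ).nat vSt 0)) :
    ∀ i < σ.nat b₁ 0, ∀ j < σ.nat b₂ 0, R i j ((den en (fill b₁ b₂ T A body) σ).nat A (σ.nat T i + j)) := by
  simp only [List.mem_cons, List.not_mem_nil, or_false, forall_eq_or_imp, forall_eq, not_or]
    at hw hA hb hT
  have key := den_loop en (v := vI) (a := b₁) (σ := σ)
    (p := loop vJ b₂ (body ;; setN A (.get T (nv vI) + nv vJ) (nv vSt)))
    (fun k τ => k ≤ σ.nat b₁ 0 → ∀ i < k, ∀ j < σ.nat b₂ 0, R i j (τ.nat A (σ.nat T i + j)))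
    (by simp) (fun k hk τ hτ hv hI hk' => by
      have hb₂ : τ.nat b₂ 0 = σ.nat b₂ 0 := by rw [hτ.1 _ (by simp [wn, hb, hw, Ne.symm hA.2.2.1])]
      have inner := den_loop en (v := vJ) (a := b₂) (σ := τ)
        (p := body ;; setN A (.get T (nv vI) + nv vJ) (nv vSt))
        (fun l υ => ∀ i j, (i < k ∧ j < σ.nat b₂ 0 ∨ i = k ∧ j < l ∧ l ≤ σ.nat b₂ 0) →
          R i j (υ.nat A (σ.nat T i + j)))
        (fun i j hij => by
          rcases hij with h1 | h1
          · simpa [hA.2.1] using hI hk.le i h1.1 j h1.2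
          · omega)
        (fun l hl υ hυ hvl hJ i j hij => by
          rw [hb₂] at hl
          simp only [wn, wf, List.append_nil] at hτ hυ
          have hs : Store.Same (vI :: vJ :: A :: body.wn) body.wf σ υ := ⟨fun a ha => by
            simp only [List.mem_cons, not_or] at ha
            rw [hυ.1 a (by simp [ha]), hτ.1 a (by simp [ha])], fun a ha => by
            rw [hυ.2 a ha, hτ.2 a ha]⟩
          have hvI : υ.nat vI 0 = k := by rw [hυ.1 _ (by simp [Ne.symm hA.1, hw.1]), hv]
          have hR := h k hk l hl υ hs hvI hvl
          have e1 : (den en body υ).nat A = υ.nat A := den_nat en hw.2.2.2.2 υ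
          have e2 : (den en body υ).nat vI 0 = k := by rw [den_nat en hw.1, hvI]
          have e3 : (den en body υ).nat vJ 0 = l := by rw [den_nat en hw.2.1, hvl]
          have e4 : (den en body υ).nat T = σ.nat T := by
            rw [den_nat en hw.2.2.2.1, hs.1 _ (by simp [hT, hw, Ne.symm hA.2.2.2.1])]
          simp only [den_seq, den_setN, Store.nat_setNat, NatExpr.eval_add, NatExpr.eval_get,
            NatExpr.eval_ofNat, e1, e2, e3, e4]
          rw [if_neg (by simp [hA.2.1])]
          by_cases hij' : i = k ∧ j = l
          · obtain ⟨rfl, rfl⟩ := hij'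
            simpa using hR
          · rw [if_neg]
            · exact hJ i j (by omega)
            · rintro ⟨-, h1⟩
              exact hij' (hinj i (by omega) j (by omega) k hk l hl h1))
      intro i hi j hj
      have := inner i j (by rw [hb₂]; omega)
      simpa [hA.1] using this)
  exact key le_rfl

/-- The rows of `fRws` are the coordinates of the elements of the field. -/
def Rows (P : PowerField F t m c) (σ : Store F) : Prop :=
  ∀ i < m + 1, ∀ l : Fin t, σ.fld fRws (i * t + l) = P.vec (P.dec i) l

/-- Elements are recognized by their coordinates: a matching row belongs to the right element, and
there is one because every element has a code. -/
theorem den_find {P : PowerField F t m c} (hS : Sized q t (m + 1) σ) (hR : Rows P σ) {e : FieldExpr}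
    (y : P.carrier) (h : ∀ l : Fin t, ∀ τ, Store.Same [vSt, vX, vEq, vY] [] σ τ →
      τ.nat vY 0 = l → e.eval en τ = P.vec y l) :
    (den en (lookup vQT e) σ).nat vSt 0 < m + 1 ∧
      P.dec ((den en (lookup vQT e) σ).nat vSt 0) = y := by
  have key : ∀ i < m + 1, (∀ l < t, σ.fld fRws (i * t + l) =
      if h : l < t then P.vec y ⟨l, h⟩ else 0) ↔ P.dec i = y := fun i hi => by
    rw [← P.vec.injective.eq_iff, funext_iff]
    refine ⟨fun h1 l => ?_, fun h1 l hl => ?_⟩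
    · rw [← hR i hi, h1 l l.2, dif_pos l.2]
    · rw [dif_pos hl, ← h1, hR i hi ⟨l, hl⟩]
  rcases den_lookup en (b := vQT) (e := e) (f := fun l => if h : l < t then P.vec y ⟨l, h⟩ else 0)
    hS hS.Q_eq le_rfl (fun l hl τ hτ hv => by rw [h ⟨l, hl⟩ τ hτ hv, dif_pos hl])
    with ⟨i, hi, h1, h2⟩ | ⟨h1, -⟩
  · rw [h2]
    exact ⟨hi, (key i hi).mp h1.1⟩
  · obtain ⟨i, hi, h2⟩ := P.exists_dec y
    exact absurd ((key i hi).mpr h2) (h1 i hi)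

/-- Codes of nonzero elements are exponents of `x`, to be added modulo `m`; a single subtraction
reduces the sum. The code `m` of zero absorbs everything. -/
theorem den_mulCode (P : PowerField F t m c) (hS : Sized q t (m + 1) σ) {i j : ℕ} (hi : i < m + 1)
    (hj : j < m + 1) (hvi : σ.nat vI 0 = i) (hvj : σ.nat vJ 0 = j) :
    (den en mulCode σ).nat vSt 0 < m + 1 ∧
      P.dec ((den en mulCode σ).nat vSt 0) = P.dec i * P.dec j := by
  have hm : σ.nat vQc 0 = m := hS.m_eq
  by_cases h : i < m ∧ j < m
  · rw [mulCode, den_ite_pos en (by simpa [hvi, hvj, hm] using h), P.dec_lt h.1, P.dec_lt h.2]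
    by_cases h' : i + j < m
    · rw [den_ite_pos en (by simpa [hvi, hvj, hm] using h')]
      simp [hvi, hvj, P.dec_lt h', pow_add, h'.trans (Nat.lt_succ_self m)]
    · rw [den_ite_neg en (by simpa [hvi, hvj, hm] using h')]
      have e : i + j - m + m = i + j := by omega
      simp only [den_setN, Store.nat_setNat, NatExpr.eval_sub, NatExpr.eval_add, NatExpr.eval_get,
        NatExpr.eval_ofNat, hvi, hvj, hm, and_self, if_true]
      refine ⟨by omega, ?_⟩
      rw [P.dec_lt (by omega), ← pow_add]
      conv_rhs => rw [← e, pow_add, P.pow_eq, mul_one]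
  · rw [mulCode, den_ite_neg en (by simpa [hvi, hvj, hm] using h)]
    simp only [den_setN, Store.nat_setNat, NatExpr.eval_get, NatExpr.eval_ofNat, hm, and_self,
      if_true, P.dec_self]
    refine ⟨Nat.lt_succ_self m, ?_⟩
    rcases (by omega : i = m ∨ j = m) with rfl | rfl <;> simp

theorem den_invCode (P : PowerField F t m c) (hS : Sized q t (m + 1) σ) {i : ℕ} (hi : i < m + 1)
    (hvi : σ.nat vI 0 = i) : (den en invCode σ).nat vSt 0 < m + 1 ∧
      P.dec ((den en invCode σ).nat vSt 0) = (P.dec i)⁻¹ := by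
  have hm : σ.nat vQc 0 = m := hS.m_eq
  by_cases h : 0 < i ∧ i < m
  · rw [invCode, den_ite_pos en (by simpa [hvi, hm] using h)]
    simp only [den_setN, Store.nat_setNat, NatExpr.eval_sub, NatExpr.eval_get, NatExpr.eval_ofNat,
      hvi, hm, and_self, if_true]
    rw [P.dec_lt (by omega), P.dec_lt h.2]
    refine ⟨by omega, eq_inv_of_mul_eq_one_left ?_⟩
    rw [← pow_add, Nat.sub_add_cancel h.2.le, P.pow_eq]
  · rw [invCode, den_ite_neg en (by simpa [hvi, hm] using h)]
    simp only [den_setN, Store.nat_setNat, NatExpr.eval_get, NatExpr.eval_ofNat, hvi, and_self,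
      if_true]
    refine ⟨hi, ?_⟩
    by_cases him : i = m
    · simp [him]
    · obtain rfl : i = 0 := by omega
      simp [P.dec_lt (by omega : 0 < m)]

/-- Sums and differences are found by comparing coordinates, products and inverses by exponents. The
table of inverses is filled for all columns as well, but only column 0 is ever read. -/
theorem den_arithmetic (P : PowerField F t m c) (hm : 0 < m) (hS : Sized q t (m + 1) σ)
    (hR : Rows P σ) : Tables P.dec (m + 1) (den en arithmetic σ) := by
  have w1 (e : FieldExpr) : (lookup vQT e).wn = [vSt, vX, vEq, vY, vEq, vSt] := rfl
  have w2 (e : FieldExpr) : (lookup vQT e).wf = [] := rfl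
  have hinj {σ : Store F} (h : Sized q t (m + 1) σ) : ∀ i < σ.nat vQT 0, ∀ j < σ.nat vQT 0,
      ∀ i' < σ.nat vQT 0, ∀ j' < σ.nat vQT 0, σ.nat tOq i + j = σ.nat tOq i' + j' →
      i = i' ∧ j = j' := by
    rw [h.Q_eq]
    intro i hi j hj i' hi' j' hj' e
    rw [h.oq i hi.le, h.oq i' hi'.le] at e
    exact add_mul_inj hj hj' e
  simp only [arithmetic, den_seq]
  have h1 := den_fill en (σ := σ) (b₁ := vQT) (b₂ := vQT) (T := tOq) (A := tAdd)
    (body := lookup vQT (coord (nv vI) + coord (nv vJ)))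
    (fun i j s => s < m + 1 ∧ P.dec s = P.dec i + P.dec j) (by simp [w1]) (by simp) (by simp)
    (by simp) (hinj hS) (fun i hi j hj τ hτ hvi hvj => by
      rw [hS.Q_eq] at hi hj
      rw [w1, w2] at hτ
      refine den_find en (hS.of_same hτ (by simp) (by simp)) (by rwa [Rows, hτ.2 _ (by simp)]) _
        fun l υ hυ hvl => ?_
      simp [hυ.1, hυ.2, hτ.1, hτ.2, hvi, hvj, hvl, hS.ot i hi.le, hS.ot j hj.le, hR i hi, hR j hj])
  have s₁ : Store.Same (vI :: vJ :: (lookup vQT (coord (nv vI) + coord (nv vJ))).wn ++ [tAdd]) [] σ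
    _ := den_same en (fill vQT vQT tOq tAdd (lookup vQT (coord (nv vI) + coord (nv vJ)))) σ
  rw [w1] at s₁
  set σ₁ := den en (fill vQT vQT tOq tAdd (lookup vQT (coord (nv vI) + coord (nv vJ)))) σ
  clear_value σ₁
  have hS₁ := hS.of_same s₁ (by simp) (by simp)
  have h2 := den_fill en (σ := σ₁) (b₁ := vQT) (b₂ := vQT) (T := tOq) (A := tSub)
    (body := lookup vQT (coord (nv vI) - coord (nv vJ)))
    (fun i j s => s < m + 1 ∧ P.dec s = P.dec i - P.dec j) (by simp [w1]) (by simp) (by simp)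
    (by simp) (hinj hS₁) (fun i hi j hj τ hτ hvi hvj => by
      rw [hS₁.Q_eq] at hi hj
      rw [w1, w2] at hτ
      refine den_find en (hS₁.of_same hτ (by simp) (by simp))
        (by rwa [Rows, hτ.2 _ (by simp), s₁.2 _ (by simp)]) _ fun l υ hυ hvl => ?_
      simp [hυ.1, hυ.2, hτ.1, hτ.2, s₁.2, hvi, hvj, hvl, hS₁.ot i hi.le, hS₁.ot j hj.le, hR i hi,
        hR j hj])
  have s₂ : Store.Same (vI :: vJ :: (lookup vQT (coord (nv vI) - coord (nv vJ))).wn ++ [tSub]) [] σ₁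
    _ := den_same en (fill vQT vQT tOq tSub (lookup vQT (coord (nv vI) - coord (nv vJ)))) σ₁
  rw [w1] at s₂
  set σ₂ := den en (fill vQT vQT tOq tSub (lookup vQT (coord (nv vI) - coord (nv vJ)))) σ₁
  clear_value σ₂
  have hS₂ := hS₁.of_same s₂ (by simp) (by simp)
  have h3 := den_fill en (σ := σ₂) (b₁ := vQT) (b₂ := vQT) (T := tOq) (A := tMul)
    (body := mulCode) (fun i j s => s < m + 1 ∧ P.dec s = P.dec i * P.dec j) (by simp [mulCode, wn])
    (by simp) (by simp) (by simp) (hinj hS₂) (fun i hi j hj τ hτ hvi hvj => by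
      rw [hS₂.Q_eq] at hi hj
      exact den_mulCode en P (hS₂.of_same hτ (by simp [mulCode, wn]) (by simp [mulCode, wf])) hi hj
        hvi hvj)
  have s₃ : Store.Same [vI, vJ, vSt, vSt, vSt, tMul] [] σ₂ _ :=
    den_same en (fill vQT vQT tOq tMul mulCode) σ₂
  set σ₃ := den en (fill vQT vQT tOq tMul mulCode) σ₂
  clear_value σ₃
  have hS₃ := hS₂.of_same s₃ (by simp) (by simp)
  have h4 := den_fill en (σ := σ₃) (b₁ := vQT) (b₂ := vQT) (T := tOq) (A := tInv)
    (body := invCode) (fun i j s => s < m + 1 ∧ P.dec s = (P.dec i)⁻¹) (by simp [invCode, wn])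
    (by simp) (by simp) (by simp) (hinj hS₃) (fun i hi j hj τ hτ hvi hvj => by
      rw [hS₃.Q_eq] at hi
      exact den_invCode en P (hS₃.of_same hτ (by simp [invCode, wn]) (by simp [invCode, wf])) hi hvi)
  have s₄ : Store.Same [vI, vJ, vSt, vSt, tInv] [] σ₃ _ :=
    den_same en (fill vQT vQT tOq tInv invCode) σ₃
  set σ₄ := den en (fill vQT vQT tOq tInv invCode) σ₃
  clear_value σ₄
  rw [hS.Q_eq] at h1
  rw [hS₁.Q_eq] at h2
  rw [hS₂.Q_eq] at h3
  rw [hS₃.Q_eq] at h4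
  have e1 := s₁.1 tOq (by simp)
  have e2 := s₂.1 tOq (by simp)
  have e3 := s₃.1 tOq (by simp)
  have e4 := s₄.1 tOq (by simp)
  refine ⟨fun i hi j hj => P.dec_inj hi hj, ?_, by rw [P.dec_lt hm, pow_zero], ?_, ?_, ?_, ?_⟩
  · rw [(hS₃.of_same s₄ (by simp) (by simp)).m_eq]
    exact ⟨Nat.lt_succ_self m, P.dec_self⟩
  · rwa [e4, e3, e2, e1, s₄.1 _ (by simp), s₃.1 _ (by simp), s₂.1 _ (by simp)]
  · rwa [e4, e3, e2, s₄.1 _ (by simp), s₃.1 _ (by simp)]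
  · rwa [e4, e3, s₄.1 _ (by simp)]
  · rw [e4]
    exact fun i hi => h4 i hi 0 (by omega)

end LoopProg

/-! ## Computations over the extension field -/

namespace LoopProg

variable {F : Type u} [Field F] (en : Enumeration F) {q t m : ℕ} {c : ℕ → F} {σ : Store F}

/-- During the search row `m` held the coordinates of `x^m = 1`. From now on code `m` stands for
zero, so its row is cleared. -/
theorem den_zeroPower {P : PowerField F t m c} (hS : Sized q t (m + 1) σ)
    (h : ∀ i < m + 1, ∀ l < t, σ.fld fRws (i * t + l) = powerCoord t c i l) :
    Rows P (den en zeroPower σ) := by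
  have key := loop_setF en (v := vL) (a := vTt) (A := fRws) (idx := .get tOt (nv vQc) + nv vL)
    (e := 0) (σ := σ) (fun l => m * t + l) (fun _ => 0) (fun _ _ _ _ h => by simpa using h)
    (fun i _ τ hτ hv _ => by simp [hv, hτ.1, hS.m_eq, hS.ot m (Nat.le_succ m)])
  rw [hS.t_eq] at key
  intro i hi l
  rw [zeroPower]
  by_cases him : i = m
  · rw [him, P.dec_self, key.1 l l.2, map_zero, Pi.zero_apply]
  · rw [P.dec_lt (by omega), P.vec_pow, ← h i hi l l.2]
    refine key.2 _ fun l' hl' e => him (add_mul_inj l.2 hl' e).1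

/-- The representation of the extension field is in place. -/
structure Ready (n d r q : ℕ) (P : PowerField F t m c) (σ : Store F) : Prop where
  params : Params n d r σ
  sized : Sized q t (m + 1) σ
  rows : Rows P σ
  tables : Tables P.dec (m + 1) σ
  q_eq : σ.nat vQ 0 = q

theorem Ready.of_same {n d r : ℕ} {P : PowerField F t m c} {τ : Store F} {wn wf : List ℕ}
    (s : Store.Same wn wf σ τ)
    (h1 : ∀ a ∈ [vn, vd, vr, vN, vnd, vW, vR2, vK, vRK, vN0, vM, vR, vC, vMchk, vR1, vTot, tC, tD,
      tNP, tW, tR2, tR, tSd, tnd, tQu, tRm, vTt, vQT, vQc, tOt, tOq, tQb, tRb, tAdd, tSub, tMul, tInv, vQ],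
      a ∉ wn)
    (h2 : ∀ a ∈ [fNz, fRws], a ∉ wf) (h : Ready n d r q P σ) : Ready n d r q P τ := by
  have h3 : ∀ a ∈ [vQ, vQc, tAdd, tOq, tSub, tMul, tInv], τ.nat a = σ.nat a := fun a ha =>
    s.1 a (h1 a (by revert a; decide))
  simp only [List.mem_cons, List.not_mem_nil, or_false, forall_eq_or_imp, forall_eq] at h3
  refine ⟨h.params.of_same s fun a ha => h1 a (by revert a; decide),
    h.sized.of_same s (fun a ha => h1 a (by revert a; decide)) (h2 _ (by simp)), ?_, ?_, ?_⟩
  · rw [Rows, s.2 _ (h2 _ (by simp))]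
    exact h.rows
  · obtain ⟨g1, g2, g3, g4, g5, g6, g7⟩ := h.tables
    constructor <;> (try simp only [h3]) <;> assumption
  · rw [h3.1, h.q_eq]

theorem den_fieldTables {n d r N₀ : ℕ} (hP : Params n d r σ) (hN : (d * n) ^ halves d 1 = N₀)
    (hF : ENat.card F ≤ N₀) : ∃ (q t m : ℕ) (c : ℕ → F) (P : PowerField F t m c), 0 < t ∧ N₀ ≤ m ∧
      2 ^ (t - 1) ≤ N₀ ∧ m + 1 ≤ N₀ * N₀ ∧ q ≤ N₀ ∧ Ready n d r q P (den en fieldTables σ) := by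
  simp only [fieldTables, den_seq]
  obtain ⟨hfin, h1, h2⟩ := den_listField en (hP.N0_eq.trans hN) hF
  have s₁ := den_same en listField σ
  set σ₁ := den en listField σ
  clear_value σ₁
  rw [ENat.card_eq_coe_natCard, Nat.cast_le] at hF
  have hP₁ := hP.of_same s₁ (by decide)
  obtain ⟨t, ht, h3, h4, h5, h6, h7⟩ := den_fieldSizes en (hP₁.N0_eq.trans hN) h1
    Finite.one_lt_card hF
  have s₂ := den_same en fieldSizes σ₁
  set σ₂ := den en fieldSizes σ₁
  clear_value σ₂
  have hq : σ₂.nat vQ 0 = Nat.card F := by rw [s₂.1 _ (by decide), h1]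
  have hS := den_fieldOffsets en h3 h4 hq Nat.card_pos
  have s₃ := den_same en fieldOffsets σ₂
  set σ₃ := den en fieldOffsets σ₂
  clear_value σ₃
  obtain ⟨c, hc, hrows⟩ := den_findField en hS ht fun y => by
    rw [s₃.2 _ (by decide), s₂.2 _ (by decide)]
    exact h2 y
  have s₄ := den_same en findField σ₃
  set σ₄ := den en findField σ₃
  clear_value σ₄
  obtain ⟨P⟩ := exists_powerField ht hc
  have e : Nat.card F ^ t - 1 + 1 = Nat.card F ^ t := Nat.sub_add_cancel (by omega)
  have hm : 0 < Nat.card F ^ t - 1 := by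
    have := (Finite.one_lt_card (α := F)).trans_le (Nat.le_self_pow ht.ne' _)
    omega
  have hS₄ := hS.of_same s₄ (by decide) (by decide)
  rw [← e] at hS₄ hrows
  have hR := den_zeroPower en (P := P) hS₄ hrows
  have s₅ := den_same en zeroPower σ₄
  set σ₅ := den en zeroPower σ₄
  clear_value σ₅
  have hS₅ := hS₄.of_same s₅ (by decide) (by decide)
  have s₆ := den_same en arithmetic σ₅
  refine ⟨_, t, _, c, P, ht, by omega, h6, by omega, hF, ?_, hS₅.of_same s₆ (by decide +kernel)
    (by decide +kernel), ?_, den_arithmetic en P hm hS₅ hR, ?_⟩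
  · exact ((((hP₁.of_same s₂ (by decide)).of_same s₃ (by decide)).of_same s₄ (by decide)).of_same s₅
      (by decide)).of_same s₆ (by decide +kernel)
  · rw [Rows, s₆.2 _ (by decide +kernel)]
    exact hR
  · rw [s₆.1 _ (by decide +kernel), s₅.1 _ (by decide), s₄.1 _ (by decide), s₃.1 _ (by decide), hq]

end LoopProg

/-! ## Parity checks over the small field -/

namespace PowerField

variable {F : Type u} [Field F] {t m : ℕ} {c : ℕ → F} (P : PowerField F t m c)

/-- Functionals that map `1` to `1` and determine an element. -/
def functional (l : Fin t) (y : P.carrier) : F :=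
  P.vec y l + (if (l : ℕ) = 0 then 0 else 1) * P.vec y ⟨0, l.pos⟩

/-- Adding coordinate 0 to the others sends `1` to `1` under every functional. The factors of the
checks begin with the entry `1`, so they stay nonzero after a functional is applied. -/
theorem functional_one (l : Fin t) : P.functional l 1 = 1 := by
  have h (l : Fin t) : P.vec 1 l = if (l : ℕ) = 0 then 1 else 0 := by
    rw [← P.vec_algebraMap, (algebraMap F P.carrier).map_one]
  rw [functional, h, h]
  split_ifs <;> simp_all

/-- With `f_0 = y_0` and `f_l = y_l + y_0` for `l ≠ 0`, the expansion `y = y_0 + ∑ y_l x^l` becomes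
`f_0 (1 - ∑ x^l) + ∑ f_l x^l`, the sums running over `l ≠ 0`. This shows the dual elements. -/
theorem exists_dual (ht : 0 < t) : ∃ β : Fin t → P.carrier, ∀ y,
    y = ∑ l, algebraMap F P.carrier (P.functional l y) * β l := by
  let o : Fin t := ⟨0, ht⟩
  have ho (l : Fin t) : ((l : ℕ) = 0) = (l = o) := propext (Fin.ext_iff (b := o)).symm
  refine ⟨fun l => if l = o then 1 - ∑ k, (if k = o then 0 else P.x ^ (k : ℕ)) else P.x ^ (l : ℕ),
    fun y => ?_⟩
  have h := P.sum_vec y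
  simp only [functional, ho, Algebra.smul_def] at h ⊢
  rw [← Finset.add_sum_erase _ _ (Finset.mem_univ o)] at h ⊢
  rw [← Finset.add_sum_erase (a := o) _ (fun k => if k = o then 0 else P.x ^ (k : ℕ))
    (Finset.mem_univ o)]
  have h1 (f g : Fin t → P.carrier) : ∑ l ∈ Finset.univ.erase o, (if l = o then f l else g l) =
      ∑ l ∈ Finset.univ.erase o, g l :=
    Finset.sum_congr rfl fun l hl => if_neg (Finset.ne_of_mem_erase hl)
  have h2 : ∑ l ∈ Finset.univ.erase o, algebraMap F P.carrier (P.vec y l + (if l = o then 0 else 1) *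
      P.vec y o) * (if l = o then 1 - ((if o = o then 0 else P.x ^ (o : ℕ)) +
        ∑ k ∈ Finset.univ.erase o, if k = o then 0 else P.x ^ (k : ℕ)) else P.x ^ (l : ℕ)) =
      ∑ l ∈ Finset.univ.erase o, (algebraMap F P.carrier (P.vec y l) * P.x ^ (l : ℕ) +
        algebraMap F P.carrier (P.vec y o) * P.x ^ (l : ℕ)) :=
    Finset.sum_congr rfl fun l hl => by
      simp only [if_neg (Finset.ne_of_mem_erase hl), one_mul, map_add, add_mul]
  rw [h2, h1, Finset.sum_add_distrib, ← Finset.mul_sum]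
  simp only [if_true, zero_mul, add_zero, zero_add]
  nth_rw 1 [h]
  rw [show P.x ^ (o : ℕ) = 1 from pow_zero _]
  ring

end PowerField

namespace LoopProg

/-- The codes of the entries of the input. -/
def encode : LoopProg :=
  loop vJ vnd (lookup vQT (.get fIn (nv vJ) * (1 - .get fNz (nv vY))) ;; setN 1 (nv vJ) (nv vSt))

/-- The functional with number `l` of the element with code `x`. -/
abbrev functional (l x : NatExpr) : FieldExpr :=
  .get fRws (.get tOt x + l) + .get fNz l * .get fRws (.get tOt x)

/-- Write the functionals of rows of length `D * L`, whose codes are in array `S`, to array `A`: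
there are `D` blocks in each row, to each of which a functional is applied. -/
def expand (A S D L : ℕ) : LoopProg :=
  powProg vTD vT1 vX vY vTt D ;; mulProg vMc vX vMchk vTD ;; mulProg vE vX D L ;;
  multiples tV vX vMchk vE ;; divTable tQb tRb vX vTD vTt ;; letN vPtr 0 ;;
  loop vB vMchk (loop vKk vTD (letN vT1 (nv vPtr) ;; letN vCur (nv vKk) ;;
    loop vJ D (loop vI L (setF A (nv vPtr) (functional (.get tRb (nv vCur))
      (.get S (.get tV (nv vB) + (nv vPtr - nv vT1)))) ;; letN vPtr (nv vPtr + 1)) ;;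
      letN vCur (.get tQb (nv vCur)))))

variable {F : Type u} [Field F] (en : Enumeration F) {n d r q t m : ℕ} {c : ℕ → F} {σ : Store F}

/-- An element of `F` has the coordinates `(y, 0, …, 0)`. The factor `1 - fNz` produces this vector,
and the lookup turns it into a code, stored where the simulation expects the input array. -/
theorem den_encode {P : PowerField F t m c} (hR : Ready n d r q P σ)
    (h1 : ∀ i, σ.nat 1 i < m + 1) (p : ℕ) : (den en encode σ).nat 1 p < m + 1 ∧
      (p < n ^ d → P.dec ((den en encode σ).nat 1 p) = algebraMap F P.carrier (σ.fld fIn p)) := by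
  have key := den_loop en (v := vJ) (a := vnd) (σ := σ)
    (p := lookup vQT (.get fIn (nv vJ) * (1 - .get fNz (nv vY))) ;; setN 1 (nv vJ) (nv vSt))
    (fun k τ => ∀ p, τ.nat 1 p < m + 1 ∧
      (p < k → P.dec (τ.nat 1 p) = algebraMap F P.carrier (σ.fld fIn p)))
    (by simpa using h1) (fun k hk τ hτ hv hI p => by
      have hRτ := hR.of_same hτ (by decide) (by decide)
      have h2 := den_find en hRτ.sized hRτ.rows (e := .get fIn (nv vJ) * (1 - .get fNz (nv vY)))
        (algebraMap F P.carrier (σ.fld fIn k)) (fun l υ hυ hvl => by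
          rw [P.vec_algebraMap]
          simp [hυ.1, hυ.2, hvl, hv, hRτ.sized.nz l l.2, hτ.2 fIn (by decide)]
          split_ifs <;> simp)
      have e1 : (den en (lookup vQT (.get fIn (nv vJ) * (1 - .get fNz (nv vY)))) τ).nat 1 = τ.nat 1 :=
        den_nat en (by decide) τ
      have e2 : (den en (lookup vQT (.get fIn (nv vJ) * (1 - .get fNz (nv vY)))) τ).nat vJ = τ.nat vJ :=
        den_nat en (by decide) τ
      by_cases hp : p = k
      · simpa [e1, e2, hv, hp] using h2
      · obtain ⟨g1, g2⟩ := hI p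
        simp only [den_seq, den_setN, Store.nat_setNat, NatExpr.eval_get, NatExpr.eval_ofNat, e1, e2,
          hv, hp, and_false, if_false]
        exact ⟨by simpa using g1, fun h => by simpa using g2 (by omega)⟩)
  rw [hR.params.nd_eq] at key
  exact key p

-- The digits in base `t` of `l < t ^ δ` choose one functional for each of the `δ` blocks of a row.
-- One block of length `n ^ d` gives the coordinates of a whole check; `d` blocks of length `n` give
-- all products of coordinates of its factors.
set_option maxHeartbeats 400000 in
theorem den_expand {P : PowerField F t m c} (hR : Ready n d r q P σ) {A S D L M δ ℓ : ℕ} (ht : 0 < t)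
    (hA : A ∉ [fRws, fNz])
    (hS : ∀ a ∈ [S, D, L], a ∉ [vTD, vT1, vX, vY, vMc, vE, tV, tQb, tRb, vPtr, vB, vKk, vCur, vJ, vI])
    (hDt : [vTD, vT1, vX, vY, vTt, D].Nodup)
    (hM : σ.nat vMchk 0 = M) (hD : σ.nat D 0 = δ) (hL : σ.nat L 0 = ℓ)
    (hC : ∀ i, σ.nat S i < m + 1) : (den en (expand A S D L) σ).nat vMc 0 = M * t ^ δ ∧
    (den en (expand A S D L) σ).nat vTD 0 = t ^ δ ∧ ∀ a < M, ∀ l < t ^ δ, ∀ j < δ, ∀ i < ℓ, (den en (expand A S D L) σ).fld A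
      (((a * t ^ δ + l) * δ + j) * ℓ + i) = P.functional ⟨l / t ^ j % t, Nat.mod_lt _ ht⟩
        (P.dec (σ.nat S ((a * δ + j) * ℓ + i))) := by
  simp only [List.mem_cons, List.not_mem_nil, or_false, forall_eq_or_imp, forall_eq, not_or] at hS hA
  obtain ⟨⟨a1, a2, a3, a4, a5, a6, a7, a8, a9, a10, a11, a12, a13, a14, a15⟩,
    ⟨b1, b2, b3, b4, b5, b6, b7, b8, b9, b10, b11, b12, b13, b14, b15⟩,
    ⟨c1, c2, c3, c4, c5, c6, c7, c8, c9, c10, c11, c12, c13, c14, c15⟩⟩ := hS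
  simp only [expand, den_seq]
  have h1 := den_powProg en hDt σ
  have s₁ := den_same en (powProg vTD vT1 vX vY vTt D) σ
  rw [powProg_wn, show (powProg vTD vT1 vX vY vTt D).wf = [] from rfl] at s₁
  set σ₁ := den en (powProg vTD vT1 vX vY vTt D) σ
  clear_value σ₁
  rw [hR.sized.t_eq, hD] at h1
  have h2 := den_mulProg en (dst := vMc) (v := vX) (b := vMchk) (y := vTD) (by simp) (by simp)
    (by simp) (by simp) σ₁
  have s₂ : Store.Same [vMc, vX, vMc] [] σ₁ _ := den_same en (mulProg vMc vX vMchk vTD) σ₁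
  set σ₂ := den en (mulProg vMc vX vMchk vTD) σ₁
  clear_value σ₂
  rw [h1, s₁.1 _ (by simp), hM] at h2
  have h3 := den_mulProg en (dst := vE) (v := vX) (b := D) (y := L) (by simp) (Ne.symm b6)
    (Ne.symm c6) (Ne.symm c3) σ₂
  have s₃ : Store.Same [vE, vX, vE] [] σ₂ _ := den_same en (mulProg vE vX D L) σ₂
  set σ₃ := den en (mulProg vE vX D L) σ₂
  clear_value σ₃
  rw [s₂.1 _ (by simp [*]), s₁.1 _ (by simp [*]), s₂.1 _ (by simp [*]), s₁.1 _ (by simp [*]), hD, hL]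
    at h3
  have h4 : ∀ i ≤ M, _ := fun i hi => den_multiples en (arr := tV) (v := vX) (b := vMchk) (w := vE)
    (by simp) (by simp) (by simp) (by simp) σ₃ (i := i)
    (by rwa [s₃.1 _ (by simp), s₂.1 _ (by simp), s₁.1 _ (by simp), hM])
  have s₄ : Store.Same [tV, vX, tV] [] σ₃ _ := den_same en (multiples tV vX vMchk vE) σ₃
  set σ₄ := den en (multiples tV vX vMchk vE) σ₃
  clear_value σ₄
  rw [h3] at h4
  have hT₄ : σ₄.nat vTD 0 = t ^ δ := by
    rw [s₄.1 _ (by simp), s₃.1 _ (by simp), s₂.1 _ (by simp), h1]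
  have ht₄ : σ₄.nat vTt 0 = t := by
    rw [s₄.1 _ (by simp), s₃.1 _ (by simp), s₂.1 _ (by simp), s₁.1 _ (by simp), hR.sized.t_eq]
  have h5 : ∀ i ≤ t ^ δ, _ := fun i hi => den_divTable en (qu := tQb) (rm := tRb) (v := vX)
    (b := vTD) (w := vTt) (by simp) σ₄ (by rwa [ht₄]) (i := i) (by rwa [hT₄])
  have s₅ := den_same en (divTable tQb tRb vX vTD vTt) σ₄
  rw [divTable_wn, show (divTable tQb tRb vX vTD vTt).wf = [] from rfl] at s₅
  set σ₅ := den en (divTable tQb tRb vX vTD vTt) σ₄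
  clear_value σ₅
  rw [ht₄] at h5
  set σ₆ := den en (letN vPtr 0) σ₅ with hσ₆
  have s₆ : Store.Same [vPtr] [] σ₅ σ₆ := same_of_eq en hσ₆
  have h6 : σ₆.nat vPtr 0 = 0 := by simp [hσ₆]
  clear_value σ₆
  have s : Store.Same [vTD, vT1, vX, vY, vMc, vE, tV, tQb, tRb, vPtr] [] σ σ₆ := ⟨fun a ha => by
    simp only [List.mem_cons, List.not_mem_nil, or_false, not_or] at ha
    rw [s₆.1 _ (by simp [ha]), s₅.1 _ (by simp [ha]), s₄.1 _ (by simp [ha]), s₃.1 _ (by simp [ha]),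
      s₂.1 _ (by simp [ha]), s₁.1 _ (by simp [ha])], fun a _ => by
    rw [s₆.2 _ (by simp), s₅.2 _ (by simp), s₄.2 _ (by simp), s₃.2 _ (by simp), s₂.2 _ (by simp),
      s₁.2 _ (by simp)]⟩
  have hT₆ : σ₆.nat vTD 0 = t ^ δ := by simp [s₆.1, s₅.1, hT₄]
  have hM₆ : σ₆.nat vMchk 0 = M := by simp [s.1, hM]
  have hD₆ : σ₆.nat D 0 = δ := by rw [s.1 _ (by simp [*]), hD]
  have hL₆ : σ₆.nat L 0 = ℓ := by rw [s.1 _ (by simp [*]), hL]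
  have hS₆ : σ₆.nat S = σ.nat S := s.1 _ (by simp [*])
  have hV₆ : ∀ a < M, σ₆.nat tV a = a * (δ * ℓ) := fun a ha => by simp [s₆.1, s₅.1, h4 a ha.le]
  have hq₆ : ∀ x < t ^ δ, σ₆.nat tQb x = x / t := fun x hx => by simp [s₆.1, (h5 x hx.le).1]
  have hr₆ : ∀ x < t ^ δ, σ₆.nat tRb x = x % t := fun x hx => by simp [s₆.1, (h5 x hx.le).2]
  have ho₆ : σ₆.nat tOt = σ.nat tOt := s.1 _ (by simp)
  let g (a l j i : ℕ) : F := P.functional ⟨l / t ^ j % t, Nat.mod_lt _ ht⟩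
    (P.dec (σ.nat S (a * (δ * ℓ) + (j * ℓ + i))))
  set emit := setF A (nv vPtr) (functional (.get tRb (nv vCur))
    (.get S (.get tV (nv vB) + (nv vPtr - nv vT1)))) ;; letN vPtr (nv vPtr + 1) with he
  set row := loop vI L emit ;; letN vCur (.get tQb (nv vCur)) with hrow
  set rows := letN vT1 (nv vPtr) ;; letN vCur (nv vKk) ;; loop vJ D row with hrows
  have ew : emit.wn = [vPtr] := rfl
  have ef : emit.wf = [A] := rfl
  have rw' : row.wn = [vI, vPtr, vCur] := rfl
  have rf : row.wf = [A] := rfl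
  have rsw : rows.wn = [vT1, vCur, vJ, vI, vPtr, vCur] := rfl
  have rsf : rows.wf = [A] := rfl
  have key := loop_emitted en (v := vB) (b := vMchk) (A := A) (L := t ^ δ * (δ * ℓ)) (σ := σ₆)
    (p := loop vKk vTD rows) (f := fun a x => g a (x / (δ * ℓ)) (x % (δ * ℓ) / ℓ) (x % (δ * ℓ) % ℓ))
    (fun _ _ => True) (by simp) trivial fun a ha τ hτ hva _ _ => ⟨?_, trivial⟩
  · rw [hM₆] at key
    refine ⟨?_, ?_, fun a ha l hl j hj i hi => ?_⟩
    · rw [den_nat en (by simp [wn, rsw]), s₆.1 _ (by simp), s₅.1 _ (by simp), s₄.1 _ (by simp),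
        s₃.1 _ (by simp), h2]
    · rw [den_nat en (by simp [wn, rsw]), hT₆]
    · have e1 := mul_add_lt hj hi
      have e2 := mul_add_lt hl e1
      have e3 : ((a * t ^ δ + l) * δ + j) * ℓ + i =
        a * (t ^ δ * (δ * ℓ)) + (l * (δ * ℓ) + (j * ℓ + i)) := by ring
      have := key.1.2.1 _ (mul_add_lt ha e2)
      simp only [h6, zero_add, (mul_add_div_mod e2).1, (mul_add_div_mod e2).2,
        (mul_add_div_mod e1).1, (mul_add_div_mod e1).2, (mul_add_div_mod hi).1,
        (mul_add_div_mod hi).2] at this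
      rw [e3, this, show (a * δ + j) * ℓ + i = a * (δ * ℓ) + (j * ℓ + i) by ring]
  · rw [hM₆] at ha
    simp only [wn, wf, rsw, rsf] at hτ
    have key := loop_emitted en (v := vKk) (b := vTD) (A := A) (L := δ * ℓ) (σ := τ)
      (p := rows) (f := fun l y => g a l (y / ℓ) (y % ℓ))
      (fun _ _ => True) (by simp) trivial fun l hl υ hυ hvl _ _ => ⟨?_, trivial⟩
    · simpa only [hτ.1 vTD (by simp), hT₆] using key.1
    rw [hτ.1 _ (by simp), hT₆] at hl
    rw [rsw, rsf] at hυ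
    rw [hrows, den_seq, den_seq]
    set υ₁ := den en (letN vCur (nv vKk)) (den en (letN vT1 (nv vPtr)) υ) with hυ₁
    have u : Store.Same [vT1, vCur] [] υ υ₁ :=
      same_of_eq en (p := letN vT1 (nv vPtr) ;; letN vCur (nv vKk)) hυ₁
    have hT1 : υ₁.nat vT1 0 = υ.nat vPtr 0 := by simp [hυ₁]
    have hcur : υ₁.nat vCur 0 = l := by simp [hυ₁, hvl]
    clear_value υ₁
    have hu : Store.Same [vTD, vT1, vX, vY, vMc, vE, tV, tQb, tRb, vPtr, vB, vKk, vCur, vJ, vI] [A]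
        σ υ₁ := ⟨fun b hb => by
      simp only [List.mem_cons, List.not_mem_nil, or_false, not_or] at hb
      rw [u.1 _ (by simp [hb]), hυ.1 _ (by simp [hb]), hτ.1 _ (by simp [hb]), s.1 _ (by simp [hb])],
      fun b hb => by
      rw [u.2 _ (by simp), hυ.2 _ hb, hτ.2 _ hb, s.2 _ (by simp)]⟩
    have hu' : ∀ b ∈ [tV, tQb, tRb], υ₁.nat b = σ₆.nat b := fun b hb => by
      rw [u.1 _ (by revert b; decide), hυ.1 _ (by revert b; decide), hτ.1 _ (by revert b; decide)]
    have hDu : υ₁.nat D 0 = δ := by rw [hu.1 _ (by simp [*]), hD]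
    have hLu : υ₁.nat L 0 = ℓ := by rw [hu.1 _ (by simp [*]), hL]
    have hau : υ₁.nat vB 0 = a := by rw [u.1 _ (by simp), hυ.1 _ (by simp), hva]
    have key := loop_emitted en (v := vJ) (b := D) (A := A) (L := ℓ) (σ := υ₁)
      (p := row) (f := fun j z => g a l j z)
      (fun j τ => τ.nat vCur 0 = l / t ^ j) (by simp) (by simp [hcur]) fun j hj φ hφ hvj hptr hI => ?_
    · rw [hDu] at key
      exact key.1.of_same u (by simp) (by simp)
    rw [hDu] at hj
    rw [rw', rf] at hφ
    have hlj : l / t ^ j < t ^ δ := (Nat.div_le_self _ _).trans_lt hl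
    have key := loop_emitted en (v := vI) (b := L) (A := A) (L := 1) (σ := φ)
      (p := emit) (f := fun i _ => g a l j i)
      (fun _ _ => True) (by simp) trivial fun i hi χ hχ hvi hptr' _ => ⟨?_, trivial⟩
    · rw [hφ.1 _ (by simp [*]), hLu] at key
      simp only [mul_one, Nat.div_one] at key
      refine ⟨by simpa [hrow, Emitted] using key.1, ?_⟩
      have e1 : (den en (loop vI L emit) φ).nat vCur = φ.nat vCur := den_nat en (by simp [wn, ew]) φ
      have e2 : (den en (loop vI L emit) φ).nat tQb = σ₆.nat tQb := by
        rw [den_nat en (by simp [wn, ew]), hφ.1 _ (by simp), hu' _ (by simp)]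
      simp [hrow, e1, e2, hI, hq₆ _ hlj, Nat.div_div_eq_div_mul, pow_succ]
    · rw [ew, ef] at hχ
      have f1 : χ.nat vPtr 0 - χ.nat vT1 0 = j * ℓ + i := by
        rw [hptr', hptr, hχ.1 vT1 (by simp), hφ.1 vT1 (by simp), hT1, u.1 vPtr (by simp)]
        omega
      have f2 : χ.nat vCur 0 = l / t ^ j := by rw [hχ.1 _ (by simp), hI]
      have f3 : χ.nat tRb (l / t ^ j) = l / t ^ j % t := by
        rw [hχ.1 _ (by simp), hφ.1 _ (by simp), hu' _ (by simp), hr₆ _ hlj]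
      have f4 : χ.nat tV (χ.nat vB 0) = a * (δ * ℓ) := by
        rw [hχ.1 _ (by simp), hφ.1 _ (by simp), hu' _ (by simp), hχ.1 _ (by simp), hφ.1 _ (by simp),
          hau, hV₆ _ ha]
      have f5 : χ.nat S = σ.nat S := by
        rw [hχ.1 _ (by simp [*]), hφ.1 _ (by simp [*]), hu.1 _ (by simp [*])]
      have f6 : χ.nat tOt = σ.nat tOt := by
        rw [hχ.1 _ (by simp [*]), hφ.1 _ (by simp [*]), hu.1 _ (by simp [*])]
      have f7 : ∀ b ∈ [fRws, fNz], χ.fld b = σ.fld b := fun b hb => by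
        have : b ∉ [A] := by rintro h; simp only [List.mem_singleton] at h; simp_all
        rw [hχ.2 _ this, hφ.2 _ this, hu.2 _ this]
      have f8 := hC (a * (δ * ℓ) + (j * ℓ + i))
      have f9 : ∀ k : Fin t, _ := hR.rows _ f8
      have f10 := hR.sized.nz (l / t ^ j % t) (Nat.mod_lt _ ht)
      have f11 := f9 ⟨0, ht⟩
      have f12 := f9 ⟨l / t ^ j % t, Nat.mod_lt _ ht⟩
      simp only [add_zero] at f11 f12
      refine ⟨by simp [he], fun x hx => ?_, fun x hx => ?_⟩
      · obtain rfl : x = 0 := by omega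
        simp [he, f1, f2, f3, f4, f5, f6, f7, hR.sized.ot _ f8.le, g, PowerField.functional, f10, f11,
          f12]
      · simp [he, hx.ne]

end LoopProg

/-! ## Decoding over small fields -/

namespace Tensor

variable {F : Type u} [Field F] {n d t m : ℕ} {c : ℕ → F} {P : PowerField F t m c}

/-- Extension of scalars. -/
def lift (P : PowerField F t m c) (T : Tensor F n d) : Tensor P.carrier n d :=
  fun i => algebraMap F P.carrier (T i)

theorem lift_add (S T : Tensor F n d) : lift P (S + T) = lift P S + lift P T :=
  funext fun _ => map_add _ _ _

theorem rank_lift_le (hd : 1 ≤ d) {r : ℕ} {E : Tensor F n d} (h : rank E ≤ r) :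
    rank (lift P E) ≤ r := by
  obtain ⟨v, rfl⟩ := exists_sum_pure_of_rank_le hd h
  have : lift P (∑ l, pure (v l)) =
      ∑ l, pure fun j i => algebraMap F P.carrier (v l j i) := by
    funext i
    simp [lift, pure, Finset.sum_apply]
  rw [this]
  exact rank_sum_pure_le _

/-- The inner product over the extension is a combination, with the dual elements as coefficients,
of the inner products over `F`, since the entries of `T` lie in `F`. -/
theorem inner_lift_eq_zero (ht : 0 < t) {T : Tensor F n d} {H : Tensor P.carrier n d}
    (h : ∀ l, inner T (fun i => P.functional l (H i)) = 0) : inner (lift P T) H = 0 := by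
  obtain ⟨β, hβ⟩ := P.exists_dual ht
  have e (i) : lift P T i * H i =
      ∑ l, algebraMap F P.carrier (T i * P.functional l (H i)) * β l := by
    rw [hβ (H i), Finset.mul_sum]
    refine Finset.sum_congr rfl fun l _ => ?_
    rw [← hβ, map_mul, mul_assoc, lift]
  simp only [inner, e]
  rw [Finset.sum_comm]
  refine Finset.sum_eq_zero fun l _ => ?_
  rw [← Finset.sum_mul, ← map_sum]
  exact (congrArg (algebraMap F P.carrier · * β l) (h l)).trans (by simp)

/-- Each factor is expanded by the dual elements and the product is multiplied out. The check then
becomes a combination of the `t ^ d` rank-one tensors over `F`. -/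
theorem inner_lift_pure_eq_zero (ht : 0 < t) {T : Tensor F n d} {v : Fin d → Fin n → P.carrier}
    (h : ∀ l : Fin d → Fin t, inner T (pure fun j i => P.functional (l j) (v j i)) = 0) :
    inner (lift P T) (pure v) = 0 := by
  obtain ⟨β, hβ⟩ := P.exists_dual ht
  have e (i) : lift P T i * pure v i = ∑ l : Fin d → Fin t, algebraMap F P.carrier
      (T i * pure (fun j i => P.functional (l j) (v j i)) i) * ∏ j, β (l j) := by
    rw [pure, Finset.prod_congr rfl fun j _ => hβ (v j (i j)), Finset.prod_univ_sum, Fintype.piFinset_univ,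
      Finset.mul_sum]
    refine Finset.sum_congr rfl fun l _ => ?_
    rw [Finset.prod_mul_distrib, ← map_prod, map_mul, mul_assoc, lift]
    rfl
  simp only [inner, e]
  rw [Finset.sum_comm]
  refine Finset.sum_eq_zero fun l _ => ?_
  rw [← Finset.sum_mul, ← map_sum]
  exact (congrArg (algebraMap F P.carrier · * ∏ j, β (l j)) (h l)).trans (by simp)

end Tensor

namespace LoopProg

theorem boundsLe_seq {F : Type u} [Field F] (en : Enumeration F) {X : ℕ} {p q : LoopProg}
    {σ : Store F} : (p ;; q).BoundsLe en X σ ↔ p.BoundsLe en X σ ∧ q.BoundsLe en X (den en p σ) :=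
  Iff.rfl

/-- Decode over the extension field. -/
def extensionDecoder : LoopProg :=
  encode ;; setN 9 0 1 ;; (prelude ;; decoder).simulate ;;
  loop vP vnd (setF fOut (nv vP) (.get fRws (.get tOt (.get 5 (nv vP)))))

/-- The decoder over all fields. -/
def smallDecoder : LoopProg :=
  setup ;; ite (.natEq (nv vFound) 1) decoder (fieldTables ;; extensionDecoder)

variable {F : Type u} [Field F] (en : Enumeration F) {n d r q t m : ℕ} {c : ℕ → F} {σ τ : Store F}
  {P : PowerField F t m c}

/-- The element of the extension field represented by numbers. -/
def represented (P : PowerField F t m c) (σ : Store F) : Store P.carrier :=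
  ⟨fun a i => σ.nat (4 * a) i, fun a i => P.dec (σ.nat (4 * a + 1) i)⟩

instance : Finite P.carrier := Finite.of_surjective (fun i : Fin (m + 1) => P.dec i) fun y =>
  (P.exists_dec y).elim fun i h => ⟨⟨i, h.1⟩, h.2⟩

/-- An enumeration of the extension field. -/
noncomputable def enumeration (P : PowerField F t m c) : Enumeration P.carrier :=
  (Enumeration.nonempty_of_finite P.carrier).some

theorem den_simulate (hR : Ready n d r q P σ) (h : ∀ a i, σ.nat (4 * a + 1) i < m + 1)
    {p : LoopProg} (hp : p.plain = true) (X : ℕ) :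
    Simulates P.dec (m + 1) σ (den (enumeration P) p (represented P σ)) (den en p.simulate σ) ∧
      (p.BoundsLe (enumeration P) X (represented P σ) → p.simulate.BoundsLe en X σ) :=
  Simulates.den ⟨fun _ _ => rfl, fun a i => ⟨h a i, rfl⟩, fun _ _ => rfl, rfl⟩ hR.tables _ en hp

/-- The degree and the sizes of an extension field are small, but the field is large enough. -/
structure Fits (N₀ q t m : ℕ) : Prop where
  t_pos : 0 < t
  m_ge : N₀ ≤ m
  t_le : 2 ^ (t - 1) ≤ N₀
  m_le : m + 1 ≤ N₀ * N₀
  q_le : q ≤ N₀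

theorem good_x {N₀ : ℕ} (h : Fits N₀ q t m) (h2 : 2 ≤ N₀) : Good N₀ P.x :=
  ⟨P.x_ne_zero (by have := h.m_ge; omega), fun k hk h0 => P.pow_ne k h0 (hk.trans_le h.m_ge)⟩

/-- The state in which the computation over the extension field starts. -/
structure Starts (P : PowerField F t m c) (Y : Tensor F n d) (r q : ℕ) (σ : Store F) : Prop where
  ready : Ready n d r q P σ
  nat : ∀ a, a % 4 ≠ 3 → σ.nat a = (Tensor.input r Y).nat a
  fld : σ.fld fIn = (Tensor.input r Y).fld fIn

theorem two_le_pow_halves (hn : 1 ≤ n) (hd : 2 ≤ d) : 2 ≤ (d * n) ^ halves d 1 := by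
  have h2 : 2 ≤ d * n := by nlinarith
  exact h2.trans (Nat.le_self_pow (by have := halves_pos (d := d) (by omega) 1; omega) _)

/-- Which case occurs, and the extension in the second one, are the same for all received tensors,
as neither the search nor the tables read them. Arrays not congruent to 3 modulo 4 are untouched, so
the simulation starts from a clean memory. -/
theorem setup_cases (hn : 1 ≤ n) (hd : 2 ≤ d) :
    ((∀ Y : Tensor F n d, (den en setup (Tensor.input r Y)).nat vFound 0 = 1) ∧
      Good ((d * n) ^ halves d 1) (root en n d r)) ∨
    ((∀ Y : Tensor F n d, (den en setup (Tensor.input r Y)).nat vFound 0 = 0) ∧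
      ∃ (q t m : ℕ) (c : ℕ → F) (P : PowerField F t m c), Fits ((d * n) ^ halves d 1) q t m ∧
        ∀ Y : Tensor F n d, Starts P Y r q (den en fieldTables (den en setup (Tensor.input r Y)))) := by
  obtain ⟨hP, h, -⟩ := den_setup en (r := r) hn hd (0 : Tensor F n d)
  have hY (Y : Tensor F n d) := (den_setup_root en (r := r) Y).2
  refine h.imp (fun h => ⟨fun Y => by rw [hY Y, h.1], h.2⟩) fun h => ⟨fun Y => by rw [hY Y, h.1], ?_⟩
  obtain ⟨q, t, m, c, P, h1, h2, h3, h4, h5, hR⟩ := den_fieldTables en hP rfl h.2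
  refine ⟨q, t, m, c, P, ⟨h1, h2, h3, h4, h5⟩, fun Y => ?_⟩
  have h := den_agreeOff en (p := setup ;; fieldTables) (a := fIn) (by decide +kernel)
    (Tensor.input_agreeOff r Y (0 : Tensor F n d))
  rw [den_seq, den_seq] at h
  have s : Store.Same [] [fIn] (den en fieldTables (den en setup (Tensor.input r (0 : Tensor F n d))))
    (den en fieldTables (den en setup (Tensor.input r Y))) :=
    ⟨fun a _ => by rw [h.1], fun a ha => h.2 a (by simpa using ha)⟩
  refine ⟨hR.of_same s (by simp) (by simp), fun a ha => ?_, ?_⟩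
  · have hw : ∀ a ∈ (setup ;; fieldTables).wn, a % 4 = 3 := by decide +kernel
    rw [← den_seq, den_nat en fun h => ha (hw a h)]
  · rw [← den_seq, den_fld en (by decide +kernel)]

theorem Starts.nat_eq_zero {Y : Tensor F n d} (h : Starts P Y r q σ) (a i : ℕ) :
    a ≠ 0 → a % 4 ≠ 3 → σ.nat a i = 0 := fun h0 h3 => by
  rw [h.nat a h3]
  simp [Tensor.input, h0]

/-- From `2^(t-1) ≤ (d n)^⌈d/2⌉` one gets `t ≤ d² n ≤ (2 n d)²`. Hence even the `t^d` checks that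
replace a single one stay within a polynomial of the size. -/
theorem Fits.pow_le (hn : 1 ≤ n) (hd : 2 ≤ d) (hr : 1 ≤ r) (hF : Fits ((d * n) ^ halves d 1) q t m) :
    t ≤ t ^ d ∧ (2 * r) ^ Nat.clog 2 d * (d * n) * t ^ d ≤ size n d r ^ 4 := by
  have hN : 0 < d * n := Nat.mul_pos (by omega) hn
  have h1 : 2 ^ (t - 1) < 2 ^ (d * n * d) :=
    calc 2 ^ (t - 1) ≤ (d * n) ^ halves d 1 := hF.t_le
      _ < (2 ^ (d * n)) ^ halves d 1 := Nat.pow_lt_pow_left Nat.lt_two_pow_self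
        (Nat.one_le_iff_ne_zero.mp (halves_pos (by omega) 1))
      _ ≤ (2 ^ (d * n)) ^ d := Nat.pow_le_pow_right (by positivity) (halves_le (by omega) 1)
      _ = _ := (pow_mul _ _ _).symm
  have h2 := (Nat.pow_lt_pow_iff_right one_lt_two).mp h1
  have h3 : t ≤ (2 * n * d) ^ 2 := by
    have : t ≤ d * n * d := by omega
    nlinarith [Nat.mul_le_mul_left (d * d * n) hn]
  have h4 : t ^ d ≤ size n d r ^ 2 :=
    calc t ^ d ≤ ((2 * n * d) ^ 2) ^ d := Nat.pow_le_pow_left h3 d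
      _ = ((2 * n * d) ^ d) ^ 2 := by rw [← pow_mul, ← pow_mul, mul_comm 2 d]
      _ ≤ _ := Nat.pow_le_pow_left (base_le_size hn hd hr).1 2
  have h5 := Nat.mul_le_mul (Nat.mul_le_mul (rank_le_size (r := r) hn hd).2
    (base_le_size hn hd hr).2.2.2.1) h4
  exact ⟨Nat.le_self_pow (by omega) t, h5.trans (by rw [← sq, ← pow_add])⟩

theorem Ready.bounds (hn : 1 ≤ n) (hd : 2 ≤ d) (hr : 1 ≤ r)
    (hF : Fits ((d * n) ^ halves d 1) q t m) (h : Ready n d r q P σ) :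
    ∀ a ∈ fieldVars, σ.nat a 0 ≤ size n d r ^ 4 := by
  have h1 := h.params.bounds_le hn hd hr
  have h2 := hF.m_le
  have h3 := hF.q_le
  have h4 := h1 vM (by simp)
  have h5 := h1 vN0 (by simp)
  have h6 : t ≤ size n d r ^ 4 := (hF.pow_le hn hd hr).1.trans ((Nat.le_mul_of_pos_left _
    (by positivity)).trans (hF.pow_le hn hd hr).2)
  rw [h.params.M_eq] at h4
  rw [h.params.N0_eq] at h5
  intro a ha
  refine (List.mem_append.mp ha).elim (h1 a) fun ha => ?_
  simp only [List.mem_cons, List.not_mem_nil, or_false] at ha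
  rcases ha with rfl | rfl | rfl | rfl
  · rw [h.q_eq]; omega
  · rwa [h.sized.t_eq]
  · rw [h.sized.Q_eq]; omega
  · rw [h.sized.m_eq]; omega

theorem ready_boundsLe (hn : 1 ≤ n) (hd : 2 ≤ d) (hr : 1 ≤ r)
    (hF : Fits ((d * n) ^ halves d 1) q t m) {p : LoopProg} (h : Ready n d r q P (den en p σ))
    (hp : p.settled = true) (hb : ∀ a ∈ p.bds, a ∈ fieldVars) :
    p.BoundsLe en (size n d r ^ 4) σ :=
  boundsLe_of_settled en hp fun a ha => h.bounds hn hd hr hF a (hb a ha)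

/-- The start of the computation over the extension field. -/
theorem den_prelude_represented (hn : 1 ≤ n) (hd : 2 ≤ d) {Y : Tensor F n d} (hm : 1 < m)
    (h0 : σ.nat 0 = (Tensor.input r Y).nat 0) (h9 : σ.nat 9 0 = 1) :
    Params n d r (den (enumeration P) prelude (represented P σ)) ∧
    (den (enumeration P) prelude (represented P σ)).fld = (represented P σ).fld ∧
    (represented P σ).fld fG 0 = P.x := by
  refine ⟨den_prelude _ hn hd ?_ ?_ ?_, funext fun a => den_fld _ (by simp [show prelude.wf = [] from
    by decide +kernel]) _, ?_⟩
  · change σ.nat 0 0 = n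
    simp [h0, Tensor.input]
  · change σ.nat 0 1 = d
    simp [h0, Tensor.input]
  · change σ.nat 0 2 = r
    simp [h0, Tensor.input]
  · change P.dec (σ.nat 9 0) = _
    rw [h9, P.dec_lt hm, pow_one]

/-- Extension of scalars does not increase the rank of the error, so the decoder over the extension
returns the lifted code word. Its entries lie in `F` and are read off as coordinate 0. -/
theorem den_extensionDecoder (hn : 1 ≤ n) (hd : 2 ≤ d) (hr : 1 ≤ r)
    (hF : Fits ((d * n) ^ halves d 1) q t m) {Y : Tensor F n d} (hσ : Starts P Y r q σ) :
    extensionDecoder.BoundsLe en (size n d r ^ 4) σ ∧ ∀ T E : Tensor F n d, Tensor.rank E ≤ r →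
      Y = T + E → (∀ a < (2 * r) ^ Nat.clog 2 d * (d * n),
        Tensor.inner (Tensor.lift P T) (Tensor.pure (Tensor.checkFactor P.x n d r a)) = 0) →
      ∀ i, (den en extensionDecoder σ).fld fOut (Tensor.pos i) = T i := by
  have h2 := two_le_pow_halves hn hd
  have hm := hF.m_ge
  rw [extensionDecoder, den_seq, den_seq, den_seq, boundsLe_seq, boundsLe_seq, boundsLe_seq]
  have h1 := den_encode en hσ.ready fun i => by
    rw [hσ.nat_eq_zero _ _ (by simp) (by simp)]; omega
  have s₁ := den_same en encode σ
  have hR₁ := hσ.ready.of_same s₁ (by decide) (by decide)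
  have b₁ := ready_boundsLe en hn hd hr hF hR₁ (by decide) (by decide)
  set σ₁ := den en encode σ
  clear_value σ₁
  -- Array `9 = 4 * 2 + 1` represents `fG`, and code 1 is the element `P.x`: the generator takes the
  -- place of the element found by the search.
  set σ₂ := den en (setN 9 0 1) σ₁ with hσ₂
  have s₂ : Store.Same [9] [] σ₁ σ₂ := same_of_eq en hσ₂
  have h9 : ∀ i, σ₂.nat 9 i = if i = 0 then 1 else 0 := fun i => by
    simp [hσ₂, s₁.1 9 (by decide), hσ.nat_eq_zero]
  clear_value σ₂
  have hR₂ := hR₁.of_same s₂ (by decide) (by decide)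
  have hc : ∀ a i, σ₂.nat (4 * a + 1) i < m + 1 := fun a i => by
    by_cases ha0 : a = 0
    · rw [ha0, s₂.1 _ (by simp)]
      exact (h1 i).1
    by_cases ha : a = 2
    · rw [ha, h9]
      split_ifs <;> omega
    · have hw : ∀ a ∈ encode.wn, a % 4 = 3 ∨ a = 1 := by decide
      rw [s₂.1 _ (by simp; omega), s₁.1 _ fun h => by have := hw _ h; omega,
        hσ.nat_eq_zero _ _ (by omega) (by omega)]
      omega
  obtain ⟨hS, hB⟩ := den_simulate en hR₂ hc (p := prelude ;; decoder) (by decide +kernel)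
    (size n d r ^ 4)
  have hR₃ := hR₂.of_same (den_same en (prelude ;; decoder).simulate σ₂) (by decide +kernel)
    (by decide +kernel)
  set σ₃ := den en (prelude ;; decoder).simulate σ₂
  clear_value σ₃
  obtain ⟨g1, g2, g3⟩ := den_prelude_represented (P := P) (σ := σ₂) hn hd (Y := Y) (by omega)
    (by rw [s₂.1 _ (by simp), s₁.1 _ (by decide), hσ.nat _ (by simp)]) (h9 0)
  refine ⟨⟨b₁, trivial, hB (decoder_bounds _ hn hd hr g1 (by decide +kernel) (by decide +kernel)),
    ready_boundsLe en hn hd hr hF (hR₃.of_same (den_same en _ _) (by decide) (by decide)) (by decide)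
    (by decide)⟩, fun T E hE hY hT i => ?_⟩
  rw [den_seq] at hS
  have key := den_decoder_of_mem (enumeration P) hn hd hr (good_x hF h2) g1 (by rw [g2, g3])
    (Tensor.rank_lift_le (P := P) (by omega) hE) (T := Tensor.lift P T) (fun i => by
      rw [g2, ← Tensor.lift_add, ← hY]
      change P.dec (σ₂.nat 1 _) = _
      rw [s₂.1 _ (by simp), (h1 _).2 (Tensor.pos_lt i), hσ.fld, Tensor.input_fld_pos]
      rfl) hT i
  obtain ⟨k1, k2⟩ := hS.fld fOut (Tensor.pos i)
  rw [key] at k2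
  have h3 := loop_fill en (v := vP) (a := vnd) (A := fOut) (σ := σ₃)
    (e := .get fRws (.get tOt (.get 5 (nv vP)))) (fun p => σ₃.fld fRws (σ₃.nat tOt (σ₃.nat 5 p)))
    (fun p _ τ hτ hv => by simp [hv, hτ.1, hτ.2])
  rw [hR₃.params.nd_eq] at h3
  refine (h3 _ (Tensor.pos_lt i)).trans ?_
  -- The copying loop reads the cell of coordinate 0 in the row of the code.
  have := hR₃.rows _ k1 ⟨0, hF.t_pos⟩
  rw [add_zero] at this
  simp only [Nat.reduceMul, Nat.reduceAdd] at k1 k2 this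
  rw [hR₃.sized.ot _ k1.le, this, k2, Tensor.lift, P.vec_algebraMap, if_pos rfl]

end LoopProg

/-! ## Codes over all fields -/

namespace LoopProg

/-- The parity checks over all fields, where `p` computes them from those over an extension. -/
def smallChecks (p : LoopProg) : LoopProg :=
  setup ;; ite (.natEq (nv vFound) 1) (checks ;; setN 1 0 (nv vMchk))
    (fieldTables ;; setN 9 0 1 ;; (prelude ;; checks).simulate ;; p ;; setN 1 0 (nv vMc))

/-- Apply functionals to the parity checks. -/
def expandChecks : LoopProg := letN vU2 1 ;; expand fOut 5 vU2 vnd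

/-- Apply functionals to the factors of the parity checks. -/
def expandFactors : LoopProg := expand fVec 13 vd vn ;; products

variable {F : Type u} [Field F] (en : Enumeration F) {n d r q t m : ℕ} {c : ℕ → F} {σ τ : Store F}
  {P : PowerField F t m c}

theorem smallDecoder_corrects_of_good (hn : 1 ≤ n) (hd : 2 ≤ d) (hr : 1 ≤ r) {k : ℕ}
    (hk : smallDecoder.weight + (4 + 1) * smallDecoder.depth ≤ k)
    (h : ∀ Y : Tensor F n d, (den en setup (Tensor.input r Y)).nat vFound 0 = 1)
    (hg : Good ((d * n) ^ halves d 1) (root en n d r)) {C : Submodule F (Tensor F n d)}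
    (hC : ∀ T ∈ C, ∀ a < (2 * r) ^ Nat.clog 2 d * (d * n),
      Tensor.inner T (Tensor.pure (Tensor.checkFactor (root en n d r) n d r a)) = 0) :
    Tensor.Corrects en smallDecoder.toProg r (polyBound k n d r) r C := fun Y => by
  have hb := largeDecoder_bounds en hn hd hr Y
  have ht : (Test.natEq (nv vFound) 1).Holds en (den en setup (Tensor.input r Y)) := by simp [h]
  obtain ⟨s, hs, hs'⟩ := exists_exec_poly en hn hd hr (p := smallDecoder) (by decide +kernel)
    ⟨hb.1, fun _ => hb.2, fun h => absurd ht h⟩ hk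
  refine ⟨s, hs, _, hs', fun T hT E hE hY i => ?_⟩
  obtain ⟨hP, -, hin⟩ := den_setup en (r := r) hn hd Y
  rw [smallDecoder, den_seq, den_ite_pos en ht]
  exact den_decoder_of_mem en hn hd hr hg hP (den_setup_root en Y).1 hE
    (fun i => by rw [hin, Tensor.input_fld_pos, hY]) (hC T hT) i

theorem smallDecoder_corrects_of_fits (hn : 1 ≤ n) (hd : 2 ≤ d) (hr : 1 ≤ r) {k : ℕ}
    (hk : smallDecoder.weight + (4 + 1) * smallDecoder.depth ≤ k)
    (h : ∀ Y : Tensor F n d, (den en setup (Tensor.input r Y)).nat vFound 0 = 0)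
    (hF : Fits ((d * n) ^ halves d 1) q t m)
    (hS : ∀ Y : Tensor F n d, Starts P Y r q (den en fieldTables (den en setup (Tensor.input r Y))))
    {C : Submodule F (Tensor F n d)}
    (hC : ∀ T ∈ C, ∀ a < (2 * r) ^ Nat.clog 2 d * (d * n),
      Tensor.inner (Tensor.lift P T) (Tensor.pure (Tensor.checkFactor P.x n d r a)) = 0) :
    Tensor.Corrects en smallDecoder.toProg r (polyBound k n d r) r C := fun Y => by
  have hb := largeDecoder_bounds en hn hd hr Y
  have ht : ¬ (Test.natEq (nv vFound) 1).Holds en (den en setup (Tensor.input r Y)) := by simp [h]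
  obtain ⟨h1, h2⟩ := den_extensionDecoder en hn hd hr hF (hS Y)
  obtain ⟨s, hs, hs'⟩ := exists_exec_poly en hn hd hr (p := smallDecoder) (by decide +kernel)
    ⟨hb.1, fun h => absurd h ht, fun _ => ⟨ready_boundsLe en hn hd hr hF (hS Y).ready
      (by decide +kernel) (by decide +kernel), h1⟩⟩ hk
  refine ⟨s, hs, _, hs', fun T hT E hE hY i => ?_⟩
  rw [smallDecoder, den_seq, den_ite_neg en ht, den_seq]
  exact h2 T E hE hY (hC T hT) i

/-- The parity checks over the extension field. -/
theorem den_checks_represented (hn : 1 ≤ n) (hd : 2 ≤ d) (hr : 1 ≤ r)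
    (hF : Fits ((d * n) ^ halves d 1) q t m) (hσ : Starts P (0 : Tensor F n d) r q σ) :
    (setN 9 0 1 ;; (prelude ;; checks).simulate).BoundsLe en (size n d r ^ 4) σ ∧
    Ready n d r q P (den en (setN 9 0 1 ;; (prelude ;; checks).simulate) σ) ∧
    (∀ i, (den en (setN 9 0 1 ;; (prelude ;; checks).simulate) σ).nat 5 i < m + 1 ∧
      (den en (setN 9 0 1 ;; (prelude ;; checks).simulate) σ).nat 13 i < m + 1) ∧
    ∀ a < (2 * r) ^ Nat.clog 2 d * (d * n), (∀ i : Fin d → Fin n,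
      P.dec ((den en (setN 9 0 1 ;; (prelude ;; checks).simulate) σ).nat 5 (a * n ^ d + Tensor.pos i)) =
        Tensor.pure (Tensor.checkFactor P.x n d r a) i) ∧ ∀ (j : Fin d) (i : Fin n),
      P.dec ((den en (setN 9 0 1 ;; (prelude ;; checks).simulate) σ).nat 13 ((a * d + j) * n + i)) =
        Tensor.checkFactor P.x n d r a j i := by
  have h2 := two_le_pow_halves hn hd
  have hm := hF.m_ge
  rw [den_seq, boundsLe_seq]
  set σ₂ := den en (setN 9 0 1) σ with hσ₂
  have s₂ : Store.Same [9] [] σ σ₂ := same_of_eq en hσ₂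
  have h9 : ∀ i, σ₂.nat 9 i = if i = 0 then 1 else 0 := fun i => by
    simp [hσ₂, hσ.nat_eq_zero]
  clear_value σ₂
  have hR₂ := hσ.ready.of_same s₂ (by decide) (by decide)
  have hc : ∀ a i, σ₂.nat (4 * a + 1) i < m + 1 := fun a i => by
    by_cases ha : a = 2
    · rw [ha, h9]
      split_ifs <;> omega
    · rw [s₂.1 _ (by simp; omega), hσ.nat_eq_zero _ _ (by omega) (by omega)]
      omega
  obtain ⟨hS, hB⟩ := den_simulate en hR₂ hc (p := prelude ;; checks) (by decide +kernel)
    (size n d r ^ 4)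
  have hR₃ := hR₂.of_same (den_same en (prelude ;; checks).simulate σ₂) (by decide +kernel)
    (by decide +kernel)
  set σ₃ := den en (prelude ;; checks).simulate σ₂
  clear_value σ₃
  obtain ⟨g1, g2, g3⟩ := den_prelude_represented (P := P) (σ := σ₂) hn hd (Y := (0 : Tensor F n d))
    (by omega) (by rw [s₂.1 _ (by simp), hσ.nat _ (by simp)]) (h9 0)
  have hb := decoder_bounds (enumeration P) hn hd hr g1 (by decide +kernel) (by decide +kernel)
  rw [den_seq] at hS
  refine ⟨⟨trivial, hB ⟨hb.1, hb.2.1⟩⟩, hR₃, fun i => ⟨(hS.fld fOut i).1, (hS.fld fVec i).1⟩,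
    fun a ha => ⟨fun i => ?_, fun j i => ?_⟩⟩
  · rw [← g3, ← g2, ← den_checks _ hr g1 ha]
    exact (hS.fld fOut _).2
  · rw [← g3, ← g2, ← den_checks_factor _ hr g1 ha]
    exact (hS.fld fVec _).2

end LoopProg

namespace LoopProg

/-- The program `p` computes parity checks from those over the extension field, each of which is
replaced by `e t d` parity checks. -/
def Expands (p : LoopProg) (e : ℕ → ℕ → ℕ) (rankOne : Prop) : Prop :=
  ∀ (F : Type u) [Field F] (en : Enumeration F) (n d r q t m : ℕ) (c : ℕ → F)
    (P : PowerField F t m c) (σ : Store F), 1 ≤ n → 2 ≤ d → 1 ≤ r →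
    Fits ((d * n) ^ halves d 1) q t m → Ready n d r q P σ →
    (∀ i, σ.nat 5 i < m + 1 ∧ σ.nat 13 i < m + 1) →
    (∀ a < (2 * r) ^ Nat.clog 2 d * (d * n), (∀ i : Fin d → Fin n,
      P.dec (σ.nat 5 (a * n ^ d + Tensor.pos i)) =
        Tensor.pure (Tensor.checkFactor P.x n d r a) i) ∧ ∀ (j : Fin d) (i : Fin n),
      P.dec (σ.nat 13 ((a * d + j) * n + i)) = Tensor.checkFactor P.x n d r a j i) →
    p.BoundsLe en (size n d r ^ 4) σ ∧
    (den en p σ).nat vMc 0 = (2 * r) ^ Nat.clog 2 d * (d * n) * e t d ∧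
    ∃ H : Fin ((2 * r) ^ Nat.clog 2 d * (d * n) * e t d) → Tensor F n d,
      (∀ (a : Fin _) i, (den en p σ).fld fOut (a * n ^ d + Tensor.pos i) = H a i) ∧
      (∀ T ∈ Tensor.codeOf H, ∀ a < (2 * r) ^ Nat.clog 2 d * (d * n),
        Tensor.inner (Tensor.lift P T) (Tensor.pure (Tensor.checkFactor P.x n d r a)) = 0) ∧
      (rankOne → ∀ a, Tensor.IsRankOne (H a))

/-- One block per check: its entries are replaced by their images under each of the `t` functionals.
The number of checks grows only by the factor `t`, but products are not preserved. -/
theorem expands_expandChecks : Expands.{u} expandChecks (fun t _ => t) False := by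
  intro F _ en n d r q t m c P σ hn hd hr hF hR hc h
  have ht := hF.t_pos
  set M := (2 * r) ^ Nat.clog 2 d * (d * n) with hM
  rw [expandChecks, boundsLe_seq, den_seq]
  set σ₁ := den en (letN vU2 1) σ with hσ₁
  have s₁ : Store.Same [vU2] [] σ σ₁ := same_of_eq en hσ₁
  have h1 : σ₁.nat vU2 0 = 1 := by simp [hσ₁]
  clear_value σ₁
  have hR₁ := hR.of_same s₁ (by decide) (by decide)
  obtain ⟨g1, g2, g3⟩ := den_expand en hR₁ (A := fOut) (S := 5) (D := vU2) (L := vnd) ht (by decide)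
    (by decide) (by decide) (hR₁.params.Mchk_eq.trans hM.symm) h1 hR₁.params.nd_eq
    (fun i => by rw [s₁.1 _ (by simp)]; exact (hc i).1)
  rw [s₁.1 5 (by simp)] at g3
  simp only [pow_one, mul_one] at g1 g2 g3
  have hb : ∀ a ∈ (expand fOut 5 vU2 vnd).bds, a ∉ (expand fOut 5 vU2 vnd).wn ∧ (a = vU2 ∨
      a ∈ fieldVars) ∨ a = vTD := by decide +kernel
  have hX := hF.pow_le hn hd hr
  have hX1 : 1 ≤ size n d r ^ 4 := Nat.one_le_pow _ _ (by have := size_ge hn hd hr; omega)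
  refine ⟨⟨trivial, boundsLe_of_settled en (by decide +kernel) fun a ha => ?_⟩, g1,
    fun b i => P.functional ⟨b % t, Nat.mod_lt _ ht⟩
      (Tensor.pure (Tensor.checkFactor P.x n d r (b / t)) i), fun b i => ?_, fun T hT a ha => ?_,
    False.elim⟩
  · rcases hb a ha with ⟨h2, h3⟩ | rfl
    · rw [den_nat en h2]
      exact h3.elim (fun h => by rwa [h, h1]) (hR₁.bounds hn hd hr hF a)
    · rw [g2]
      exact hX.1.trans ((Nat.le_mul_of_pos_left _ (by positivity)).trans hX.2)
  · have hb := Nat.div_lt_of_lt_mul (b.2.trans_eq (mul_comm _ _))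
    have := g3 _ hb _ (Nat.mod_lt b ht) 0 one_pos _ (Tensor.pos_lt i)
    simp only [add_zero, pow_zero, Nat.div_one, Nat.mod_mod, Nat.div_add_mod', (h _ hb).1 i] at this
    exact this
  · refine Tensor.inner_lift_eq_zero ht fun l => ?_
    have := hT ⟨a * t + l, mul_add_lt ha l.2⟩
    simpa only [(mul_add_div_mod l.2).1, (mul_add_div_mod l.2).2] using this

/-- The functionals are applied to the factors independently, and the products are formed over `F`
afterwards. This keeps rank one at the price of the factor `t ^ d`. -/
theorem expands_expandFactors : Expands.{u} expandFactors (fun t d => t ^ d) True := by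
  intro F _ en n d r q t m c P σ hn hd hr hF hR hc h
  have ht := hF.t_pos
  set M := (2 * r) ^ Nat.clog 2 d * (d * n) with hM
  rw [expandFactors, boundsLe_seq, den_seq]
  obtain ⟨g1, g2, g3⟩ := den_expand en hR (A := fVec) (S := 13) (D := vd) (L := vn) ht (by decide)
    (by decide) (by decide) (hR.params.Mchk_eq.trans hM.symm) hR.params.d_eq hR.params.n_eq
    (fun i => (hc i).2)
  have s₁ := den_same en (expand fVec 13 vd vn) σ
  have hb : ∀ a ∈ (expand fVec 13 vd vn).bds, a ∉ (expand fVec 13 vd vn).wn ∧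
      a ∈ fieldVars ∨ a = vTD := by decide +kernel
  have hX := hF.pow_le hn hd hr
  have b₁ : (expand fVec 13 vd vn).BoundsLe en (size n d r ^ 4) σ :=
    boundsLe_of_settled en (by decide +kernel) fun a ha => by
      rcases hb a ha with ⟨h2, h3⟩ | rfl
      · rw [den_nat en h2]
        exact hR.bounds hn hd hr hF a h3
      · rw [g2]
        exact (Nat.le_mul_of_pos_left _ (by positivity)).trans hX.2
  set σ₁ := den en (expand fVec 13 vd vn) σ
  clear_value σ₁
  have hP₁ := hR.params.of_same s₁ (by decide)
  have hp : ∀ a ∈ products.bds, a ∈ sizeVars ∨ a = vMc := by decide +kernel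
  refine ⟨⟨b₁, boundsLe_of_static en (by decide +kernel) fun a ha => ?_⟩,
    by rw [den_nat en (by decide), g1], fun b => Tensor.pure fun j i =>
      P.functional ⟨b % t ^ d / t ^ (j : ℕ) % t, Nat.mod_lt _ ht⟩
        (Tensor.checkFactor P.x n d r (b / t ^ d) j i), fun b i => ?_, fun T hT a ha => ?_,
    fun _ b => ⟨_, fun j h0 => ?_, rfl⟩⟩
  · rcases hp a ha with h | rfl
    · exact hP₁.bounds_le hn hd hr a h
    · rw [g1]
      exact hX.2
  · have hb := Nat.div_lt_of_lt_mul (b.2.trans_eq (mul_comm _ _))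
    rw [den_products en hP₁ g1 b.2 (Tensor.pos_lt i), Finset.prod_range]
    refine Finset.prod_congr rfl fun j _ => ?_
    have := g3 _ hb _ (Nat.mod_lt b (pow_pos ht d)) j j.2 _ (i j).2
    rw [(h _ hb).2 j (i j), Nat.div_add_mod'] at this
    rw [Tensor.pos_div_mod, this]
  · refine Tensor.inner_lift_pure_eq_zero ht fun l => ?_
    have := hT ⟨a * t ^ d + Tensor.pos l, mul_add_lt ha (Tensor.pos_lt l)⟩
    simpa only [(mul_add_div_mod (Tensor.pos_lt l)).1, (mul_add_div_mod (Tensor.pos_lt l)).2,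
      Tensor.pos_div_mod] using this
  -- Entry 0 of every factor is a zeroth power, hence 1, and the functionals fix 1.
  · have := congrFun h0 ⟨0, hn⟩
    simp [Tensor.checkFactor, P.functional_one] at this

/-- The codes over all fields. -/
theorem exists_small_field_code {p : LoopProg} {e : ℕ → ℕ → ℕ} {rankOne : Prop}
    (hp : Expands.{u} p e rankOne) (hok : (smallChecks p).ok = true) :
    ∃ (k₀ : ℕ) (con dec : Prog), ∀ (F : Type u) [Field F] (en : Enumeration F) (n d r : ℕ), 1 ≤ n →
      2 ≤ d → 1 ≤ r → ∃ (m : ℕ) (H : Fin m → Tensor F n d) (k : ℕ),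
      Tensor.IsExplicitCode en con dec r (polyBound k₀ n d r) k H ∧ n ^ d ≤ k + m ∧
      (m = (2 * r) ^ Nat.clog 2 d * (d * n) ∨ ∃ t, 2 ^ (t - 1) ≤ (d * n) ^ halves d 1 ∧
        m = (2 * r) ^ Nat.clog 2 d * (d * n) * e t d) ∧ (rankOne → ∀ a, Tensor.IsRankOne (H a)) := by
  obtain ⟨k₀, hk₁, hk₂⟩ : ∃ c, (smallChecks p).weight + (4 + 1) * (smallChecks p).depth ≤ c ∧
      smallDecoder.weight + (4 + 1) * smallDecoder.depth ≤ c :=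
    ⟨_, le_max_left _ _, le_max_right _ _⟩
  refine ⟨k₀, (smallChecks p).toProg, smallDecoder.toProg, fun F _ en n d r hn hd hr => ?_⟩
  have hb := largeDecoder_bounds en hn hd hr (0 : Tensor F n d)
  obtain ⟨hP, -, -⟩ := den_setup en (r := r) hn hd (0 : Tensor F n d)
  rcases setup_cases en (r := r) hn hd with ⟨h, hg⟩ | ⟨h, q, t, m, c, P, hF, hS⟩
  · let H : Fin ((2 * r) ^ Nat.clog 2 d * (d * n)) → Tensor F n d := fun a =>
      Tensor.pure (Tensor.checkFactor (root en n d r) n d r a)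
    have hcor := smallDecoder_corrects_of_good en hn hd hr hk₂ h hg (C := Tensor.codeOf H)
      fun T hT a ha => hT ⟨a, ha⟩
    have ht : (Test.natEq (nv vFound) 1).Holds en (den en setup (Tensor.input r (0 : Tensor F n d))) := by
      simp [h]
    refine ⟨_, H, _, ⟨hcor.isRankMetricCode (by omega), ?_, hcor⟩, Tensor.finrank_codeOf_ge H,
      Or.inl rfl, fun _ a => ⟨_, Tensor.checkFactor_ne_zero hn _ r a, rfl⟩⟩
    obtain ⟨s, hs, hs'⟩ := exists_exec_poly en hn hd hr (p := smallChecks p) hok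
      ⟨hb.1, fun _ => ⟨hb.2.1, trivial⟩, fun h => absurd ht h⟩ hk₁
    refine ⟨s, hs, _, hs', ?_, fun a i => ?_⟩
    · rw [smallChecks, den_seq, den_ite_pos en ht, den_seq]
      simpa using (hP.of_same (den_same en checks _) (by decide)).Mchk_eq
    · rw [smallChecks, den_seq, den_ite_pos en ht, den_seq, den_setN, Store.fld_setNat,
        den_checks en hr hP a.2, (den_setup_root en 0).1]
  · obtain ⟨b₁, h1, h2, h3⟩ := den_checks_represented en hn hd hr hF (hS 0)
    obtain ⟨b₂, h4, H, h5, h6, h7⟩ := hp F en n d r q t m c P _ hn hd hr hF h1 h2 h3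
    have hcor := smallDecoder_corrects_of_fits en hn hd hr hk₂ h hF hS h6
    have ht : ¬ (Test.natEq (nv vFound) 1).Holds en
      (den en setup (Tensor.input r (0 : Tensor F n d))) := by simp [h]
    refine ⟨_, H, _, ⟨hcor.isRankMetricCode (by omega), ?_, hcor⟩, Tensor.finrank_codeOf_ge H,
      Or.inr ⟨t, hF.t_le, rfl⟩, h7⟩
    obtain ⟨s, hs, hs'⟩ := exists_exec_poly en hn hd hr (p := smallChecks p) hok
      ⟨hb.1, fun h => absurd h ht, fun _ => ⟨ready_boundsLe en hn hd hr hF (hS 0).ready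
        (by decide +kernel) (by decide +kernel), b₁.1, b₁.2, b₂, trivial⟩⟩ hk₁
    refine ⟨s, hs, _, hs', ?_, fun a i => ?_⟩
    · simp only [smallChecks, den_seq, den_ite_neg en ht] at h4 ⊢
      simpa using h4
    · simp only [smallChecks, den_seq, den_ite_neg en ht] at h5 ⊢
      rw [den_setN, Store.fld_setNat, h5]

end LoopProg

theorem LoopProg.smallChecks_ok : (LoopProg.smallChecks LoopProg.expandChecks).ok = true ∧
    (LoopProg.smallChecks LoopProg.expandFactors).ok = true := by decide +kernel

theorem Tensor.IsExplicitCode.mono {F : Type u} [Field F] {n d r t t' k m : ℕ} {en : Enumeration F}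
    {con dec : Prog} {H : Fin m → Tensor F n d} (h : IsExplicitCode en con dec r t k H)
    (ht : t ≤ t') : IsExplicitCode en con dec r t' k H :=
  ⟨h.1, h.2.1.imp fun _ h => ⟨h.1.trans ht, h.2⟩, fun Y => (h.2.2 Y).imp fun _ h => ⟨h.1.trans ht, h.2⟩⟩

section Dimension

variable {n d r t k m : ℕ}

theorem two_le_logb (hn : 1 ≤ n) (hd : 2 ≤ d) : 2 ≤ Real.logb 2 (2 * d * n) := by
  rw [Real.le_logb_iff_rpow_le one_lt_two (by positivity)]
  have h1 : (1 : ℝ) ≤ n := by exact_mod_cast hn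
  have h2 : (2 : ℝ) ≤ d := by exact_mod_cast hd
  norm_num
  nlinarith

/-- Taking logarithms, `t - 1 ≤ (d + 1)/2 · lg(d n)`. The remaining 1 is absorbed by passing to
`lg(2 d n) = 1 + lg(d n)`, since `(d + 1)/2 ≥ 1`. -/
theorem degree_le (hn : 1 ≤ n) (hd : 2 ≤ d) (ht : 2 ^ (t - 1) ≤ (d * n) ^ halves d 1) :
    (t : ℝ) ≤ (d + 1) / 2 * Real.logb 2 (2 * d * n) := by
  have h1 : (0 : ℝ) < d * n := by positivity
  have h2 : Real.logb 2 (2 * d * n) = 1 + Real.logb 2 (d * n) := by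
    rw [mul_assoc, Real.logb_mul two_ne_zero h1.ne', Real.logb_self_eq_one one_lt_two]
  have h3 : ((t - 1 : ℕ) : ℝ) ≤ halves d 1 * Real.logb 2 (d * n) := by
    rw [← Real.logb_pow, Real.le_logb_iff_rpow_le one_lt_two (by positivity), Real.rpow_natCast]
    exact_mod_cast ht
  have h4 : (t : ℝ) ≤ (t - 1 : ℕ) + 1 := by
    exact_mod_cast (by omega : t ≤ t - 1 + 1)
  have h5 : (halves d 1 : ℝ) ≤ (d + 1) / 2 := Nat.cast_div_le.trans (by simp [halves])
  have h6 := two_le_logb hn hd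
  have h7 : (2 : ℝ) ≤ d := by exact_mod_cast hd
  nlinarith

/-- `2^(⌈lg d⌉ - 1) < d`. -/
theorem two_pow_clog_le (hd : 2 ≤ d) : 2 ^ Nat.clog 2 d ≤ 2 * d := by
  obtain ⟨x, hx⟩ : ∃ x, Nat.clog 2 d = x + 1 := Nat.exists_eq_succ_of_ne_zero
    (Nat.clog_pos one_lt_two hd).ne'
  have h : 2 ^ x < d := (Nat.lt_clog_iff_pow_lt one_lt_two).mp (by omega)
  rw [hx, pow_succ]
  omega

theorem dimension_ge (h : n ^ d ≤ k + m) {x : ℝ} (hm : (m : ℝ) ≤ x) : (n : ℝ) ^ d - x ≤ k := by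
  have : (n : ℝ) ^ d ≤ k + m := by exact_mod_cast h
  linarith

theorem count_le (hn : 1 ≤ n) (hd : 2 ≤ d) (hm : m = (2 * r) ^ Nat.clog 2 d * (d * n) ∨
    ∃ t, 2 ^ (t - 1) ≤ (d * n) ^ halves d 1 ∧ m = (2 * r) ^ Nat.clog 2 d * (d * n) * t) :
    (m : ℝ) ≤ d * n * (2 * r) ^ Nat.clog 2 d * (d * Real.logb 2 (2 * d * n)) := by
  have h6 := two_le_logb hn hd
  have h7 : (2 : ℝ) ≤ d := by exact_mod_cast hd
  obtain ⟨s, hs, rfl⟩ : ∃ s : ℕ, (s : ℝ) ≤ d * Real.logb 2 (2 * d * n) ∧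
      m = (2 * r) ^ Nat.clog 2 d * (d * n) * s := by
    rcases hm with rfl | ⟨t, ht, rfl⟩
    · exact ⟨1, by push_cast; nlinarith, by ring⟩
    · exact ⟨t, (degree_le hn hd ht).trans (by nlinarith), rfl⟩
  push_cast
  rw [mul_comm ((2 * r : ℝ) ^ Nat.clog 2 d)]
  exact mul_le_mul_of_nonneg_left hs (by positivity)

theorem succ_pow_le (hd : 2 ≤ d) : ((d : ℝ) + 1) ^ d ≤ 3 * (d : ℝ) ^ d := by
  have h7 : (0 : ℝ) < d := by positivity
  have h1 : ((d : ℝ)⁻¹ + 1) ^ d ≤ 3 := by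
    refine (pow_le_pow_left₀ (by positivity) (Real.add_one_le_exp _) d).trans ?_
    rw [← Real.exp_nat_mul, mul_inv_cancel₀ h7.ne']
    exact Real.exp_one_lt_three.le
  calc ((d : ℝ) + 1) ^ d = ((d : ℝ)⁻¹ + 1) ^ d * (d : ℝ) ^ d := by
        rw [← mul_pow, add_mul, inv_mul_cancel₀ h7.ne', one_mul, add_comm]
    _ ≤ _ := mul_le_mul_of_nonneg_right h1 (by positivity)

/-- The factor `2^⌈lg d⌉ ≤ 2 d ≤ 2^d` cancels the denominators in the bound `((d + 1)/2 · L)^d` for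
`t^d`. What remains is `(d + 1)^d L^d ≤ 3 (d L)^d`, because `(1 + 1/d)^d ≤ e < 3`. -/
theorem count_rankOne_le (hn : 1 ≤ n) (hd : 2 ≤ d) (hm : m = (2 * r) ^ Nat.clog 2 d * (d * n) ∨
    ∃ t, 2 ^ (t - 1) ≤ (d * n) ^ halves d 1 ∧ m = (2 * r) ^ Nat.clog 2 d * (d * n) * t ^ d) :
    (m : ℝ) ≤ d * n * r ^ Nat.clog 2 d * (3 * (d * Real.logb 2 (2 * d * n)) ^ d) := by
  have h6 := two_le_logb hn hd
  have h7 : (2 : ℝ) ≤ d := by exact_mod_cast hd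
  obtain ⟨s, hs, rfl⟩ : ∃ s : ℕ, (s : ℝ) ≤ (d + 1) / 2 * Real.logb 2 (2 * d * n) ∧
      m = (2 * r) ^ Nat.clog 2 d * (d * n) * s ^ d := by
    rcases hm with rfl | ⟨t, ht, rfl⟩
    · exact ⟨1, by push_cast; nlinarith, by ring⟩
    · exact ⟨t, degree_le hn hd ht, rfl⟩
  set L := Real.logb 2 (2 * d * n)
  have h1 : ((2 : ℕ) ^ Nat.clog 2 d : ℝ) ≤ 2 ^ d := by
    have : 2 * d ≤ 2 ^ d := by
      obtain ⟨x, rfl⟩ := Nat.exists_eq_add_of_le' hd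
      have := Nat.lt_two_pow_self (n := x + 1)
      rw [show x + 2 = x + 1 + 1 from rfl, pow_succ]
      omega
    exact_mod_cast (two_pow_clog_le hd).trans this
  have h2 : (s : ℝ) ^ d * 2 ^ d ≤ 3 * (d * L) ^ d := by
    calc (s : ℝ) ^ d * 2 ^ d ≤ ((d + 1) / 2 * L) ^ d * 2 ^ d :=
          mul_le_mul_of_nonneg_right (pow_le_pow_left₀ (by positivity) hs d) (by positivity)
      _ = (d + 1) ^ d * L ^ d := by rw [← mul_pow, ← mul_pow]; ring
      _ ≤ 3 * d ^ d * L ^ d := mul_le_mul_of_nonneg_right (succ_pow_le hd) (by positivity)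
      _ = _ := by rw [mul_pow]; ring
  push_cast at h1 ⊢
  calc ((2 * r : ℝ) ^ Nat.clog 2 d) * (d * n) * s ^ d
      = d * n * r ^ Nat.clog 2 d * (s ^ d * 2 ^ Nat.clog 2 d) := by rw [mul_pow]; ring
    _ ≤ d * n * r ^ Nat.clog 2 d * (s ^ d * 2 ^ d) := by gcongr
    _ ≤ _ := mul_le_mul_of_nonneg_left h2 (by positivity)

end Dimension

theorem corollary8 :
    ∃ c : ℕ,
      -- large fields, rank-one parity checks
      (∃ con dec : Prog, ∀ (F : Type u) [Field F] (en : Enumeration F) (n d r : ℕ),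
        1 ≤ n → 2 ≤ d → 1 ≤ r → (((2 * n * d) ^ d : ℕ) : ℕ∞) < ENat.card F →
        ∃ (m : ℕ) (H : Fin m → Tensor F n d),
          Tensor.IsExplicitCode en con dec r (polyBound c n d r)
            (n ^ d - d * n * (2 * r) ^ Nat.clog 2 d) H ∧
          ∀ a, Tensor.IsRankOne (H a)) ∧
      -- all fields
      (∃ con dec : Prog, ∀ (F : Type u) [Field F] (en : Enumeration F) (n d r : ℕ),
        1 ≤ n → 2 ≤ d → 1 ≤ r →
        ∃ (m : ℕ) (H : Fin m → Tensor F n d) (k : ℕ),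
          Tensor.IsExplicitCode en con dec r (polyBound c n d r) k H ∧
          (n : ℝ) ^ d - d * n * (2 * r) ^ Nat.clog 2 d *
            (c * (d * Real.logb 2 (2 * d * n))) ≤ k) ∧
      -- all fields, rank-one parity checks
      (∃ con dec : Prog, ∀ (F : Type u) [Field F] (en : Enumeration F) (n d r : ℕ),
        1 ≤ n → 2 ≤ d → 1 ≤ r →
        ∃ (m : ℕ) (H : Fin m → Tensor F n d) (k : ℕ),
          Tensor.IsExplicitCode en con dec r (polyBound c n d r) k H ∧
          (n : ℝ) ^ d - d * n * r ^ Nat.clog 2 d *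
            (c * (d * Real.logb 2 (2 * d * n)) ^ d) ≤ k ∧
          ∀ a, Tensor.IsRankOne (H a)) := by
  obtain ⟨c₁, con₁, dec₁, h₁⟩ := LoopProg.exists_large_field_code.{u}
  obtain ⟨c₂, con₂, dec₂, h₂⟩ := LoopProg.exists_small_field_code
    LoopProg.expands_expandChecks.{u} LoopProg.smallChecks_ok.1
  obtain ⟨c₃, con₃, dec₃, h₃⟩ := LoopProg.exists_small_field_code
    LoopProg.expands_expandFactors.{u} LoopProg.smallChecks_ok.2
  -- One constant serves as the bound for the running times of all three pairs of programs and as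
  -- the factor in the dimensions, which needs to be at least 3.
  have hc : (3 : ℝ) ≤ (c₁ + c₂ + c₃ + 3 : ℕ) := by exact_mod_cast Nat.le_add_left 3 _
  refine ⟨c₁ + c₂ + c₃ + 3, ⟨con₁, dec₁, fun F _ en n d r hn hd hr hF => ?_⟩,
    ⟨con₂, dec₂, fun F _ en n d r hn hd hr => ?_⟩, ⟨con₃, dec₃, fun F _ en n d r hn hd hr => ?_⟩⟩
  · obtain ⟨m, H, h, h'⟩ := h₁ F en n d r hn hd hr hF
    exact ⟨m, H, h.mono (LoopProg.polyBound_mono (by omega) hn hd hr), h'⟩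
  · obtain ⟨m, H, k, h, hk, hm, -⟩ := h₂ F en n d r hn hd hr
    refine ⟨m, H, k, h.mono (LoopProg.polyBound_mono (by omega) hn hd hr),
      dimension_ge hk ((count_le hn hd hm).trans ?_)⟩
    have := two_le_logb hn hd
    exact mul_le_mul_of_nonneg_left (le_mul_of_one_le_left (by positivity) (by linarith))
      (by positivity)
  · obtain ⟨m, H, k, h, hk, hm, h'⟩ := h₃ F en n d r hn hd hr
    refine ⟨m, H, k, h.mono (LoopProg.polyBound_mono (by omega) hn hd hr),
      dimension_ge hk ((count_rankOne_le hn hd hm).trans ?_), h' trivial⟩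
    have := two_le_logb hn hd
    exact mul_le_mul_of_nonneg_left (mul_le_mul_of_nonneg_right hc (by positivity)) (by positivity)
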